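/- Let $m,n\ge 0$ be integers with $m+n\ge 1$. Put $\bar i=0$ for $1\le i\le m$ and $\bar i=1$ for $m+1\le i\le m+n$. Let ${\rm DY}(\mathfrak{gl}_{m|n})$ be the (level $0$) double Yangian, i.e. the $h$-adic completion of the $\mathbb Z_2$-graded unital associative algebra over $\mathbb C[[h]]$ with generators $t_{ij}^{(r)}$, $t_{ij}^{(-r)}$ ($1\le i,j\le m+n$, $r\ge 1$) of parity $\bar i+\bar j$ and with the defining relations $$R(u-v)T_1^{\pm}(u)T_2^{\pm}(v)=T_2^{\pm}(v)T_1^{\pm}(u)R(u-v),\qquad R(u-v)T_1^{-}(u)T_2^{+}(v)=T_2^{+}(v)T_1^{-}(u)R(u-v),$$ where $R(u)=1-hPu^{-1}$, $P=\sum_{i,j}(-1)^{\bar j}e_{ij}\otimes e_{ji}$, $T^{\pm}(u)=\sum_{i,j}(-1)^{\bar i\bar j+\bar j}e_{ij}\otimes t_{ij}^{\pm}(u)$ and $$t_{ij}^-(u)=\delta_{ij}+h\sum_{r\ge1}t_{ij}^{(r)}u^{-r},\qquad t_{ij}^+(u)=\delta_{ij}-h\sum_{r\ge1}t_{ij}^{(-r)}u^{r-1}.$$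 (All coefficients of the differences of the two sides of these relations are divisible by $h^2$, and the relations imposed on the generators are those obtained by cancelling the factor $h^2$.) Write $T^\pm(u)^{-1}=\sum_{i,j}(-1)^{\bar i\bar j+\bar j}e_{ij}\otimes t_{ij}^{\pm\prime}(u)$ and define the quantum Berezinians $$b_{m|n}^{\pm}(u)=\sum_{\tau\in\mathfrak S_m}{\rm sgn}\,\tau\; t^\pm_{\tau(1)1}(u)\,t^\pm_{\tau(2)2}(u-h)\cdots t^\pm_{\tau(m)m}(u-(m-1)h)\;\times\sum_{\sigma\in\mathfrak S_n}{\rm sgn}\,\sigma\; t^{\pm\prime}_{m+1\,m+\sigma(1)}(u-(m-1)h)\cdots t^{\pm\prime}_{m+n\,m+\sigma(n)}(u-(m-n)h).$$ Then there are unique elements $b_{m|n}^{(\pm r)}\in{\rm DY}(\mathfrak{gl}_{m|n})$, $r\ge1$, such that $$b^-_{m|n}(u)=1+h\sum_{r\ge1}b_{m|n}^{(r)}u^{-r},\qquad b^+_{m|n}(u)=1-h\sum_{r\ge1}b_{m|n}^{(-r)}u^{r-1}.$$ The elements $b_{m|n}^{(\pm r)}$, $r\ge1$, belong to the center of ${\rm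 DY}(\mathfrak{gl}_{m|n})$, they are algebraically independent over $\mathbb C[[h]]$, and they topologically generate the center: the center is the $h$-adic closure of the $\mathbb C[[h]]$-subalgebra generated by them. -/

import Mathlib

namespace DoubleYangian

/-! ### The ground ring, and completion with respect to `h` -/

/-- The ground ring `ℂ[[h]]`. -/
abbrev CH : Type := PowerSeries ℂ

/-- The formal parameter `h`. -/
noncomputable def h : CH := PowerSeries.X

section Completion

/-- The two-sided ideal `h ^ k A` of a `ℂ[[h]]`-algebra `A`. -/
noncomputable def hIdeal (A : Type) [Ring A] [Algebra CH A] (k : ℕ) : Ideal A :=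
  Ideal.span {algebraMap CH A (h ^ k)}

theorem mem_hIdeal {A : Type} [Ring A] [Algebra CH A] {k : ℕ} {x : A} :
    x ∈ hIdeal A k ↔ ∃ a : A, h ^ k • a = x := by
  simp only [hIdeal, Ideal.mem_span_singleton', Algebra.smul_def, Algebra.commutes]

instance hIdeal_isTwoSided (A : Type) [Ring A] [Algebra CH A] (k : ℕ) :
    (hIdeal A k).IsTwoSided where
  mul_mem_of_left b ha := by
    obtain ⟨c, rfl⟩ := mem_hIdeal.1 ha
    exact mem_hIdeal.2 ⟨c * b, by rw [smul_mul_assoc]⟩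

theorem hIdeal_succ_le (A : Type) [Ring A] [Algebra CH A] (k : ℕ) :
    hIdeal A (k + 1) ≤ hIdeal A k := by
  intro x hx
  obtain ⟨a, rfl⟩ := mem_hIdeal.1 hx
  exact mem_hIdeal.2 ⟨h • a, by rw [smul_smul, ← pow_succ]⟩

/-- The projection `A / h ^ (k + 1) A → A / h ^ k A`. -/
noncomputable def hProj (A : Type) [Ring A] [Algebra CH A] (k : ℕ) :
    (A ⧸ hIdeal A (k + 1)) →ₐ[CH] (A ⧸ hIdeal A k) :=
  Ideal.Quotient.factorₐ CH (hIdeal_succ_le A k)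

/-- The `h`-adic completion of a (not necessarily commutative) `ℂ[[h]]`-algebra `A`: the inverse
limit of the algebras `A / h ^ k A`. -/
noncomputable def hCompletion (A : Type) [Ring A] [Algebra CH A] :
    Subalgebra CH ((k : ℕ) → A ⧸ hIdeal A k) where
  carrier := {f | ∀ k, hProj A k (f (k + 1)) = f k}
  mul_mem' hf hg k := by simp [hf k, hg k]
  add_mem' hf hg k := by simp [hf k, hg k]
  algebraMap_mem' c k := by simp

/-- The canonical map from `A` to its `h`-adic completion. -/
noncomputable def toCompletion (A : Type) [Ring A] [Algebra CH A] (x : A) : hCompletion A :=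
  ⟨fun k => Ideal.Quotient.mk (hIdeal A k) x, fun _ => rfl⟩

/-- The `h`-adically convergent sum `∑ s, h ^ s f s` in an `h`-adic completion; modulo `h ^ k` it is
the finite sum over `s < k`. -/
noncomputable def hSum {A : Type} [Ring A] [Algebra CH A] (f : ℕ → hCompletion A) :
    hCompletion A :=
  ⟨fun k => ∑ s ∈ Finset.range k, h ^ s • (f s).1 k, fun k => by
    have hz : ∀ y : A ⧸ hIdeal A k, h ^ k • y = 0 := by
      intro y
      obtain ⟨a, rfl⟩ := Ideal.Quotient.mk_surjective y
      exact Ideal.Quotient.eq_zero_iff_mem.2 (mem_hIdeal.2 ⟨a, rfl⟩)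
    have hf : ∀ s, hProj A k ((f s).1 (k + 1)) = (f s).1 k := fun s => (f s).2 k
    beta_reduce
    rw [Finset.sum_range_succ, map_add, map_smul, hz, add_zero, map_sum]
    exact Finset.sum_congr rfl fun s _ => by rw [map_smul, hf]⟩

/-- The closure of a subset `S` of a `ℂ[[h]]`-algebra in the `h`-adic topology. -/
def hClosure {D : Type} [Ring D] [Algebra CH D] (S : Set D) : Set D :=
  {x | ∀ k : ℕ, ∃ y ∈ S, ∃ z : D, x - y = h ^ k • z}

end Completion

/-! ### Generators and generating series -/

/-- The index set `{1, …, m + n}`: `inl` stands for `1, …, m` and `inr` for `m + 1, …, m + n`. -/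
abbrev Idx (m n : ℕ) : Type := Fin m ⊕ Fin n

/-- The parity of an index. -/
def par {m n : ℕ} : Idx m n → ℕ
  | Sum.inl _ => 0
  | Sum.inr _ => 1

/-- The superscripts `r` and `-r`, for `r ≥ 1`: nonzero integers. -/
abbrev Deg : Type := {r : ℤ // r ≠ 0}

/-- The two superscripts `-` (Yangian) and `+` (dual Yangian) of the generating series. -/
inductive Half : Type
  | minus
  | plus

/-- For a family `t` of elements `t i j r`, the coefficient of `u ^ a` (`a` an integer) in
`t⁻ᵢⱼ(u) = δᵢⱼ + h ∑_{r ≥ 1} t i j r u ^ (-r)` and in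
`t⁺ᵢⱼ(u) = δᵢⱼ - h ∑_{r ≥ 1} t i j (-r) u ^ (r - 1)`, respectively. -/
noncomputable def tCoeff {m n : ℕ} {A : Type} [Ring A] [Algebra CH A]
    (t : Idx m n → Idx m n → Deg → A) : Half → Idx m n → Idx m n → ℤ → A
  | Half.minus, i, j, a =>
      (if a = 0 ∧ i = j then 1 else 0) + (if ha : a < 0 then h • t i j ⟨-a, by omega⟩ else 0)
  | Half.plus, i, j, a =>
      (if a = 0 ∧ i = j then 1 else 0) -
        (if ha : 0 ≤ a then h • t i j ⟨-(a + 1), by omega⟩ else 0)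

/-! ### The `RTT` relations -/

/-- Elements `∑ eᵢⱼ ⊗ eₖₗ ⊗ X i j k l` of the graded tensor product
`End ℂ^{m|n} ⊗ End ℂ^{m|n} ⊗ A`. -/
abbrev Mat2 (m n : ℕ) (A : Type) : Type := Idx m n → Idx m n → Idx m n → Idx m n → A

/-- The product of `End ℂ^{m|n} ⊗ End ℂ^{m|n} ⊗ A` on even elements, that is, the entry `X i j k l`
has parity `ī + j̄ + k̄ + l̄` (likewise for `Y`). The sign is the one of
`(eᵢₚ ⊗ eₖᵩ ⊗ x) (eₚⱼ ⊗ eᵩₗ ⊗ y)`, where `x` passes `eₚⱼ ⊗ eᵩₗ` and `eₖᵩ` passes `eₚⱼ`. -/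
def superMul {m n : ℕ} {A : Type} [Ring A] (X Y : Mat2 m n A) : Mat2 m n A :=
  fun i j k l => ∑ p : Idx m n, ∑ q : Idx m n,
    (-1) ^ ((par i + par p + par k + par q) * (par p + par j + par q + par l)
        + (par k + par q) * (par p + par j)) * (X i p k q * Y p j q l)

/-- `P = ∑ eᵢⱼ ⊗ eⱼᵢ (-1)^{j̄}`. -/
def superPerm (m n : ℕ) (A : Type) [Ring A] : Mat2 m n A :=
  fun i j k l => if k = j ∧ l = i then (-1) ^ par j else 0

/-- The coefficient of `u ^ a` in `T₁(u)`, where `T(u) = ∑ (-1)^{ī j̄ + j̄} eᵢⱼ ⊗ tᵢⱼ(u)`. -/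
noncomputable def T₁ {m n : ℕ} {A : Type} [Ring A] [Algebra CH A]
    (t : Idx m n → Idx m n → Deg → A) (ε : Half) (a : ℤ) : Mat2 m n A :=
  fun i j k l => if k = l then (-1) ^ (par i * par j + par j) * tCoeff t ε i j a else 0

/-- The coefficient of `v ^ b` in `T₂(v)`. -/
noncomputable def T₂ {m n : ℕ} {A : Type} [Ring A] [Algebra CH A]
    (t : Idx m n → Idx m n → Deg → A) (ε : Half) (b : ℤ) : Mat2 m n A :=
  fun i j k l => if i = j then (-1) ^ (par k * par l + par l) * tCoeff t ε k l b else 0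

/-- The coefficient of `u ^ a v ^ b` in
`(u - v) (R(u - v) T₁(u) T₂(v) - T₂(v) T₁(u) R(u - v))`, where `(u - v) R(u - v) = u - v - h P`,
`T₁(u)` is built from the series with superscript `ε₁` and `T₂(v)` from those with superscript
`ε₂`. -/
noncomputable def rttCoeff {m n : ℕ} {A : Type} [Ring A] [Algebra CH A]
    (t : Idx m n → Idx m n → Deg → A) (ε₁ ε₂ : Half) (a b : ℤ) : Mat2 m n A :=
  (superMul (T₁ t ε₁ (a - 1)) (T₂ t ε₂ b) - superMul (T₁ t ε₁ a) (T₂ t ε₂ (b - 1))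
      - h • superMul (superPerm m n A) (superMul (T₁ t ε₁ a) (T₂ t ε₂ b)))
    - (superMul (T₂ t ε₂ b) (T₁ t ε₁ (a - 1)) - superMul (T₂ t ε₂ (b - 1)) (T₁ t ε₁ a)
      - h • superMul (superMul (T₂ t ε₂ b) (T₁ t ε₁ a)) (superPerm m n A))

/-- The free `ℂ[[h]]`-algebra on symbols `t i j r`. -/
abbrev Free (m n : ℕ) : Type := FreeAlgebra CH (Idx m n × Idx m n × Deg)

/-- The generators of the free algebra. -/
noncomputable def freeGen (m n : ℕ) (i j : Idx m n) (r : Deg) : Free m n :=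
  FreeAlgebra.ι CH (i, j, r)

/-- The defining relations of the double Yangian:
`R(u - v) T⁻₁(u) T⁻₂(v) = T⁻₂(v) T⁻₁(u) R(u - v)`, `R(u - v) T⁺₁(u) T⁺₂(v) = T⁺₂(v) T⁺₁(u) R(u - v)`
and `R(u - v) T⁻₁(u) T⁺₂(v) = T⁺₂(v) T⁻₁(u) R(u - v)`.
As the nonconstant parts of the series `tᵢⱼ(u)` carry a factor `h`, all coefficients of the
differences of the two sides are divisible by `h ^ 2`; the relations among the generators are
obtained by cancelling this factor (the free algebra has no `h`-torsion, so that `x` is determined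
by `h ^ 2 x`). -/
inductive Rel (m n : ℕ) : Free m n → Free m n → Prop
  | rtt (ε₁ ε₂ : Half) (hε : ¬ (ε₁ = Half.plus ∧ ε₂ = Half.minus)) (a b : ℤ) (i j k l : Idx m n)
      (x : Free m n) (hx : h ^ 2 • x = rttCoeff (freeGen m n) ε₁ ε₂ a b i j k l) : Rel m n x 0

/-- The algebra with the generators and defining relations of the double Yangian, before
completion. -/
abbrev PreDY (m n : ℕ) : Type := RingQuot (Rel m n)

/-- The (level `0`, `h`-adically completed) double Yangian of `𝔤𝔩_{m|n}` over `ℂ[[h]]`. -/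
abbrev DY (m n : ℕ) : Type := hCompletion (PreDY m n)

/-- The generators `t i j r` of the double Yangian (with `r` a nonzero integer). -/
noncomputable def gen (m n : ℕ) (i j : Idx m n) (r : Deg) : DY m n :=
  toCompletion (PreDY m n) (RingQuot.mkAlgHom CH (Rel m n) (freeGen m n i j r))

/-! ### The quantum Berezinian -/

/-- Series with coefficients in the double Yangian, in the variable `u⁻¹` for the superscript `-`
and in the variable `u` for the superscript `+`. -/
abbrev Series (m n : ℕ) : Type := PowerSeries (DY m n)

/-- The matrix of the series `tᵢⱼ(u)`. -/
noncomputable def tMatrix (m n : ℕ) : Half → Matrix (Idx m n) (Idx m n) (Series m n)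
  | Half.minus => fun i j =>
      PowerSeries.mk fun a : ℕ => tCoeff (gen m n) Half.minus i j (-(a : ℤ))
  | Half.plus => fun i j =>
      PowerSeries.mk fun a : ℕ => tCoeff (gen m n) Half.plus i j (a : ℤ)

/-- The matrix of the series `t'ᵢⱼ(u)`, where `T(u)⁻¹ = ∑ (-1)^{ī j̄ + j̄} eᵢⱼ ⊗ t'ᵢⱼ(u)`.
With these signs the signs of the graded tensor product cancel in `T(u) T(u)⁻¹ = 1`, so this is the
ordinary two-sided inverse of the (invertible) matrix of the series `tᵢⱼ(u)`. -/
noncomputable def tInvMatrix (m n : ℕ) (ε : Half) : Matrix (Idx m n) (Idx m n) (Series m n) :=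
  Ring.inverse (tMatrix m n ε)

/-- The series `f(u - c h)`, for an integer `c`, expanded by the binomial formula:
`(u - c h) ^ (-r) = ∑ₛ binom(r + s - 1, s) (c h) ^ s u ^ (-r - s)` for series in `u⁻¹`, and
`(u - c h) ^ r = ∑ₛ binom(r, s) (-c h) ^ s u ^ (r - s)` for series in `u`. -/
noncomputable def shift {m n : ℕ} (c : ℤ) : Half → Series m n → Series m n
  | Half.minus, f => PowerSeries.mk fun a : ℕ => ∑ x ∈ Finset.HasAntidiagonal.antidiagonal a,
      ((Nat.multichoose x.1 x.2 : ℤ) * c ^ x.2) • (h ^ x.2 • PowerSeries.coeff x.1 f)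
  | Half.plus, f => PowerSeries.mk fun a : ℕ => hSum fun s : ℕ =>
      ((Nat.choose (a + s) s : ℤ) * (-c) ^ s) • PowerSeries.coeff (a + s) f

/-- The quantum Berezinian: the product of
`∑_τ sgn τ t_{τ(1) 1}(u) t_{τ(2) 2}(u - h) ⋯ t_{τ(m) m}(u - (m - 1) h)` and
`∑_σ sgn σ t'_{m+1, m+σ(1)}(u - (m - 1) h) ⋯ t'_{m+n, m+σ(n)}(u - (m - n) h)`. -/
noncomputable def berezinian (m n : ℕ) (ε : Half) : Series m n :=
  (∑ τ : Equiv.Perm (Fin m), (Equiv.Perm.sign τ : ℤ) •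
      (List.ofFn fun a : Fin m =>
        shift (a : ℤ) ε (tMatrix m n ε (Sum.inl (τ a)) (Sum.inl a))).prod) *
  (∑ σ : Equiv.Perm (Fin n), (Equiv.Perm.sign σ : ℤ) •
      (List.ofFn fun a : Fin n =>
        shift ((m : ℤ) - 1 - (a : ℤ)) ε (tInvMatrix m n ε (Sum.inr a) (Sum.inr (σ a)))).prod)

/-- `b` is the family of coefficients of the quantum Berezinians:
`b⁻(u) = 1 + h ∑_{r ≥ 1} b r u ^ (-r)` and `b⁺(u) = 1 - h ∑_{r ≥ 1} b (-r) u ^ (r - 1)`. -/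
def IsBerezinianCoeffs (m n : ℕ) (b : Deg → DY m n) : Prop :=
  berezinian m n Half.minus = 1 + PowerSeries.mk (fun a : ℕ =>
      if ha : a = 0 then 0 else h • b ⟨(a : ℤ), by omega⟩) ∧
  berezinian m n Half.plus = 1 - PowerSeries.mk (fun a : ℕ =>
      h • b ⟨-((a : ℤ) + 1), by omega⟩)

end DoubleYangian

set_option linter.unusedSectionVars false
set_option linter.unusedSimpArgs false

namespace DoubleYangian

/-! ### Completeness with respect to `h` -/

section Completeness

variable {A : Type} [Ring A] [Algebra CH A]

/-! Write `U` for the reduction of the algebra modulo `h`. Its generators supercommute up to terms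
of degree at most one, and it plays the role of the enveloping superalgebra of the loop algebra of
`𝔤𝔩_{m|n}`: `t i j r` stands for a matrix unit times `z ^ evalDeg r`. The theorem follows from three
facts by `h`-adic lifting: the completed algebra has no `h`-torsion; the coefficients of the
Berezinians are central and reduce modulo `h` to the elements `casimir r = ∑ (-1)^ī t i i r`; and in
`U` these elements generate the center and satisfy no relation that is nontrivial modulo `h`.

The first and the third fact come from one device, which takes the place of a PBW theorem. By the
Yang--Baxter equation, a representation tensored with the evaluation representation at a central
unit `a` is again a representation (`isRTTFamily_fuse`). With `a = z` and modulo `h`, this is the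
map `psi`, which sends a generator `t` to `t + (matrix unit) z ^ e`. On an element `x` of degree
`D`, the leading part of `psi x - x` is a sum over the ways of replacing one factor of `x` by its
matrix unit. Contracting the matrix with the generators (`mu`) puts the factor back, so the result
is `D x` modulo lower degree (`euler`). As `D` is invertible, induction on the degree applies three
times. An element that vanishes modulo `h` in all torsion free representations is zero
(`Invisible.eq_zero`), which gives `torsionFree_DY`. If `x` is central, then `psi x` is a scalar
matrix, whose contraction is a combination of `casimir`s (`mem_casimirAlg_of_commute_of_mem`).
Finally, on polynomials in the `casimir`s `psi` acts by the substitution `X r ↦ X r - z ^ e`, and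
the same argument shows independence (`exists_h_smul_of_casimir`).

Centrality of the Berezinian rests on the `RTT` relation specialised at `v = u - h`, which makes
column determinants alternate in their columns. The last diagonal entry of the inverse matrix then
relates a determinant to that of its corner (`IsBlock.peel`). Peeling shows that column and row
determinants agree and that the determinant commutes with one diagonal series. Commutation with `t i
j 1`, `i ≠ j`, inside a block holds because the commutator is a difference of determinants with a
repeated row or column. For the odd simple roots the two blocks compensate each other: their last
factors carry the same shift, and an off-diagonal entry of `T T⁻¹` or `T⁻¹ T` vanishes
(`commute_qdet_mul_rdet`). These zero modes and one diagonal series suffice to reach every entry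
(`commute_of_zeroModes`). -/

theorem hCompletion_ext {x y : hCompletion A} (hxy : ∀ k, x.1 k = y.1 k) : x = y :=
  Subtype.ext (funext hxy)

theorem h_pow_smul_quotient (k : ℕ) (y : A ⧸ hIdeal A k) : h ^ k • y = 0 := by
  obtain ⟨a, rfl⟩ := Ideal.Quotient.mk_surjective y
  exact Ideal.Quotient.eq_zero_iff_mem.2 (mem_hIdeal.2 ⟨a, rfl⟩)

theorem hProj_mk (k : ℕ) (a : A) :
    hProj A k (Ideal.Quotient.mk (hIdeal A (k + 1)) a) = Ideal.Quotient.mk (hIdeal A k) a := rfl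

theorem coe_h_pow_smul (k j : ℕ) (x : hCompletion A) : (h ^ k • x).1 j = h ^ k • x.1 j := rfl

theorem quotient_mk_smul (k : ℕ) (c : CH) (a : A) :
    Ideal.Quotient.mk (hIdeal A k) (c • a) = c • Ideal.Quotient.mk (hIdeal A k) a := rfl

theorem mk_eq_apply_of_add (x : hCompletion A) {j : ℕ} (c : A) (i : ℕ)
    (hc : Ideal.Quotient.mk (hIdeal A (j + i)) c = x.1 (j + i)) :
    Ideal.Quotient.mk (hIdeal A j) c = x.1 j := by
  induction i with
  | zero => exact hc
  | succ i ih =>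
    refine ih ?_
    rw [← hProj_mk (j + i), ← x.2 (j + i)]
    exact congrArg _ hc

/-- An element of the completion that vanishes modulo `h ^ k` is divisible by `h ^ k`. -/
theorem exists_eq_h_pow_smul {k : ℕ} {x : hCompletion A} (hx : x.1 k = 0) :
    ∃ y, x = h ^ k • y := by
  have hlift : ∀ j, ∃ b : A, Ideal.Quotient.mk (hIdeal A (k + j)) b = x.1 (k + j) := fun j =>
    Ideal.Quotient.mk_surjective _
  choose b' hb' using hlift
  -- Since `x` vanishes modulo `h ^ k`, the lift at level `k` may be taken to be `0`. Consecutive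
  -- lifts then differ by `h ^ (k + j) • a j`, and the quotient is the convergent sum of the `h ^ j
  -- • a j`.
  let b : ℕ → A := fun j => if j = 0 then 0 else b' j
  have hb : ∀ j, Ideal.Quotient.mk (hIdeal A (k + j)) (b j) = x.1 (k + j) := by
    intro j
    by_cases hj : j = 0
    · subst hj; simpa [b] using hx.symm
    · simpa [b, hj] using hb' j
  have hstep : ∀ j, ∃ a : A, h ^ (k + j) • a = b (j + 1) - b j := by
    intro j
    rw [← mem_hIdeal, ← Ideal.Quotient.eq_zero_iff_mem, map_sub, hb j, sub_eq_zero,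
      ← hProj_mk (k + j), ← x.2 (k + j)]
    exact congrArg _ (hb (j + 1))
  choose a ha using hstep
  have hsum : ∀ j, b j = ∑ i ∈ Finset.range j, h ^ (k + i) • a i := by
    intro j
    induction j with
    | zero => simp [b]
    | succ j ih => rw [Finset.sum_range_succ, ← ih, ha, add_sub_cancel]
  refine ⟨hSum fun i => toCompletion A (a i), hCompletion_ext fun j => ?_⟩
  have h2 : Ideal.Quotient.mk (hIdeal A (j + k)) (b j) = x.1 (j + k) := by
    have := hb j
    rwa [Nat.add_comm k j] at this
  rw [← mk_eq_apply_of_add x (b j) k h2, coe_h_pow_smul, hsum j, map_sum]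
  show _ = h ^ k • ∑ s ∈ Finset.range j, h ^ s • Ideal.Quotient.mk (hIdeal A j) (a s)
  rw [Finset.smul_sum]
  exact Finset.sum_congr rfl fun s _ => by rw [quotient_mk_smul, smul_smul, pow_add]

theorem exists_eq_h_pow_smul_iff {k : ℕ} {x : hCompletion A} :
    (∃ y, x = h ^ k • y) ↔ x.1 k = 0 := by
  refine ⟨?_, exists_eq_h_pow_smul⟩
  rintro ⟨y, rfl⟩
  exact h_pow_smul_quotient k _

/-- Separatedness and completeness with respect to the `h`-adic topology. -/
structure HComplete (R : Type) [AddCommGroup R] [Module CH R] : Prop where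
  sep : ∀ x : R, (∀ k : ℕ, ∃ y, x = h ^ k • y) → x = 0
  lim : ∀ f : ℕ → R, ∃ s, ∀ K : ℕ, ∃ y, s - ∑ k ∈ Finset.range K, h ^ k • f k = h ^ K • y

theorem hSum_apply (f : ℕ → hCompletion A) (k : ℕ) :
    (hSum f).1 k = ∑ s ∈ Finset.range k, h ^ s • (f s).1 k := rfl

theorem coe_sum_apply {α : Type*} (s : Finset α) (f : α → hCompletion A) (k : ℕ) :
    (∑ i ∈ s, f i).1 k = ∑ i ∈ s, (f i).1 k := by
  rw [AddSubmonoidClass.coe_finsetSum, Finset.sum_apply]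

theorem hSum_sub_sum (f : ℕ → hCompletion A) (K : ℕ) :
    ∃ y, hSum f - ∑ k ∈ Finset.range K, h ^ k • f k = h ^ K • y := by
  apply exists_eq_h_pow_smul
  show (hSum f).1 K - (∑ k ∈ Finset.range K, h ^ k • f k : hCompletion A).1 K = 0
  rw [hSum_apply, coe_sum_apply]
  exact sub_self _

theorem hComplete_hCompletion : HComplete (hCompletion A) where
  sep _ hx := hCompletion_ext fun k => exists_eq_h_pow_smul_iff.1 (hx k)
  lim f := ⟨hSum f, hSum_sub_sum f⟩

theorem HComplete.pi {α : Type} {R : Type} [AddCommGroup R] [Module CH R] (hR : HComplete R) :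
    HComplete (α → R) where
  sep x hx := by
    funext a
    refine hR.sep _ fun k => ?_
    obtain ⟨y, hy⟩ := hx k
    exact ⟨y a, congrFun hy a⟩
  lim f := by
    choose s y hy using fun a => hR.lim fun k => f k a
    refine ⟨s, fun K => ⟨fun a => y a K, funext fun a => ?_⟩⟩
    simpa using hy a K

theorem HComplete.of_equiv {R S : Type} [AddCommGroup R] [Module CH R] [AddCommGroup S]
    [Module CH S] (hR : HComplete R) (e : R ≃ₗ[CH] S) : HComplete S where
  sep x hx := by
    have := hR.sep (e.symm x) fun k => by
      obtain ⟨y, hy⟩ := hx k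
      exact ⟨e.symm y, by rw [hy, map_smul]⟩
    simpa using this
  lim f := by
    obtain ⟨s, hs⟩ := hR.lim fun k => e.symm (f k)
    refine ⟨e s, fun K => ?_⟩
    obtain ⟨y, hy⟩ := hs K
    refine ⟨e y, ?_⟩
    rw [← map_smul, ← hy]
    simp

theorem HComplete.matrix {J R : Type} [AddCommGroup R] [Module CH R]
    (hR : HComplete R) : HComplete (Matrix J J R) :=
  hR.pi.pi.of_equiv (Matrix.ofLinearEquiv CH)

theorem HComplete.powerSeries {R : Type} [Ring R] [Algebra CH R] (hR : HComplete R) :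
    HComplete (PowerSeries R) :=
  (hR.pi (α := Unit →₀ ℕ)).of_equiv (LinearEquiv.refl CH _)

/-- The inverse is the limit of the geometric sums of `h ^ k • (-N) ^ k`. Both products with the
limit agree with `1` modulo every power of `h`, and separatedness does the rest. -/
theorem HComplete.isUnit {R : Type} [Ring R] [Algebra CH R] (hR : HComplete R) (N : R) :
    IsUnit (1 + h • N) := by
  obtain ⟨s, hs⟩ := hR.lim fun k => (-N) ^ k
  have hgeom : ∀ K : ℕ, (1 + h • N) * ∑ k ∈ Finset.range K, h ^ k • (-N) ^ k =
      1 - h ^ K • (-N) ^ K := by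
    intro K
    have := mul_neg_geom_sum (-(h • N)) K
    simp only [sub_neg_eq_add] at this
    rw [show -(h • N) = h • (-N) by rw [smul_neg]] at this
    simpa only [smul_pow] using this
  have hgeom' : ∀ K : ℕ, (∑ k ∈ Finset.range K, h ^ k • (-N) ^ k) * (1 + h • N) =
      1 - h ^ K • (-N) ^ K := by
    intro K
    have := geom_sum_mul_neg (-(h • N)) K
    simp only [sub_neg_eq_add] at this
    rw [show -(h • N) = h • (-N) by rw [smul_neg]] at this
    simpa only [smul_pow] using this
  refine ⟨⟨1 + h • N, s, ?_, ?_⟩, rfl⟩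
  · rw [← sub_eq_zero]
    refine hR.sep _ fun K => ?_
    obtain ⟨y, hy⟩ := hs K
    refine ⟨(1 + h • N) * y - (-N) ^ K, ?_⟩
    rw [smul_sub, ← mul_smul_comm, ← hy, mul_sub, hgeom]
    abel
  · rw [← sub_eq_zero]
    refine hR.sep _ fun K => ?_
    obtain ⟨y, hy⟩ := hs K
    refine ⟨y * (1 + h • N) - (-N) ^ K, ?_⟩
    rw [smul_sub, ← smul_mul_assoc, ← hy, sub_mul, hgeom']
    abel

end Completeness

/-! ### Torsion -/

/-- Multiplication by `h` is injective. -/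
def TorsionFree (R : Type) [AddCommGroup R] [Module CH R] : Prop := ∀ x : R, h • x = 0 → x = 0

theorem TorsionFree.pow {R : Type} [AddCommGroup R] [Module CH R] (hR : TorsionFree R) (k : ℕ)
    {x : R} (hx : h ^ k • x = 0) : x = 0 := by
  induction k with
  | zero => simpa using hx
  | succ k ih => exact ih (hR _ (by rwa [smul_smul, ← pow_succ']))

theorem TorsionFree.cancel {R : Type} [AddCommGroup R] [Module CH R] (hR : TorsionFree R)
    {x y : R} (hxy : h • x = h • y) : x = y :=
  sub_eq_zero.1 (hR _ (by rw [smul_sub, hxy, sub_self]))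

theorem torsionFree_CH : TorsionFree CH := fun x hx => by
  simpa [h, PowerSeries.X_ne_zero] using hx

theorem TorsionFree.pi {α R : Type} [AddCommGroup R] [Module CH R] (hR : TorsionFree R) :
    TorsionFree (α → R) := fun _ hx => funext fun a => hR _ (congrFun hx a)

theorem TorsionFree.of_injective {R S : Type} [AddCommGroup R] [Module CH R] [AddCommGroup S]
    [Module CH S] (hR : TorsionFree R) (e : S →ₗ[CH] R) (he : Function.Injective e) :
    TorsionFree S := fun x hx => he (by
  rw [map_zero]; exact hR _ (by rw [← map_smul, hx, map_zero]))

theorem TorsionFree.matrix {J R : Type} [AddCommGroup R] [Module CH R] (hR : TorsionFree R) :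
    TorsionFree (Matrix J J R) :=
  hR.pi.pi.of_injective (Matrix.ofLinearEquiv CH).symm.toLinearMap
    (Matrix.ofLinearEquiv CH).symm.injective

theorem TorsionFree.powerSeries {R : Type} [Ring R] [Algebra CH R] (hR : TorsionFree R) :
    TorsionFree (PowerSeries R) := fun x hx => PowerSeries.ext fun k => hR _ (by
  have := congrArg (PowerSeries.coeff k) hx
  simpa using this)

end DoubleYangian

namespace DoubleYangian

/-! ### `RTT` relations over an arbitrary ring -/

section RTT

variable {J : Type} [Fintype J] [DecidableEq J] {B : Type} [Ring B]

/-- The super permutation, as an element of `End V ⊗ End V`. -/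
def permMat (par : J → ℕ) (B : Type) [Ring B] : Matrix J J (Matrix J J B) :=
  fun i j => Matrix.single j i ((-1) ^ (par i * par j))

/-- A matrix acting in the second leg. -/
def leg₂ : Matrix J J B →+* Matrix J J (Matrix J J B) := Matrix.scalar J

/-- A matrix acting in the first leg. -/
def leg₁ (par : J → ℕ) (T : Matrix J J B) : Matrix J J (Matrix J J B) :=
  permMat par B * leg₂ T * permMat par B

/-- Scalars. -/
def scal₂ : B →+* Matrix J J (Matrix J J B) := leg₂.comp (Matrix.scalar J)

theorem permMat_mul_apply (par : J → ℕ) (X : Matrix J J (Matrix J J B)) (i j k l : J) :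
    (permMat par B * X) i j k l = (-1) ^ (par i * par k) * X k j i l := by
  rw [Matrix.mul_apply, Matrix.sum_apply, Finset.sum_eq_single k]
  · rw [permMat, Matrix.single_mul_apply_same]
  · intro b _ hb
    rw [permMat, Matrix.single_mul_apply_of_ne _ _ _ _ _ hb.symm]
  · simp

theorem mul_permMat_apply (par : J → ℕ) (X : Matrix J J (Matrix J J B)) (i j k l : J) :
    (X * permMat par B) i j k l = X i l k j * (-1) ^ (par l * par j) := by
  rw [Matrix.mul_apply, Matrix.sum_apply, Finset.sum_eq_single l]
  · rw [permMat, Matrix.mul_single_apply_same]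
  · intro b _ hb
    rw [permMat, Matrix.mul_single_apply_of_ne _ _ _ _ _ hb.symm]
  · simp

theorem ext₂ {X Y : Matrix J J (Matrix J J B)} (hXY : ∀ i j k l, X i j k l = Y i j k l) : X = Y :=
  Matrix.ext fun i j => Matrix.ext fun k l => hXY i j k l

theorem neg_one_pow_mul_self (n : ℕ) : ((-1 : B) ^ n) * (-1) ^ n = 1 := by
  rw [← pow_add]
  exact (Even.add_self n).neg_one_pow

theorem mul_neg_one_pow (x : B) (n : ℕ) : x * (-1) ^ n = (-1) ^ n * x :=
  ((Commute.neg_one_left x).pow_left n).eq.symm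

theorem neg_one_pow_mul_mul {a b c : ℕ} (habc : Even (a + b) ↔ Even c) (x : B) :
    (-1) ^ a * ((-1) ^ b * x) = (-1) ^ c * x := by
  rw [← mul_assoc, ← pow_add, neg_one_pow_congr habc]

theorem neg_one_pow_mul_left_comm (n : ℕ) (q x : B) :
    (-1) ^ n * (q * x) = q * ((-1) ^ n * x) := by
  rw [← mul_assoc, ← mul_neg_one_pow, mul_assoc]

theorem permMat_apply (par : J → ℕ) (i j k l : J) :
    permMat par B i j k l = if j = k ∧ i = l then (-1) ^ (par i * par j) else 0 := by
  rw [permMat, Matrix.single_apply]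

theorem permMat_mul_self (par : J → ℕ) : permMat par B * permMat par B = 1 := by
  refine ext₂ fun i j k l => ?_
  rw [permMat_mul_apply, permMat_apply, Matrix.one_apply]
  by_cases hij : i = j
  · by_cases hkl : k = l
    · subst hij hkl
      simp [mul_comm (par k), neg_one_pow_mul_self]
    · simp [hij, hkl]
  · simp [hij, Ne.symm hij]

theorem leg₂_apply (T : Matrix J J B) (i j k l : J) :
    leg₂ T i j k l = if i = j then T k l else 0 := by
  by_cases hij : i = j <;> simp [leg₂, Matrix.scalar_apply, hij]

theorem leg₁_apply (par : J → ℕ) (T : Matrix J J B) (i j k l : J) :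
    leg₁ par T i j k l = if k = l then (-1) ^ ((par i + par j) * par k) * T i j else 0 := by
  rw [leg₁, mul_permMat_apply, permMat_mul_apply, leg₂_apply]
  by_cases hkl : k = l
  · subst hkl
    rw [if_pos rfl, if_pos rfl, mul_assoc, ← ((Commute.neg_one_left _).pow_left _).eq,
      ← mul_assoc, ← pow_add]
    ring_nf
  · simp [hkl]

theorem leg₁_mul_leg₂_apply (par : J → ℕ) (T S : Matrix J J B) (i j k l : J) :
    (leg₁ par T * leg₂ S) i j k l = (-1) ^ ((par i + par j) * par k) * (T i j * S k l) := by
  rw [Matrix.mul_apply, Matrix.sum_apply, Finset.sum_eq_single j]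
  · rw [Matrix.mul_apply, Finset.sum_eq_single k]
    · rw [leg₁_apply, leg₂_apply, if_pos rfl, if_pos rfl, mul_assoc]
    · intro b _ hb
      rw [leg₁_apply, if_neg hb.symm, zero_mul]
    · simp
  · intro b _ hb
    rw [Matrix.mul_apply]
    refine Finset.sum_eq_zero fun c _ => ?_
    rw [leg₂_apply, if_neg hb, mul_zero]
  · simp

theorem leg₂_mul_leg₁_apply (par : J → ℕ) (T S : Matrix J J B) (i j k l : J) :
    (leg₂ S * leg₁ par T) i j k l = (-1) ^ ((par i + par j) * par l) * (S k l * T i j) := by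
  rw [Matrix.mul_apply, Matrix.sum_apply, Finset.sum_eq_single i]
  · rw [Matrix.mul_apply, Finset.sum_eq_single l]
    · rw [leg₁_apply, leg₂_apply, if_pos rfl, if_pos rfl, ← mul_assoc,
        ← ((Commute.neg_one_left _).pow_left _).eq, mul_assoc]
    · intro b _ hb
      rw [leg₁_apply, if_neg hb, mul_zero]
    · simp
  · intro b _ hb
    rw [Matrix.mul_apply]
    refine Finset.sum_eq_zero fun c _ => ?_
    rw [leg₂_apply, if_neg hb.symm, zero_mul]
  · simp

theorem scal₂_mul_apply (q : B) (X : Matrix J J (Matrix J J B)) (i j k l : J) :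
    (scal₂ (J := J) q * X) i j k l = q * X i j k l := by
  simp [scal₂, leg₂, Matrix.scalar_apply, Matrix.diagonal_mul]

theorem commute_scal₂ {q : B} (hq : ∀ x, Commute q x) (X : Matrix J J (Matrix J J B)) :
    Commute (scal₂ q) X :=
  Matrix.scalar_commute _ (fun Y => Matrix.scalar_commute _ hq Y) X

/-- The relation `(q - p P) T₁ S₂ = S₂ T₁ (q - p P)`. -/
def IsRTT (par : J → ℕ) (p q : B) (T S : Matrix J J B) : Prop :=
  scal₂ q * (leg₁ par T * leg₂ S - leg₂ S * leg₁ par T) =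
    scal₂ p * (permMat par B * (leg₁ par T * leg₂ S) - leg₂ S * leg₁ par T * permMat par B)

/-- The relation `T₁ S₂ (q + p P) = (q + p P) S₂ T₁`. -/
def IsAltRTT (par : J → ℕ) (p q : B) (T S : Matrix J J B) : Prop :=
  scal₂ q * (leg₁ par T * leg₂ S - leg₂ S * leg₁ par T) =
    scal₂ p * (permMat par B * (leg₂ S * leg₁ par T) - leg₁ par T * leg₂ S * permMat par B)

/-- The matrix form is convenient for multiplying by `P` and by inverses, the entrywise form for
comparing with the defining relations. The signs arise from conjugating by `P`, so that ordinary
nested matrices replace the graded tensor product. -/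
theorem isRTT_iff {par : J → ℕ} {p q : B} {T S : Matrix J J B} :
    IsRTT par p q T S ↔ ∀ i j k l,
      q * ((-1) ^ ((par i + par j) * par k) * (T i j * S k l) -
        (-1) ^ ((par i + par j) * par l) * (S k l * T i j)) =
      p * ((-1) ^ (par i * par j) * (T k j * S i l - S k j * T i l)) := by
  have key : ∀ i j k l : J,
      (permMat par B * (leg₁ par T * leg₂ S) - leg₂ S * leg₁ par T * permMat par B) i j k l =
      (-1) ^ (par i * par j) * (T k j * S i l - S k j * T i l) := by
    intro i j k l
    rw [Matrix.sub_apply, Matrix.sub_apply, permMat_mul_apply, mul_permMat_apply,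
      leg₁_mul_leg₂_apply, leg₂_mul_leg₁_apply, mul_neg_one_pow, mul_sub]
    congr 1
    · refine neg_one_pow_mul_mul ?_ _
      simp only [Nat.even_add, Nat.even_mul]; tauto
    · refine neg_one_pow_mul_mul ?_ _
      simp only [Nat.even_add, Nat.even_mul]; tauto
  constructor
  · intro H i j k l
    have := congrFun (congrFun (congrFun (congrFun H i) j) k) l
    rwa [scal₂_mul_apply, scal₂_mul_apply, key, Matrix.sub_apply, Matrix.sub_apply,
      leg₁_mul_leg₂_apply, leg₂_mul_leg₁_apply] at this
  · intro H
    refine ext₂ fun i j k l => ?_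
    rw [scal₂_mul_apply, scal₂_mul_apply, key, Matrix.sub_apply, Matrix.sub_apply,
      leg₁_mul_leg₂_apply, leg₂_mul_leg₁_apply, H]

theorem isAltRTT_iff {par : J → ℕ} {p q : B} {T S : Matrix J J B} :
    IsAltRTT par p q T S ↔ ∀ i j k l,
      q * ((-1) ^ ((par i + par j) * par k) * (T i j * S k l) -
        (-1) ^ ((par i + par j) * par l) * (S k l * T i j)) =
      p * ((-1) ^ (par i * par k + par k * par l + par l * par j) *
        (S i l * T k j - T i l * S k j)) := by
  have key : ∀ i j k l : J,
      (permMat par B * (leg₂ S * leg₁ par T) - leg₁ par T * leg₂ S * permMat par B) i j k l =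
      (-1) ^ (par i * par k + par k * par l + par l * par j) *
        (S i l * T k j - T i l * S k j) := by
    intro i j k l
    rw [Matrix.sub_apply, Matrix.sub_apply, permMat_mul_apply, mul_permMat_apply,
      leg₁_mul_leg₂_apply, leg₂_mul_leg₁_apply, mul_neg_one_pow, mul_sub]
    congr 1
    · refine neg_one_pow_mul_mul ?_ _
      simp only [Nat.even_add, Nat.even_mul]; tauto
    · refine neg_one_pow_mul_mul ?_ _
      simp only [Nat.even_add, Nat.even_mul]; tauto
  constructor
  · intro H i j k l
    have := congrFun (congrFun (congrFun (congrFun H i) j) k) l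
    rwa [scal₂_mul_apply, scal₂_mul_apply, key, Matrix.sub_apply, Matrix.sub_apply,
      leg₁_mul_leg₂_apply, leg₂_mul_leg₁_apply] at this
  · intro H
    refine ext₂ fun i j k l => ?_
    rw [scal₂_mul_apply, scal₂_mul_apply, key, Matrix.sub_apply, Matrix.sub_apply,
      leg₁_mul_leg₂_apply, leg₂_mul_leg₁_apply, H]

theorem IsRTT.of_map {B' : Type} [Ring B'] (f : B →+* B') (hf : Function.Injective f)
    {par : J → ℕ} {p q : B} {T S : Matrix J J B}
    (H : IsRTT par (f p) (f q) (T.map f) (S.map f)) : IsRTT par p q T S := by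
  rw [isRTT_iff] at H ⊢
  intro i j k l
  apply hf
  simpa using H i j k l

/-- Passing to the opposite order of the two matrices. -/
theorem IsAltRTT.swap {par : J → ℕ} {p q : B} {T S : Matrix J J B}
    (H : IsAltRTT par p q T S) : IsRTT par p (-q) S T := by
  rw [isAltRTT_iff] at H
  rw [isRTT_iff]
  intro i j k l
  -- Exchanging the legs means reading the relation at `(k, l, i, j)`; the prefactor is the sign
  -- that realigns all four terms. The result has `-q`, in agreement with `u - v` becoming `v - u`.
  have := congrArg (fun x => (-1) ^ (par i * par k + par j * par l) * x) (H k l i j)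
  simp only [neg_one_pow_mul_left_comm _ q, neg_one_pow_mul_left_comm _ p, mul_sub] at this
  rw [neg_one_pow_mul_mul (c := (par i + par j) * par l),
    neg_one_pow_mul_mul (c := (par i + par j) * par k),
    neg_one_pow_mul_mul (c := par i * par j), neg_one_pow_mul_mul (c := par i * par j)] at this
  · rw [neg_mul, ← mul_neg, neg_sub, mul_sub, mul_sub, mul_sub, this]
  all_goals simp only [Nat.even_add, Nat.even_mul]; tauto

/-- Since `P² = 1`, one has `(q - pP)(q + pP) = (q - p)(q + p)`, which is central. Multiplying the
relation by `q + pP` on both sides gives the other form up to this factor, and the factor may be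
cancelled. -/
theorem IsAltRTT.of_isRTT {par : J → ℕ} {p q : B} (hp : ∀ x, Commute p x) (hq : ∀ x, Commute q x)
    (hpq : ∀ x, (q - p) * x = 0 → x = 0) (hpq' : ∀ x, (q + p) * x = 0 → x = 0)
    {T S : Matrix J J B} (H : IsRTT par p q T S) : IsAltRTT par p q T S := by
  have reg : ∀ r : B, (∀ x, r * x = 0 → x = 0) → ∀ X : Matrix J J (Matrix J J B),
      scal₂ (J := J) r * X = 0 → X = 0 := by
    intro r hr X hX
    refine ext₂ fun i j k l => hr _ ?_
    rw [← scal₂_mul_apply, hX]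
    rfl
  unfold IsAltRTT
  unfold IsRTT at H
  have hP := permMat_mul_self (B := B) par
  have cq := commute_scal₂ (J := J) hq
  have cp := commute_scal₂ (J := J) hp
  generalize leg₁ par T = T₁ at *
  generalize leg₂ S = S₂ at *
  generalize permMat par B = P at *
  rw [← sub_eq_zero]
  refine reg _ hpq _ (reg _ hpq' _ ?_)
  rw [map_sub, map_add]
  generalize scal₂ (J := J) q = q at *
  generalize scal₂ (J := J) p = p at *
  have H' : (q - p * P) * (T₁ * S₂) = S₂ * T₁ * (q - p * P) := by
    rw [sub_mul, mul_sub, mul_assoc p, ← (cq (S₂ * T₁)).eq, ← mul_assoc (S₂ * T₁),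
      ← (cp (S₂ * T₁)).eq, mul_assoc p]
    rw [mul_sub, mul_sub] at H
    exact sub_eq_sub_iff_sub_eq_sub.1 H
  have e1 : (q + p * P) * (q - p * P) = (q + p) * (q - p) := by
    have : p * P * (p * P) = p * p := by
      rw [mul_assoc, ← mul_assoc P, ← (cp P).eq, mul_assoc p P, hP, mul_one]
    rw [add_mul, mul_sub, mul_sub, this, add_mul, mul_sub, mul_sub, (cq (p * P)).eq, (cq p).eq]
    abel
  have e2 : (q - p * P) * (q + p * P) = (q + p) * (q - p) := by
    have : p * P * (p * P) = p * p := by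
      rw [mul_assoc, ← mul_assoc P, ← (cp P).eq, mul_assoc p P, hP, mul_one]
    rw [sub_mul, mul_add, mul_add, this, add_mul, mul_sub, mul_sub, (cq (p * P)).eq, (cq p).eq]
    abel
  have e3 : (q + p) * (q - p) * (T₁ * S₂ * (q + p * P)) =
      (q + p * P) * (S₂ * T₁) * ((q + p) * (q - p)) := by
    rw [← e1, ← mul_assoc, mul_assoc (q + p * P) (q - p * P), H', e1, ← e2]
    simp only [mul_assoc]
  have cc : ∀ X, (q + p) * (q - p) * X = X * ((q + p) * (q - p)) := by
    intro X
    rw [mul_assoc, sub_mul, (cq X).eq, (cp X).eq, ← mul_sub, ← mul_assoc, add_mul, (cq X).eq,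
      (cp X).eq, ← mul_add, mul_assoc]
  rw [← cc ((q + p * P) * (S₂ * T₁))] at e3
  rw [← mul_assoc (q + p)]
  rw [← sub_eq_zero, ← mul_sub] at e3
  rw [← e3]
  congr 1
  rw [mul_add, add_mul, ← (cq (T₁ * S₂)).eq, ← mul_assoc (T₁ * S₂), ← (cp (T₁ * S₂)).eq,
    mul_sub, mul_sub, mul_assoc p, mul_assoc p]
  abel

theorem leg₁_mul (par : J → ℕ) (T S : Matrix J J B) :
    leg₁ par (T * S) = leg₁ par T * leg₁ par S := by
  have hP := permMat_mul_self (B := B) par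
  simp only [leg₁, map_mul, mul_assoc]
  rw [← mul_assoc (permMat par B) (permMat par B), hP, one_mul]

theorem leg₁_one (par : J → ℕ) : leg₁ par (1 : Matrix J J B) = 1 := by
  rw [leg₁, map_one, mul_one, permMat_mul_self]

theorem permMat_mul_leg₁ (par : J → ℕ) (T : Matrix J J B) :
    permMat par B * leg₁ par T = leg₂ T * permMat par B := by
  rw [leg₁, ← mul_assoc, ← mul_assoc, permMat_mul_self, one_mul]

theorem leg₁_mul_permMat (par : J → ℕ) (T : Matrix J J B) :
    leg₁ par T * permMat par B = permMat par B * leg₂ T := by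
  rw [leg₁, mul_assoc, permMat_mul_self, mul_one]

/-- The commutation relations between `T` and the inverse of `S`. -/
theorem IsRTT.inv_right {par : J → ℕ} {p q : B} (hp : ∀ x, Commute p x) (hq : ∀ x, Commute q x)
    {T S S' : Matrix J J B} (H : IsRTT par p q T S) (h1 : S * S' = 1) (h2 : S' * S = 1) :
    scal₂ q * (leg₁ par T * leg₂ S' - leg₂ S' * leg₁ par T) =
      scal₂ p * (permMat par B * leg₂ (T * S') - leg₂ (S' * T) * permMat par B) := by
  have cq := commute_scal₂ (J := J) hq
  have cp := commute_scal₂ (J := J) hp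
  have e1 : leg₂ S * leg₂ S' = 1 := by rw [← map_mul, h1, map_one]
  have e2 : leg₂ S' * leg₂ S = 1 := by rw [← map_mul, h2, map_one]
  unfold IsRTT at H
  have := congrArg (fun x => leg₂ S' * (x * leg₂ S')) H
  simp only [mul_sub, sub_mul] at this
  simp only [← mul_assoc, (cq (leg₂ S')).eq.symm, (cp (leg₂ S')).eq.symm] at this
  simp only [mul_assoc] at this
  rw [e1, ← mul_assoc (leg₂ S') (leg₂ S), e2, one_mul, mul_one, ← mul_assoc (leg₂ S') (leg₂ S), e2,
    one_mul, ← mul_assoc (leg₁ par T), leg₁_mul_permMat, permMat_mul_leg₁]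
    at this
  rw [mul_sub, mul_sub, map_mul, map_mul, ← neg_inj, neg_sub, neg_sub]
  simpa only [mul_assoc, mul_one] using this

/-- Entries of `T` and of `S⁻¹` in disjoint positions commute. -/
theorem IsRTT.commute_inv {par : J → ℕ} {p q : B} (hp : ∀ x, Commute p x)
    (hq : ∀ x, Commute q x) (hreg : ∀ x, q * x = 0 → x = 0)
    {T S S' : Matrix J J B} (H : IsRTT par p q T S) (h1 : S * S' = 1) (h2 : S' * S = 1)
    {i j k l : J} (hkj : k ≠ j) (hil : i ≠ l) (hij : par i = par j) :
    Commute (T i j) (S' k l) := by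
  have := congrFun (congrFun (congrFun (congrFun (H.inv_right hp hq h1 h2) i) j) k) l
  rw [scal₂_mul_apply, scal₂_mul_apply, Matrix.sub_apply, Matrix.sub_apply, Matrix.sub_apply,
    Matrix.sub_apply, leg₁_mul_leg₂_apply, leg₂_mul_leg₁_apply, permMat_mul_apply,
    mul_permMat_apply, leg₂_apply, leg₂_apply, if_neg hkj, if_neg hil, mul_zero, zero_mul, sub_zero,
    mul_zero, (Even.neg_one_pow (by simp [hij, ← two_mul, mul_assoc]) :
      (-1 : B) ^ ((par i + par j) * par k) = 1), one_mul,
    (Even.neg_one_pow (by simp [hij, ← two_mul, mul_assoc]) :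
      (-1 : B) ^ ((par i + par j) * par l) = 1), one_mul] at this
  exact sub_eq_zero.1 (hreg _ this)

/-- Multiply by `S'₂ T'₁` on the left and by `T'₁ S'₂` on the right. The other form of the relation
is the one in which `P` ends up on the correct sides; the price is the sign of `p`. -/
theorem IsAltRTT.inv_inv {par : J → ℕ} {p q : B} (hp : ∀ x, Commute p x)
    (hq : ∀ x, Commute q x)
    {T S T' S' : Matrix J J B} (H : IsAltRTT par p q T S) (hT1 : T * T' = 1) (hT2 : T' * T = 1)
    (hS1 : S * S' = 1) (hS2 : S' * S = 1) : IsRTT par (-p) q T' S' := by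
  have cq := commute_scal₂ (J := J) hq
  have cp := commute_scal₂ (J := J) hp
  have e1 : leg₂ S * leg₂ S' = 1 := by rw [← map_mul, hS1, map_one]
  have e2 : leg₂ S' * leg₂ S = 1 := by rw [← map_mul, hS2, map_one]
  have f1 : leg₁ par T * leg₁ par T' = 1 := by rw [← leg₁_mul, hT1, leg₁_one]
  have f2 : leg₁ par T' * leg₁ par T = 1 := by rw [← leg₁_mul, hT2, leg₁_one]
  unfold IsAltRTT at H
  unfold IsRTT
  generalize leg₁ par T = X at *
  generalize leg₁ par T' = X' at *
  generalize leg₂ S = Y at *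
  generalize leg₂ S' = Y' at *
  have k1 : Y' * X' * (X * Y) = 1 := by rw [mul_assoc, ← mul_assoc X', f2, one_mul, e2]
  have k2 : Y * X * (X' * Y') = 1 := by rw [mul_assoc, ← mul_assoc X, f1, one_mul, e1]
  have := congrArg (fun x => Y' * X' * (x * (X' * Y'))) H
  simp only [mul_sub, sub_mul] at this
  simp only [mul_assoc (scal₂ (J := J) q), mul_assoc (scal₂ (J := J) p), ← (cq _).left_comm,
    ← (cp _).left_comm] at this
  rw [k2, mul_assoc (permMat par B), k2, ← mul_assoc (Y' * X') (X * Y), k1, one_mul,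
    mul_assoc (X * Y), ← mul_assoc (Y' * X') (X * Y), k1, one_mul, mul_one, mul_one] at this
  rw [map_neg, neg_mul, ← mul_neg, neg_sub, mul_sub, mul_sub]
  exact this

theorem IsRTT.submatrix {K : Type} [Fintype K] [DecidableEq K] {par : J → ℕ} {p q : B}
    {T S : Matrix J J B} (H : IsRTT par p q T S) (f : K → J) :
    IsRTT (par ∘ f) p q (T.submatrix f f) (S.submatrix f f) := by
  rw [isRTT_iff] at H ⊢
  exact fun i j k l => H (f i) (f j) (f k) (f l)

/-- On odd indices the signs of the products disappear and `P` changes sign. Together with the sign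
in `IsAltRTT.inv_inv`, the odd block of `T⁻¹` satisfies the same even relation as the even block of
`T`. -/
theorem IsRTT.of_odd {p q : B} {T S : Matrix J J B} (H : IsRTT (fun _ => 1) p q T S) :
    IsRTT (fun _ => 0) (-p) q T S := by
  rw [isRTT_iff] at H ⊢
  intro i j k l
  rw [neg_mul, ← mul_neg, ← mul_neg, neg_sub]
  simpa using H i j k l

end RTT
end DoubleYangian

namespace DoubleYangian

/-! ### The defining relations in terms of series -/

theorem neg_one_pow_mul_mul_mul {B : Type} [Ring B] {a b c d : ℕ}
    (habc : Even (a + b + c) ↔ Even d) (x : B) :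
    (-1) ^ a * ((-1) ^ b * ((-1) ^ c * x)) = (-1) ^ d * x := by
  rw [neg_one_pow_mul_mul (c := b + c) Iff.rfl, neg_one_pow_mul_mul]
  rw [← habc, add_assoc]

section Entries

variable {m n : ℕ} {A : Type} [Ring A] [Algebra CH A]

theorem superMul_T₁_T₂ (t : Idx m n → Idx m n → Deg → A) (ε₁ ε₂ : Half) (a b : ℤ)
    (i j k l : Idx m n) :
    superMul (T₁ t ε₁ a) (T₂ t ε₂ b) i j k l =
      (-1) ^ (par i * par j + par j + par k * par l + par l + (par i + par j) * (par k + par l)) *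
        (tCoeff t ε₁ i j a * tCoeff t ε₂ k l b) := by
  rw [superMul, Finset.sum_eq_single j, Finset.sum_eq_single k]
  · rw [T₁, T₂, if_pos rfl, if_pos rfl, mul_assoc ((-1) ^ (par i * par j + par j)),
      ← neg_one_pow_mul_left_comm _ (tCoeff t ε₁ i j a), neg_one_pow_mul_mul_mul]
    -- Equality of signs is an identity between polynomials in four parities, checked by enumeration
    -- over `ZMod 2`.
    rw [← ZMod.natCast_eq_zero_iff_even, ← ZMod.natCast_eq_zero_iff_even]
    push_cast
    generalize (par i : ZMod 2) = i, (par j : ZMod 2) = j, (par k : ZMod 2) = k,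
      (par l : ZMod 2) = l
    revert i j k l
    decide
  · intro q _ hq
    rw [T₁, if_neg hq.symm, zero_mul, mul_zero]
  · simp
  · intro p _ hp
    refine Finset.sum_eq_zero fun q _ => ?_
    rw [T₂, if_neg hp, mul_zero, mul_zero]
  · simp

theorem superMul_T₂_T₁ (t : Idx m n → Idx m n → Deg → A) (ε₁ ε₂ : Half) (a b : ℤ)
    (i j k l : Idx m n) :
    superMul (T₂ t ε₂ b) (T₁ t ε₁ a) i j k l =
      (-1) ^ (par i * par j + par j + par k * par l + par l) *
        (tCoeff t ε₂ k l b * tCoeff t ε₁ i j a) := by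
  rw [superMul, Finset.sum_eq_single i, Finset.sum_eq_single l]
  · rw [T₁, T₂, if_pos rfl, if_pos rfl, mul_assoc ((-1) ^ (par k * par l + par l)),
      ← neg_one_pow_mul_left_comm _ (tCoeff t ε₂ k l b), neg_one_pow_mul_mul_mul]
    rw [← ZMod.natCast_eq_zero_iff_even, ← ZMod.natCast_eq_zero_iff_even]
    push_cast
    generalize (par i : ZMod 2) = i, (par j : ZMod 2) = j, (par k : ZMod 2) = k,
      (par l : ZMod 2) = l
    revert i j k l
    decide
  · intro q _ hq
    rw [T₁, if_neg hq, mul_zero, mul_zero]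
  · simp
  · intro p _ hp
    refine Finset.sum_eq_zero fun q _ => ?_
    rw [T₂, if_neg hp.symm, zero_mul, mul_zero]
  · simp

theorem superMul_superPerm_left (Z : Mat2 m n A) (i j k l : Idx m n) :
    superMul (superPerm m n A) Z i j k l =
      (-1) ^ (par k + (par k + par i) * (par k + par j)) * Z k j i l := by
  rw [superMul, Finset.sum_eq_single k, Finset.sum_eq_single i]
  · rw [superPerm, if_pos ⟨rfl, rfl⟩, neg_one_pow_mul_mul]
    rw [← ZMod.natCast_eq_zero_iff_even, ← ZMod.natCast_eq_zero_iff_even]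
    push_cast
    generalize (par i : ZMod 2) = i, (par j : ZMod 2) = j, (par k : ZMod 2) = k,
      (par l : ZMod 2) = l
    revert i j k l
    decide
  · intro q _ hq
    rw [superPerm, if_neg (fun hc => hq hc.2), zero_mul, mul_zero]
  · simp
  · intro p _ hp
    refine Finset.sum_eq_zero fun q _ => ?_
    rw [superPerm, if_neg (fun hc => hp hc.1.symm), zero_mul, mul_zero]
  · simp

theorem superMul_superPerm_right (Z : Mat2 m n A) (i j k l : Idx m n) :
    superMul Z (superPerm m n A) i j k l =
      (-1) ^ (par j + (par k + par j) * (par l + par j)) * Z i l k j := by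
  rw [superMul, Finset.sum_eq_single l, Finset.sum_eq_single j]
  · rw [superPerm, if_pos ⟨rfl, rfl⟩, mul_neg_one_pow, neg_one_pow_mul_mul]
    rw [← ZMod.natCast_eq_zero_iff_even, ← ZMod.natCast_eq_zero_iff_even]
    push_cast
    generalize (par i : ZMod 2) = i, (par j : ZMod 2) = j, (par k : ZMod 2) = k,
      (par l : ZMod 2) = l
    revert i j k l
    decide
  · intro q _ hq
    rw [superPerm, if_neg (fun hc => hq hc.1), mul_zero, mul_zero]
  · simp
  · intro p _ hp
    refine Finset.sum_eq_zero fun q _ => ?_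
    rw [superPerm, if_neg (fun hc => hp hc.2.symm), mul_zero, mul_zero]
  · simp

/-- An entry of the `RTT` relation, in terms of the coefficients of the series. -/
noncomputable def rttEntry (c₁ c₂ : Idx m n → Idx m n → ℤ → A) (a b : ℤ) (i j k l : Idx m n) : A :=
  (-1) ^ ((par i + par j) * par k) * (c₁ i j (a - 1) * c₂ k l b - c₁ i j a * c₂ k l (b - 1))
    - (-1) ^ ((par i + par j) * par l) * (c₂ k l b * c₁ i j (a - 1) - c₂ k l (b - 1) * c₁ i j a)
    - h • ((-1) ^ (par i * par j) * (c₁ k j a * c₂ i l b - c₂ k j b * c₁ i l a))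

/-- The exponent of the sign relating `rttCoeff` and `rttEntry`. -/
def gauge (i j k l : Idx m n) : ℕ :=
  (par k + par l) * par j + (par i + par j + par k + par l) * (par j + par l)

/-- An overall sign, depending only on the four indices, turns the conventions of the graded tensor
product into those of `isRTT_iff`. Hence the two systems of relations are equivalent. -/
theorem gauge_mul_rttCoeff (t : Idx m n → Idx m n → Deg → A) (ε₁ ε₂ : Half) (a b : ℤ)
    (i j k l : Idx m n) :
    (-1) ^ gauge i j k l * rttCoeff t ε₁ ε₂ a b i j k l =
      rttEntry (tCoeff t ε₁) (tCoeff t ε₂) a b i j k l := by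
  simp only [rttCoeff, Pi.sub_apply, Pi.smul_apply, superMul_T₁_T₂, superMul_T₂_T₁,
    superMul_superPerm_left, superMul_superPerm_right, mul_sub, mul_smul_comm, rttEntry, smul_sub,
    gauge]
  have s1 : Even ((par k + par l) * par j + (par i + par j + par k + par l) * (par j + par l) +
      (par i * par j + par j + par k * par l + par l + (par i + par j) * (par k + par l))) ↔
      Even ((par i + par j) * par k) := by
    rw [← ZMod.natCast_eq_zero_iff_even, ← ZMod.natCast_eq_zero_iff_even]
    push_cast
    generalize (par i : ZMod 2) = i, (par j : ZMod 2) = j, (par k : ZMod 2) = k,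
      (par l : ZMod 2) = l
    revert i j k l
    decide
  have s2 : Even ((par k + par l) * par j + (par i + par j + par k + par l) * (par j + par l) +
      (par i * par j + par j + par k * par l + par l)) ↔ Even ((par i + par j) * par l) := by
    rw [← ZMod.natCast_eq_zero_iff_even, ← ZMod.natCast_eq_zero_iff_even]
    push_cast
    generalize (par i : ZMod 2) = i, (par j : ZMod 2) = j, (par k : ZMod 2) = k,
      (par l : ZMod 2) = l
    revert i j k l
    decide
  have s3 : Even ((par k + par l) * par j + (par i + par j + par k + par l) * (par j + par l) +
      (par k + (par k + par i) * (par k + par j)) +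
      (par k * par j + par j + par i * par l + par l + (par k + par j) * (par i + par l))) ↔
      Even (par i * par j) := by
    rw [← ZMod.natCast_eq_zero_iff_even, ← ZMod.natCast_eq_zero_iff_even]
    push_cast
    generalize (par i : ZMod 2) = i, (par j : ZMod 2) = j, (par k : ZMod 2) = k,
      (par l : ZMod 2) = l
    revert i j k l
    decide
  have s4 : Even ((par k + par l) * par j + (par i + par j + par k + par l) * (par j + par l) +
      (par j + (par k + par j) * (par l + par j)) +
      (par i * par l + par l + par k * par j + par j)) ↔ Even (par i * par j) := by
    rw [← ZMod.natCast_eq_zero_iff_even, ← ZMod.natCast_eq_zero_iff_even]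
    push_cast
    generalize (par i : ZMod 2) = i, (par j : ZMod 2) = j, (par k : ZMod 2) = k,
      (par l : ZMod 2) = l
    revert i j k l
    decide
  rw [neg_one_pow_mul_mul s1, neg_one_pow_mul_mul s1, neg_one_pow_mul_mul s2,
    neg_one_pow_mul_mul s2, neg_one_pow_mul_mul_mul s3, neg_one_pow_mul_mul_mul s4]
  abel

/-- The coefficient `τ` in `tCoeff = δ + h τ`. -/
noncomputable def tauCoeff (t : Idx m n → Idx m n → Deg → A) : Half → Idx m n → Idx m n → ℤ → A
  | Half.minus, i, j, a => if ha : a < 0 then t i j ⟨-a, by omega⟩ else 0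
  | Half.plus, i, j, a => - (if ha : 0 ≤ a then t i j ⟨-(a + 1), by omega⟩ else 0)

/-- The constant term of the series `tᵢⱼ(u)`. -/
noncomputable def delta (i j : Idx m n) (a : ℤ) : CH := if a = 0 ∧ i = j then 1 else 0

theorem tCoeff_eq (t : Idx m n → Idx m n → Deg → A) (ε : Half) (i j : Idx m n) (a : ℤ) :
    tCoeff t ε i j a = delta i j a • (1 : A) + h • tauCoeff t ε i j a := by
  cases ε
  · simp only [tCoeff, tauCoeff, delta]
    congr 1
    · split_ifs <;> simp
    · split_ifs <;> simp
  · simp only [tCoeff, tauCoeff, delta, sub_eq_add_neg, smul_neg]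
    congr 1
    · split_ifs <;> simp
    · split_ifs <;> simp

/-- The `RTT` relation divided by `h ^ 2`. -/
noncomputable def relEntry (τ₁ τ₂ : Idx m n → Idx m n → ℤ → A) (a b : ℤ) (i j k l : Idx m n) :
    A :=
  ((-1) ^ ((par i + par j) * par k) * (τ₁ i j (a - 1) * τ₂ k l b - τ₁ i j a * τ₂ k l (b - 1))
    - (-1) ^ ((par i + par j) * par l) * (τ₂ k l b * τ₁ i j (a - 1) - τ₂ k l (b - 1) * τ₁ i j a))
    - (-1) ^ (par i * par j) * (delta k j a • τ₂ i l b + delta i l b • τ₁ k j a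
      - delta k j b • τ₁ i l a - delta i l a • τ₂ k j b +
        h • (τ₁ k j a * τ₂ i l b - τ₂ k j b * τ₁ i l a))

/-- Both products vanish unless `a = b = 0`, where they coincide. This kills the term of order `h`
in the relation and is the reason why a factor `h ^ 2` can be cancelled. -/
theorem delta_mul_delta (i j k l : Idx m n) (a b : ℤ) :
    delta i j a * delta k l b = delta i j b * delta k l a := by
  simp only [delta]
  split_ifs <;> simp_all

theorem neg_one_pow_smul_delta (i j k : Idx m n) (a : ℤ) :
    (-1) ^ ((par i + par j) * par k) * delta i j a = delta i j a := by
  simp only [delta]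
  split_ifs with hij
  · rw [hij.2, ← two_mul, mul_assoc, pow_mul]; simp
  · simp

theorem neg_one_pow_eq_smul (n : ℕ) (x : A) : (-1) ^ n * x = ((-1 : CH) ^ n) • x := by
  rcases neg_one_pow_eq_or CH n with hn | hn <;> rcases Nat.even_or_odd n with he | he <;>
    simp [he.neg_one_pow]

/-- The expansion in powers of `h` with all signs and constant terms as abstract scalars. The
hypotheses say that a sign is immaterial wherever it multiplies a Kronecker delta; they cancel
everything below order `h ^ 2`. -/
theorem h_sq_smul_rel_expand {R : Type} [CommRing R] {A : Type} [Ring A] [Algebra R A]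
    (h s s' s'' d₁ d₁' d₂ d₂' e f e' f' : R) (x x' y y' z z' w w' : A)
    (h1 : s * d₁ = d₁) (h1' : s * d₁' = d₁') (h2 : s' * d₁ = d₁) (h2' : s' * d₁' = d₁')
    (h3 : s * d₂ = s' * d₂) (h3' : s * d₂' = s' * d₂') (h4 : e * f = e' * f') :
    h ^ 2 • (s • (x * y - x' * y') - s' • (y * x - y' * x') - s'' • (e • w + f • z - e' • w' - f' • z'
      + h • (z * w - z' * w'))) =
    s • ((d₁ • (1 : A) + h • x) * (d₂ • (1 : A) + h • y) -
        (d₁' • (1 : A) + h • x') * (d₂' • (1 : A) + h • y')) -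
      s' • ((d₂ • (1 : A) + h • y) * (d₁ • (1 : A) + h • x) -
        (d₂' • (1 : A) + h • y') * (d₁' • (1 : A) + h • x')) -
      h • (s'' • ((e • (1 : A) + h • z) * (f • (1 : A) + h • w) -
        (e' • (1 : A) + h • z') * (f' • (1 : A) + h • w'))) := by
  simp only [mul_add, add_mul, smul_mul_assoc, mul_smul_comm, one_mul, mul_one]
  match_scalars
  all_goals ring_nf
  · linear_combination d₂ * (h2 - h1) + d₂' * (h1' - h2') + h * s'' * h4
  · linear_combination - h * h3
  · linear_combination h * (h2 - h1)
  · linear_combination h * h3'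
  · linear_combination h * (h1' - h2')

theorem h_sq_smul_relEntry (t : Idx m n → Idx m n → Deg → A) (ε₁ ε₂ : Half) (a b : ℤ)
    (i j k l : Idx m n) :
    h ^ 2 • relEntry (tauCoeff t ε₁) (tauCoeff t ε₂) a b i j k l =
      rttEntry (tCoeff t ε₁) (tCoeff t ε₂) a b i j k l := by
  simp only [relEntry, rttEntry, tCoeff_eq, neg_one_pow_eq_smul]
  have e1 := neg_one_pow_smul_delta i j k
  have e2 := neg_one_pow_smul_delta i j l
  have e3 : ∀ a, (-1) ^ ((par i + par j) * par k) * delta k l a =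
      (-1) ^ ((par i + par j) * par l) * delta k l a := fun a => by
    by_cases hkl : k = l
    · rw [hkl]
    · simp [delta, hkl]
  exact h_sq_smul_rel_expand (s := (-1) ^ ((par i + par j) * par k))
    (s' := (-1) ^ ((par i + par j) * par l)) (h1 := e1 (a - 1)) (h1' := e1 a) (h2 := e2 (a - 1))
    (h2' := e2 a) (h3 := e3 b) (h3' := e3 (b - 1)) (h4 := delta_mul_delta k j i l a b) ..

end Entries
end DoubleYangian

namespace DoubleYangian

/-! ### Representations and the `RTT` relations for series in two variables -/

section Relations

variable {m n : ℕ} {A : Type} [Ring A] [Algebra CH A] {A' : Type} [Ring A'] [Algebra CH A']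

theorem map_tauCoeff (f : A →ₐ[CH] A') (t : Idx m n → Idx m n → Deg → A) (ε : Half)
    (i j : Idx m n) (a : ℤ) :
    f (tauCoeff t ε i j a) = tauCoeff (fun i j r => f (t i j r)) ε i j a := by
  cases ε
  · simp only [tauCoeff]; split_ifs <;> simp
  · simp only [tauCoeff, map_neg]; split_ifs <;> simp

theorem map_tCoeff (f : A →ₐ[CH] A') (t : Idx m n → Idx m n → Deg → A) (ε : Half)
    (i j : Idx m n) (a : ℤ) :
    f (tCoeff t ε i j a) = tCoeff (fun i j r => f (t i j r)) ε i j a := by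
  rw [tCoeff_eq, tCoeff_eq, map_add, map_smul, map_smul, map_one, map_tauCoeff]

theorem map_rttEntry (f : A →ₐ[CH] A') (c₁ c₂ : Idx m n → Idx m n → ℤ → A) (a b : ℤ)
    (i j k l : Idx m n) :
    f (rttEntry c₁ c₂ a b i j k l) =
      rttEntry (fun i j r => f (c₁ i j r)) (fun i j r => f (c₂ i j r)) a b i j k l := by
  simp only [rttEntry, map_sub, map_mul, map_pow, map_neg, map_one, map_smul]

theorem map_relEntry (f : A →ₐ[CH] A') (c₁ c₂ : Idx m n → Idx m n → ℤ → A) (a b : ℤ)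
    (i j k l : Idx m n) :
    f (relEntry c₁ c₂ a b i j k l) =
      relEntry (fun i j r => f (c₁ i j r)) (fun i j r => f (c₂ i j r)) a b i j k l := by
  simp only [relEntry, map_sub, map_add, map_mul, map_pow, map_neg, map_one, map_smul]

/-- The generators before completion. -/
noncomputable def preGen (m n : ℕ) (i j : Idx m n) (r : Deg) : PreDY m n :=
  RingQuot.mkAlgHom CH (Rel m n) (freeGen m n i j r)

theorem neg_one_pow_mul_eq_zero {B : Type} [Ring B] {k : ℕ} {x : B} (hx : (-1) ^ k * x = 0) :
    x = 0 := by
  rw [← one_mul x, ← neg_one_pow_mul_self k, mul_assoc, hx, mul_zero]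

theorem relEntry_preGen {ε₁ ε₂ : Half} (hε : ¬ (ε₁ = Half.plus ∧ ε₂ = Half.minus)) (a b : ℤ)
    (i j k l : Idx m n) :
    relEntry (tauCoeff (preGen m n) ε₁) (tauCoeff (preGen m n) ε₂) a b i j k l = 0 := by
  have h1 : Rel m n ((-1) ^ gauge i j k l *
      relEntry (tauCoeff (freeGen m n) ε₁) (tauCoeff (freeGen m n) ε₂) a b i j k l) 0 := by
    refine Rel.rtt ε₁ ε₂ hε a b i j k l _ ?_
    rw [← mul_smul_comm, h_sq_smul_relEntry, ← gauge_mul_rttCoeff, ← mul_assoc,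
      neg_one_pow_mul_self, one_mul]
  have h2 := RingQuot.mkAlgHom_rel CH h1
  rw [map_mul, map_pow, map_neg, map_one, map_zero] at h2
  have h3 := map_relEntry (A := Free m n) (A' := PreDY m n) (RingQuot.mkAlgHom CH (Rel m n))
    (tauCoeff (freeGen m n) ε₁) (tauCoeff (freeGen m n) ε₂) a b i j k l
  rw [show (RingQuot.mkAlgHom CH (Rel m n)) (relEntry (tauCoeff (freeGen m n) ε₁)
    (tauCoeff (freeGen m n) ε₂) a b i j k l) = 0 from
    neg_one_pow_mul_eq_zero (B := PreDY m n) h2] at h3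
  have h4 : ∀ ε i j a, (RingQuot.mkAlgHom CH (Rel m n)) (tauCoeff (freeGen m n) ε i j a) =
      tauCoeff (preGen m n) ε i j a := fun ε i j a =>
    map_tauCoeff (A := Free m n) (A' := PreDY m n) (RingQuot.mkAlgHom CH (Rel m n)) (freeGen m n) ε i j a
  simpa only [h4] using h3.symm

theorem rttEntry_preGen {ε₁ ε₂ : Half} (hε : ¬ (ε₁ = Half.plus ∧ ε₂ = Half.minus)) (a b : ℤ)
    (i j k l : Idx m n) :
    rttEntry (tCoeff (preGen m n) ε₁) (tCoeff (preGen m n) ε₂) a b i j k l = 0 := by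
  rw [← h_sq_smul_relEntry, relEntry_preGen hε, smul_zero]

/-- A family of elements satisfying the `RTT` relations. -/
def IsRTTFamily (t : Idx m n → Idx m n → Deg → A) : Prop :=
  ∀ ε₁ ε₂ : Half, ¬ (ε₁ = Half.plus ∧ ε₂ = Half.minus) → ∀ a b i j k l,
    rttEntry (tCoeff t ε₁) (tCoeff t ε₂) a b i j k l = 0

theorem isRTTFamily_algHom (φ : PreDY m n →ₐ[CH] A) :
    IsRTTFamily fun i j r => φ (preGen m n i j r) := by
  intro ε₁ ε₂ hε a b i j k l
  have h1 := map_rttEntry (A := PreDY m n) φ (tCoeff (preGen m n) ε₁) (tCoeff (preGen m n) ε₂)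
    a b i j k l
  rw [rttEntry_preGen hε, map_zero] at h1
  have h2 : ∀ ε i j a, φ (tCoeff (preGen m n) ε i j a) =
      tCoeff (fun i j r => φ (preGen m n i j r)) ε i j a := fun ε i j a =>
    map_tCoeff (A := PreDY m n) φ (preGen m n) ε i j a
  simpa only [h2] using h1.symm

/-- The representation of the double Yangian defined by an `RTT` family in a torsion free
algebra. -/
theorem IsRTTFamily.exists_algHom {t : Idx m n → Idx m n → Deg → A} (ht : IsRTTFamily t)
    (hA : TorsionFree A) :
    ∃ φ : PreDY m n →ₐ[CH] A, ∀ i j r, φ (preGen m n i j r) = t i j r := by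
  let f : Free m n →ₐ[CH] A := FreeAlgebra.lift CH fun x => t x.1 x.2.1 x.2.2
  have hf : ∀ i j r, f (freeGen m n i j r) = t i j r := fun i j r => by
    simp only [f, freeGen, FreeAlgebra.lift_ι_apply]
  have hf' : ∀ ⦃x y : Free m n⦄, Rel m n x y → f x = f y := by
    rintro x y ⟨ε₁, ε₂, hε, a, b, i, j, k, l, x, hx⟩
    rw [map_zero]
    refine hA.pow 2 ?_
    rw [← map_smul, hx]
    refine neg_one_pow_mul_eq_zero (k := gauge i j k l) ?_
    have := congrArg f (gauge_mul_rttCoeff (freeGen m n) ε₁ ε₂ a b i j k l)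
    rw [map_mul, map_pow, map_neg, map_one, map_rttEntry] at this
    rw [this]
    simp only [map_tCoeff, hf]
    exact ht ε₁ ε₂ hε a b i j k l
  refine ⟨RingQuot.liftAlgHom CH ⟨f, hf'⟩, fun i j r => ?_⟩
  rw [preGen, RingQuot.liftAlgHom_mkAlgHom_apply]
  exact hf i j r

/-- The matrix of the series `tᵢⱼ(u)`. -/
noncomputable def seriesMatrix (t : Idx m n → Idx m n → Deg → A) :
    Half → Matrix (Idx m n) (Idx m n) (PowerSeries A)
  | Half.minus => fun i j => PowerSeries.mk fun a : ℕ => tCoeff t Half.minus i j (-(a : ℤ))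
  | Half.plus => fun i j => PowerSeries.mk fun a : ℕ => tCoeff t Half.plus i j (a : ℤ)

/-- The power of `u` corresponding to a power of the variable of the series. -/
def Half.exponent : Half → ℕ → ℤ
  | Half.minus, a => -(a : ℤ)
  | Half.plus, a => a

theorem coeff_seriesMatrix (t : Idx m n → Idx m n → Deg → A) (ε : Half) (i j : Idx m n) (a : ℕ) :
    PowerSeries.coeff a (seriesMatrix t ε i j) = tCoeff t ε i j (ε.exponent a) := by
  cases ε <;> simp [seriesMatrix, Half.exponent]

/-- A series in `u`, as a series in two variables `u` (outer) and `v` (inner). -/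
noncomputable def inOuter (A : Type) [Ring A] : PowerSeries A →+* PowerSeries (PowerSeries A) :=
  PowerSeries.map PowerSeries.C

/-- A series in `v`, as a series in two variables `u` (outer) and `v` (inner). -/
noncomputable def inInner (A : Type) [Ring A] : PowerSeries A →+* PowerSeries (PowerSeries A) :=
  PowerSeries.C

/-- With `rttDen = p`, `rttNum = q`, one has `u - v = q / p` in terms of the variables of the
series. -/
noncomputable def rttDen (A : Type) [Ring A] : Half → Half → PowerSeries (PowerSeries A)
  | Half.minus, Half.minus => PowerSeries.X * inInner A PowerSeries.X
  | Half.minus, Half.plus => PowerSeries.X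
  | Half.plus, _ => 1

/-- See `rttDen`. -/
noncomputable def rttNum (A : Type) [Ring A] : Half → Half → PowerSeries (PowerSeries A)
  | Half.minus, Half.minus => inInner A PowerSeries.X - PowerSeries.X
  | Half.minus, Half.plus => 1 - PowerSeries.X * inInner A PowerSeries.X
  | Half.plus, _ => PowerSeries.X - inInner A PowerSeries.X

theorem commute_X (x : PowerSeries A) : Commute PowerSeries.X x :=
  (PowerSeries.commute_X x).symm

theorem commute_inInner_X (x : PowerSeries (PowerSeries A)) :
    Commute (inInner A PowerSeries.X) x := by
  refine PowerSeries.ext fun k => ?_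
  rw [inInner, PowerSeries.coeff_C_mul, PowerSeries.coeff_mul_C, (commute_X _).eq]

theorem commute_rttDen (ε₁ ε₂ : Half) (x : PowerSeries (PowerSeries A)) :
    Commute (rttDen A ε₁ ε₂) x := by
  cases ε₁ <;> cases ε₂
  · exact (PowerSeries.commute_X x).symm.mul_left (commute_inInner_X x)
  · exact (PowerSeries.commute_X x).symm
  · exact Commute.one_left x
  · exact Commute.one_left x

theorem commute_rttNum (ε₁ ε₂ : Half) (x : PowerSeries (PowerSeries A)) :
    Commute (rttNum A ε₁ ε₂) x := by
  cases ε₁ <;> cases ε₂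
  · exact (commute_inInner_X x).sub_left (PowerSeries.commute_X x).symm
  · exact (Commute.one_left x).sub_left
      ((PowerSeries.commute_X x).symm.mul_left (commute_inInner_X x))
  · exact (PowerSeries.commute_X x).symm.sub_left (commute_inInner_X x)
  · exact (PowerSeries.commute_X x).symm.sub_left (commute_inInner_X x)

/-- The coefficient of a monomial in two variables. -/
noncomputable def coeff₂ (a b : ℕ) : PowerSeries (PowerSeries A) →+ A :=
  (PowerSeries.coeff (R := A) b).toAddMonoidHom.comp
    (PowerSeries.coeff (R := PowerSeries A) a).toAddMonoidHom

theorem coeff₂_apply (a b : ℕ) (F : PowerSeries (PowerSeries A)) :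
    coeff₂ a b F = PowerSeries.coeff b (PowerSeries.coeff a F) := rfl

theorem ext_coeff₂ {F G : PowerSeries (PowerSeries A)} (hFG : ∀ a b, coeff₂ a b F = coeff₂ a b G) :
    F = G := PowerSeries.ext fun a => PowerSeries.ext fun b => hFG a b

theorem coeff₂_outer_mul_inner (f g : PowerSeries A) (a b : ℕ) :
    coeff₂ a b (inOuter A f * inInner A g) =
      PowerSeries.coeff a f * PowerSeries.coeff b g := by
  rw [coeff₂_apply, inOuter, inInner, PowerSeries.coeff_mul_C, PowerSeries.coeff_map,
    PowerSeries.coeff_C_mul]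

theorem coeff₂_inner_mul_outer (f g : PowerSeries A) (a b : ℕ) :
    coeff₂ a b (inInner A g * inOuter A f) =
      PowerSeries.coeff b g * PowerSeries.coeff a f := by
  rw [coeff₂_apply, inOuter, inInner, PowerSeries.coeff_C_mul, PowerSeries.coeff_map,
    PowerSeries.coeff_mul_C]

theorem coeff₂_neg_one_pow_mul (F : PowerSeries (PowerSeries A)) (k a b : ℕ) :
    coeff₂ a b ((-1) ^ k * F) = (-1) ^ k * coeff₂ a b F := by
  rcases Nat.even_or_odd k with hk | hk <;> simp [hk.neg_one_pow]

theorem coeff₂_inner_X_mul_zero (F : PowerSeries (PowerSeries A)) (a : ℕ) :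
    coeff₂ a 0 (inInner A PowerSeries.X * F) = 0 := by
  rw [coeff₂_apply, inInner, PowerSeries.coeff_C_mul, PowerSeries.coeff_zero_X_mul]

theorem coeff₂_inner_X_mul_succ (F : PowerSeries (PowerSeries A)) (a b : ℕ) :
    coeff₂ a (b + 1) (inInner A PowerSeries.X * F) = coeff₂ a b F := by
  rw [coeff₂_apply, inInner, PowerSeries.coeff_C_mul, PowerSeries.coeff_succ_X_mul, coeff₂_apply]

theorem coeff₂_X_mul_zero (F : PowerSeries (PowerSeries A)) (b : ℕ) :
    coeff₂ 0 b (PowerSeries.X * F) = 0 := by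
  rw [coeff₂_apply, PowerSeries.coeff_zero_X_mul, map_zero]

theorem coeff₂_X_mul_succ (F : PowerSeries (PowerSeries A)) (a b : ℕ) :
    coeff₂ (a + 1) b (PowerSeries.X * F) = coeff₂ a b F := by
  rw [coeff₂_apply, PowerSeries.coeff_succ_X_mul, coeff₂_apply]

theorem coeff₂_smul (F : PowerSeries (PowerSeries A)) (a b : ℕ) (c : CH) :
    coeff₂ a b (algebraMap CH _ c * F) = c • coeff₂ a b F := by
  rw [← Algebra.smul_def]; rfl

theorem tCoeff_minus_of_pos (t : Idx m n → Idx m n → Deg → A) (i j : Idx m n) {a : ℤ}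
    (ha : 0 < a) : tCoeff t Half.minus i j a = 0 := by
  rw [tCoeff, if_neg (fun hc => ha.ne' hc.1), dif_neg ha.le.not_gt, add_zero]

theorem tCoeff_plus_of_neg (t : Idx m n → Idx m n → Deg → A) (i j : Idx m n) {a : ℤ}
    (ha : a < 0) : tCoeff t Half.plus i j a = 0 := by
  rw [tCoeff, if_neg (fun hc => ha.ne hc.1), dif_neg (not_le.2 ha), sub_zero]

/-- The powers of `u` and `v` in the relation `RTT` corresponding to powers of the variables of the
series. -/
def relExponent : Half → Half → ℕ → ℕ → ℤ × ℤ
  | Half.minus, Half.minus, α, β => (1 - α, 1 - β)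
  | Half.minus, Half.plus, α, β => (1 - α, β)
  | Half.plus, _, α, β => (α, β)

/-- The relation is multiplied by `rttDen` so that `u - v` becomes `rttNum`, a polynomial in the
variables of the series. Each variable `u⁻¹` that occurs shifts the exponent, which explains `1 - α`
in `relExponent`. -/
theorem coeff_rtt (t : Idx m n → Idx m n → Deg → A) {ε₁ ε₂ : Half}
    (hε : ¬ (ε₁ = Half.plus ∧ ε₂ = Half.minus)) (i j k l : Idx m n) (α β : ℕ) :
    coeff₂ α β (
      rttNum A ε₁ ε₂ * ((-1) ^ ((par i + par j) * par k) *
          (inOuter A (seriesMatrix t ε₁ i j) * inInner A (seriesMatrix t ε₂ k l)) -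
        (-1) ^ ((par i + par j) * par l) *
          (inInner A (seriesMatrix t ε₂ k l) * inOuter A (seriesMatrix t ε₁ i j))) -
      algebraMap CH _ h * rttDen A ε₁ ε₂ * ((-1) ^ (par i * par j) *
        (inOuter A (seriesMatrix t ε₁ k j) * inInner A (seriesMatrix t ε₂ i l) -
          inInner A (seriesMatrix t ε₂ k j) * inOuter A (seriesMatrix t ε₁ i l)))) =
    rttEntry (tCoeff t ε₁) (tCoeff t ε₂) (relExponent ε₁ ε₂ α β).1 (relExponent ε₁ ε₂ α β).2
      i j k l := by
  -- These two vanishing coefficients account for the boundary cases `α = 0` and `β = 0`, where a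
  -- product with a variable has no coefficient.
  have m1 : ∀ i j, tCoeff t Half.minus i j 1 = 0 := fun i j => tCoeff_minus_of_pos t i j one_pos
  have p1 : ∀ i j, tCoeff t Half.plus i j (-1) = 0 :=
    fun i j => tCoeff_plus_of_neg t i j (by norm_num)
  have i1 : ∀ x : ℤ, 1 - (x + 1) = - x := fun x => by ring
  have i2 : ∀ x : ℤ, 1 - x - 1 = - x := fun x => by ring
  have i3 : ∀ x : ℤ, - (x + 1) = - x - 1 := fun x => by ring
  have i4 : ∀ x : ℤ, x + 1 - 1 = x := fun x => by ring
  rcases ε₁ with _ | _ <;> rcases ε₂ with _ | _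
  · rcases α with _ | α <;> rcases β with _ | β <;>
    simp only [rttNum, rttDen, sub_mul, mul_assoc, rttEntry, relExponent, mul_sub, map_sub, smul_sub, mul_neg, neg_mul, zero_sub, map_neg, smul_neg,
      coeff₂_smul, coeff₂_inner_X_mul_zero, coeff₂_inner_X_mul_succ, coeff₂_X_mul_succ,
      coeff₂_X_mul_zero, coeff₂_neg_one_pow_mul, coeff₂_outer_mul_inner, coeff₂_inner_mul_outer,
      coeff_seriesMatrix, Half.exponent, m1, i1, i2, i3, i4, Nat.cast_zero, sub_zero, sub_self,
      neg_zero, zero_mul, mul_zero, smul_zero, Nat.cast_add, Nat.cast_one]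
  · rcases α with _ | α <;> rcases β with _ | β <;>
    simp only [rttNum, rttDen, sub_mul, mul_assoc, rttEntry, relExponent, mul_sub, map_sub, smul_sub, mul_neg, neg_mul, zero_sub, map_neg, smul_neg,
      coeff₂_smul, coeff₂_inner_X_mul_zero, coeff₂_inner_X_mul_succ, coeff₂_X_mul_succ,
      coeff₂_X_mul_zero, coeff₂_neg_one_pow_mul, coeff₂_outer_mul_inner, coeff₂_inner_mul_outer,
      coeff_seriesMatrix, Half.exponent, m1, p1, i1, i2, i3, i4, Nat.cast_zero, sub_zero, sub_self,
      neg_zero, zero_mul, mul_zero, smul_zero, Nat.cast_add, Nat.cast_one, one_mul]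
  · exact absurd ⟨rfl, rfl⟩ hε
  · rcases α with _ | α <;> rcases β with _ | β <;>
    simp only [rttNum, rttDen, sub_mul, mul_assoc, rttEntry, relExponent, mul_sub, map_sub, smul_sub, mul_neg, neg_mul, zero_sub, map_neg, smul_neg,
      coeff₂_smul, coeff₂_inner_X_mul_zero, coeff₂_inner_X_mul_succ, coeff₂_X_mul_succ,
      coeff₂_X_mul_zero, coeff₂_neg_one_pow_mul, coeff₂_outer_mul_inner, coeff₂_inner_mul_outer,
      coeff_seriesMatrix, Half.exponent, m1, p1, i1, i2, i3, i4, Nat.cast_zero, sub_zero, sub_self,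
      neg_zero, zero_mul, mul_zero, smul_zero, Nat.cast_add, Nat.cast_one, one_mul]

/-- The `RTT` relations in terms of series in two variables. -/
theorem isRTTFamily_iff {t : Idx m n → Idx m n → Deg → A} :
    IsRTTFamily t ↔ ∀ ε₁ ε₂ : Half, ¬ (ε₁ = Half.plus ∧ ε₂ = Half.minus) →
      IsRTT par (algebraMap CH _ h * rttDen A ε₁ ε₂) (rttNum A ε₁ ε₂)
        ((seriesMatrix t ε₁).map (inOuter A)) ((seriesMatrix t ε₂).map (inInner A)) := by
  refine forall_congr' fun ε₁ => forall_congr' fun ε₂ => forall_congr' fun hε => ?_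
  rw [isRTT_iff]
  constructor
  · intro H i j k l
    rw [← sub_eq_zero]
    refine ext_coeff₂ fun α β => ?_
    rw [map_zero, ← H (relExponent ε₁ ε₂ α β).1 (relExponent ε₁ ε₂ α β).2 i j k l,
      ← coeff_rtt t hε]
    rfl
  · intro H a b i j k l
    have key : ∀ α β, rttEntry (tCoeff t ε₁) (tCoeff t ε₂) (relExponent ε₁ ε₂ α β).1
        (relExponent ε₁ ε₂ α β).2 i j k l = 0 := by
      intro α β
      rw [← coeff_rtt t hε]
      have := congrArg (coeff₂ α β) (sub_eq_zero.2 (H i j k l))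
      rw [map_zero] at this
      exact this
    -- For exponents that are not values of `relExponent` every coefficient involved is zero,
    -- because `T⁻` has no positive and `T⁺` no negative powers.
    rcases ε₁ with _ | _
    · by_cases ha : 1 < a
      · simp only [rttEntry, tCoeff_minus_of_pos t _ _ (show 0 < a - 1 by omega),
          tCoeff_minus_of_pos t _ _ (show 0 < a by omega), zero_mul, mul_zero, sub_zero, smul_zero]
      rcases ε₂ with _ | _
      · by_cases hb : 1 < b
        · simp only [rttEntry, tCoeff_minus_of_pos t _ _ (show 0 < b - 1 by omega),
            tCoeff_minus_of_pos t _ _ (show 0 < b by omega), zero_mul, mul_zero, sub_zero,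
            smul_zero]
        have := key (1 - a).toNat (1 - b).toNat
        simp only [relExponent] at this
        rwa [show (1 : ℤ) - (1 - a).toNat = a by omega,
          show (1 : ℤ) - (1 - b).toNat = b by omega] at this
      · by_cases hb : b < 0
        · simp only [rttEntry, tCoeff_plus_of_neg t _ _ (show b - 1 < 0 by omega),
            tCoeff_plus_of_neg t _ _ hb, zero_mul, mul_zero, sub_zero, smul_zero]
        have := key (1 - a).toNat b.toNat
        simp only [relExponent] at this
        rwa [show (1 : ℤ) - (1 - a).toNat = a by omega, show (b.toNat : ℤ) = b by omega] at this
    · by_cases ha : a < 0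
      · simp only [rttEntry, tCoeff_plus_of_neg t _ _ (show a - 1 < 0 by omega),
          tCoeff_plus_of_neg t _ _ ha, zero_mul, mul_zero, sub_zero, smul_zero]
      rcases ε₂ with _ | _
      · exact absurd ⟨rfl, rfl⟩ hε
      · by_cases hb : b < 0
        · simp only [rttEntry, tCoeff_plus_of_neg t _ _ (show b - 1 < 0 by omega),
            tCoeff_plus_of_neg t _ _ hb, zero_mul, mul_zero, sub_zero, smul_zero]
        have := key a.toNat b.toNat
        simp only [relExponent] at this
        rwa [show (a.toNat : ℤ) = a by omega, show (b.toNat : ℤ) = b by omega] at this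

end Relations
end DoubleYangian

namespace DoubleYangian
-- The Yang--Baxter equation and fusion
section Fusion

/-- The Yang--Baxter equation. -/
theorem yang_baxter {Z E : Type} [CommRing Z] [Ring E] [Algebra Z E] {s r : E} {p q γ γ' : Z}
    (hs : s * s = 1) (hr : r * r = 1) (hbr : s * r * s = r * s * r)
    (hγ : q * (γ * γ') = p * (γ' - γ)) :
    (q • 1 - p • s) * ((1 - γ • (s * r * s)) * (1 - γ' • r)) =
      (1 - γ' • r) * ((1 - γ • (s * r * s)) * (q • 1 - p • s)) := by
  have e1 : s * r * s * r = r * s := by rw [hbr, mul_assoc, hr, mul_one]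
  have e2 : r * (s * r * s) = s * r := by
    rw [hbr, ← mul_assoc, ← mul_assoc, hr, one_mul]
  have e3 : s * (s * r * s) = r * s := by rw [← mul_assoc, ← mul_assoc, hs, one_mul]
  have e4 : s * r * s * s = s * r := by rw [mul_assoc, hs, mul_one]
  have e5 : r * (s * r) = s * r * s := by rw [hbr, mul_assoc]
  have e6 : s * (r * s) = s * r * s := by rw [mul_assoc]
  simp only [mul_sub, sub_mul, smul_mul_assoc, mul_smul_comm, one_mul, mul_one, e1, e2, e3, e4, e5,
    e6]
  linear_combination (norm := module) hγ • (r * s) - hγ • (s * r)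

/-- Here `s` and `r` exchange legs `1, 2` and `2, 3`, while `τ` and `σ` are `T` and `S` in leg `3`.
The claim is the `RTT` relation in legs `1, 2` for `(1 - γ P₁₃) T₁` and `(1 - γ' P₂₃) S₂`. The
hypothesis on `γ, γ'` says that they are `h / (u - a)` and `h / (v - a)`. -/
theorem fusion_aux {Z E : Type} [CommRing Z] [Ring E] [Algebra Z E] {s r τ σ : E} {p q γ γ' : Z}
    (hs : s * s = 1) (hr : r * r = 1) (hbr : s * r * s = r * s * r)
    (hτ : Commute s τ) (hσ : Commute s σ)
    (H : q • (r * τ * r * σ - σ * (r * τ * r)) =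
      p • (r * (r * τ * r * σ) - σ * (r * τ * r) * r))
    (hγ : q * (γ * γ') = p * (γ' - γ)) :
    q • (s * ((1 - γ • r) * (r * τ * r)) * s * ((1 - γ' • r) * (r * σ * r)) -
        (1 - γ' • r) * (r * σ * r) * (s * ((1 - γ • r) * (r * τ * r)) * s)) =
      p • (s * (s * ((1 - γ • r) * (r * τ * r)) * s * ((1 - γ' • r) * (r * σ * r))) -
        (1 - γ' • r) * (r * σ * r) * (s * ((1 - γ • r) * (r * τ * r)) * s) * s) := by
  set T := s * (r * τ * r) * s with hT
  set S := r * σ * r with hS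
  -- `P₂₃` commutes with `T₁`.
  have hrT : Commute r T := by
    have : r * T = T * r := by
      calc r * T = r * s * r * τ * r * s := by simp only [hT, mul_assoc]
        _ = s * r * (s * τ) * r * s := by rw [← hbr]; simp only [mul_assoc]
        _ = s * r * τ * (s * r * s) := by rw [hτ.eq]; simp only [mul_assoc]
        _ = T * r := by rw [hbr]; simp only [hT, mul_assoc]
    exact this
  have hT' : s * ((1 - γ • r) * (r * τ * r)) * s = (1 - γ • (s * r * s)) * T := by
    simp only [hT, sub_mul, mul_sub, one_mul, smul_mul_assoc, mul_smul_comm]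
    congr 2
    simp only [mul_assoc]
    rw [← mul_assoc s s, hs, one_mul]
  -- `P₁₃` commutes with `S₂`.
  have hkS : Commute (s * r * s) S := by
    have : s * r * s * S = S * (s * r * s) := by
      rw [hbr, hS]
      calc r * s * r * (r * σ * r) = r * s * (r * r) * σ * r := by simp only [mul_assoc]
        _ = r * (s * σ) * r := by rw [hr, mul_one, mul_assoc r s]
        _ = r * σ * (r * r) * s * r := by rw [hσ.eq, hr, mul_one]; simp only [mul_assoc]
        _ = _ := by simp only [mul_assoc]
    exact this
  -- Conjugation by `r * s` carries the given relation from legs `2, 3` to legs `1, 2`.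
  have hRTT : (q • 1 - p • s) * (T * S) = S * T * (q • 1 - p • s) := by
    have hg : s * r * (r * s) = 1 := by rw [mul_assoc, ← mul_assoc r, hr, one_mul, hs]
    have cmul : ∀ x y, r * s * (x * y) * (s * r) = r * s * x * (s * r) * (r * s * y * (s * r)) :=
      fun x y => by
        calc _ = r * s * x * 1 * y * (s * r) := by simp only [mul_one, mul_assoc]
          _ = _ := by rw [← hg]; simp only [mul_assoc]
    have cr : r * s * r * (s * r) = s := by
      rw [← hbr, ← mul_assoc, mul_assoc _ s s, hs, mul_one, mul_assoc, hr, mul_one]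
    have cσ : r * s * σ * (s * r) = S := by
      rw [mul_assoc r, hσ.eq, ← mul_assoc, ← mul_assoc, mul_assoc _ s s, hs, mul_one, hS]
    have cT : r * s * (r * τ * r) * (s * r) = T := by
      calc _ = (r * s * r) * τ * (r * s * r) := by simp only [mul_assoc]
        _ = s * r * (s * τ) * s * r * s := by rw [← hbr]; simp only [mul_assoc]
        _ = s * r * τ * (s * s) * r * s := by rw [hτ.eq]; simp only [mul_assoc]
        _ = _ := by rw [hs, mul_one, hT]; simp only [mul_assoc]
    generalize r * τ * r = X at H cT
    have := congrArg (fun x => r * s * x * (s * r)) H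
    simp only [mul_smul_comm, smul_mul_assoc, mul_sub (r * s), sub_mul _ _ (s * r), cmul, cr, cσ,
      cT] at this
    simp only [sub_mul, mul_sub, smul_mul_assoc, mul_smul_comm, one_mul, mul_one]
    linear_combination (norm := module) this
  have hY := yang_baxter hs hr hbr hγ
  rw [hT']
  have key : (q • 1 - p • s) * ((1 - γ • (s * r * s)) * T * ((1 - γ' • r) * S)) =
      (1 - γ' • r) * S * ((1 - γ • (s * r * s)) * T) * (q • 1 - p • s) := by
    have c1 : Commute T (1 - γ' • r) := ((Commute.one_left T).sub_left (hrT.smul_left γ')).symm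
    have c2 : Commute (1 - γ • (s * r * s)) S := (Commute.one_left S).sub_left (hkS.smul_left γ)
    calc _ = (q • 1 - p • s) * ((1 - γ • (s * r * s)) * (T * (1 - γ' • r)) * S) := by
          simp only [mul_assoc]
      _ = ((q • 1 - p • s) * ((1 - γ • (s * r * s)) * (1 - γ' • r))) * (T * S) := by
          rw [c1.eq]; simp only [mul_assoc]
      _ = (1 - γ' • r) * (1 - γ • (s * r * s)) * ((q • 1 - p • s) * (T * S)) := by
          rw [hY]; simp only [mul_assoc]
      _ = (1 - γ' • r) * ((1 - γ • (s * r * s)) * S) * T * (q • 1 - p • s) := by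
          rw [hRTT]; simp only [mul_assoc]
      _ = _ := by rw [c2.eq]; simp only [mul_assoc]
  simp only [sub_mul (q • (1 : E)), mul_sub _ (q • (1 : E)), smul_mul_assoc, mul_smul_comm, one_mul,
    mul_one] at key
  rw [smul_sub, smul_sub, sub_eq_sub_iff_sub_eq_sub]
  linear_combination (norm := module) key

variable {J : Type} [Fintype J] [DecidableEq J] {B : Type} [Ring B]

theorem scal₂_apply (x : B) (i j k l : J) :
    scal₂ (J := J) x i j k l = if i = j ∧ k = l then x else 0 := by
  rw [scal₂, RingHom.comp_apply, leg₂_apply]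
  by_cases hij : i = j <;> by_cases hkl : k = l <;> simp [hij, hkl]

theorem commute_permMat_scal₂ (par : J → ℕ) (x : B) :
    Commute (permMat par B) (scal₂ (J := J) x) := by
  refine ext₂ fun i j k l => ?_
  rw [permMat_mul_apply, mul_permMat_apply, scal₂_apply, scal₂_apply]
  by_cases hkj : k = j <;> by_cases hil : i = l
  · subst hkj hil
    simp [mul_neg_one_pow]
  all_goals simp [hkj, hil]

theorem neg_one_pow_mul_matrix_apply (c : ℕ) (X : Matrix J J B) (i j : J) :
    ((-1) ^ c * X) i j = (-1) ^ c * X i j := by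
  rcases Nat.even_or_odd c with hc | hc <;> simp [hc.neg_one_pow]

/-- Both sides exchange legs `1` and `3`; the signs agree because each pair of the three indices
contributes once. -/
theorem permMat_braid (par : J → ℕ) :
    permMat par (Matrix J J B) * leg₂ (permMat par B) * permMat par (Matrix J J B) =
      leg₂ (permMat par B) * permMat par (Matrix J J B) * leg₂ (permMat par B) := by
  refine ext₂ fun i j k l => Matrix.ext fun a b => ?_
  have e1 : (leg₂ (permMat par B) * permMat par (Matrix J J B) * leg₂ (permMat par B)) i j =
      permMat par B * permMat par (Matrix J J B) i j * permMat par B := by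
    simp only [leg₂, Matrix.scalar_apply, Matrix.mul_diagonal, Matrix.diagonal_mul]
  rw [e1, mul_permMat_apply, permMat_mul_apply, leg₂_apply, mul_permMat_apply, permMat_mul_apply,
    permMat_apply, mul_neg_one_pow, mul_neg_one_pow, neg_one_pow_mul_matrix_apply,
    neg_one_pow_mul_matrix_apply]
  by_cases hkl : k = l
  · subst hkl
    rw [if_pos rfl, permMat_apply]
    by_cases hab : j = a ∧ i = b
    · obtain ⟨rfl, rfl⟩ := hab
      have e2 : ((-1 : Matrix J J B) ^ (par i * par j)) k k = (-1) ^ (par i * par j) := by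
        rw [← mul_one ((-1 : Matrix J J B) ^ (par i * par j)), neg_one_pow_mul_matrix_apply,
          Matrix.one_apply_eq, mul_one]
      simp only [and_self, if_true, e2]
      simp only [← pow_add]
      ring_nf
    · simp [hab]
  · rw [if_neg hkl]
    by_cases hab : j = a ∧ i = b
    · have e2 : ((-1 : Matrix J J B) ^ (par i * par j)) k l = 0 := by
        rw [← mul_one ((-1 : Matrix J J B) ^ (par i * par j)), neg_one_pow_mul_matrix_apply,
          Matrix.one_apply_ne hkl, mul_zero]
      obtain ⟨rfl, rfl⟩ := hab
      simp only [and_self, if_true, e2, Matrix.zero_apply, mul_zero]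
    · simp [hab]

/-- A series of matrices, as a matrix of series. -/
noncomputable def matCoeff (J : Type) [Fintype J] [DecidableEq J] (R : Type) [Ring R] :
    PowerSeries (Matrix J J R) →+* Matrix J J (PowerSeries R) where
  toFun F := Matrix.of fun i j => PowerSeries.mk fun k => PowerSeries.coeff k F i j
  map_zero' := by ext; simp
  map_add' F G := by ext; simp
  map_one' := by
    ext i j k
    rw [Matrix.of_apply, PowerSeries.coeff_mk, PowerSeries.coeff_one]
    by_cases hij : i = j <;> by_cases hk : k = 0 <;>
      simp [Matrix.one_apply, PowerSeries.coeff_one, hij, hk]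
  map_mul' F G := by
    ext i j k
    simp only [Matrix.of_apply, PowerSeries.coeff_mk, PowerSeries.coeff_mul, Matrix.mul_apply, Matrix.sum_apply,
      map_sum]
    exact Finset.sum_comm

theorem coeff_matCoeff {R : Type} [Ring R] (F : PowerSeries (Matrix J J R)) (i j : J) (k : ℕ) :
    PowerSeries.coeff k (matCoeff J R F i j) = PowerSeries.coeff k F i j :=
  PowerSeries.coeff_mk k fun k => PowerSeries.coeff k F i j

/-- A series in two variables of matrices, as a matrix of series in two variables. -/
noncomputable def matCoeff₂ (J : Type) [Fintype J] [DecidableEq J] (R : Type) [Ring R] :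
    PowerSeries (PowerSeries (Matrix J J R)) →+* Matrix J J (PowerSeries (PowerSeries R)) :=
  (matCoeff J (PowerSeries R)).comp (PowerSeries.map (matCoeff J R))

variable {R : Type} [Ring R] [Algebra CH R]

theorem coeff₂_matCoeff₂ (F : PowerSeries (PowerSeries (Matrix J J R)))
    (i j : J) (a b : ℕ) : coeff₂ a b (matCoeff₂ J R F i j) = coeff₂ a b F i j := by
  rw [coeff₂_apply, matCoeff₂, RingHom.comp_apply, coeff_matCoeff, PowerSeries.coeff_map,
    coeff_matCoeff, coeff₂_apply]

theorem matCoeff₂_injective : Function.Injective (matCoeff₂ J R) := by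
  intro F G hFG
  refine ext_coeff₂ fun a b => ?_
  ext i j
  rw [← coeff₂_matCoeff₂, ← coeff₂_matCoeff₂, hFG]

theorem matCoeff₂_inOuter (f : PowerSeries (Matrix J J R)) :
    matCoeff₂ J R (inOuter _ f) = (matCoeff J R f).map (inOuter R) := by
  ext i j a b
  rw [← coeff₂_apply, ← coeff₂_apply, coeff₂_matCoeff₂, Matrix.map_apply,
    ← mul_one (inOuter _ f), ← mul_one (inOuter R _), ← map_one (inInner _),
    ← map_one (inInner _), coeff₂_outer_mul_inner, coeff₂_outer_mul_inner, coeff_matCoeff,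
    PowerSeries.coeff_one, PowerSeries.coeff_one]
  split_ifs <;> simp

theorem matCoeff₂_inInner (f : PowerSeries (Matrix J J R)) :
    matCoeff₂ J R (inInner _ f) = (matCoeff J R f).map (inInner R) := by
  ext i j a b
  rw [← coeff₂_apply, ← coeff₂_apply, coeff₂_matCoeff₂, Matrix.map_apply,
    ← one_mul (inInner _ f), ← one_mul (inInner R _), ← map_one (inOuter _),
    ← map_one (inOuter _), coeff₂_outer_mul_inner, coeff₂_outer_mul_inner, coeff_matCoeff,
    PowerSeries.coeff_one, PowerSeries.coeff_one]
  split_ifs <;> simp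

theorem matCoeff_X :
    matCoeff J R PowerSeries.X = Matrix.scalar J PowerSeries.X := by
  ext i j k
  rw [coeff_matCoeff, PowerSeries.coeff_X, Matrix.scalar_apply]
  by_cases hij : i = j <;> by_cases hk : k = 1 <;> simp [Matrix.one_apply, PowerSeries.coeff_X, hij, hk]

theorem matCoeff₂_X :
    matCoeff₂ J R PowerSeries.X = Matrix.scalar J PowerSeries.X := by
  have : (PowerSeries.X : PowerSeries (PowerSeries (Matrix J J R))) = inOuter _ PowerSeries.X := by
    rw [inOuter, PowerSeries.map_X]
  rw [this, matCoeff₂_inOuter, matCoeff_X]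
  ext i j : 2
  by_cases hij : i = j <;> simp [Matrix.scalar_apply, hij, inOuter]

theorem matCoeff₂_inInner_X :
    matCoeff₂ J R (inInner _ PowerSeries.X) = Matrix.scalar J (inInner R PowerSeries.X) := by
  rw [matCoeff₂_inInner, matCoeff_X]
  ext i j : 2
  by_cases hij : i = j <;> simp [Matrix.scalar_apply, hij]

theorem matCoeff₂_rttDen (ε₁ ε₂ : Half) :
    matCoeff₂ J R (rttDen _ ε₁ ε₂) = Matrix.scalar J (rttDen R ε₁ ε₂) := by
  rcases ε₁ with _ | _ <;> rcases ε₂ with _ | _ <;>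
    simp only [rttDen, map_mul, map_one, matCoeff₂_X, matCoeff₂_inInner_X]

theorem matCoeff₂_rttNum (ε₁ ε₂ : Half) :
    matCoeff₂ J R (rttNum _ ε₁ ε₂) = Matrix.scalar J (rttNum R ε₁ ε₂) := by
  rcases ε₁ with _ | _ <;> rcases ε₂ with _ | _ <;>
    simp only [rttNum, map_mul, map_one, map_sub, matCoeff₂_X, matCoeff₂_inInner_X]

theorem matCoeff₂_algebraMap (c : CH) :
    matCoeff₂ J R (algebraMap CH _ c) = Matrix.scalar J (algebraMap CH _ c) := by
  have e1 : algebraMap CH (PowerSeries (PowerSeries (Matrix J J R))) c =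
    inInner _ (PowerSeries.C (algebraMap CH _ c)) := by
    rw [PowerSeries.algebraMap_apply, PowerSeries.algebraMap_apply, inInner]
  have e2 : algebraMap CH (PowerSeries (PowerSeries R)) c =
    inInner _ (PowerSeries.C (algebraMap CH _ c)) := by
    rw [PowerSeries.algebraMap_apply, PowerSeries.algebraMap_apply, inInner]
  rw [e1, matCoeff₂_inInner, e2]
  ext i j a b
  rw [Matrix.map_apply, inInner, PowerSeries.coeff_C, Matrix.scalar_apply]
  by_cases hij : i = j <;> by_cases ha : a = 0 <;> by_cases hb : b = 0 <;>
    simp [hij, ha, hb, coeff_matCoeff, PowerSeries.coeff_C, Matrix.algebraMap_matrix_apply]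

end Fusion
end DoubleYangian

namespace DoubleYangian
section FusedMatrix

variable {J : Type} [Fintype J] [DecidableEq J] {B : Type} [Ring B]

/-- The product `(1 - γ P) T₁`. -/
def fusedMatrix (par : J → ℕ) (γ : B) (T : Matrix J J B) : Matrix J J (Matrix J J B) :=
  (1 - scal₂ γ * permMat par B) * leg₁ par T

theorem fusedMatrix_apply (par : J → ℕ) (γ : B) (T : Matrix J J B) (i j k l : J) :
    fusedMatrix par γ T i j k l =
      (if k = l then (-1) ^ ((par i + par j) * par k) * T i j else 0) -
        γ * (if i = l then (-1) ^ (par i * par j) * T k j else 0) := by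
  rw [fusedMatrix, sub_mul, one_mul, Matrix.sub_apply, Matrix.sub_apply, leg₁_apply, mul_assoc,
    scal₂_mul_apply, permMat_mul_leg₁, mul_permMat_apply, leg₂_apply]
  split_ifs with h1 h2 h2
  · rw [mul_neg_one_pow, h2]
  · rw [zero_mul]
  · rw [mul_neg_one_pow, h2]
  · rw [zero_mul]

/-- The scalars of `fusion_aux` must lie in a commutative ring; the center of the ambient ring
serves. -/
theorem fusion_central {E : Type} [Ring E] {s r τ σ p q γ γ' : E}
    (hp : ∀ x, Commute p x) (hq : ∀ x, Commute q x) (hγc : ∀ x, Commute γ x)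
    (hγc' : ∀ x, Commute γ' x)
    (hs : s * s = 1) (hr : r * r = 1) (hbr : s * r * s = r * s * r)
    (hτ : Commute s τ) (hσ : Commute s σ)
    (H : q * (r * τ * r * σ - σ * (r * τ * r)) =
      p * (r * (r * τ * r * σ) - σ * (r * τ * r) * r))
    (hγ : q * (γ * γ') = p * (γ' - γ)) :
    q * (s * ((1 - γ * r) * (r * τ * r)) * s * ((1 - γ' * r) * (r * σ * r)) -
        (1 - γ' * r) * (r * σ * r) * (s * ((1 - γ * r) * (r * τ * r)) * s)) =
      p * (s * (s * ((1 - γ * r) * (r * τ * r)) * s * ((1 - γ' * r) * (r * σ * r))) -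
        (1 - γ' * r) * (r * σ * r) * (s * ((1 - γ * r) * (r * τ * r)) * s) * s) := by
  have hc : ∀ x : E, (∀ y, Commute x y) → x ∈ Subring.center E := fun x hx =>
    Subring.mem_center_iff.2 fun y => (hx y).eq.symm
  exact fusion_aux (Z := Subring.center E) (p := ⟨p, hc p hp⟩) (q := ⟨q, hc q hq⟩)
    (γ := ⟨γ, hc γ hγc⟩) (γ' := ⟨γ', hc γ' hγc'⟩) hs hr hbr hτ hσ H (Subtype.ext hγ)

theorem leg₂_fusedMatrix (par : J → ℕ) (γ : B) (T : Matrix J J B) :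
    leg₂ (fusedMatrix par γ T) = (1 - scal₂ (Matrix.scalar J γ) * leg₂ (permMat par B)) *
        (leg₂ (permMat par B) * leg₂ (leg₂ T) * leg₂ (permMat par B)) := by
  rw [fusedMatrix, leg₁]
  simp only [map_mul, map_sub, map_one]
  rfl

/-- The triple tensor product is realised by matrices nested three times, with the evaluation
representation in the innermost place, so that the fused matrix has matrices as coefficients. -/
theorem IsRTT.fusedMatrix {par : J → ℕ} {p q γ γ' : B} (hp : ∀ x, Commute p x)
    (hq : ∀ x, Commute q x) (hγc : ∀ x, Commute γ x) (hγc' : ∀ x, Commute γ' x)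
    {T S : Matrix J J B} (H : IsRTT par p q T S) (hγ : q * (γ * γ') = p * (γ' - γ)) :
    IsRTT par (Matrix.scalar J p) (Matrix.scalar J q) (fusedMatrix par γ T)
      (fusedMatrix par γ' S) := by
  have hc : ∀ x : B, (∀ y, Commute x y) →
      ∀ Y : Matrix J J (Matrix J J (Matrix J J B)), Commute (scal₂ (Matrix.scalar J x)) Y :=
    fun x hx y => commute_scal₂ (fun z => Matrix.scalar_commute _ hx z) y
  have hsc : ∀ x : B, leg₂ (J := J) (scal₂ (J := J) x) = scal₂ (Matrix.scalar J x) := fun x => rfl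
  rw [IsRTT, leg₁, leg₂_fusedMatrix, leg₂_fusedMatrix]
  refine fusion_central (hc p hp) (hc q hq) (hc γ hγc) (hc γ' hγc') (permMat_mul_self par)
    (by rw [← map_mul, permMat_mul_self, map_one])
    (permMat_braid par) (commute_permMat_scal₂ par T)
    (commute_permMat_scal₂ par S) ?_ ?_
  · have := congrArg (leg₂ (J := J)) H
    simpa only [leg₁, map_mul, map_sub, hsc] using this
  · simp only [← map_mul, ← map_sub, hγ]

end FusedMatrix

/-! ### Tensor product of a representation with an evaluation representation -/

section Fuse

variable {L : Type} [Ring L] [Algebra CH L]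

/-- The series `1 / (u - a)`, expanded in the variable of the series. -/
noncomputable def pole (a : Lˣ) : Half → PowerSeries L
  | Half.minus => PowerSeries.mk fun k : ℕ => if k = 0 then 0 else (a : L) ^ (k - 1)
  | Half.plus => PowerSeries.mk fun k : ℕ => -((a⁻¹ : Lˣ) : L) ^ (k + 1)

theorem coeff_pole_minus_zero (a : Lˣ) : PowerSeries.coeff 0 (pole a Half.minus) = 0 := by
  simp [pole]

theorem coeff_pole_minus_succ (a : Lˣ) (k : ℕ) :
    PowerSeries.coeff (k + 1) (pole a Half.minus) = (a : L) ^ k := by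
  simp [pole]

theorem coeff_pole_plus (a : Lˣ) (k : ℕ) :
    PowerSeries.coeff k (pole a Half.plus) = -((a⁻¹ : Lˣ) : L) ^ (k + 1) := by
  simp [pole]

theorem commute_powerSeries {f : PowerSeries L}
    (hf : ∀ k x, Commute (PowerSeries.coeff k f) x) (g : PowerSeries L) : Commute f g := by
  refine PowerSeries.ext fun k => ?_
  rw [PowerSeries.coeff_mul, PowerSeries.coeff_mul,
    ← Finset.Nat.sum_antidiagonal_swap]
  exact Finset.sum_congr rfl fun x _ => (hf _ _).eq

theorem commute_coeff_pole {a : Lˣ} (ha : ∀ x : L, Commute (a : L) x) (ε : Half) (k : ℕ) (x : L) :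
    Commute (PowerSeries.coeff k (pole a ε)) x := by
  cases ε
  · rcases k with _ | k
    · rw [coeff_pole_minus_zero]; exact Commute.zero_left x
    · rw [coeff_pole_minus_succ]; exact (ha x).pow_left k
  · rw [coeff_pole_plus]
    exact ((ha x).units_inv_left.pow_left _).neg_left

theorem coeff₂_inInner (f : PowerSeries L) (a b : ℕ) :
    coeff₂ a b (inInner L f) = if a = 0 then PowerSeries.coeff b f else 0 := by
  rw [coeff₂_apply, inInner, PowerSeries.coeff_C]
  split_ifs <;> simp

theorem coeff₂_inOuter (f : PowerSeries L) (a b : ℕ) :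
    coeff₂ a b (inOuter L f) = if b = 0 then PowerSeries.coeff a f else 0 := by
  rw [coeff₂_apply, inOuter, PowerSeries.coeff_map, PowerSeries.coeff_C]

/-- This is `(u - v) / ((u - a)(v - a)) = 1 / (v - a) - 1 / (u - a)`, the condition needed for
fusion. Expanding at `u = 0` for the superscript `+` is what forces `a` to be invertible. -/
theorem rttNum_mul_pole (a : Lˣ) {ε₁ ε₂ : Half} (hε : ¬ (ε₁ = Half.plus ∧ ε₂ = Half.minus)) :
    rttNum L ε₁ ε₂ * (inOuter L (pole a ε₁) * inInner L (pole a ε₂)) =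
      rttDen L ε₁ ε₂ * (inInner L (pole a ε₂) - inOuter L (pole a ε₁)) := by
  refine ext_coeff₂ fun α β => ?_
  have i2 : ∀ k l : ℕ, (a : L) ^ (k + 1) * ((a⁻¹ : Lˣ) : L) ^ (l + 1) =
      (a : L) ^ k * ((a⁻¹ : Lˣ) : L) ^ l := fun k l => by
    rw [pow_succ, pow_succ', mul_assoc, ← mul_assoc (a : L) _ (_ ^ l), a.mul_inv, one_mul]
  have i3 : ∀ k : ℕ, (a : L) ^ (k + 1) * ((a⁻¹ : Lˣ) : L) = (a : L) ^ k := fun k => by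
    rw [pow_succ, mul_assoc, a.mul_inv, mul_one]
  rcases ε₁ with _ | _ <;> rcases ε₂ with _ | _
  · rcases α with _ | _ | α <;> rcases β with _ | _ | β <;>
    simp [rttNum, rttDen, sub_mul, mul_assoc, mul_sub, coeff₂_inInner, coeff₂_inOuter,
      coeff₂_inner_X_mul_zero, coeff₂_inner_X_mul_succ, coeff₂_X_mul_succ,
      coeff₂_X_mul_zero, coeff₂_outer_mul_inner, coeff_pole_minus_zero, coeff_pole_minus_succ,
      ← pow_add, add_comm, add_left_comm]
  · rcases α with _ | _ | α <;> rcases β with _ | _ | β <;>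
    simp [rttNum, rttDen, sub_mul, mul_assoc, mul_sub, coeff₂_inInner, coeff₂_inOuter,
      coeff₂_inner_X_mul_zero, coeff₂_inner_X_mul_succ, coeff₂_X_mul_succ,
      coeff₂_X_mul_zero, coeff₂_outer_mul_inner, coeff_pole_minus_zero, coeff_pole_minus_succ,
      coeff_pole_plus, i2, i3]
  · exact absurd ⟨rfl, rfl⟩ hε
  · rcases α with _ | _ | α <;> rcases β with _ | _ | β <;>
    simp [rttNum, rttDen, sub_mul, mul_assoc, mul_sub, coeff₂_inInner, coeff₂_inOuter,
      coeff₂_inner_X_mul_zero, coeff₂_inner_X_mul_succ, coeff₂_X_mul_succ,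
      coeff₂_X_mul_zero, coeff₂_outer_mul_inner,
      ← pow_add, ← pow_succ, ← pow_succ', add_comm, add_left_comm, coeff_pole_plus]
    · exact (sq _).symm
    · exact (sq _).symm
    · rw [sub_eq_zero]
      congr 1
      omega

variable {m n : ℕ}

/-- The part of the fused generators which comes from the pole at `a`. -/
noncomputable def fuseCoeff (a : Lˣ) (t : Idx m n → Idx m n → Deg → L) (i j : Idx m n) (r : Deg) :
    L :=
  if 0 < r.1 then PowerSeries.coeff r.1.toNat (pole a Half.minus * seriesMatrix t Half.minus i j)
  else -PowerSeries.coeff (-r.1 - 1).toNat (pole a Half.plus * seriesMatrix t Half.plus i j)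

/-- The image of the generators in the tensor product of a representation with the evaluation
representation at `a`. -/
noncomputable def fuse (a : Lˣ) (t : Idx m n → Idx m n → Deg → L) (i j : Idx m n) (r : Deg) :
    Matrix (Idx m n) (Idx m n) L :=
  Matrix.of fun k l => (if k = l then (-1) ^ ((par i + par j) * par k) * t i j r else 0) -
    (if i = l then (-1) ^ (par i * par j) * fuseCoeff a t k j r else 0)

theorem tauCoeff_fuse (a : Lˣ) (t : Idx m n → Idx m n → Deg → L) (ε : Half) (i j k l : Idx m n)
    (c : ℕ) :
    tauCoeff (fuse a t) ε i j (ε.exponent c) k l =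
      (if k = l then (-1) ^ ((par i + par j) * par k) * tauCoeff t ε i j (ε.exponent c) else 0) -
        (if i = l then (-1) ^ (par i * par j) *
          PowerSeries.coeff c (pole a ε * seriesMatrix t ε k j) else 0) := by
  cases ε
  · rcases c with _ | c
    · have h0 : PowerSeries.coeff 0 (pole a Half.minus * seriesMatrix t Half.minus k j) = 0 := by
        rw [PowerSeries.coeff_mul, Finset.Nat.antidiagonal_zero, Finset.sum_singleton,
          coeff_pole_minus_zero, zero_mul]
      simp [tauCoeff, Half.exponent, h0]
    · have hc : Half.minus.exponent (c + 1) < 0 := by simp only [Half.exponent]; omega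
      have hc' : 0 < - Half.minus.exponent (c + 1) := by omega
      have hc'' : (- Half.minus.exponent (c + 1)).toNat = c + 1 := by
        simp only [Half.exponent]; omega
      simp only [tauCoeff, dif_pos hc, fuse, Matrix.of_apply, fuseCoeff, if_pos hc', hc'']
  · have hc : 0 ≤ Half.plus.exponent c := by simp only [Half.exponent]; omega
    have hc' : ¬ 0 < - (Half.plus.exponent c + 1) := by omega
    have hc'' : (- - (Half.plus.exponent c + 1) - 1).toNat = c := by
      simp only [Half.exponent]; omega
    simp only [tauCoeff, dif_pos hc, fuse, Matrix.of_apply, fuseCoeff, if_neg hc', hc'',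
      Matrix.neg_apply]
    split_ifs <;> simp [add_comm, sub_eq_add_neg]

/-- The pole enters with a factor `h`, so the fused series again has the form `δ + h τ` and
determines new generators after division by `h`. -/
theorem matCoeff_fuse (a : Lˣ) (t : Idx m n → Idx m n → Deg → L) (ε : Half) (i j : Idx m n) :
    matCoeff (Idx m n) L (seriesMatrix (fuse a t) ε i j) =
      fusedMatrix par (algebraMap CH _ h * pole a ε) (seriesMatrix t ε) i j := by
  refine Matrix.ext fun k l => PowerSeries.ext fun c => ?_
  have e1 : ∀ (s : ℕ) (f : PowerSeries L),
      PowerSeries.coeff c ((-1) ^ s * f) = (-1) ^ s * PowerSeries.coeff c f := fun s f => by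
    rcases Nat.even_or_odd s with hs | hs <;> simp [hs.neg_one_pow]
  have e2 := neg_one_pow_smul_delta i j k (ε.exponent c)
  rw [coeff_matCoeff, coeff_seriesMatrix, fusedMatrix_apply, map_sub, mul_assoc,
    ← Algebra.smul_def, tCoeff_eq, Matrix.add_apply, Matrix.smul_apply, Matrix.smul_apply,
    tauCoeff_fuse, PowerSeries.coeff_smul, mul_ite, mul_zero, ← neg_one_pow_mul_left_comm _ (pole a ε),
    apply_ite (PowerSeries.coeff c), apply_ite (PowerSeries.coeff c), e1, e1, coeff_seriesMatrix,
    tCoeff_eq, map_zero]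
  have e3 : delta i j (ε.exponent c) • (1 : Matrix (Idx m n) (Idx m n) L) k l =
      if k = l then (-1) ^ ((par i + par j) * par k) * delta i j (ε.exponent c) • (1 : L)
        else 0 := by
    rw [Matrix.one_apply]
    split_ifs
    · rw [neg_one_pow_eq_smul, smul_smul, e2]
    · rw [smul_zero]
  rw [e3]
  split_ifs <;> simp [mul_add, mul_smul_comm, smul_sub, add_sub]

/-- The fusion identity applies because `h / (u - a)` is central and satisfies the relation of
`rttNum_mul_pole`. An injective map from series of matrices to matrices of series brings the
statement into the form of `IsRTT.fusedMatrix`. -/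
theorem isRTTFamily_fuse {a : Lˣ} (ha : ∀ x : L, Commute (a : L) x)
    {t : Idx m n → Idx m n → Deg → L} (ht : IsRTTFamily t) : IsRTTFamily (fuse a t) := by
  rw [isRTTFamily_iff] at ht ⊢
  intro ε₁ ε₂ hε
  refine IsRTT.of_map _ (matCoeff₂_injective) ?_
  have e1 : ((seriesMatrix (fuse a t) ε₁).map (inOuter _)).map (matCoeff₂ (Idx m n) L) =
      fusedMatrix par (inOuter L (algebraMap CH _ h * pole a ε₁))
        ((seriesMatrix t ε₁).map (inOuter L)) := by
    refine Matrix.ext fun i j => ?_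
    rw [Matrix.map_apply, Matrix.map_apply, matCoeff₂_inOuter, matCoeff_fuse]
    refine Matrix.ext fun k l => ?_
    rw [Matrix.map_apply, fusedMatrix_apply, fusedMatrix_apply]
    simp only [map_sub, map_mul, apply_ite (inOuter L), map_zero, map_pow, map_neg, map_one,
      Matrix.map_apply]
  have e2 : ((seriesMatrix (fuse a t) ε₂).map (inInner _)).map (matCoeff₂ (Idx m n) L) =
      fusedMatrix par (inInner L (algebraMap CH _ h * pole a ε₂))
        ((seriesMatrix t ε₂).map (inInner L)) := by
    refine Matrix.ext fun i j => ?_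
    rw [Matrix.map_apply, Matrix.map_apply, matCoeff₂_inInner, matCoeff_fuse]
    refine Matrix.ext fun k l => ?_
    rw [Matrix.map_apply, fusedMatrix_apply, fusedMatrix_apply]
    simp only [map_sub, map_mul, apply_ite (inInner L), map_zero, map_pow, map_neg, map_one,
      Matrix.map_apply]
  rw [e1, e2, map_mul, matCoeff₂_rttDen, matCoeff₂_rttNum, matCoeff₂_algebraMap, ← map_mul]
  have hH : ∀ x : PowerSeries (PowerSeries L), Commute (algebraMap CH _ h) x :=
    fun x => Algebra.commutes _ _
  have hO : inOuter L (algebraMap CH _ h) = algebraMap CH _ h := by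
    simp [inOuter, PowerSeries.algebraMap_apply]
  have hI : inInner L (algebraMap CH _ h) = algebraMap CH _ h := by
    simp [inInner, PowerSeries.algebraMap_apply]
  rw [map_mul (inOuter L), map_mul (inInner L), hO, hI]
  refine IsRTT.fusedMatrix (fun x => (hH x).mul_left (commute_rttDen _ _ x))
    (fun x => commute_rttNum _ _ x) (fun x => (hH x).mul_left ?_) (fun x => (hH x).mul_left ?_)
    (ht ε₁ ε₂ hε) ?_
  · refine commute_powerSeries (fun k y => ?_) x
    rw [inOuter, PowerSeries.coeff_map]
    refine commute_powerSeries (fun k' z => ?_) y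
    rw [PowerSeries.coeff_C]
    split_ifs
    · exact commute_coeff_pole ha _ _ _
    · exact Commute.zero_left z
  · refine commute_powerSeries (fun k y => ?_) x
    rw [inInner, PowerSeries.coeff_C]
    split_ifs
    · exact commute_powerSeries (fun k' z => commute_coeff_pole ha _ _ _) y
    · exact Commute.zero_left y
  · have h1 := rttNum_mul_pole a hε
    simp only [← Algebra.smul_def, smul_mul_assoc, mul_smul_comm, h1, ← smul_sub]
end Fuse
end DoubleYangian

namespace DoubleYangian
-- Reduction modulo `h`
section ModH

variable {A B C : Type} [Ring A] [Algebra CH A] [Ring B] [Algebra CH B] [Ring C] [Algebra CH C]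

/-- The reduction of an algebra modulo `h`. -/
abbrev ModH (A : Type) [Ring A] [Algebra CH A] : Type := A ⧸ hIdeal A 1

/-- The reduction modulo `h`. -/
noncomputable def mkH (A : Type) [Ring A] [Algebra CH A] : A →ₐ[CH] ModH A :=
  Ideal.Quotient.mkₐ CH (hIdeal A 1)

theorem mkH_surjective : Function.Surjective (mkH A) := Ideal.Quotient.mk_surjective

theorem mkH_eq_zero_iff {a : A} : mkH A a = 0 ↔ ∃ y, h • y = a := by
  have := mem_hIdeal (A := A) (k := 1) (x := a)
  rw [pow_one] at this
  rw [← this]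
  exact Ideal.Quotient.eq_zero_iff_mem

theorem h_smul_modH (x : ModH A) : h • x = 0 := by
  obtain ⟨a, rfl⟩ := mkH_surjective x
  rw [← map_smul]
  exact mkH_eq_zero_iff.2 ⟨a, rfl⟩

/-- Functoriality of the reduction modulo `h`. -/
noncomputable def mapH (f : A →ₐ[CH] B) : ModH A →ₐ[CH] ModH B :=
  Ideal.Quotient.liftₐ (hIdeal A 1) ((mkH B).comp f) fun a ha => by
    obtain ⟨y, rfl⟩ := mem_hIdeal.1 ha
    rw [pow_one, map_smul, h_smul_modH]

end ModH

/-! ### The filtration by degree in the generators -/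

section Filtration

variable {m n : ℕ} {A B : Type} [Ring A] [Algebra CH A] [Ring B] [Algebra CH B]

/-- The span of `1` and of the elements of a family. -/
noncomputable def genSpan (t : Idx m n → Idx m n → Deg → A) : Submodule CH A :=
  Submodule.span CH (insert 1 (Set.range fun x : Idx m n × Idx m n × Deg => t x.1 x.2.1 x.2.2))

/-- The filtration of an algebra by the degree in the elements of a family, starting with `⊥`. -/
noncomputable def genFilt (t : Idx m n → Idx m n → Deg → A) : ℕ → Submodule CH A
  | 0 => ⊥
  | D + 1 => genSpan t ^ D

variable {t : Idx m n → Idx m n → Deg → A}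

theorem one_mem_genSpan : 1 ∈ genSpan t := Submodule.subset_span (Set.mem_insert _ _)

theorem mem_genSpan (i j : Idx m n) (r : Deg) : t i j r ∈ genSpan t :=
  Submodule.subset_span (Set.mem_insert_of_mem _ ⟨(i, j, r), rfl⟩)

theorem genFilt_le_succ (D : ℕ) : genFilt t D ≤ genFilt t (D + 1) := by
  cases D with
  | zero => exact bot_le
  | succ D =>
    intro x hx
    rw [genFilt, pow_succ, ← mul_one x]
    exact Submodule.mul_mem_mul hx one_mem_genSpan

theorem genFilt_mono : Monotone (genFilt t) := monotone_nat_of_le_succ genFilt_le_succ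

theorem mul_mem_genFilt {D : ℕ} {x y : A} (hx : x ∈ genSpan t) (hy : y ∈ genFilt t D) :
    x * y ∈ genFilt t (D + 1) := by
  cases D with
  | zero => rw [(Submodule.mem_bot CH).1 hy, mul_zero]; exact zero_mem _
  | succ D =>
    rw [genFilt, pow_succ']
    exact Submodule.mul_mem_mul hx hy

theorem mul_mem_genFilt' {D : ℕ} {x y : A} (hy : y ∈ genFilt t D) (hx : x ∈ genSpan t) :
    y * x ∈ genFilt t (D + 1) := by
  cases D with
  | zero => rw [(Submodule.mem_bot CH).1 hy, zero_mul]; exact zero_mem _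
  | succ D =>
    rw [genFilt, pow_succ]
    exact Submodule.mul_mem_mul hy hx

/-- Because of the index shift, `genFilt t (D + 1)` is the part of degree at most `D`. An element of
degree at most `D + 1` is a sum of elements of degree at most `D` and of generators times such
elements. -/
theorem genFilt_induction {D : ℕ} {p : A → Prop} (hadd : ∀ x y, p x → p y → p (x + y))
    (hlow : ∀ x ∈ genFilt t (D + 1), p x)
    (hgen : ∀ i j r, ∀ x ∈ genFilt t (D + 1), p (t i j r * x)) {x : A}
    (hx : x ∈ genFilt t (D + 2)) : p x := by
  rw [genFilt, pow_succ'] at hx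
  refine Submodule.mul_induction_on hx (fun v hv f hf => ?_) hadd
  revert f
  refine Submodule.span_induction (p := fun v _ => ∀ f ∈ genSpan t ^ D, p (v * f))
    ?_ ?_ ?_ ?_ hv
  · rintro v (rfl | ⟨x, rfl⟩) f hf
    · rw [one_mul]; exact hlow f hf
    · exact hgen _ _ _ f hf
  · intro f _
    rw [zero_mul]; exact hlow 0 (zero_mem _)
  · intro v v' _ _ h1 h2 f hf
    rw [add_mul]; exact hadd _ _ (h1 f hf) (h2 f hf)
  · intro c v _ h1 f hf
    rw [smul_mul_assoc, ← mul_smul_comm]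
    exact h1 _ (Submodule.smul_mem _ c hf)

theorem map_genFilt (f : A →ₐ[CH] B) (D : ℕ) :
    (genFilt t D).map f.toLinearMap = genFilt (fun i j r => f (t i j r)) D := by
  cases D with
  | zero => exact Submodule.map_bot _
  | succ D =>
    rw [genFilt, genFilt, Submodule.map_pow, genSpan, genSpan, Submodule.map_span,
      Set.image_insert_eq, ← Set.range_comp]
    rw [AlgHom.toLinearMap_apply, map_one]
    rfl

theorem genFilt_mul_mem {D E : ℕ} {x y : A} (hx : x ∈ genFilt t (D + 1))
    (hy : y ∈ genFilt t (E + 1)) : x * y ∈ genFilt t (D + E + 1) := by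
  rw [genFilt, pow_add]
  exact Submodule.mul_mem_mul hx hy

theorem exists_mem_genFilt_freeGen (f : Free m n) : ∃ D, f ∈ genFilt (freeGen m n) (D + 1) := by
  induction f using FreeAlgebra.induction with
  | grade0 c =>
    refine ⟨0, ?_⟩
    rw [genFilt, pow_zero, Algebra.algebraMap_eq_smul_one]
    exact Submodule.smul_mem _ c (Submodule.one_le.1 le_rfl)
  | grade1 x =>
    refine ⟨1, ?_⟩
    rw [genFilt, pow_one]
    exact mem_genSpan (t := freeGen m n) x.1 x.2.1 x.2.2
  | mul a b ha hb =>
    obtain ⟨D, hD⟩ := ha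
    obtain ⟨E, hE⟩ := hb
    exact ⟨D + E, genFilt_mul_mem hD hE⟩
  | add a b ha hb =>
    obtain ⟨D, hD⟩ := ha
    obtain ⟨E, hE⟩ := hb
    exact ⟨D + E, add_mem (genFilt_mono (by omega) hD) (genFilt_mono (by omega) hE)⟩

end Filtration

/-! ### The universal property and the parity automorphism -/

section Universal

variable {m n : ℕ} {A B : Type} [Ring A] [Algebra CH A]

theorem torsionFree_free : TorsionFree (Free m n) := by
  intro x hx
  rw [Algebra.smul_def, mul_eq_zero] at hx
  refine hx.resolve_left fun h0 => ?_
  have : (h : CH) = 0 := FreeAlgebra.algebraMap_leftInverse.injective (by rw [h0, map_zero])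
  exact PowerSeries.X_ne_zero this

/-- The universal property of the algebra `PreDY`. -/
theorem exists_algHom_of_relEntry {t : Idx m n → Idx m n → Deg → A}
    (ht : ∀ ε₁ ε₂ : Half, ¬ (ε₁ = Half.plus ∧ ε₂ = Half.minus) → ∀ a b i j k l,
      relEntry (tauCoeff t ε₁) (tauCoeff t ε₂) a b i j k l = 0) :
    ∃ φ : PreDY m n →ₐ[CH] A, ∀ i j r, φ (preGen m n i j r) = t i j r := by
  let f : Free m n →ₐ[CH] A := FreeAlgebra.lift CH fun x => t x.1 x.2.1 x.2.2
  have hf : ∀ i j r, f (freeGen m n i j r) = t i j r := fun i j r => by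
    simp only [f, freeGen, FreeAlgebra.lift_ι_apply]
  have hf' : ∀ ⦃x y : Free m n⦄, Rel m n x y → f x = f y := by
    rintro x y ⟨ε₁, ε₂, hε, a, b, i, j, k, l, x, hx⟩
    rw [map_zero]
    -- In the torsion free free algebra the relator `x` is determined by `h ^ 2 • x`, hence equals
    -- `relEntry` up to sign. No hypothesis on the torsion of the target is therefore required.
    have h1 : (-1) ^ gauge i j k l * x =
        relEntry (tauCoeff (freeGen m n) ε₁) (tauCoeff (freeGen m n) ε₂) a b i j k l := by
      rw [← sub_eq_zero]
      refine torsionFree_free.pow 2 ?_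
      rw [smul_sub, h_sq_smul_relEntry, ← gauge_mul_rttCoeff, ← hx, mul_smul_comm, sub_self]
    refine neg_one_pow_mul_eq_zero (k := gauge i j k l) ?_
    have := congrArg f h1
    rw [map_mul, map_pow, map_neg, map_one, map_relEntry] at this
    rw [this]
    simp only [map_tauCoeff, hf]
    exact ht ε₁ ε₂ hε a b i j k l
  refine ⟨RingQuot.liftAlgHom CH ⟨f, hf'⟩, fun i j r => ?_⟩
  rw [preGen, RingQuot.liftAlgHom_mkAlgHom_apply]
  exact hf i j r

theorem preDY_algHom_ext {φ ψ : PreDY m n →ₐ[CH] A}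
    (hφ : ∀ i j r, φ (preGen m n i j r) = ψ (preGen m n i j r)) : φ = ψ := by
  apply RingQuot.ringQuot_ext'
  apply FreeAlgebra.hom_ext
  funext x
  exact hφ x.1 x.2.1 x.2.2

theorem tauCoeff_twist (t : Idx m n → Idx m n → Deg → A) (s : ℕ) (ε : Half) (i j : Idx m n)
    (a : ℤ) : tauCoeff (fun i j r => (-1) ^ ((par i + par j) * s) * t i j r) ε i j a =
      (-1) ^ ((par i + par j) * s) * tauCoeff t ε i j a := by
  cases ε <;> simp only [tauCoeff] <;> split_ifs <;> simp

/-- All terms of the relation have the same total parity; a term with a Kronecker delta omits a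
factor whose two indices are equal, and such a factor is even. -/
theorem relEntry_twist (τ₁ τ₂ : Idx m n → Idx m n → ℤ → A) (s : ℕ) (a b : ℤ)
    (i j k l : Idx m n) :
    relEntry (fun i j r => (-1) ^ ((par i + par j) * s) * τ₁ i j r)
      (fun i j r => (-1) ^ ((par i + par j) * s) * τ₂ i j r) a b i j k l =
      (-1) ^ ((par i + par j + (par k + par l)) * s) * relEntry τ₁ τ₂ a b i j k l := by
  have e0 : ∀ (c d : ℕ) (x y : A), ((-1) ^ (c * s) * x) * ((-1) ^ (d * s) * y) =
      (-1) ^ ((c + d) * s) * (x * y) := by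
    intro c d x y
    rw [mul_assoc, ← mul_assoc x, mul_neg_one_pow x, mul_assoc _ x, ← mul_assoc, ← pow_add,
      add_mul]
  have h1 : par k + par l + (par i + par j) = par i + par j + (par k + par l) := by ring
  have h2 : par k + par j + (par i + par l) = par i + par j + (par k + par l) := by ring
  have e2 : ∀ (a : ℤ) (x : A), delta k j a • ((-1) ^ ((par i + par l) * s) * x) =
      (-1) ^ ((par i + par j + (par k + par l)) * s) * (delta k j a • x) := by
    intro a x
    by_cases hkj : k = j
    · rw [mul_smul_comm, hkj, show (par i + par j + (par j + par l)) * s =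
        par j * s + par j * s + (par i + par l) * s by ring, pow_add, pow_add,
        neg_one_pow_mul_self, one_mul]
    · simp [delta, hkj]
  have e3 : ∀ (a : ℤ) (x : A), delta i l a • ((-1) ^ ((par k + par j) * s) * x) =
      (-1) ^ ((par i + par j + (par k + par l)) * s) * (delta i l a • x) := by
    intro a x
    by_cases hil : i = l
    · rw [mul_smul_comm, hil, show (par l + par j + (par k + par l)) * s =
        par l * s + par l * s + (par k + par j) * s by ring, pow_add, pow_add,
        neg_one_pow_mul_self, one_mul]
    · simp [delta, hil]
  simp only [relEntry, e0, e2, e3, h1, h2]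
  have hX := fun (n : ℕ) (y : A) => neg_one_pow_mul_left_comm n
    ((-1) ^ ((par i + par j + (par k + par l)) * s)) y
  generalize (-1 : A) ^ ((par i + par j + (par k + par l)) * s) = X at hX ⊢
  simp only [← mul_sub, ← mul_add, hX, ← mul_smul_comm]

/-- With the exponent `s` as a parameter, `s = par k` selects the identity or the parity
automorphism according to the row `k`. This produces the signs of the graded tensor product in
ordinary matrices. -/
theorem exists_parity (m n s : ℕ) : ∃ φ : PreDY m n →ₐ[CH] PreDY m n,
    ∀ i j r, φ (preGen m n i j r) = (-1) ^ ((par i + par j) * s) * preGen m n i j r := by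
  refine exists_algHom_of_relEntry (A := PreDY m n) fun ε₁ ε₂ hε a b i j k l => ?_
  have e : ∀ ε, tauCoeff (fun i j r => (-1) ^ ((par i + par j) * s) * preGen m n i j r) ε =
      fun i j r => (-1) ^ ((par i + par j) * s) * tauCoeff (preGen m n) ε i j r := fun ε => by
    funext i j a
    exact tauCoeff_twist (A := PreDY m n) (preGen m n) s ε i j a
  rw [e, e]
  have h1 := relEntry_twist (A := PreDY m n) (tauCoeff (preGen m n) ε₁)
    (tauCoeff (preGen m n) ε₂) s a b i j k l
  rw [relEntry_preGen hε, mul_zero] at h1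
  exact h1

end Universal
end DoubleYangian

namespace DoubleYangian
open LaurentPolynomial

/-! ### The algebra modulo `h`: supercommutators of generators have degree one -/

section U

variable {m n : ℕ} {A : Type} [Ring A] [Algebra CH A]

/-- The reduction of the double Yangian modulo `h`. -/
def U (m n : ℕ) : Type := ModH (PreDY m n)

noncomputable instance : Ring (U m n) := inferInstanceAs (Ring (ModH (PreDY m n)))

noncomputable instance : Algebra CH (U m n) := inferInstanceAs (Algebra CH (ModH (PreDY m n)))

/-- The projection to `U`. -/
noncomputable def toU (m n : ℕ) : PreDY m n →ₐ[CH] U m n := mkH (PreDY m n)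

theorem toU_surjective : Function.Surjective (toU m n) := mkH_surjective

theorem toU_eq_zero_iff {a : PreDY m n} : toU m n a = 0 ↔ ∃ y, h • y = a := mkH_eq_zero_iff

theorem h_smul_U (x : U m n) : h • x = 0 := h_smul_modH x

/-- The reduction modulo `h` of a representation. -/
noncomputable def mapU (f : PreDY m n →ₐ[CH] A) : U m n →ₐ[CH] ModH A := mapH f

theorem mapU_toU (f : PreDY m n →ₐ[CH] A) (a : PreDY m n) : mapU f (toU m n a) = mkH A (f a) := rfl

/-- The generators modulo `h`. -/
noncomputable def genU (m n : ℕ) (i j : Idx m n) (r : Deg) : U m n := toU m n (preGen m n i j r)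

theorem U_algHom_ext {φ ψ : U m n →ₐ[CH] A}
    (hφ : ∀ i j r, φ (genU m n i j r) = ψ (genU m n i j r)) : φ = ψ := by
  have : φ.comp (toU m n) = ψ.comp (toU m n) := preDY_algHom_ext hφ
  refine AlgHom.ext fun x => ?_
  obtain ⟨a, rfl⟩ := toU_surjective x
  exact AlgHom.congr_fun this a

/-- The projection of the free algebra. -/
noncomputable def freeToU (m n : ℕ) : Free m n →ₐ[CH] U m n :=
  (toU m n).comp (RingQuot.mkAlgHom CH (Rel m n))

theorem freeToU_freeGen (i j : Idx m n) (r : Deg) :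
    freeToU m n (freeGen m n i j r) = genU m n i j r := rfl

theorem freeToU_surjective : Function.Surjective (freeToU m n) :=
  toU_surjective.comp (RingQuot.mkAlgHom_surjective CH (Rel m n))

theorem exists_mem_genFilt_genU (x : U m n) : ∃ D, x ∈ genFilt (genU m n) (D + 1) := by
  obtain ⟨f, rfl⟩ := freeToU_surjective x
  obtain ⟨D, hD⟩ := exists_mem_genFilt_freeGen f
  exact ⟨D, map_genFilt (t := freeGen m n) (freeToU m n) (D + 1) ▸ Submodule.mem_map_of_mem hD⟩

theorem exists_free_of_mem_genFilt {D : ℕ} {x : U m n} (hx : x ∈ genFilt (genU m n) D) :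
    ∃ f ∈ genFilt (freeGen m n) D, freeToU m n f = x := by
  have := map_genFilt (t := freeGen m n) (freeToU m n) D
  simp only [freeToU_freeGen] at this
  rw [← this] at hx
  exact Submodule.mem_map.1 hx

/-- The parity automorphism (for odd `s`). -/
noncomputable def parity (m n s : ℕ) : U m n →ₐ[CH] U m n :=
  mapU (exists_parity m n s).choose

theorem parity_toU (s : ℕ) (a : PreDY m n) :
    parity m n s (toU m n a) = toU m n ((exists_parity m n s).choose a) := rfl

theorem parity_genU (s : ℕ) (i j : Idx m n) (r : Deg) :
    parity m n s (genU m n i j r) = (-1) ^ ((par i + par j) * s) * genU m n i j r := by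
  rw [genU, parity_toU, (exists_parity m n s).choose_spec,
    neg_one_pow_eq_smul (A := PreDY m n), map_smul, ← neg_one_pow_eq_smul]

theorem parity_parity (s : ℕ) (x : U m n) : parity m n s (parity m n s x) = x := by
  have : (parity m n s).comp (parity m n s) = AlgHom.id CH (U m n) := by
    refine U_algHom_ext fun i j r => ?_
    rw [AlgHom.comp_apply, parity_genU, map_mul, map_pow, map_neg, map_one, parity_genU,
      ← mul_assoc, neg_one_pow_mul_self, one_mul, AlgHom.id_apply]
  exact AlgHom.congr_fun this x

theorem genFilt_le {t t' : Idx m n → Idx m n → Deg → A} (ht : ∀ i j r, t' i j r ∈ genSpan t)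
    (D : ℕ) : genFilt t' D ≤ genFilt t D := by
  cases D with
  | zero => exact le_rfl
  | succ D =>
    refine pow_le_pow_left' (Submodule.span_le.2 ?_) D
    rintro x (rfl | ⟨y, rfl⟩)
    · exact one_mem_genSpan
    · exact ht _ _ _

theorem neg_one_pow_mul_mem {S : Submodule CH A} (s : ℕ) {x : A} (hx : x ∈ S) :
    (-1) ^ s * x ∈ S := by
  rw [neg_one_pow_eq_smul]
  exact S.smul_mem _ hx

theorem parity_mem_genFilt {D s : ℕ} {x : U m n} (hx : x ∈ genFilt (genU m n) D) :
    parity m n s x ∈ genFilt (genU m n) D := by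
  have := map_genFilt (t := genU m n) (parity m n s) D
  have h1 : parity m n s x ∈ (genFilt (genU m n) D).map (parity m n s).toLinearMap :=
    Submodule.mem_map_of_mem hx
  rw [this] at h1
  refine genFilt_le (fun i j r => ?_) D h1
  rw [parity_genU]
  exact neg_one_pow_mul_mem _ (mem_genSpan i j r)

theorem relEntry_genU {ε₁ ε₂ : Half} (hε : ¬ (ε₁ = Half.plus ∧ ε₂ = Half.minus)) (a b : ℤ)
    (i j k l : Idx m n) :
    relEntry (tauCoeff (genU m n) ε₁) (tauCoeff (genU m n) ε₂) a b i j k l = 0 := by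
  have h3 := map_relEntry (toU m n)
    (tauCoeff (preGen m n) ε₁) (tauCoeff (preGen m n) ε₂) a b i j k l
  rw [relEntry_preGen hε, map_zero] at h3
  have h4 : ∀ ε i j a, (toU m n) (tauCoeff (preGen m n) ε i j a) =
      tauCoeff (genU m n) ε i j a := fun ε i j a =>
    map_tauCoeff (toU m n) (preGen m n) ε i j a
  simpa only [h4] using h3.symm

theorem tauCoeff_mem_genSpan {t : Idx m n → Idx m n → Deg → A} (ε : Half) (i j : Idx m n) (a : ℤ) :
    tauCoeff t ε i j a ∈ genSpan t := by
  cases ε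
  · simp only [tauCoeff]
    split_ifs
    · exact mem_genSpan _ _ _
    · exact zero_mem _
  · simp only [tauCoeff]
    split_ifs
    · exact neg_mem (mem_genSpan _ _ _)
    · rw [neg_zero]; exact zero_mem _

theorem tauCoeff_minus_of_nonneg {t : Idx m n → Idx m n → Deg → A} (i j : Idx m n) {a : ℤ}
    (ha : 0 ≤ a) : tauCoeff t Half.minus i j a = 0 := by
  rw [tauCoeff, dif_neg (not_lt.2 ha)]

theorem tauCoeff_plus_of_neg {t : Idx m n → Idx m n → Deg → A} (i j : Idx m n) {a : ℤ}
    (ha : a < 0) : tauCoeff t Half.plus i j a = 0 := by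
  rw [tauCoeff, dif_neg (not_le.2 ha), neg_zero]

/-- A supercommutator of two coefficients, up to a sign. -/
noncomputable def tauComm (t : Idx m n → Idx m n → Deg → A) (ε₁ ε₂ : Half) (i j k l : Idx m n)
    (a b : ℤ) : A :=
  (-1) ^ ((par i + par j) * par k) * (tauCoeff t ε₁ i j a * tauCoeff t ε₂ k l b) -
    (-1) ^ ((par i + par j) * par l) * (tauCoeff t ε₂ k l b * tauCoeff t ε₁ i j a)

/-- Modulo `h` the quadratic part of the right-hand side of the `RTT` relation disappears, leaving
combinations of generators. -/
theorem tauComm_sub_mem {ε₁ ε₂ : Half} (hε : ¬ (ε₁ = Half.plus ∧ ε₂ = Half.minus))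
    (i j k l : Idx m n) (a b : ℤ) :
    tauComm (genU m n) ε₁ ε₂ i j k l (a - 1) b - tauComm (genU m n) ε₁ ε₂ i j k l a (b - 1) ∈
      genSpan (genU m n) := by
  have h0 := relEntry_genU (m := m) (n := n) hε a b i j k l
  rw [relEntry, sub_eq_zero, h_smul_U, add_zero] at h0
  have h1 : tauComm (genU m n) ε₁ ε₂ i j k l (a - 1) b -
      tauComm (genU m n) ε₁ ε₂ i j k l a (b - 1) =
      (-1) ^ ((par i + par j) * par k) * (tauCoeff (genU m n) ε₁ i j (a - 1) *
        tauCoeff (genU m n) ε₂ k l b - tauCoeff (genU m n) ε₁ i j a *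
        tauCoeff (genU m n) ε₂ k l (b - 1)) - (-1) ^ ((par i + par j) * par l) *
        (tauCoeff (genU m n) ε₂ k l b * tauCoeff (genU m n) ε₁ i j (a - 1) -
        tauCoeff (genU m n) ε₂ k l (b - 1) * tauCoeff (genU m n) ε₁ i j a) := by
    simp only [tauComm, mul_sub]
    abel
  rw [h1, h0]
  refine neg_one_pow_mul_mem _ ?_
  have hm := fun ε i j a (c : CH) => (genSpan (genU m n)).smul_mem c
    (tauCoeff_mem_genSpan (t := genU m n) ε i j a)
  exact sub_mem (sub_mem (add_mem (hm _ _ _ _ _) (hm _ _ _ _ _)) (hm _ _ _ _ _)) (hm _ _ _ _ _)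

/-- Telescoping along a diagonal `a + b = const`: the supercommutator changes by linear terms at
each step and vanishes once `a` leaves the support of the first series. -/
theorem tauComm_mem_of_not {ε₁ ε₂ : Half} (hε : ¬ (ε₁ = Half.plus ∧ ε₂ = Half.minus))
    (i j k l : Idx m n) (a b : ℤ) :
    tauComm (genU m n) ε₁ ε₂ i j k l a b ∈ genSpan (genU m n) := by
  cases ε₁ with
  | minus =>
    have key : ∀ c : ℕ, ∀ a b : ℤ, -(c : ℤ) ≤ a →
        tauComm (genU m n) Half.minus ε₂ i j k l a b ∈ genSpan (genU m n) := by
      intro c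
      induction c with
      | zero =>
        intro a b ha
        rw [tauComm, tauCoeff_minus_of_nonneg _ _ (by simpa using ha), zero_mul, mul_zero, mul_zero,
          mul_zero, sub_zero]
        exact zero_mem _
      | succ c ih =>
        intro a b ha
        have := tauComm_sub_mem hε i j k l (a + 1) b
        rw [add_sub_cancel_right] at this
        have h2 := add_mem this (ih (a + 1) (b - 1) (by push_cast at ha; omega))
        rwa [sub_add_cancel] at h2
    exact key a.natAbs a b (by omega)
  | plus =>
    cases ε₂ with
    | minus => exact absurd ⟨rfl, rfl⟩ hε
    | plus =>
      have key : ∀ c : ℕ, ∀ a b : ℤ, a < c →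
          tauComm (genU m n) Half.plus Half.plus i j k l a b ∈ genSpan (genU m n) := by
        intro c
        induction c with
        | zero =>
          intro a b ha
          rw [tauComm, tauCoeff_plus_of_neg _ _ (by simpa using ha), zero_mul, mul_zero, mul_zero,
            mul_zero, sub_zero]
          exact zero_mem _
        | succ c ih =>
          intro a b ha
          have := tauComm_sub_mem hε i j k l a (b + 1)
          rw [add_sub_cancel_right] at this
          have h2 := sub_mem (ih (a - 1) (b + 1) (by push_cast at ha; omega)) this
          rwa [sub_sub_cancel] at h2
      exact key (a.natAbs + 1) a b (by omega)

theorem superComm_tauCoeff_mem (ε₁ ε₂ : Half) (i j k l : Idx m n) (a b : ℤ) :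
    tauCoeff (genU m n) ε₁ i j a * tauCoeff (genU m n) ε₂ k l b -
      (-1) ^ ((par i + par j) * (par k + par l)) *
        (tauCoeff (genU m n) ε₂ k l b * tauCoeff (genU m n) ε₁ i j a) ∈ genSpan (genU m n) := by
  -- The order `+, -` is not among the defining relations; it is obtained from the order `-, +` by
  -- exchanging the two factors.
  by_cases hε : ε₁ = Half.plus ∧ ε₂ = Half.minus
  · have h1 := neg_one_pow_mul_mem ((par k + par l) * par j)
      (tauComm_mem_of_not (m := m) (n := n) (ε₁ := ε₂) (ε₂ := ε₁) (fun hc => by simp_all)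
        k l i j b a)
    rw [tauComm, mul_sub, ← mul_assoc ((-1) ^ _), ← pow_add, ← mul_add,
      ← mul_assoc ((-1) ^ _) ((-1) ^ _) (_ * _), neg_one_pow_mul_self, one_mul] at h1
    have h2 := neg_mem h1
    rwa [neg_sub, mul_comm (par k + par l), add_comm (par j)] at h2
  · have h1 := neg_one_pow_mul_mem ((par i + par j) * par k) (tauComm_mem_of_not hε i j k l a b)
    rwa [tauComm, mul_sub, ← mul_assoc, neg_one_pow_mul_self, one_mul, ← mul_assoc, ← pow_add,
      ← mul_add] at h1

theorem exists_eq_tauCoeff (t : Idx m n → Idx m n → Deg → A) (r : Deg) :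
    ∃ (ε : Half) (a : ℤ) (s : ℕ), ∀ i j, t i j r = (-1) ^ s * tauCoeff t ε i j a := by
  obtain ⟨r, hr⟩ := r
  rcases lt_or_gt_of_ne hr with h0 | h0
  · refine ⟨Half.plus, -r - 1, 1, fun i j => ?_⟩
    rw [tauCoeff, dif_pos (by omega), pow_one, neg_mul, one_mul, neg_neg]
    congr 2
    omega
  · refine ⟨Half.minus, -r, 0, fun i j => ?_⟩
    rw [tauCoeff, dif_pos (by omega), pow_zero, one_mul]
    congr 2
    omega

theorem superComm_genU_mem (i j k l : Idx m n) (r s : Deg) :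
    genU m n i j r * genU m n k l s - (-1) ^ ((par i + par j) * (par k + par l)) *
      (genU m n k l s * genU m n i j r) ∈ genSpan (genU m n) := by
  obtain ⟨ε₁, a, c, hr⟩ := exists_eq_tauCoeff (genU m n) r
  obtain ⟨ε₂, b, d, hs⟩ := exists_eq_tauCoeff (genU m n) s
  rw [hr, hs]
  have := neg_one_pow_mul_mem (c + d) (superComm_tauCoeff_mem ε₁ ε₂ i j k l a b)
  have e : ∀ (c d : ℕ) (x y : U m n), ((-1) ^ c * x) * ((-1) ^ d * y) =
      (-1) ^ (c + d) * (x * y) := by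
    intro c d x y
    rw [mul_assoc, ← mul_assoc x, mul_neg_one_pow x, mul_assoc _ x, ← mul_assoc, ← pow_add]
  rwa [e, e, add_comm d, neg_one_pow_mul_left_comm _ ((-1) ^ (c + d)), ← mul_sub]

end U
end DoubleYangian

namespace DoubleYangian
open LaurentPolynomial

/-! ### The coproduct with the evaluation representation modulo `h` -/

section Psi

variable {m n : ℕ} {A B : Type} [Ring A] [Algebra CH A] [Ring B] [Algebra CH B]

/-- Matrices over Laurent polynomials. -/
abbrev LMat (m n : ℕ) (A : Type) [Ring A] : Type := Matrix (Idx m n) (Idx m n) (LaurentPolynomial A)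

/-- Functoriality of `LMat`. -/
noncomputable def mapLMat (m n : ℕ) (f : A →ₐ[CH] B) : LMat m n A →ₐ[CH] LMat m n B :=
  (AddMonoidAlgebra.mapAlgHom ℤ f).mapMatrix

theorem mapLMat_apply (f : A →ₐ[CH] B) (X : LMat m n A) (k l : Idx m n) (e : ℤ) :
    (mapLMat m n f X k l).coeff e = f ((X k l).coeff e) := by
  rw [mapLMat, AlgHom.mapMatrix_apply, Matrix.map_apply, AddMonoidAlgebra.coeff_mapAlgHom]

theorem ext_LMat {X Y : LMat m n A} (hXY : ∀ k l e, (X k l).coeff e = (Y k l).coeff e) : X = Y :=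
  Matrix.ext fun k l => LaurentPolynomial.ext fun e => hXY k l e

/-- The algebra `A` in `LMat`, twisted by the parity automorphism. -/
noncomputable def dress (m n : ℕ) : U m n →ₐ[CH] LMat m n (U m n) :=
  (AddMonoidAlgebra.singleZeroAlgHom (R := CH) (A := U m n) (M := ℤ)).mapMatrix.comp
    ((Matrix.diagonalAlgHom CH).comp (AlgHom.pi fun k => parity m n (par k)))

theorem dress_apply (x : U m n) (k l : Idx m n) :
    dress m n x k l = if k = l then C (parity m n (par k) x) else 0 := by
  simp only [dress, AlgHom.comp_apply, AlgHom.mapMatrix_apply, Matrix.map_apply,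
    Matrix.diagonalAlgHom_apply, Matrix.diagonal_apply, AlgHom.pi_apply]
  split_ifs
  · rfl
  · exact map_zero _

theorem coeff_dress_mul (x : U m n) (X : LMat m n (U m n)) (k l : Idx m n) (e : ℤ) :
    ((dress m n x * X) k l).coeff e = parity m n (par k) x * (X k l).coeff e := by
  have : (dress m n x * X) k l = C (parity m n (par k) x) * X k l := by
    rw [Matrix.mul_apply, Finset.sum_eq_single k]
    · rw [dress_apply, if_pos rfl]
    · intro b _ hb
      rw [dress_apply, if_neg hb.symm, zero_mul]
    · simp
  rw [this, ← single_eq_C, AddMonoidAlgebra.coeff_single_mul_apply, neg_zero, zero_add]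

/-- The exponent of the evaluation representation. -/
def evalDeg (r : Deg) : ℤ := if 0 < r.1 then r.1 - 1 else r.1

/-- The inverse of `evalDeg`. -/
def degOf (e : ℤ) : Deg := if h0 : 0 ≤ e then ⟨e + 1, by omega⟩ else ⟨e, by omega⟩

theorem degOf_evalDeg (r : Deg) : degOf (evalDeg r) = r := by
  obtain ⟨r, hr⟩ := r
  apply Subtype.ext
  simp only [degOf, evalDeg]
  split_ifs <;> simp <;> omega

theorem evalDeg_degOf (e : ℤ) : evalDeg (degOf e) = e := by
  simp only [degOf]
  split_ifs with h0
  · rw [evalDeg, if_pos (by simp only; omega)]; simp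
  · rw [evalDeg, if_neg (by simp only; omega)]

/-- The evaluation representation modulo `h`. -/
noncomputable def evalGen (A : Type) [Ring A] (i j : Idx m n) (r : Deg) : LMat m n A :=
  Matrix.single j i (-(-1) ^ (par i * par j) * T (evalDeg r))

theorem evalGen_apply (i j k l : Idx m n) (r : Deg) :
    evalGen A i j r k l = if j = k ∧ i = l then -(-1) ^ (par i * par j) * T (evalDeg r) else 0 := by
  rw [evalGen, Matrix.single_apply]

theorem mapLMat_evalGen (f : A →ₐ[CH] B) (i j : Idx m n) (r : Deg) :
    mapLMat m n f (evalGen A i j r) = evalGen B i j r := by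
  refine Matrix.ext fun k l => ?_
  rw [mapLMat, AlgHom.mapMatrix_apply, Matrix.map_apply, evalGen_apply, evalGen_apply]
  split_ifs
  · rw [map_mul, map_neg, map_pow, map_neg, map_one, T, AddMonoidAlgebra.mapAlgHom_single, map_one]
    rfl
  · exact map_zero _

theorem coeff_neg_one_pow_mul (s : ℕ) (x : LaurentPolynomial A) (e : ℤ) :
    ((-1) ^ s * x).coeff e = (-1) ^ s * x.coeff e := by
  rcases Nat.even_or_odd s with hs | hs <;> simp [hs.neg_one_pow]

theorem coeff_evalGen_mul (i j k l : Idx m n) (r : Deg) (X : LMat m n A) (e : ℤ) :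
    ((evalGen A i j r * X) k l).coeff e =
      if k = j then -(-1) ^ (par i * par j) * (X i l).coeff (e - evalDeg r) else 0 := by
  split_ifs with hk
  · subst hk
    rw [evalGen, Matrix.single_mul_apply_same, neg_mul, neg_mul, neg_mul,
      AddMonoidAlgebra.coeff_neg, Finsupp.neg_apply,
      mul_assoc, coeff_neg_one_pow_mul, T, AddMonoidAlgebra.coeff_single_mul_apply, one_mul, neg_add_eq_sub]
  · rw [evalGen, Matrix.single_mul_apply_of_ne _ _ _ _ _ hk, AddMonoidAlgebra.coeff_zero]
    rfl

/-- The coproduct with the evaluation representation, modulo `h`. -/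
noncomputable def psi (m n : ℕ) : Free m n →ₐ[CH] LMat m n (U m n) :=
  FreeAlgebra.lift CH fun x => dress m n (genU m n x.1 x.2.1 x.2.2) + evalGen _ x.1 x.2.1 x.2.2

theorem psi_freeGen (i j : Idx m n) (r : Deg) :
    psi m n (freeGen m n i j r) = dress m n (genU m n i j r) + evalGen _ i j r := by
  simp only [psi, freeGen, FreeAlgebra.lift_ι_apply]

theorem torsionFree_laurent (hA : TorsionFree A) : TorsionFree (LaurentPolynomial A) := by
  intro x hx
  refine LaurentPolynomial.ext fun e => hA _ ?_
  have := congrArg (fun y => AddMonoidAlgebra.coeff y e) hx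
  simpa using this

/-- The variable of the Laurent polynomials as a unit. -/
noncomputable def unitT (A : Type) [Ring A] : (LaurentPolynomial A)ˣ where
  val := T 1
  inv := T (-1)
  val_inv := by rw [← T_add, add_neg_cancel, T_zero]
  inv_val := by rw [← T_add, neg_add_cancel, T_zero]

/-- Modulo `h` the series matrix is the identity, so only the coefficient of the pole at `z`
survives. It is the power `z ^ evalDeg r`; the sign in the expansion of the pole at `u = 0` cancels
the one in `fuseCoeff`. -/
theorem fuseCoeff_unitT (t : Idx m n → Idx m n → Deg → LaurentPolynomial A) (i j : Idx m n)
    (r : Deg) : ∃ y, fuseCoeff (unitT A) t i j r = (if i = j then T (evalDeg r) else 0) + h • y := by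
  have key : ∀ (ε : Half) (c : ℕ), ∃ y,
      PowerSeries.coeff c (pole (unitT A) ε * seriesMatrix t ε i j) =
        (if i = j then PowerSeries.coeff c (pole (unitT A) ε) else 0) + h • y := by
    intro ε c
    have e1 : seriesMatrix t ε i j = (if i = j then 1 else 0) +
        h • PowerSeries.mk fun c => tauCoeff t ε i j (ε.exponent c) := by
      refine PowerSeries.ext fun c => ?_
      rw [coeff_seriesMatrix, tCoeff_eq, map_add, PowerSeries.coeff_smul, PowerSeries.coeff_mk]
      congr 1
      have : ε.exponent c = 0 ↔ c = 0 := by cases ε <;> simp [Half.exponent]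
      simp only [delta, this]
      by_cases hij : i = j <;> by_cases hc : c = 0 <;> simp [hij, hc, PowerSeries.coeff_one]
    refine ⟨PowerSeries.coeff c (pole (unitT A) ε *
      PowerSeries.mk fun c => tauCoeff t ε i j (ε.exponent c)), ?_⟩
    rw [e1, mul_add, map_add, mul_smul_comm, PowerSeries.coeff_smul]
    congr 1
    split_ifs <;> simp
  rw [fuseCoeff]
  by_cases hr : 0 < r.1
  · obtain ⟨y, hy⟩ := key Half.minus r.1.toNat
    refine ⟨y, ?_⟩
    rw [if_pos hr, hy, evalDeg, if_pos hr]
    have h1 : r.1.toNat = (r.1.toNat - 1) + 1 := by omega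
    have h2 : ((r.1.toNat - 1 : ℕ) : ℤ) = r.1 - 1 := by omega
    rw [h1, coeff_pole_minus_succ, unitT, Units.val_mk, T_pow, mul_one, h2]
  · obtain ⟨y, hy⟩ := key Half.plus (-r.1 - 1).toNat
    refine ⟨-y, ?_⟩
    have h1 : (((-r.1 - 1).toNat + 1 : ℕ) : ℤ) * -1 = r.1 := by
      have := r.2
      omega
    have h2 : (((unitT A)⁻¹ : (LaurentPolynomial A)ˣ) : LaurentPolynomial A) = T (-1) := rfl
    rw [if_neg hr, hy, evalDeg, if_neg hr, coeff_pole_plus, h2, T_pow, h1, smul_neg, neg_add]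
    split_ifs <;> simp

/-- The reduction of the fused representation depends on `φ` only through its reduction: it is `psi`
on generators followed by `mapU φ` on coefficients. -/
theorem mapLMat_fuse {M : Type} [Ring M] [Algebra CH M] (φ : PreDY m n →ₐ[CH] M) (i j : Idx m n)
    (r : Deg) :
    mapLMat m n (mkH M) (fuse (unitT M) (fun i j r => C (φ (preGen m n i j r))) i j r) =
      mapLMat m n (mapU φ) (dress m n (genU m n i j r) + evalGen _ i j r) := by
  refine ext_LMat fun k l e => ?_
  obtain ⟨y, hy⟩ := fuseCoeff_unitT (fun i j r => C (φ (preGen m n i j r))) k j r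
  have e2 : ∀ (s : ℕ) (x : M), mkH M ((-1) ^ s * x) = (-1) ^ s * mkH M x := by
    intro s x
    rw [neg_one_pow_eq_smul, neg_one_pow_eq_smul, map_smul]
  have e3 : (mkH M) ((T (evalDeg r)).coeff e) = ((T (evalDeg r)).coeff e : ModH M) := by
    rw [T_apply, T_apply]
    split_ifs <;> simp
  rw [map_add, mapLMat_evalGen, mapLMat_apply, fuse, Matrix.of_apply, hy, Matrix.add_apply,
    AddMonoidAlgebra.coeff_add, Finsupp.add_apply, mapLMat_apply, dress_apply, evalGen_apply,
    AddMonoidAlgebra.coeff_sub, Finsupp.sub_apply, map_sub, parity_genU, sub_eq_add_neg]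
  congr 1
  · split_ifs
    · rw [coeff_neg_one_pow_mul, e2, C_apply, C_apply]
      split_ifs
      · rw [neg_one_pow_eq_smul, neg_one_pow_eq_smul, map_smul]
        rfl
      · simp
    · simp
  · by_cases hil : i = l
    · rw [if_pos hil, coeff_neg_one_pow_mul, e2, AddMonoidAlgebra.coeff_add, Finsupp.add_apply, map_add,
        AddMonoidAlgebra.coeff_smul, Finsupp.smul_apply, map_smul, h_smul_modH, add_zero]
      by_cases hkj : k = j
      · rw [if_pos hkj, if_pos ⟨hkj.symm, hil⟩, e3, neg_mul,
          AddMonoidAlgebra.coeff_neg, Finsupp.neg_apply, coeff_neg_one_pow_mul]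
      · rw [if_neg hkj, if_neg (fun hc => hkj hc.1.symm)]
        simp
    · rw [if_neg hil, if_neg (fun hc => hil hc.2)]
      simp

/-- The elements killed by all torsion free representations. -/
def Invisible (x : U m n) : Prop :=
  ∀ (M : Type) [Ring M] [Algebra CH M], TorsionFree M → ∀ φ : PreDY m n →ₐ[CH] M, mapU φ x = 0

/-- Fusing a torsion free representation at the variable `z` gives another torsion free
representation, in which `f` vanishes modulo `h`. By `mapLMat_fuse` this says that the original one
kills all coefficients of `psi f`. -/
theorem invisible_coeff_psi {f : Free m n} (hf : Invisible (freeToU m n f)) (k l : Idx m n) (e : ℤ) :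
    Invisible ((psi m n f k l).coeff e) := by
  intro M _ _ hM φ
  have hC : ∀ x : LaurentPolynomial M, Commute ((unitT M : (LaurentPolynomial M)ˣ) : LaurentPolynomial M) x :=
    fun x => commute_T 1 x
  have ht : IsRTTFamily fun i j r => (C (φ (preGen m n i j r)) : LaurentPolynomial M) :=
    isRTTFamily_algHom ((AddMonoidAlgebra.singleZeroAlgHom (R := CH) (A := M) (M := ℤ)).comp φ)
  obtain ⟨φ', hφ'⟩ := (isRTTFamily_fuse hC ht).exists_algHom (torsionFree_laurent hM).matrix
  have key : (mapLMat m n (mkH M)).comp (φ'.comp (RingQuot.mkAlgHom CH (Rel m n))) =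
      (mapLMat m n (mapU φ)).comp (psi m n) := by
    apply FreeAlgebra.hom_ext
    funext x
    have := mapLMat_fuse φ x.1 x.2.1 x.2.2
    rw [← hφ', ← psi_freeGen] at this
    exact this
  have h1 : mkH _ (φ' (RingQuot.mkAlgHom CH (Rel m n) f)) = 0 :=
    hf (Matrix (Idx m n) (Idx m n) (LaurentPolynomial M)) (torsionFree_laurent hM).matrix φ'
  obtain ⟨y, hy⟩ := mkH_eq_zero_iff.1 h1
  have h2 : mapLMat m n (mapU φ) (psi m n f) = 0 := by
    rw [← AlgHom.comp_apply, ← key, AlgHom.comp_apply, AlgHom.comp_apply, ← hy, map_smul]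
    refine ext_LMat fun k l e => ?_
    rw [Matrix.smul_apply, AddMonoidAlgebra.coeff_smul, Finsupp.smul_apply, h_smul_modH]
    rfl
  rw [← mapLMat_apply, h2]
  rfl

end Psi

/-! ### The Euler operator and elements invisible in torsion free representations -/

section Euler

variable {m n : ℕ}

/-- Multiplication of the coefficients by the generators. -/
noncomputable def muEntry (i j : Idx m n) : LaurentPolynomial (U m n) →+ U m n :=
  (Finsupp.liftAddHom fun e : ℤ => (AddMonoidHom.mulLeft (genU m n i j (degOf e))).comp
    (parity m n (par i) : U m n →+* U m n).toAddMonoidHom).comp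
    (AddMonoidAlgebra.coeffAddEquiv : LaurentPolynomial (U m n) ≃+ (ℤ →₀ U m n)).toAddMonoidHom

theorem muEntry_single (i j : Idx m n) (e : ℤ) (x : U m n) :
    muEntry i j (AddMonoidAlgebra.single e x) = genU m n i j (degOf e) * parity m n (par i) x :=
  Finsupp.liftAddHom_apply_single _ e x

theorem laurent_induction {A : Type} [Ring A] {S : AddSubgroup A} {p : LaurentPolynomial A → Prop}
    (hzero : p 0) (hadd : ∀ x y, p x → p y → p (x + y))
    (hsingle : ∀ e, ∀ u ∈ S, p (AddMonoidAlgebra.single e u)) {x : LaurentPolynomial A}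
    (hx : ∀ e, x.coeff e ∈ S) : p x := by
  rw [← x.sum_coeff_single, Finsupp.sum]
  generalize x.coeff.support = s
  induction s using Finset.cons_induction with
  | empty => simpa using hzero
  | cons a s ha ih =>
    rw [Finset.sum_cons]
    exact hadd _ _ (hsingle _ _ (hx _)) ih

theorem muEntry_mem (i j : Idx m n) {D : ℕ} {x : LaurentPolynomial (U m n)}
    (hx : ∀ e, x.coeff e ∈ genFilt (genU m n) D) :
    muEntry i j x ∈ genFilt (genU m n) (D + 1) := by
  refine laurent_induction (S := (genFilt (genU m n) D).toAddSubgroup)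
    (p := fun x => muEntry i j x ∈ genFilt (genU m n) (D + 1)) ?_ ?_ ?_ hx
  · rw [map_zero]; exact zero_mem _
  · intro x y hx hy
    rw [map_add]; exact add_mem hx hy
  · intro e u hu
    rw [muEntry_single]
    exact mul_mem_genFilt (mem_genSpan _ _ _) (parity_mem_genFilt hu)

/-- The contraction of a matrix with the generators. -/
noncomputable def mu (m n : ℕ) : LMat m n (U m n) →+ U m n where
  toFun X := ∑ k : Idx m n, ∑ l : Idx m n, -(-1) ^ (par k * par l) * muEntry k l (X l k)
  map_zero' := by simp
  map_add' X Y := by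
    simp only [Matrix.add_apply, map_add, mul_add, Finset.sum_add_distrib]

theorem mu_apply (X : LMat m n (U m n)) :
    mu m n X = ∑ k : Idx m n, ∑ l : Idx m n, -(-1) ^ (par k * par l) * muEntry k l (X l k) := rfl

theorem mu_mem {D : ℕ} {X : LMat m n (U m n)}
    (hX : ∀ k l e, (X k l).coeff e ∈ genFilt (genU m n) D) :
    mu m n X ∈ genFilt (genU m n) (D + 1) := by
  rw [mu_apply]
  refine sum_mem fun k _ => sum_mem fun l _ => ?_
  rw [neg_mul]
  exact neg_mem (neg_one_pow_mul_mem _ (muEntry_mem k l (hX l k)))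

/-- Moving the new generator past the one inserted by `muEntry` costs a supercommutator, which has
degree one. The parity twists supply exactly the sign of this exchange. -/
theorem muEntry_dress_mem (i j k l : Idx m n) (r : Deg) {D : ℕ} {x : LaurentPolynomial (U m n)}
    (hx : ∀ e, x.coeff e ∈ genFilt (genU m n) D) :
    muEntry k l (C (parity m n (par l) (genU m n i j r)) * x) - genU m n i j r * muEntry k l x ∈
      genFilt (genU m n) (D + 1) := by
  refine laurent_induction (S := (genFilt (genU m n) D).toAddSubgroup)
    (p := fun x => muEntry k l (C (parity m n (par l) (genU m n i j r)) * x) -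
      genU m n i j r * muEntry k l x ∈ genFilt (genU m n) (D + 1)) ?_ ?_ ?_ hx
  · rw [mul_zero, map_zero, mul_zero, sub_zero]; exact zero_mem _
  · intro x y hx hy
    rw [mul_add, map_add, map_add, mul_add, add_sub_add_comm]
    exact add_mem hx hy
  · intro e u hu
    rw [← single_eq_C, AddMonoidAlgebra.single_mul_single, zero_add, muEntry_single,
      muEntry_single, map_mul, parity_genU, neg_one_pow_eq_smul, map_smul, parity_genU,
      ← neg_one_pow_eq_smul, ← mul_assoc, ← mul_assoc, ← mul_assoc, ← mul_assoc, ← sub_mul,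
      mul_neg_one_pow, mul_neg_one_pow (genU m n k l _),
      ← mul_assoc ((-1) ^ _), ← pow_add, mul_assoc _ (genU m n k l _), ← mul_add]
    have h1 := neg_mem (superComm_genU_mem (m := m) (n := n) i j k l r (degOf e))
    rw [neg_sub] at h1
    exact mul_mem_genFilt h1 (parity_mem_genFilt hu)

theorem mu_dress_mul_mem (i j : Idx m n) (r : Deg) {D : ℕ} {X : LMat m n (U m n)}
    (hX : ∀ k l e, (X k l).coeff e ∈ genFilt (genU m n) D) :
    mu m n (dress m n (genU m n i j r) * X) - genU m n i j r * mu m n X ∈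
      genFilt (genU m n) (D + 1) := by
  rw [mu_apply, mu_apply, Finset.mul_sum, ← Finset.sum_sub_distrib]
  refine sum_mem fun k _ => ?_
  rw [Finset.mul_sum, ← Finset.sum_sub_distrib]
  refine sum_mem fun l _ => ?_
  have h1 : (dress m n (genU m n i j r) * X) l k =
      C (parity m n (par l) (genU m n i j r)) * X l k := by
    refine LaurentPolynomial.ext fun e => ?_
    rw [coeff_dress_mul, ← single_eq_C, AddMonoidAlgebra.coeff_single_mul_apply, neg_zero, zero_add]
  rw [h1, neg_mul, neg_mul, mul_neg, ← neg_sub', ← neg_one_pow_mul_left_comm, ← mul_sub]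
  exact neg_mem (neg_one_pow_mul_mem _ (muEntry_dress_mem i j k l r (hX l k)))

/-- The contraction undoes the evaluation: it is designed to put the generator back in place of its
matrix unit, with the parity twist applied twice and hence trivial. -/
theorem mu_evalGen_mul_dress (i j : Idx m n) (r : Deg) (x : U m n) :
    mu m n (evalGen _ i j r * dress m n x) = genU m n i j r * x := by
  have h1 : ∀ k l, (evalGen (U m n) i j r * dress m n x) l k = if k = i ∧ l = j then
      -(-1) ^ (par i * par j) * AddMonoidAlgebra.single (evalDeg r) (parity m n (par i) x)
        else 0 := by
    intro k l
    refine LaurentPolynomial.ext fun e => ?_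
    rw [coeff_evalGen_mul, dress_apply]
    by_cases hl : l = j
    · rw [if_pos hl]
      by_cases hk : k = i
      · subst hk hl
        rw [if_pos rfl, if_pos ⟨rfl, rfl⟩, neg_mul, neg_mul, AddMonoidAlgebra.coeff_neg,
          Finsupp.neg_apply, coeff_neg_one_pow_mul, C_apply, AddMonoidAlgebra.coeff_single,
          Finsupp.single_apply]
        congr 2
        by_cases he : evalDeg r = e
        · rw [if_pos he, if_pos (by rw [he, sub_self])]
        · rw [if_neg he, if_neg (fun hc => he (by omega))]
      · rw [if_neg (fun hc => hk hc.symm), if_neg (fun hc => hk hc.1)]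
        simp
    · rw [if_neg hl, if_neg (fun hc => hl hc.2)]
      rfl
  rw [mu_apply, Finset.sum_eq_single i, Finset.sum_eq_single j]
  · have e1 : ∀ (s : ℕ) (x : LaurentPolynomial (U m n)),
        muEntry i j ((-1) ^ s * x) = (-1) ^ s * muEntry i j x := by
      intro s x
      rcases Nat.even_or_odd s with hs | hs <;> simp [hs.neg_one_pow]
    rw [h1, if_pos ⟨rfl, rfl⟩, neg_mul, neg_mul, map_neg, mul_neg, neg_neg, e1,
      ← mul_assoc,
      neg_one_pow_mul_self, one_mul, muEntry_single, degOf_evalDeg, parity_parity]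
  · intro l _ hl
    rw [h1, if_neg (fun hc => hl hc.2), map_zero, mul_zero]
  · simp
  · intro k _ hk
    refine Finset.sum_eq_zero fun l _ => ?_
    rw [h1, if_neg (fun hc => hk hc.1), map_zero, mul_zero]
  · simp

/-- On a product of `D` generators the leading part of `psi f - dress f` replaces one factor by its
evaluation, in all `D` ways. Contraction restores that factor, and reordering affects only lower
degree, whence the multiple `D`. -/
theorem euler {D : ℕ} {f : Free m n} (hf : f ∈ genFilt (freeGen m n) (D + 1)) :
    (∀ k l e, ((psi m n f - dress m n (freeToU m n f)) k l).coeff e ∈ genFilt (genU m n) D) ∧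
      mu m n (psi m n f - dress m n (freeToU m n f)) - D • freeToU m n f ∈
        genFilt (genU m n) D := by
  induction D generalizing f with
  | zero =>
    rw [genFilt, pow_zero, Submodule.mem_one] at hf
    obtain ⟨c, rfl⟩ := hf
    rw [AlgHom.commutes, AlgHom.commutes, AlgHom.commutes, sub_self, map_zero, zero_smul, sub_zero]
    exact ⟨fun k l e => zero_mem _, zero_mem _⟩
  | succ D ih =>
    refine genFilt_induction (p := fun f => (∀ k l e,
      ((psi m n f - dress m n (freeToU m n f)) k l).coeff e ∈ genFilt (genU m n) (D + 1)) ∧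
      mu m n (psi m n f - dress m n (freeToU m n f)) - (D + 1) • freeToU m n f ∈
        genFilt (genU m n) (D + 1)) ?_ ?_ ?_ hf
    · rintro x y ⟨hx, hx'⟩ ⟨hy, hy'⟩
      have e1 : psi m n (x + y) - dress m n (freeToU m n (x + y)) =
          (psi m n x - dress m n (freeToU m n x)) + (psi m n y - dress m n (freeToU m n y)) := by
        simp only [map_add]; abel
      rw [e1]
      constructor
      · intro k l e
        exact add_mem (hx k l e) (hy k l e)
      · rw [map_add, map_add, smul_add, add_sub_add_comm]
        exact add_mem hx' hy'
    · intro x hx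
      obtain ⟨h1, h2⟩ := ih hx
      have hU : freeToU m n x ∈ genFilt (genU m n) (D + 1) :=
        map_genFilt (t := freeGen m n) (freeToU m n) (D + 1) ▸ Submodule.mem_map_of_mem hx
      refine ⟨fun k l e => genFilt_le_succ D (h1 k l e), ?_⟩
      rw [add_smul, one_smul, ← sub_sub]
      exact sub_mem (genFilt_le_succ D h2) hU
    · intro i j r x hx
      obtain ⟨h1, h2⟩ := ih hx
      have hU : freeToU m n x ∈ genFilt (genU m n) (D + 1) :=
        map_genFilt (t := freeGen m n) (freeToU m n) (D + 1) ▸ Submodule.mem_map_of_mem hx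
      set Δ := psi m n x - dress m n (freeToU m n x) with hΔ
      -- A product rule: the generator survives, or its evaluation meets the undeformed `x`, or its
      -- evaluation meets the deformation of `x`. The last term has lower degree after contraction.
      have e1 : psi m n (freeGen m n i j r * x) - dress m n (freeToU m n (freeGen m n i j r * x)) =
          dress m n (genU m n i j r) * Δ + (evalGen _ i j r * dress m n (freeToU m n x) +
            evalGen _ i j r * Δ) := by
        rw [map_mul, map_mul, map_mul, psi_freeGen, freeToU_freeGen, hΔ]
        noncomm_ring
      have c1 : ∀ {E : ℕ} {X : LMat m n (U m n)},
          (∀ k l e, (X k l).coeff e ∈ genFilt (genU m n) E) →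
          ∀ k l e, ((evalGen (U m n) i j r * X) k l).coeff e ∈ genFilt (genU m n) E := by
        intro E X hX k l e
        rw [coeff_evalGen_mul]
        split_ifs
        · rw [neg_mul]
          exact neg_mem (neg_one_pow_mul_mem _ (hX _ _ _))
        · exact zero_mem _
      have c2 : ∀ k l e, ((dress m n (freeToU m n x)) k l).coeff e ∈
          genFilt (genU m n) (D + 1) := by
        intro k l e
        rw [dress_apply]
        split_ifs
        · rw [C_apply]
          split_ifs
          · exact parity_mem_genFilt hU
          · exact zero_mem _
        · exact zero_mem _
      rw [e1]
      constructor
      · intro k l e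
        refine add_mem ?_ (add_mem (c1 c2 k l e) (genFilt_le_succ D (c1 h1 k l e)))
        change ((dress m n (genU m n i j r) * Δ) k l).coeff e ∈ _
        rw [coeff_dress_mul, parity_genU, mul_assoc]
        exact neg_one_pow_mul_mem _ (mul_mem_genFilt (mem_genSpan _ _ _) (h1 k l e))
      · rw [map_add, map_add, mu_evalGen_mul_dress, map_mul (freeToU m n), freeToU_freeGen]
        have h3 := mu_dress_mul_mem i j r h1
        have h4 := mu_mem (c1 h1)
        have h5 := mul_mem_genFilt (mem_genSpan i j r) h2
        have h6 := add_mem (add_mem h3 h4) h5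
        convert h6 using 1
        rw [add_smul, one_smul, mul_sub (genU m n i j r), mul_smul_comm]
        abel

theorem mapU_parity {M : Type} [Ring M] [Algebra CH M] (φ : PreDY m n →ₐ[CH] M) (s : ℕ)
    (x : U m n) : mapU φ (parity m n s x) = mapU (φ.comp (exists_parity m n s).choose) x := by
  obtain ⟨a, rfl⟩ := toU_surjective x
  rfl

/-- Nonzero integers are invertible in the ground ring, so the degree can be divided out after
applying `euler`. -/
theorem mem_of_nsmul_mem {A : Type} [AddCommGroup A] [Module CH A] {S : Submodule CH A} {k : ℕ}
    (hk : k ≠ 0) {x : A} (hx : k • x ∈ S) : x ∈ S := by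
  have h1 : PowerSeries.C ((k : ℂ)⁻¹) * (k : CH) = 1 := by
    rw [← map_natCast PowerSeries.C, ← map_mul, inv_mul_cancel₀ (Nat.cast_ne_zero.2 hk), map_one]
  have := S.smul_mem (PowerSeries.C ((k : ℂ)⁻¹)) hx
  rwa [← Nat.cast_smul_eq_nsmul CH, smul_smul, h1, one_smul] at this

/-- Both `psi f` and `dress f` have invisible coefficients, and the coefficients of their difference
have smaller degree, hence vanish by induction. Then `euler` says that a positive multiple of the
element has smaller degree, and induction applies again. -/
theorem Invisible.eq_zero_of_mem {D : ℕ} {x : U m n} (hD : x ∈ genFilt (genU m n) D)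
    (hx : Invisible x) : x = 0 := by
  induction D generalizing x with
  | zero => exact (Submodule.mem_bot CH).1 hD
  | succ D ih =>
    obtain ⟨f, hf, rfl⟩ := exists_free_of_mem_genFilt hD
    obtain ⟨h1, h2⟩ := euler hf
    rcases D with _ | D
    · rw [genFilt, pow_zero, Submodule.mem_one] at hf
      obtain ⟨c, rfl⟩ := hf
      -- In degree zero the trivial representation on the ground ring detects constants modulo `h`.
      obtain ⟨φ, -⟩ := exists_algHom_of_relEntry (m := m) (n := n) (A := CH) (t := 0)
        fun ε₁ ε₂ _ a b i j k l => by
          have : ∀ ε i j a, tauCoeff (m := m) (n := n) (A := CH) 0 ε i j a = 0 := fun ε i j a => by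
            cases ε <;> simp [tauCoeff]
          simp [relEntry, this]
      have h0 := hx CH torsionFree_CH φ
      rw [AlgHom.commutes, AlgHom.commutes, ← (mkH CH).commutes, mkH_eq_zero_iff] at h0
      obtain ⟨y, hy⟩ := h0
      rw [AlgHom.commutes, ← Algebra.algebraMap_self_apply c, ← hy, smul_eq_mul, map_mul,
        ← Algebra.smul_def, h_smul_U]
    have h3 : psi m n f - dress m n (freeToU m n f) = 0 := by
      refine ext_LMat fun k l e => ih (h1 k l e) ?_
      intro M _ _ hM φ
      rw [Matrix.sub_apply, AddMonoidAlgebra.coeff_sub, Finsupp.sub_apply, map_sub,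
        invisible_coeff_psi hx k l e M hM φ, zero_sub, neg_eq_zero, dress_apply]
      split_ifs
      · rw [C_apply]
        split_ifs
        · rw [mapU_parity]
          exact hx M hM _
        · exact map_zero _
      · exact map_zero _
    rw [h3, map_zero, zero_sub] at h2
    have h4 : freeToU m n f ∈ genFilt (genU m n) (D + 1) := by
      rw [neg_mem_iff] at h2
      exact mem_of_nsmul_mem D.succ_ne_zero h2
    exact ih h4 hx

theorem Invisible.eq_zero {x : U m n} (hx : Invisible x) : x = 0 := by
  obtain ⟨D, hD⟩ := exists_mem_genFilt_genU x
  exact hx.eq_zero_of_mem hD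

end Euler
end DoubleYangian

namespace DoubleYangian
open LaurentPolynomial

/-! ### Torsion freeness of the completed double Yangian -/

section TorsionFree

variable {m n : ℕ}

theorem exists_h_smul_eq {a : PreDY m n}
    (ha : ∀ (M : Type) [Ring M] [Algebra CH M], TorsionFree M → ∀ φ : PreDY m n →ₐ[CH] M,
      ∃ y, h • y = φ a) : ∃ y, h • y = a := by
  rw [← toU_eq_zero_iff]
  refine Invisible.eq_zero ?_
  intro M _ _ hM φ
  rw [mapU_toU]
  exact mkH_eq_zero_iff.2 (ha M hM φ)

/-- A substitute for torsion freeness before completion: torsion is not excluded there, but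
cancellation in every torsion free representation shows that `a` is divisible by `h`, and the
argument is repeated for the quotient. -/
theorem exists_h_pow_smul_eq (k j : ℕ) {a b : PreDY m n} (hab : h ^ j • a = h ^ (j + k) • b) :
    ∃ y, h ^ k • y = a := by
  induction k generalizing j a with
  | zero => exact ⟨a, by simp⟩
  | succ k ih =>
    obtain ⟨y, rfl⟩ := exists_h_smul_eq (a := a) fun M _ _ hM φ => by
      refine ⟨h ^ k • φ b, ?_⟩
      have h1 := congrArg φ hab
      rw [map_smul, map_smul, ← sub_eq_zero, pow_add, mul_smul, ← smul_sub] at h1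
      have h2 := sub_eq_zero.1 (hM.pow j h1)
      rw [h2, smul_smul, ← pow_succ']
    obtain ⟨z, rfl⟩ := ih (j + 1) (a := y) (by
      rw [pow_succ, mul_smul, hab]
      congr 2
      ring)
    exact ⟨z, by rw [smul_smul, ← pow_succ']⟩

/-- Lift `x` modulo `h ^ (k + 1)`. Since `h` times the lift is divisible by `h ^ (k + 1)`, the lift
is divisible by `h ^ k`, and this holds for all `k`. -/
theorem torsionFree_DY : TorsionFree (DY m n) := by
  intro x hx
  refine hCompletion_ext fun k => ?_
  obtain ⟨a, ha⟩ := Ideal.Quotient.mk_surjective (x.1 (k + 1))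
  have h1 : Ideal.Quotient.mk (hIdeal (PreDY m n) (k + 1)) (h • a) = 0 := by
    rw [quotient_mk_smul, ha]
    have := congrArg (fun y => y.1 (k + 1)) hx
    exact this
  obtain ⟨b, hb⟩ := mem_hIdeal.1 (Ideal.Quotient.eq_zero_iff_mem.1 h1)
  obtain ⟨y, hy⟩ := exists_h_pow_smul_eq (m := m) (n := n) k 1 (a := a) (b := b)
    (by rw [pow_one, add_comm, hb])
  rw [← mk_eq_apply_of_add x a 1 ha, ← hy]
  exact Ideal.Quotient.eq_zero_iff_mem.2 (mem_hIdeal.2 ⟨y, rfl⟩)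

/-- The map `psi` was defined on the free algebra; that it respects the relations of `U` follows
only now, since its coefficients on relators are invisible. -/
theorem psi_eq_zero {f : Free m n} (hf : freeToU m n f = 0) : psi m n f = 0 :=
  ext_LMat fun k l e => Invisible.eq_zero (invisible_coeff_psi (f := f) (by
    rw [hf]; intro M _ _ _ φ; exact map_zero _) k l e)

end TorsionFree

/-! ### The center modulo `h` -/

section Center

variable {m n : ℕ} {A : Type} [Ring A] [Algebra CH A]

theorem mem_center_U {x : U m n} (hx : ∀ i j r, Commute x (genU m n i j r)) (y : U m n) :
    Commute x y := by
  obtain ⟨f, rfl⟩ := freeToU_surjective y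
  induction f using FreeAlgebra.induction with
  | grade0 c => rw [AlgHom.commutes]; exact (Algebra.commutes c x).symm
  | grade1 z => exact hx z.1 z.2.1 z.2.2
  | mul a b ha hb => rw [map_mul]; exact ha.mul_right hb
  | add a b ha hb => rw [map_add]; exact ha.add_right hb

/-- The central elements `∑ (-1)^ī tᵢᵢ` modulo `h`. -/
noncomputable def casimir (m n : ℕ) (r : Deg) : U m n :=
  ∑ i : Idx m n, (-1) ^ par i * genU m n i i r

/-- The subalgebra generated by the elements `casimir`. -/
noncomputable def casimirAlg (m n : ℕ) : Subalgebra CH (U m n) :=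
  Algebra.adjoin CH (Set.range (casimir m n))

theorem parity_of_mem_casimirAlg (s : ℕ) {x : U m n} (hx : x ∈ casimirAlg m n) :
    parity m n s x = x := by
  have : casimirAlg m n ≤ AlgHom.equalizer (parity m n s) (AlgHom.id CH (U m n)) := by
    refine Algebra.adjoin_le ?_
    rintro _ ⟨r, rfl⟩
    change parity m n s (casimir m n r) = casimir m n r
    rw [casimir, map_sum]
    refine Finset.sum_congr rfl fun i _ => ?_
    have hev : (-1 : U m n) ^ ((par i + par i) * s) = 1 :=
      ((Even.add_self (par i)).mul_right s).neg_one_pow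
    rw [neg_one_pow_eq_smul, map_smul, parity_genU, hev, one_mul]
  exact this hx

theorem commute_of_mem_casimirAlg (hI : ∀ r (x : U m n), Commute (casimir m n r) x) {x : U m n}
    (hx : x ∈ casimirAlg m n) (y : U m n) : Commute x y := by
  have : casimirAlg m n ≤ Subalgebra.center CH (U m n) := by
    refine Algebra.adjoin_le ?_
    rintro _ ⟨r, rfl⟩
    exact Subalgebra.mem_center_iff.2 fun y => (hI r y).eq.symm
  exact (Subalgebra.mem_center_iff.1 (this hx) y).symm

theorem coeff_mul_dress (x : U m n) (X : LMat m n (U m n)) (k l : Idx m n) (e : ℤ) :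
    ((X * dress m n x) k l).coeff e = (X k l).coeff e * parity m n (par l) x := by
  have : (X * dress m n x) k l = X k l * C (parity m n (par l) x) := by
    rw [Matrix.mul_apply, Finset.sum_eq_single l]
    · rw [dress_apply, if_pos rfl]
    · intro b _ hb
      rw [dress_apply, if_neg hb, mul_zero]
    · simp
  rw [this, ← single_eq_C, AddMonoidAlgebra.coeff_mul_single_apply, neg_zero, add_zero]

theorem coeff_mul_evalGen (i j k l : Idx m n) (r : Deg) (X : LMat m n A) (e : ℤ) :
    ((X * evalGen A i j r) k l).coeff e =
      if l = i then -(-1) ^ (par i * par j) * (X k j).coeff (e - evalDeg r) else 0 := by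
  split_ifs with hk
  · subst hk
    rw [evalGen, Matrix.mul_single_apply_same, neg_mul, neg_mul, mul_neg,
      AddMonoidAlgebra.coeff_neg, Finsupp.neg_apply, ← mul_assoc, mul_neg_one_pow, mul_assoc,
      coeff_neg_one_pow_mul, T, AddMonoidAlgebra.coeff_mul_single_apply, mul_one, sub_eq_add_neg]
  · rw [evalGen, Matrix.mul_single_apply_of_ne _ _ _ _ _ hk, AddMonoidAlgebra.coeff_zero]
    rfl

theorem exists_bound (X : LMat m n A) : ∃ B : ℤ, ∀ k l e, B < |e| → (X k l).coeff e = 0 := by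
  refine ⟨((Finset.univ.sup fun k : Idx m n => Finset.univ.sup fun l : Idx m n =>
    (X k l).coeff.support.sup fun e => e.natAbs : ℕ) : ℤ), fun k l e he => ?_⟩
  by_contra hne
  refine absurd he (not_lt.2 ?_)
  rw [Int.abs_eq_natAbs, Nat.cast_le]
  calc e.natAbs ≤ (X k l).coeff.support.sup fun e => e.natAbs :=
        Finset.le_sup (f := fun e : ℤ => e.natAbs) (Finsupp.mem_support_iff.2 hne)
    _ ≤ Finset.univ.sup fun l : Idx m n => (X k l).coeff.support.sup fun e => e.natAbs :=
        Finset.le_sup (f := fun l : Idx m n => (X k l).coeff.support.sup fun e => e.natAbs)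
          (Finset.mem_univ l)
    _ ≤ _ := Finset.le_sup (f := fun k : Idx m n => Finset.univ.sup fun l : Idx m n =>
          (X k l).coeff.support.sup fun e => e.natAbs) (Finset.mem_univ k)

/-- The evaluation exponents are unbounded while `X` has finite support. A generator of large
exponent therefore separates its two summands: `X` commutes with every matrix unit and is scalar.
The coefficients of the scalar then commute with the generators. -/
theorem eq_scalar_of_commute {X : LMat m n (U m n)}
    (hX : ∀ i j r, Commute X (dress m n (genU m n i j r) + evalGen _ i j r)) (o : Idx m n) :
    (∀ k l, X k l = if k = l then X o o else 0) ∧ ∀ e y, Commute ((X o o).coeff e) y := by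
  obtain ⟨B, hB⟩ := exists_bound X
  have key : ∀ i j k b, (X k j).coeff b = if k = j then (X i i).coeff b else 0 := by
    intro i j k b
    by_cases hb : B < |b|
    · rw [hB _ _ _ hb, hB _ _ _ hb, ite_self]
    -- With `|b| ≤ B` and generator exponent `2 * |B| + 1`, the coefficient of `X` beside the
    -- undeformed generator lies outside the support, whereas the matrix unit sees the coefficient
    -- at `b`.
    have h1 := congrArg (fun Y : LMat m n (U m n) => (Y k i).coeff (2 * |B| + 1 + b))
      (hX i j (degOf (2 * |B| + 1))).eq
    have h2 : B < |2 * |B| + 1 + b| := by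
      have := le_abs_self B
      have := neg_abs_le b
      have h3 := le_abs_self (2 * |B| + 1 + b)
      have := abs_nonneg B
      omega
    simp only [mul_add, add_mul, Matrix.add_apply, AddMonoidAlgebra.coeff_add, Finsupp.add_apply,
      coeff_mul_dress, coeff_dress_mul, coeff_mul_evalGen, coeff_evalGen_mul, hB _ _ _ h2,
      zero_mul, mul_zero, zero_add, if_true, evalDeg_degOf, add_sub_cancel_left, neg_mul] at h1
    have h3 := congrArg (fun y => -((-1) ^ (par i * par j) * y)) h1
    simp only [mul_neg, neg_neg, ← mul_assoc, neg_one_pow_mul_self, one_mul] at h3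
    rw [h3]
    split_ifs
    · rw [mul_neg, neg_neg, ← mul_assoc, neg_one_pow_mul_self, one_mul]
    · rw [mul_zero, neg_zero]
  have hs : ∀ k l, X k l = if k = l then X o o else 0 := by
    intro k l
    refine LaurentPolynomial.ext fun e => ?_
    rw [key o l k]
    split_ifs <;> rfl
  refine ⟨hs, fun e => mem_center_U fun i j r => ?_⟩
  have h1 := congrArg (fun Y : LMat m n (U m n) => (Y o o).coeff e) (hX i j r).eq
  have h2 : ((X * evalGen (U m n) i j r) o o).coeff e =
      ((evalGen (U m n) i j r * X) o o).coeff e := by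
    rw [coeff_mul_evalGen, coeff_evalGen_mul, hs o j, hs i o]
    by_cases hoi : o = i <;> by_cases hoj : o = j
    · rw [if_pos hoi, if_pos hoj, if_pos hoj, if_pos hoi.symm]
    · rw [if_pos hoi, if_neg hoj, if_neg hoj]
      simp
    · rw [if_neg hoi, if_pos hoj, if_neg (fun hc => hoi hc.symm)]
      simp
    · rw [if_neg hoi, if_neg hoj]
  simp only [mul_add, add_mul, Matrix.add_apply, AddMonoidAlgebra.coeff_add, Finsupp.add_apply,
    h2, add_left_inj, coeff_mul_dress, coeff_dress_mul, parity_genU] at h1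
  rw [← mul_assoc, mul_neg_one_pow, mul_assoc, mul_assoc] at h1
  have h3 := congrArg (fun y => (-1) ^ ((par i + par j) * par o) * y) h1
  rw [add_mul] at h3
  simp only [← mul_assoc, neg_one_pow_mul_self, one_mul] at h3
  exact h3

theorem par_mul_self (i : Idx m n) : par i * par i = par i := by
  cases i <;> rfl

theorem parity_zero (x : U m n) : parity m n 0 x = x := by
  have : parity m n 0 = AlgHom.id CH (U m n) := by
    refine U_algHom_ext fun i j r => ?_
    rw [parity_genU, mul_zero, pow_zero, one_mul, AlgHom.id_apply]
  exact AlgHom.congr_fun this x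

/-- Elements of `casimirAlg` are even, but the parity automorphism reverses the sign of this
difference when `k` and `o` have different parities. Thus twice the difference vanishes. This avoids
assuming that central elements are even. -/
theorem parity_eq_of_sub_mem {k o : Idx m n} {x : U m n}
    (hx : parity m n (par o) x - parity m n (par k) x ∈ casimirAlg m n) :
    parity m n (par k) x = parity m n (par o) x := by
  have h1 := parity_of_mem_casimirAlg 1 hx
  have h2 : ∀ y : U m n, parity m n 0 y - parity m n 1 y =
      -(parity m n 0 y - parity m n 1 y) → parity m n 0 y = parity m n 1 y := by
    intro y hy
    rw [eq_neg_iff_add_eq_zero, ← two_nsmul] at hy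
    exact sub_eq_zero.1 ((Submodule.mem_bot CH).1
      (mem_of_nsmul_mem (S := ⊥) two_ne_zero (by rw [hy]; exact zero_mem _)))
  rw [map_sub] at h1
  rcases k with k | k <;> rcases o with o | o <;> simp only [par] at h1 ⊢
  · rw [parity_parity, parity_zero, ← parity_zero x, parity_zero] at h1
    refine h2 x ?_
    rw [parity_zero, neg_sub, ← h1]
  · rw [parity_parity, parity_zero] at h1
    refine (h2 x ?_).symm
    rw [parity_zero, neg_sub, ← h1]

/-- For central `x` the matrix `psi f` is scalar with central coefficients, and subtracting the copy
of `x` lowers the degree; by induction the coefficients lie in `casimirAlg`. Contracting a scalar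
matrix yields `casimir`s times coefficients, so `euler` expresses a positive multiple of `x` through
these and a central element of lower degree. -/
theorem mem_casimirAlg_of_commute_of_mem (hI : ∀ r (x : U m n), Commute (casimir m n r) x)
    (o : Idx m n) {D : ℕ} {x : U m n} (hD : x ∈ genFilt (genU m n) D) (hx : ∀ y, Commute x y) :
    x ∈ casimirAlg m n := by
  induction D generalizing x with
  | zero =>
    rw [(Submodule.mem_bot CH).1 hD]
    exact zero_mem _
  | succ D ih =>
    obtain ⟨f, hf, rfl⟩ := exists_free_of_mem_genFilt hD
    rcases D with _ | D
    · rw [genFilt, pow_zero, Submodule.mem_one] at hD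
      obtain ⟨c, hc⟩ := hD
      rw [← hc]
      exact Subalgebra.algebraMap_mem _ c
    obtain ⟨h1, h2⟩ := euler hf
    have hX : ∀ i j r, Commute (psi m n f) (dress m n (genU m n i j r) + evalGen _ i j r) := by
      intro i j r
      rw [← psi_freeGen]
      have : psi m n (f * freeGen m n i j r - freeGen m n i j r * f) = 0 := psi_eq_zero (by
        rw [map_sub, map_mul, map_mul, (hx _).eq, sub_self])
      rwa [map_sub, map_mul, map_mul, sub_eq_zero] at this
    obtain ⟨hs, hc⟩ := eq_scalar_of_commute hX o
    set x := freeToU m n f with hxdef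
    set F := psi m n f o o with hF
    have hpar : ∀ s y, Commute (parity m n s x) y := fun s y => by
      have := (hx (parity m n s y)).map (parity m n s)
      rwa [parity_parity] at this
    have hG : ∀ (k : Idx m n) e, (F - C (parity m n (par k) x)).coeff e ∈ casimirAlg m n := by
      intro k e
      refine ih ?_ fun y => ?_
      · have := h1 k k e
        rwa [Matrix.sub_apply, dress_apply, if_pos rfl, hs, if_pos rfl] at this
      · rw [AddMonoidAlgebra.coeff_sub, Finsupp.sub_apply, C_apply]
        refine (hc e y).sub_left ?_
        split_ifs
        · exact hpar _ y
        · exact Commute.zero_left y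
    -- The diagonal entries of `dress x` are twisted by parity and could differ; at exponent `0`
    -- their differences lie in `casimirAlg`, so they agree.
    have hGo : ∀ k : Idx m n, F - C (parity m n (par k) x) = F - C (parity m n (par o) x) := by
      intro k
      have h5 := sub_mem (hG k 0) (hG o 0)
      simp only [AddMonoidAlgebra.coeff_sub, Finsupp.sub_apply, sub_sub_sub_cancel_left, C_apply,
        if_true] at h5
      rw [parity_eq_of_sub_mem h5]
    have h3 : mu m n (psi m n f - dress m n x) ∈ casimirAlg m n := by
      have e1 : ∀ k l, (psi m n f - dress m n x) l k =
          if k = l then F - C (parity m n (par o) x) else 0 := by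
        intro k l
        rw [Matrix.sub_apply, dress_apply, hs]
        by_cases hkl : l = k
        · rw [if_pos hkl, if_pos hkl, if_pos hkl.symm, hGo]
        · rw [if_neg hkl, if_neg hkl, if_neg (fun hc => hkl hc.symm), sub_zero]
      have e2 : mu m n (psi m n f - dress m n x) = ∑ k : Idx m n,
          -(-1) ^ par k * muEntry k k (F - C (parity m n (par o) x)) := by
        rw [mu_apply]
        refine Finset.sum_congr rfl fun k _ => ?_
        rw [Finset.sum_eq_single k]
        · rw [e1, if_pos rfl, par_mul_self]
        · intro l _ hl
          rw [e1, if_neg hl.symm, map_zero, mul_zero]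
        · simp
      rw [e2]
      refine laurent_induction (S := (Subalgebra.toSubmodule (casimirAlg m n)).toAddSubgroup)
        (p := fun G => ∑ k : Idx m n, -(-1) ^ par k * muEntry k k G ∈ casimirAlg m n) ?_ ?_ ?_
        (hG o)
      · simp
      · intro G G' hG hG'
        simp only [map_add, mul_add, Finset.sum_add_distrib]
        exact add_mem hG hG'
      · intro e u hu
        have hu' : u ∈ casimirAlg m n := hu
        simp only [muEntry_single, parity_of_mem_casimirAlg _ hu', neg_mul, Finset.sum_neg_distrib,
          ← mul_assoc, ← Finset.sum_mul]
        exact neg_mem (mul_mem (Algebra.subset_adjoin ⟨degOf e, rfl⟩) hu')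
    have h4 := ih h2 fun y => ((commute_of_mem_casimirAlg hI h3 y).sub_left
      ((hx y).smul_left (D + 1)))
    have h5 := sub_mem h3 h4
    rw [sub_sub_cancel] at h5
    exact mem_of_nsmul_mem (S := Subalgebra.toSubmodule (casimirAlg m n)) D.succ_ne_zero h5

theorem mem_casimirAlg_of_commute (hI : ∀ r (x : U m n), Commute (casimir m n r) x)
    (o : Idx m n) {x : U m n} (hx : ∀ y, Commute x y) : x ∈ casimirAlg m n := by
  obtain ⟨D, hD⟩ := exists_mem_genFilt_genU x
  exact mem_casimirAlg_of_commute_of_mem hI o hD hx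

end Center
end DoubleYangian

namespace DoubleYangian
open LaurentPolynomial

/-! ### Independence of the `casimir` elements modulo `h` -/

section Independence

variable {m n : ℕ}

/-- The polynomial ring in variables indexed like the generators. -/
abbrev DegPoly : Type := MvPolynomial Deg CH

/-- The variables, as a family of the type of the generators of the double Yangian of `𝔤𝔩₁`. -/
noncomputable def polyGen : Idx 1 0 → Idx 1 0 → Deg → DegPoly := fun _ _ r => MvPolynomial.X r

theorem exists_mem_genFilt_polyGen (P : DegPoly) : ∃ D, P ∈ genFilt polyGen (D + 1) := by
  induction P using MvPolynomial.induction_on with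
  | C c =>
    refine ⟨0, ?_⟩
    rw [genFilt, pow_zero, Submodule.mem_one]
    exact ⟨c, rfl⟩
  | add p q hp hq =>
    obtain ⟨D, hD⟩ := hp
    obtain ⟨E, hE⟩ := hq
    exact ⟨D + E, add_mem (genFilt_mono (by omega) hD) (genFilt_mono (by omega) hE)⟩
  | mul_X p r hp =>
    obtain ⟨D, hD⟩ := hp
    exact ⟨D + 1, mul_mem_genFilt' hD (mem_genSpan (t := polyGen) (Sum.inl 0) (Sum.inl 0) r)⟩

/-- The substitution `X r ↦ X r - z ^ (evalDeg r)`. -/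
noncomputable def polyShift : DegPoly →ₐ[CH] LaurentPolynomial DegPoly :=
  MvPolynomial.aeval fun r => C (MvPolynomial.X r) - T (evalDeg r)

theorem polyShift_X (r : Deg) :
    polyShift (MvPolynomial.X r) = C (MvPolynomial.X r) - T (evalDeg r) :=
  MvPolynomial.aeval_X _ r

/-- The linear map `z ^ e ↦ X (degOf e)`. -/
noncomputable def polyMu : LaurentPolynomial DegPoly →ₗ[DegPoly] DegPoly :=
  (Finsupp.linearCombination DegPoly fun e => MvPolynomial.X (degOf e)).comp
    (AddMonoidAlgebra.coeffLinearEquiv DegPoly).toLinearMap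

theorem polyMu_single (e : ℤ) (u : DegPoly) :
    polyMu (AddMonoidAlgebra.single e u) = u * MvPolynomial.X (degOf e) := by
  exact Finsupp.linearCombination_single _ _ _

theorem polyMu_mem (S S' : Submodule CH DegPoly) (hS : ∀ r, ∀ u ∈ S, u * MvPolynomial.X r ∈ S')
    {x : LaurentPolynomial DegPoly} (hx : ∀ e, x.coeff e ∈ S) : polyMu x ∈ S' := by
  refine laurent_induction (S := S.toAddSubgroup) (p := fun x => polyMu x ∈ S') ?_ ?_ ?_ hx
  · rw [map_zero]; exact zero_mem _
  · intro x y hx hy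
    rw [map_add]; exact add_mem hx hy
  · intro e u hu
    rw [polyMu_single]
    exact hS _ _ hu

theorem coeff_C_mul (x : DegPoly) (y : LaurentPolynomial DegPoly) (e : ℤ) :
    (C x * y).coeff e = x * y.coeff e := by
  rw [← single_eq_C, AddMonoidAlgebra.coeff_single_mul_apply, neg_zero, zero_add]

/-- The commutative counterpart of `euler`: the leading part of the substitution is minus a sum of
partial derivatives times powers of `z`, and replacing these powers by variables gives minus the
Euler operator. -/
theorem poly_euler {D : ℕ} {P : DegPoly} (hP : P ∈ genFilt polyGen (D + 1)) :
    (∀ e, (polyShift P - C P).coeff e ∈ genFilt polyGen D) ∧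
      polyMu (polyShift P - C P) + D • P ∈ genFilt polyGen D := by
  induction D generalizing P with
  | zero =>
    rw [genFilt, pow_zero, Submodule.mem_one] at hP
    obtain ⟨c, rfl⟩ := hP
    have : polyShift (algebraMap CH DegPoly c) - C (algebraMap CH DegPoly c) = 0 := by
      rw [AlgHom.commutes]
      exact sub_self _
    rw [this, map_zero, zero_smul, add_zero]
    exact ⟨fun e => zero_mem _, zero_mem _⟩
  | succ D ih =>
    refine genFilt_induction (p := fun P => (∀ e, (polyShift P - C P).coeff e ∈
      genFilt polyGen (D + 1)) ∧ polyMu (polyShift P - C P) + (D + 1) • P ∈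
        genFilt polyGen (D + 1)) ?_ ?_ ?_ hP
    · rintro x y ⟨hx, hx'⟩ ⟨hy, hy'⟩
      have e1 : polyShift (x + y) - C (x + y) = (polyShift x - C x) + (polyShift y - C y) := by
        simp only [map_add]; abel
      rw [e1]
      constructor
      · intro e
        exact add_mem (hx e) (hy e)
      · rw [map_add, smul_add, add_add_add_comm]
        exact add_mem hx' hy'
    · intro x hx
      obtain ⟨h1, h2⟩ := ih hx
      refine ⟨fun e => genFilt_le_succ D (h1 e), ?_⟩
      rw [add_smul, one_smul, ← add_assoc]
      exact add_mem (genFilt_le_succ D h2) hx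
    · intro i j r x hx
      obtain ⟨h1, h2⟩ := ih hx
      have hr : MvPolynomial.X r ∈ genSpan polyGen := mem_genSpan (t := polyGen) i j r
      set Δ := polyShift x - C x with hΔ
      have e1 : polyShift (polyGen i j r * x) - C (polyGen i j r * x) =
          C (MvPolynomial.X r) * Δ - (T (evalDeg r) * C x + T (evalDeg r) * Δ) := by
        rw [map_mul, map_mul, polyGen, polyShift_X, hΔ]
        ring
      have c1 : ∀ {E : ℕ} {X : LaurentPolynomial DegPoly},
          (∀ e, X.coeff e ∈ genFilt polyGen E) →
          ∀ e, (T (evalDeg r) * X).coeff e ∈ genFilt polyGen E := by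
        intro E X hX e
        rw [T, AddMonoidAlgebra.coeff_single_mul_apply, one_mul]
        exact hX _
      have c2 : ∀ e, ((C x : LaurentPolynomial DegPoly)).coeff e ∈ genFilt polyGen (D + 1) := by
        intro e
        rw [C_apply]
        split_ifs
        · exact hx
        · exact zero_mem _
      have c3 : ∀ {E : ℕ} {X : LaurentPolynomial DegPoly},
          (∀ e, X.coeff e ∈ genFilt polyGen E) → polyMu X ∈ genFilt polyGen (E + 1) :=
        fun hX => polyMu_mem _ _ (fun s u hu => mul_mem_genFilt' hu
          (mem_genSpan (t := polyGen) i j s)) hX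
      have e2 : polyMu (C (MvPolynomial.X r) * Δ) = MvPolynomial.X r * polyMu Δ := by
        rw [← smul_eq_C_mul, map_smul, smul_eq_mul]
      have e3 : polyMu (T (evalDeg r) * C x) = x * MvPolynomial.X r := by
        rw [mul_comm, ← single_eq_C_mul_T, polyMu_single, degOf_evalDeg]
      rw [e1]
      constructor
      · intro e
        refine sub_mem ?_ (add_mem (c1 c2 e) (genFilt_le_succ D (c1 h1 e)))
        change (C (MvPolynomial.X r) * Δ).coeff e ∈ _
        rw [coeff_C_mul]
        exact mul_mem_genFilt hr (h1 e)
      · rw [map_sub, map_add, e2, e3]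
        have h4 := c3 (c1 h1)
        have h5 := mul_mem_genFilt hr h2
        have h6 := sub_mem h5 h4
        convert h6 using 1
        rw [add_smul, one_smul, mul_add, mul_smul_comm, polyGen]
        ring

/-- The scalar matrices. -/
noncomputable def scalarLMat (e : DegPoly →ₐ[CH] U m n) :
    LaurentPolynomial DegPoly →ₐ[CH] LMat m n (U m n) :=
  (Matrix.diagonalAlgHom CH).comp (AlgHom.pi fun _ => AddMonoidAlgebra.mapAlgHom ℤ e)

theorem scalarLMat_apply (e : DegPoly →ₐ[CH] U m n) (x : LaurentPolynomial DegPoly)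
    (k l : Idx m n) (c : ℤ) :
    (scalarLMat e x k l).coeff c = if k = l then e (x.coeff c) else 0 := by
  simp only [scalarLMat, AlgHom.comp_apply, Matrix.diagonalAlgHom_apply, Matrix.diagonal_apply,
    AlgHom.pi_apply]
  split_ifs
  · rw [AddMonoidAlgebra.coeff_mapAlgHom]
  · rfl

/-- The evaluations of the `t i i r` add up, with their signs, to `-z ^ evalDeg r` times the
identity matrix, so `psi` sends a `casimir` to a scalar matrix. -/
theorem psi_casimir {e : DegPoly →ₐ[CH] U m n} (he : ∀ r, e (MvPolynomial.X r) = casimir m n r)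
    (r : Deg) : psi m n (∑ i : Idx m n, (-1) ^ par i * freeGen m n i i r) =
      scalarLMat e (polyShift (MvPolynomial.X r)) := by
  have e1 : psi m n (∑ i : Idx m n, (-1) ^ par i * freeGen m n i i r) =
      dress m n (casimir m n r) + ∑ i : Idx m n, (-1) ^ par i * evalGen _ i i r := by
    rw [casimir]
    simp only [map_sum, map_mul, map_pow, map_neg, map_one, psi_freeGen, mul_add,
      Finset.sum_add_distrib]
  refine ext_LMat fun k l c => ?_
  rw [e1, scalarLMat_apply, polyShift_X, Matrix.add_apply, AddMonoidAlgebra.coeff_add,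
    Finsupp.add_apply, dress_apply, AddMonoidAlgebra.coeff_sub, Finsupp.sub_apply, map_sub,
    parity_of_mem_casimirAlg _ (Algebra.subset_adjoin ⟨r, rfl⟩), C_apply]
  have e2 : (∑ i : Idx m n, (-1) ^ par i * evalGen (U m n) i i r) k l =
      if k = l then -T (evalDeg r) else 0 := by
    rw [Matrix.sum_apply, Finset.sum_eq_single k]
    · have : (((-1) ^ par k : LMat m n (U m n)) * evalGen (U m n) k k r) k l =
          (-1) ^ par k * evalGen (U m n) k k r k l := by
        rcases Nat.even_or_odd (par k) with hs | hs <;> simp [hs.neg_one_pow]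
      rw [this, evalGen_apply, par_mul_self]
      by_cases hkl : k = l
      · rw [if_pos ⟨rfl, hkl⟩, if_pos hkl, neg_mul, mul_neg, ← mul_assoc, neg_one_pow_mul_self,
          one_mul]
      · rw [if_neg (fun hc => hkl hc.2), if_neg hkl, mul_zero]
    · intro i _ hi
      have : (((-1) ^ par i : LMat m n (U m n)) * evalGen (U m n) i i r) k l =
          (-1) ^ par i * evalGen (U m n) i i r k l := by
        rcases Nat.even_or_odd (par i) with hs | hs <;> simp [hs.neg_one_pow]
      rw [this, evalGen_apply, if_neg (fun hc => hi hc.1), mul_zero]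
    · simp
  rw [e2]
  by_cases hkl : k = l
  · rw [if_pos hkl, if_pos hkl, if_pos hkl, C_apply, AddMonoidAlgebra.coeff_neg, Finsupp.neg_apply,
      sub_eq_add_neg, T_apply, T_apply, apply_ite e, apply_ite e, he, map_zero, map_one]
  · rw [if_neg hkl, if_neg hkl, if_neg hkl]
    exact zero_add (0 : U m n)

theorem exists_psi_eq {e : DegPoly →ₐ[CH] U m n} (he : ∀ r, e (MvPolynomial.X r) = casimir m n r)
    (P : DegPoly) : ∃ f, freeToU m n f = e P ∧ psi m n f = scalarLMat e (polyShift P) := by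
  induction P using MvPolynomial.induction_on with
  | C c =>
    refine ⟨algebraMap CH _ c, ?_, ?_⟩
    · rw [AlgHom.commutes]
      exact (e.commutes c).symm
    · rw [AlgHom.commutes, ← (scalarLMat e).commutes, ← polyShift.commutes]
      rfl
  | add p q hp hq =>
    obtain ⟨f, h1, h2⟩ := hp
    obtain ⟨g, h3, h4⟩ := hq
    exact ⟨f + g, by rw [map_add, map_add, h1, h3], by rw [map_add, map_add, map_add, h2, h4]⟩
  | mul_X p r hp =>
    obtain ⟨f, h1, h2⟩ := hp
    refine ⟨f * ∑ i : Idx m n, (-1) ^ par i * freeGen m n i i r, ?_, ?_⟩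
    · rw [map_mul, map_mul, h1, he, casimir]
      simp only [map_sum, map_mul, map_pow, map_neg, map_one, freeToU_freeGen]
    · rw [map_mul, map_mul, map_mul, h2, psi_casimir he]

theorem coeff_polyShift_eq_zero (o : Idx m n) {e : DegPoly →ₐ[CH] U m n}
    (he : ∀ r, e (MvPolynomial.X r) = casimir m n r) {P : DegPoly} (hP : e P = 0) (c : ℤ) :
    e ((polyShift P).coeff c) = 0 := by
  obtain ⟨f, h1, h2⟩ := exists_psi_eq he P
  have h3 := psi_eq_zero (f := f) (h1.trans hP)
  rw [h2] at h3
  have h4 := congrArg (fun X : LMat m n (U m n) => (X o o).coeff c) h3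
  simp only [scalarLMat_apply, if_true] at h4
  exact h4

theorem exists_h_mul_of_algebraMap_U {c : CH} (hc : algebraMap CH (U m n) c = 0) :
    ∃ y : CH, h * y = c := by
  obtain ⟨φ, -⟩ := exists_algHom_of_relEntry (m := m) (n := n) (A := CH) (t := 0)
    fun ε₁ ε₂ _ a b i j k l => by
      have : ∀ ε i j a, tauCoeff (m := m) (n := n) (A := CH) 0 ε i j a = 0 := fun ε i j a => by
        cases ε <;> simp [tauCoeff]
      simp [relEntry, this]
  have h0 := congrArg (mapU φ) hc
  rw [AlgHom.commutes, map_zero, ← (mkH CH).commutes, mkH_eq_zero_iff] at h0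
  exact h0

/-- A relation `P` among the `casimir`s yields relations given by all coefficients of its shift,
since `psi` respects the relations of `U`. The differences with `P` have lower degree and are
divisible by `h` by induction; `poly_euler` then shows that a multiple of `P` is so modulo a
relation of lower degree. Degree zero is settled by the trivial representation. -/
theorem exists_h_smul_of_casimir (o : Idx m n) {e : DegPoly →ₐ[CH] U m n}
    (he : ∀ r, e (MvPolynomial.X r) = casimir m n r) {P : DegPoly} (hP : e P = 0) :
    ∃ Q, h • Q = P := by
  let S : Submodule CH DegPoly := LinearMap.range (LinearMap.lsmul CH DegPoly h)
  suffices ∀ D, ∀ P : DegPoly, P ∈ genFilt polyGen D → e P = 0 → P ∈ S by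
    obtain ⟨D, hD⟩ := exists_mem_genFilt_polyGen P
    obtain ⟨Q, hQ⟩ := this _ P hD hP
    exact ⟨Q, hQ⟩
  have hS : ∀ P ∈ S, e P = 0 := by
    rintro _ ⟨Q, rfl⟩
    rw [LinearMap.lsmul_apply, map_smul, h_smul_U]
  intro D
  induction D with
  | zero =>
    intro P hD _
    rw [(Submodule.mem_bot CH).1 hD]
    exact zero_mem _
  | succ D ih =>
    intro P hD hP
    obtain ⟨h1, h2⟩ := poly_euler hD
    have h3 : ∀ c, (polyShift P - C P).coeff c ∈ S := fun c => ih _ (h1 c) (by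
      rw [AddMonoidAlgebra.coeff_sub, Finsupp.sub_apply, map_sub,
        coeff_polyShift_eq_zero o he hP, C_apply]
      split_ifs
      · rw [hP, sub_zero]
      · rw [map_zero, sub_zero])
    have h4 : polyMu (polyShift P - C P) ∈ S := polyMu_mem S S (by
      rintro r _ ⟨Q, rfl⟩
      exact ⟨Q * MvPolynomial.X r, by simp⟩) h3
    rcases D with _ | D
    · rw [genFilt, pow_zero, Submodule.mem_one] at hD
      obtain ⟨c, rfl⟩ := hD
      rw [AlgHom.commutes] at hP
      obtain ⟨y, rfl⟩ := exists_h_mul_of_algebraMap_U hP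
      exact ⟨algebraMap CH _ y, by
        rw [LinearMap.lsmul_apply, map_mul, ← Algebra.smul_def]⟩
    · have h5 := ih _ h2 (by rw [map_add, hS _ h4, map_nsmul, hP, smul_zero, add_zero])
      have h6 := sub_mem h5 h4
      rw [add_sub_cancel_left] at h6
      exact mem_of_nsmul_mem D.succ_ne_zero h6

end Independence
end DoubleYangian

namespace DoubleYangian
open Equiv

/-! ### Column determinants over a noncommutative ring -/

section Determinants

variable {S : Type} [Ring S]

/-- Isolates two neighbouring factors; `L` and `R` are common to all products that agree elsewhere,
so a relation between neighbours can be applied inside. -/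
theorem prod_ofFn_adjacent {k : ℕ} (a : Fin k) (x : Fin (k + 1) → S) :
    ∃ L R : S, ∀ y : Fin (k + 1) → S, (∀ b, b ≠ a.castSucc → b ≠ a.succ → y b = x b) →
      (List.ofFn y).prod = L * (y a.castSucc * y a.succ) * R := by
  induction k with
  | zero => exact a.elim0
  | succ k ih =>
    refine Fin.cases ?_ (fun a => ?_) a
    · refine ⟨1, (List.ofFn fun b : Fin k => x b.succ.succ).prod, fun y hy => ?_⟩
      have : (fun b : Fin k => y b.succ.succ) = fun b => x b.succ.succ := funext fun b =>
        hy _ (by simp [Fin.ext_iff]) (by simp [Fin.ext_iff])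
      rw [List.ofFn_succ, List.ofFn_succ, List.prod_cons, List.prod_cons, this, one_mul, ← mul_assoc]
      rfl
    · obtain ⟨L, R, h1⟩ := ih a fun b => x b.succ
      refine ⟨x 0 * L, R, fun y hy => ?_⟩
      rw [List.ofFn_succ, List.prod_cons, h1 _ fun b hb hb' => hy _ ?_ ?_, hy 0]
      · simp only [mul_assoc, Fin.succ_castSucc]
      · simp [Fin.ext_iff]
      · simp [Fin.ext_iff]
      · rw [← Fin.succ_castSucc]
        exact fun hc => hb (Fin.succ_injective _ hc)
      · exact fun hc => hb' (Fin.succ_injective _ hc)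

theorem commutator_prod_ofFn {k : ℕ} (E : S) (x : Fin k → S) :
    E * (List.ofFn x).prod - (List.ofFn x).prod * E =
      ∑ a, (List.ofFn (Function.update x a (E * x a - x a * E))).prod := by
  induction k with
  | zero => simp
  | succ k ih =>
    rw [Fin.sum_univ_succ, List.ofFn_succ, List.prod_cons, List.ofFn_succ, List.prod_cons,
      Function.update_self]
    have e1 : (fun i : Fin k => Function.update x 0 (E * x 0 - x 0 * E) i.succ) =
        fun i => x i.succ := funext fun i => Function.update_of_ne (Fin.succ_ne_zero i) _ _
    have e2 : ∀ a : Fin k, (List.ofFn (Function.update x a.succ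
        (E * x a.succ - x a.succ * E))).prod = x 0 * (List.ofFn (Function.update
          (fun i : Fin k => x i.succ) a (E * x a.succ - x a.succ * E))).prod := by
      intro a
      rw [List.ofFn_succ, List.prod_cons, Function.update_of_ne (Fin.succ_ne_zero a).symm]
      congr 3
      funext i
      by_cases hi : i = a
      · subst hi; rw [Function.update_self, Function.update_self]
      · rw [Function.update_of_ne hi, Function.update_of_ne fun hc => hi (Fin.succ_injective _ hc)]
    rw [e1, Finset.sum_congr rfl fun a _ => e2 a, ← Finset.mul_sum, ← ih fun i => x i.succ]
    noncomm_ring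

/-- The column determinant of the matrix whose `a`-th column is taken from `M a`, with the rows
`f` and the columns `g`. -/
def qdet {k : ℕ} (M : Fin k → Matrix (Fin k) (Fin k) S) (f g : Fin k → Fin k) : S :=
  ∑ τ : Perm (Fin k), (Perm.sign τ : ℤ) • (List.ofFn fun a => M a (f (τ a)) (g a)).prod

/-- The symmetry property of `X(u) Y(u - h)` for a generating matrix of a Yangian. -/
def ColAlt {K : Type} (X Y : Matrix K K S) : Prop :=
  ∀ i j k l, X i j * Y k l + X i l * Y k j = X k j * Y i l + X k l * Y i j

/-- The factors are ordered by column, so exchanging two equal rows changes only the sign of the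
permutation; no commutation relation is needed. -/
theorem qdet_eq_zero_of_row {k : ℕ} (M : Fin k → Matrix (Fin k) (Fin k) S) {f g : Fin k → Fin k}
    {a b : Fin k} (hab : a ≠ b) (hf : f a = f b) : qdet M f g = 0 := by
  have hf' : ∀ c, f (swap a b c) = f c := by
    intro c
    rcases swap_apply_eq_iff.1 (rfl : swap a b c = swap a b c) with h1
    by_cases hca : c = a
    · subst hca; rw [swap_apply_left, hf]
    by_cases hcb : c = b
    · subst hcb; rw [swap_apply_right, hf]
    rw [swap_apply_of_ne_of_ne hca hcb]
  refine Finset.sum_involution (fun τ _ => swap a b * τ) (fun τ _ => ?_) (fun τ _ _ hc => ?_)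
    (fun τ _ => Finset.mem_univ _) fun τ _ => ?_
  · simp only [Perm.sign_mul, Perm.sign_swap hab, Perm.mul_apply, hf']
    simp
  · exact hab (swap_eq_one_iff.1 (mul_eq_right.1 hc))
  · simp [← mul_assoc]

/-- The permutations `τ` and `τ * s` differ in two adjacent factors only. The four resulting
products cancel by `ColAlt`. -/
theorem qdet_comp_swap {k : ℕ} {M : Fin (k + 1) → Matrix (Fin (k + 1)) (Fin (k + 1)) S}
    {a : Fin k} (hM : ColAlt (M a.castSucc) (M a.succ)) (f g : Fin (k + 1) → Fin (k + 1)) :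
    qdet M f (g ∘ swap a.castSucc a.succ) = -qdet M f g := by
  have hne : a.castSucc ≠ a.succ := (Fin.castSucc_lt_succ).ne
  set s := swap a.castSucc a.succ with hs
  have h1 : s a.castSucc = a.succ := swap_apply_left _ _
  have h2 : s a.succ = a.castSucc := swap_apply_right _ _
  have h3 : ∀ b, b ≠ a.castSucc → b ≠ a.succ → s b = b := fun b hb hb' =>
    swap_apply_of_ne_of_ne hb hb'
  have h4 : Perm.sign s = -1 := Perm.sign_swap hne
  have h5 : s * s = 1 := swap_mul_self _ _
  have h6 : s ≠ 1 := fun hc => hne (swap_eq_one_iff.1 hc)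
  clear_value s
  rw [eq_neg_iff_add_eq_zero, qdet, qdet, ← Finset.sum_add_distrib]
  refine Finset.sum_involution (fun τ _ => τ * s) (fun τ _ => ?_) (fun τ _ _ hc => ?_)
    (fun τ _ => Finset.mem_univ _) fun τ _ => ?_
  · obtain ⟨L, R, hLR⟩ := prod_ofFn_adjacent a fun b => M b (f (τ b)) (g b)
    rw [hLR (fun b => M b (f (τ b)) (g b)) fun b _ _ => rfl,
      hLR (fun b => M b (f (τ b)) ((g ∘ s) b)) fun b hb hb' => by
        rw [Function.comp_apply, h3 b hb hb'],
      hLR (fun b => M b (f ((τ * s) b)) (g b)) fun b hb hb' => by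
        rw [Perm.mul_apply, h3 b hb hb'],
      hLR (fun b => M b (f ((τ * s) b)) ((g ∘ s) b)) fun b hb hb' => by
        rw [Perm.mul_apply, Function.comp_apply, h3 b hb hb']]
    simp only [Function.comp_apply, Perm.mul_apply, h1, h2, Perm.sign_mul, h4,
      mul_neg, mul_one, Units.val_neg, neg_smul]
    rw [← smul_add, ← neg_add, ← smul_add, ← sub_eq_add_neg, ← smul_sub, ← add_mul, ← mul_add,
      ← add_mul, ← mul_add, ← sub_mul, ← mul_sub]
    have := hM (f (τ a.castSucc)) (g a.castSucc) (f (τ a.succ)) (g a.succ)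
    rw [add_comm (_ * M a.succ _ (g a.castSucc)), this, add_comm (M a.castSucc (f (τ a.succ)) (g a.castSucc) * _),
      sub_self, mul_zero, zero_mul, smul_zero]
  · exact h6 (mul_eq_left.1 hc)
  · simp [mul_assoc, h5]

/-- The property `ColAlt` for consecutive members of a family. -/
def ColAltFamily {K : Type} {k : ℕ} (M : Fin k → Matrix K K S) : Prop :=
  ∀ a b : Fin k, (a : ℕ) + 1 = b → ColAlt (M a) (M b)

theorem qdet_comp_perm {k : ℕ} {M : Fin k → Matrix (Fin k) (Fin k) S}
    (hM : ColAltFamily M) (f g : Fin k → Fin k) (σ : Perm (Fin k)) :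
    qdet M f (g ∘ σ) = (Perm.sign σ : ℤ) • qdet M f g := by
  rcases k with _ | k
  · rw [Subsingleton.elim (g ∘ σ) g, Subsingleton.elim σ 1]; simp
  have hσ : σ ∈ Submonoid.closure (Set.range fun i : Fin k => swap i.castSucc i.succ) := by
    rw [Perm.mclosure_swap_castSucc_succ]; trivial
  induction hσ using Submonoid.closure_induction_right with
  | one => simp
  | mul_right σ _ s hs ih =>
    obtain ⟨a, rfl⟩ := hs
    rw [Perm.coe_mul, ← Function.comp_assoc, qdet_comp_swap (hM _ _ (by simp)), ih, Perm.sign_mul,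
      Perm.sign_swap (Fin.castSucc_lt_succ).ne]
    simp

/-- Absence of `2`-torsion. -/
def TwoFree (S : Type) [Ring S] : Prop := ∀ x : S, x + x = 0 → x = 0

/-- Alternation under column permutations gives `x = -x`; this is where absence of `2`-torsion
enters. -/
theorem qdet_eq_zero_of_col {k : ℕ} (h2 : TwoFree S) {M : Fin k → Matrix (Fin k) (Fin k) S}
    (hM : ColAltFamily M) {f g : Fin k → Fin k} {a b : Fin k} (hab : a ≠ b) (hg : g a = g b) :
    qdet M f g = 0 := by
  have h1 := qdet_comp_perm hM f g (swap a b)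
  have h3 : g ∘ swap a b = g := by
    funext c
    rw [Function.comp_apply]
    by_cases hca : c = a
    · subst hca; rw [swap_apply_left, hg]
    by_cases hcb : c = b
    · subst hcb; rw [swap_apply_right, hg]
    rw [swap_apply_of_ne_of_ne hca hcb]
  rw [h3, Perm.sign_swap hab] at h1
  refine h2 _ ?_
  nth_rewrite 1 [h1]
  simp

/-- The determinant with the last column replaced by a vector. -/
def qdetV {k : ℕ} (M : Fin (k + 1) → Matrix (Fin (k + 1)) (Fin (k + 1)) S) (c : Fin (k + 1) → S) :
    S :=
  ∑ τ : Perm (Fin (k + 1)), (Perm.sign τ : ℤ) •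
    ((List.ofFn fun a : Fin k => M a.castSucc (τ a.castSucc) a.castSucc).prod * c (τ (Fin.last k)))

theorem prod_ofFn_castSucc {k : ℕ} (x : Fin (k + 1) → S) :
    (List.ofFn x).prod = (List.ofFn fun a : Fin k => x a.castSucc).prod * x (Fin.last k) := by
  rw [List.ofFn_succ_last, List.prod_append, List.prod_singleton]

section Peel

variable {k : ℕ} {M : Fin (k + 1) → Matrix (Fin (k + 1)) (Fin (k + 1)) S}

theorem qdetV_col (l : Fin (k + 1)) : qdetV M (fun i => M (Fin.last k) i l) =
    qdet M id (Function.update id (Fin.last k) l) := by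
  refine Finset.sum_congr rfl fun τ _ => ?_
  rw [prod_ofFn_castSucc, Function.update_self]
  congr 4
  funext a
  rw [Function.update_of_ne (Fin.castSucc_lt_last a).ne]
  rfl

theorem qdetV_last : qdetV M (fun i => M (Fin.last k) i (Fin.last k)) = qdet M id id := by
  rw [qdetV_col]
  congr 1
  exact Function.update_eq_self _ _

theorem qdetV_eq_zero (h2 : TwoFree S) (hM : ColAltFamily M) {l : Fin (k + 1)}
    (hl : l ≠ Fin.last k) : qdetV M (fun i => M (Fin.last k) i l) = 0 := by
  rw [qdetV_col]
  refine qdet_eq_zero_of_col h2 hM hl ?_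
  rw [Function.update_of_ne hl, Function.update_self]
  rfl

theorem qdetV_sum {ι : Type} [Fintype ι] (c : ι → Fin (k + 1) → S) (x : ι → S) :
    qdetV M (fun i => ∑ p, c p i * x p) = ∑ p, qdetV M (c p) * x p := by
  simp only [qdetV, Finset.mul_sum, Finset.smul_sum, Finset.sum_mul]
  rw [Finset.sum_comm]
  exact Finset.sum_congr rfl fun p _ => Finset.sum_congr rfl fun τ _ => by
    rw [← mul_assoc, smul_mul_assoc]

/-- The family of the upper left corners. -/
def corner (M : Fin (k + 1) → Matrix (Fin (k + 1)) (Fin (k + 1)) S) :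
    Fin k → Matrix (Fin k) (Fin k) S :=
  fun a => (M a.castSucc).submatrix Fin.castSucc Fin.castSucc

/-- Only permutations fixing the last index contribute; `Perm.decomposeOption` separates them from
the others. -/
theorem qdetV_single : qdetV M (Pi.single (Fin.last k) 1) = qdet (corner M) id id := by
  rw [qdetV, ← (permCongr (finSuccEquivLast (n := k))).symm.sum_comp, 
    ← Perm.decomposeOption.symm.sum_comp, Fintype.sum_prod_type, Fintype.sum_option,
    Finset.sum_eq_zero (s := (Finset.univ : Finset (Fin k))), add_zero]
  · refine Finset.sum_congr rfl fun τ _ => ?_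
    rw [permCongr_symm, Perm.sign_permCongr, Perm.decomposeOption_symm_sign]
    simp [permCongr_apply, corner, Perm.decomposeOption]
  · intro o _
    refine Finset.sum_eq_zero fun τ _ => ?_
    rw [Pi.single_eq_of_ne, mul_zero, smul_zero]
    simp [permCongr_apply, Perm.decomposeOption]

/-- Expansion of the determinant of a corner. -/
theorem qdet_mul_inv (h2 : TwoFree S) (hM : ColAltFamily M)
    {Z : Matrix (Fin (k + 1)) (Fin (k + 1)) S} (hZ : M (Fin.last k) * Z = 1) :
    qdet M id id * Z (Fin.last k) (Fin.last k) = qdet (corner M) id id := by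
  -- The last unit vector is a combination of the columns of the last matrix, with coefficients from
  -- its inverse on the right. All columns but the last give determinants with a repeated column.
  have h1 : (Pi.single (Fin.last k) 1 : Fin (k + 1) → S) =
      fun i => ∑ p, M (Fin.last k) i p * Z p (Fin.last k) := by
    funext i
    rw [← Matrix.mul_apply, hZ, Matrix.one_apply, Pi.single_apply]
  rw [← qdetV_single, h1, qdetV_sum fun p i => M (Fin.last k) i p,
    Finset.sum_eq_single (Fin.last k), qdetV_last]
  · intro p _ hp
    rw [qdetV_eq_zero h2 hM hp, zero_mul]
  · simp

end Peel

theorem commutator_qdet {k : ℕ} (M : Fin k → Matrix (Fin k) (Fin k) S) (E : S) :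
    E * qdet M id id - qdet M id id * E = ∑ τ : Perm (Fin k), (Perm.sign τ : ℤ) •
      ∑ a, (List.ofFn (Function.update (fun b => M b (τ b) b) a
        (E * M a (τ a) a - M a (τ a) a * E))).prod := by
  simp only [qdet, Finset.mul_sum, Finset.sum_mul, ← Finset.sum_sub_distrib,
    ← commutator_prod_ofFn, mul_smul_comm, smul_mul_assoc, ← smul_sub, id]

/-- The determinant commutes with off-diagonal zero modes. -/
theorem commute_qdet {k : ℕ} (h2 : TwoFree S) {M : Fin k → Matrix (Fin k) (Fin k) S}
    (hM : ColAltFamily M) {E : S} {i j : Fin k} (hij : i ≠ j)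
    (hE : ∀ a p q, E * M a p q - M a p q * E =
      (if p = j then M a i q else 0) - (if q = i then M a p j else 0)) :
    Commute E (qdet M id id) := by
  refine sub_eq_zero.1 ?_
  rw [commutator_qdet]
  -- By the Leibniz rule the commutator is the determinant with row `j` replaced by row `i`, minus
  -- the one with column `i` replaced by column `j`. Both vanish.
  have e1 : ∀ τ : Perm (Fin k), ∑ a, (List.ofFn (Function.update (fun b => M b (τ b) b) a
        (E * M a (τ a) a - M a (τ a) a * E))).prod =
      (List.ofFn fun b => M b (Function.update id j i (τ b)) b).prod -
        (List.ofFn fun b => M b (τ b) (Function.update id i j b)).prod := by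
    intro τ
    have upd_sub : ∀ (x : Fin k → S) (a : Fin k) (u v : S),
        (List.ofFn (Function.update x a (u - v))).prod =
          (List.ofFn (Function.update x a u)).prod - (List.ofFn (Function.update x a v)).prod := by
      intro x a u v
      exact (MultilinearMap.mkPiAlgebraFin ℤ k S).map_update_sub x a u v
    have upd_zero : ∀ (x : Fin k → S) (a : Fin k),
        (List.ofFn (Function.update x a 0)).prod = 0 := by
      intro x a
      refine List.prod_eq_zero ?_
      rw [List.mem_ofFn]
      exact ⟨a, Function.update_self _ _ _⟩
    simp only [hE, upd_sub, Finset.sum_sub_distrib]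
    congr 1
    · rw [Finset.sum_eq_single (τ.symm j)]
      · rw [if_pos (τ.apply_symm_apply j)]
        congr 2
        funext b
        by_cases hb : b = τ.symm j
        · subst hb; rw [Function.update_self, τ.apply_symm_apply, Function.update_self]
        · rw [Function.update_of_ne hb, Function.update_of_ne (fun hc => hb (by
            rw [← hc, τ.symm_apply_apply]))]
          rfl
      · intro b _ hb
        rw [if_neg (fun hc => hb (by rw [← hc, τ.symm_apply_apply])), upd_zero]
      · simp
    · rw [Finset.sum_eq_single i]
      · rw [if_pos rfl]
        congr 2
        funext b
        by_cases hb : b = i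
        · subst hb; rw [Function.update_self, Function.update_self]
        · rw [Function.update_of_ne hb, Function.update_of_ne hb]
          rfl
      · intro b _ hb
        rw [if_neg hb, upd_zero]
      · simp
  simp only [e1, smul_sub, Finset.sum_sub_distrib]
  have e2 := qdet_eq_zero_of_row M (f := Function.update id j i) (g := id) hij (by
    rw [Function.update_of_ne hij, Function.update_self]; rfl)
  have e3 := qdet_eq_zero_of_col h2 hM (f := id) (g := Function.update id i j) hij (by
    rw [Function.update_self, Function.update_of_ne hij.symm]; rfl)
  exact (congrArg₂ _ e2 e3).trans (sub_self 0)

/-- The commutator of the determinant with a zero mode that acts on the last column only. -/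
theorem commutator_qdet_last {k : ℕ} {M : Fin (k + 1) → Matrix (Fin (k + 1)) (Fin (k + 1)) S}
    {E : S} {c : Fin (k + 1) → S} (hE : ∀ a ≠ Fin.last k, ∀ p, Commute E (M a p a))
    (hc : ∀ p, E * M (Fin.last k) p (Fin.last k) - M (Fin.last k) p (Fin.last k) * E = c p) :
    E * qdet M id id - qdet M id id * E = qdetV M c := by
  rw [commutator_qdet, qdetV]
  refine Finset.sum_congr rfl fun τ _ => ?_
  rw [Finset.sum_eq_single (Fin.last k)]
  · rw [hc, prod_ofFn_castSucc, Function.update_self]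
    congr 4
    funext a
    rw [Function.update_of_ne (Fin.castSucc_lt_last a).ne]
  · intro a _ ha
    refine List.prod_eq_zero ?_
    rw [List.mem_ofFn]
    refine ⟨a, ?_⟩
    rw [Function.update_self, sub_eq_zero]
    exact hE a ha _
  · simp

end Determinants
end DoubleYangian

namespace DoubleYangian
open MulOpposite

/-! ### Row determinants and products of two determinants -/

section RowDeterminants

variable {S : Type} [Ring S]

/-- The transposed family over the opposite ring. -/
def opFamily {k : ℕ} (M : Fin k → Matrix (Fin k) (Fin k) S) : Fin k → Matrix (Fin k) (Fin k) Sᵐᵒᵖ :=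
  fun a p q => op (M a q p)

/-- The row determinant: the rows are taken in the reversed order from the members of the family. -/
def rdet {k : ℕ} (M : Fin k → Matrix (Fin k) (Fin k) S) : S := unop (qdet (opFamily M) id id)

/-- The row determinant with the last row replaced by a vector. -/
def rdetV {k : ℕ} (M : Fin (k + 1) → Matrix (Fin (k + 1)) (Fin (k + 1)) S) (c : Fin (k + 1) → S) :
    S := unop (qdetV (opFamily M) fun i => op (c i))

theorem op_finset_sum {ι : Type*} (s : Finset ι) (f : ι → S) :
    op (∑ i ∈ s, f i) = ∑ i ∈ s, op (f i) := map_sum (opAddEquiv : S ≃+ Sᵐᵒᵖ) f s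

theorem unop_finset_sum {ι : Type*} (s : Finset ι) (f : ι → Sᵐᵒᵖ) :
    unop (∑ i ∈ s, f i) = ∑ i ∈ s, unop (f i) := map_sum (opAddEquiv : S ≃+ Sᵐᵒᵖ).symm f s

theorem TwoFree.op (h2 : TwoFree S) : TwoFree Sᵐᵒᵖ := fun x hx =>
  unop_injective (h2 (unop x) (by rw [← unop_add, hx, unop_zero]))

/-- The determinants in the definition of the quantum Berezinian. -/
theorem rdet_eq_sum {k : ℕ} (M : Fin k → Matrix (Fin k) (Fin k) S) :
    rdet M = ∑ σ : Equiv.Perm (Fin k), (Equiv.Perm.sign σ : ℤ) •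
      (List.ofFn fun a => M (Fin.rev a) (Fin.rev a) (Fin.rev (σ a))).prod := by
  have hprod : ∀ {k : ℕ} (x : Fin k → S), unop (List.ofFn fun a => op (x a)).prod =
      (List.ofFn fun a => x (Fin.rev a)).prod := by
    intro k x
    rw [unop_list_prod, List.map_ofFn]
    congr 1
    refine List.ext_getElem (by simp) fun i h₁ h₂ => ?_
    simp only [List.length_ofFn] at h₂
    simp only [List.getElem_reverse, List.getElem_ofFn, Function.comp_apply, unop_op,
      List.length_ofFn]
    congr 1
    simp only [Fin.ext_iff, Fin.val_rev]
    omega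
  rw [rdet, qdet, unop_finset_sum, ← (Equiv.permCongr (Fin.revPerm (n := k))).sum_comp]
  refine Finset.sum_congr rfl fun σ _ => ?_
  rw [unop_smul, Equiv.Perm.sign_permCongr]
  congr 1
  rw [show (fun a => opFamily M a (id ((Fin.revPerm.permCongr σ) a)) (id a)) =
    fun a => op (M a a ((Fin.revPerm.permCongr σ) a)) from rfl, hprod]
  simp [Equiv.permCongr_apply]

theorem opFamily_mul {k : ℕ} {X Z : Matrix (Fin k) (Fin k) S} (hZ : Z * X = 1) :
    (Matrix.of fun p q => op (X q p) : Matrix (Fin k) (Fin k) Sᵐᵒᵖ) *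
      (Matrix.of fun p q => op (Z q p)) = 1 := by
  refine Matrix.ext fun p q => ?_
  have := congrArg op (congrFun (congrFun hZ q) p)
  rw [Matrix.mul_apply, op_finset_sum] at this
  rw [Matrix.mul_apply]
  refine Eq.trans (Finset.sum_congr rfl fun r _ => ?_) (this.trans ?_)
  · rw [op_mul]; rfl
  · rw [Matrix.one_apply, Matrix.one_apply]
    by_cases hpq : p = q
    · rw [if_pos hpq, if_pos hpq.symm, op_one]
    · rw [if_neg hpq, if_neg (fun hc => hpq hc.symm), op_zero]

theorem inv_mul_rdet {k : ℕ} {M : Fin (k + 1) → Matrix (Fin (k + 1)) (Fin (k + 1)) S}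
    (h2 : TwoFree S) (hM : ColAltFamily (opFamily M))
    {Z : Matrix (Fin (k + 1)) (Fin (k + 1)) S} (hZ : Z * M (Fin.last k) = 1) :
    Z (Fin.last k) (Fin.last k) * rdet M = rdet (corner M) := by
  have := congrArg unop (qdet_mul_inv h2.op hM (Z := Matrix.of fun p q => op (Z q p))
    (opFamily_mul hZ))
  exact this

/-- The last factor of the column determinant stands next to the first factor of the reversed row
determinant, so the sum over `p` can be carried out between them. -/
theorem qdetV_mul_rdetV {k l : ℕ} (M : Fin (k + 1) → Matrix (Fin (k + 1)) (Fin (k + 1)) S)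
    (N : Fin (l + 1) → Matrix (Fin (l + 1)) (Fin (l + 1)) S) {ι : Type} [Fintype ι]
    {c : ι → Fin (k + 1) → S} {d : ι → Fin (l + 1) → S} (hcd : ∀ i j, ∑ p, c p i * d p j = 0) :
    ∑ p, qdetV M (c p) * rdetV N (d p) = 0 := by
  simp only [qdetV, rdetV, unop_finset_sum, unop_smul, unop_mul, unop_op, Finset.sum_mul,
    Finset.mul_sum]
  rw [Finset.sum_comm]
  refine Finset.sum_eq_zero fun σ _ => ?_
  rw [Finset.sum_comm]
  refine Finset.sum_eq_zero fun τ _ => ?_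
  simp only [smul_mul_assoc, mul_smul_comm, ← Finset.smul_sum]
  have key : ∀ (L R : S) (i : Fin (k + 1)) (j : Fin (l + 1)),
      ∑ p, L * c p i * (d p j * R) = 0 := by
    intro L R i j
    have : ∀ p, L * c p i * (d p j * R) = L * (c p i * d p j) * R := fun p => by
      simp only [mul_assoc]
    rw [Finset.sum_congr rfl fun p _ => this p, ← Finset.sum_mul, ← Finset.mul_sum, hcd, mul_zero,
      zero_mul]
  rw [key, smul_zero, smul_zero]

/-- A product of determinants commutes with an odd zero mode. -/
theorem commute_qdet_mul_rdet {k l : ℕ} (h2 : TwoFree S)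
    {M : Fin (k + 1) → Matrix (Fin (k + 1)) (Fin (k + 1)) S}
    {N : Fin (l + 1) → Matrix (Fin (l + 1)) (Fin (l + 1)) S} (hM : ColAltFamily M)
    (hN : ColAltFamily (opFamily N)) {c : Fin (l + 1) → Fin (k + 1) → S}
    {d : Fin (k + 1) → Fin (l + 1) → S}
    (hcd : ∀ i j, ∑ a, M (Fin.last k) i a * d a j + ∑ b, c b i * N (Fin.last l) b j = 0) {E : S}
    (hE : ∀ a ≠ Fin.last k, ∀ p, Commute E (M a p a))
    (hE' : ∀ b ≠ Fin.last l, ∀ p, Commute E (N b b p))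
    (hc : ∀ p, E * M (Fin.last k) p (Fin.last k) - M (Fin.last k) p (Fin.last k) * E =
      c (Fin.last l) p)
    (hd : ∀ p, E * N (Fin.last l) (Fin.last l) p - N (Fin.last l) (Fin.last l) p * E =
      d (Fin.last k) p) :
    Commute E (qdet M id id * rdet N) := by
  have h1 := commutator_qdet_last hE hc
  have h3 := commutator_qdet_last (M := opFamily N) (E := op E)
    (c := fun p => -op (d (Fin.last k) p)) (fun b hb p => (hE' b hb p).op) (fun p => by
      rw [← hd, op_sub, op_mul, op_mul, neg_sub]; rfl)
  have h4 : E * rdet N - rdet N * E = rdetV N (d (Fin.last k)) := by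
    have := congrArg unop h3
    rw [unop_sub, unop_mul, unop_mul, unop_op] at this
    rw [← neg_inj, neg_sub]
    refine this.trans ?_
    simp only [qdetV, rdetV, mul_neg, smul_neg, Finset.sum_neg_distrib, unop_neg]
  -- Summed over all columns and rows; terms with a repeated column or row vanish. The two survivors
  -- are the summands of the Leibniz rule for the commutator of `E` with the product.
  have h5 := qdetV_mul_rdetV M N (ι := Fin (k + 1) ⊕ Fin (l + 1))
    (c := Sum.elim (fun a i => M (Fin.last k) i a) c)
    (d := Sum.elim d fun b j => N (Fin.last l) b j) (fun i j => by
      rw [Fintype.sum_sum_type]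
      exact hcd i j)
  rw [Fintype.sum_sum_type, Finset.sum_eq_single (Fin.last k), Finset.sum_eq_single (Fin.last l)]
    at h5
  · simp only [Sum.elim_inl, Sum.elim_inr, qdetV_last] at h5
    have h6 : rdetV N (fun j => N (Fin.last l) (Fin.last l) j) = rdet N :=
      congrArg unop (qdetV_last (M := opFamily N))
    rw [h6, ← h4, ← h1] at h5
    refine sub_eq_zero.1 (Eq.trans ?_ h5)
    noncomm_ring
  · intro b _ hb
    have : rdetV N (fun j => N (Fin.last l) b j) = 0 :=
      congrArg unop (qdetV_eq_zero h2.op hN hb)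
    simp only [Sum.elim_inr, this, mul_zero]
  · simp
  · intro a _ ha
    simp only [Sum.elim_inl, qdetV_eq_zero h2 hM ha, zero_mul]
  · simp

end RowDeterminants
end DoubleYangian

namespace DoubleYangian

section Instances

variable (m n : ℕ)

noncomputable scoped instance : Ring (DY m n) := inferInstance

noncomputable scoped instance : Semiring (DY m n) := inferInstance

noncomputable scoped instance : NonAssocRing (DY m n) := inferInstance

noncomputable scoped instance : NonAssocSemiring (DY m n) := inferInstance

noncomputable scoped instance : NonUnitalNonAssocSemiring (DY m n) := inferInstance

noncomputable scoped instance : AddCommGroup (DY m n) := inferInstance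

noncomputable scoped instance : AddCommMonoid (DY m n) := inferInstance

noncomputable scoped instance : AddGroup (DY m n) := inferInstance

noncomputable scoped instance : AddMonoid (DY m n) := inferInstance

noncomputable scoped instance : AddZeroClass (DY m n) := inferInstance

noncomputable scoped instance : Semigroup (DY m n) := inferInstance

noncomputable scoped instance : Zero (DY m n) := inferInstance

noncomputable scoped instance : One (DY m n) := inferInstance

noncomputable scoped instance : Add (DY m n) := inferInstance

noncomputable scoped instance : Sub (DY m n) := inferInstance

noncomputable scoped instance : Mul (DY m n) := inferInstance

noncomputable scoped instance : Algebra CH (DY m n) := inferInstance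

noncomputable scoped instance : Module CH (DY m n) := inferInstance

noncomputable scoped instance : SMul CH (DY m n) := inferInstance

noncomputable scoped instance : Ring (Series m n) := inferInstance

noncomputable scoped instance : Semiring (Series m n) := inferInstance

noncomputable scoped instance : NonAssocRing (Series m n) := inferInstance

noncomputable scoped instance : NonAssocSemiring (Series m n) := inferInstance

noncomputable scoped instance : AddCommGroup (Series m n) := inferInstance

noncomputable scoped instance : AddCommMonoid (Series m n) := inferInstance

noncomputable scoped instance : AddGroup (Series m n) := inferInstance

noncomputable scoped instance : AddMonoid (Series m n) := inferInstance

noncomputable scoped instance : AddZeroClass (Series m n) := inferInstance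

noncomputable scoped instance : Monoid (Series m n) := inferInstance

noncomputable scoped instance : Semigroup (Series m n) := inferInstance

noncomputable scoped instance : Zero (Series m n) := inferInstance

noncomputable scoped instance : One (Series m n) := inferInstance

noncomputable scoped instance : Add (Series m n) := inferInstance

noncomputable scoped instance : Sub (Series m n) := inferInstance

noncomputable scoped instance : Mul (Series m n) := inferInstance

noncomputable scoped instance : Algebra CH (Series m n) := inferInstance

noncomputable scoped instance : Module CH (Series m n) := inferInstance

noncomputable scoped instance : SMul CH (Series m n) := inferInstance

end Instances

/-! ### The substitution `u ↦ u - c h` -/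

section Shift

variable {m n : ℕ}

/-- Series whose coefficients below `N` are divisible by `h ^ k`. -/
def Small (N k : ℕ) (f : Series m n) : Prop :=
  ∀ a < N, ∃ y, PowerSeries.coeff a f = h ^ k • y

theorem Small.mono {N N' k : ℕ} {f : Series m n} (hf : Small N' k f) (hN : N ≤ N') : Small N k f :=
  fun a ha => hf a (ha.trans_le hN)

theorem exists_smul_sum {R ι : Type} [AddCommGroup R] [Module CH R] {s : Finset ι} {f : ι → R}
    {c : CH} (hf : ∀ i ∈ s, ∃ y, f i = c • y) : ∃ y, ∑ i ∈ s, f i = c • y := by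
  have h1 : ∀ i, ∃ y, i ∈ s → f i = c • y := fun i => by
    by_cases hi : i ∈ s
    · obtain ⟨y, hy⟩ := hf i hi
      exact ⟨y, fun _ => hy⟩
    · exact ⟨0, fun hc => absurd hc hi⟩
  choose y hy using h1
  exact ⟨∑ i ∈ s, y i, by rw [Finset.smul_sum]; exact Finset.sum_congr rfl hy⟩

theorem Small.sub {N k : ℕ} {f g : Series m n} (hf : Small N k f) (hg : Small N k g) :
    Small N k (f - g) := fun a ha => by
  obtain ⟨y, hy⟩ := hf a ha
  obtain ⟨z, hz⟩ := hg a ha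
  exact ⟨y - z, by rw [map_sub, hy, hz, smul_sub]⟩

theorem Small.mul_left {N k : ℕ} {f : Series m n} (hf : Small N k f) (g : Series m n) :
    Small N k (g * f) := fun a ha => by
  rw [PowerSeries.coeff_mul]
  refine exists_smul_sum fun x hx => ?_
  obtain ⟨y, hy⟩ := hf x.2 (by have := Finset.HasAntidiagonal.mem_antidiagonal.1 hx; omega)
  exact ⟨PowerSeries.coeff x.1 g * y, by rw [hy, mul_smul_comm]⟩

theorem Small.mul_right {N k : ℕ} {f : Series m n} (hf : Small N k f) (g : Series m n) :
    Small N k (f * g) := fun a ha => by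
  rw [PowerSeries.coeff_mul]
  refine exists_smul_sum fun x hx => ?_
  obtain ⟨y, hy⟩ := hf x.1 (by have := Finset.HasAntidiagonal.mem_antidiagonal.1 hx; omega)
  exact ⟨y * PowerSeries.coeff x.2 g, by rw [hy, smul_mul_assoc]⟩

theorem hSum_add (f g : ℕ → DY m n) : hSum (fun s => f s + g s) = hSum f + hSum g := by
  refine hCompletion_ext fun k => ?_
  change _ = (hSum f).1 k + (hSum g).1 k
  simp only [hSum_apply, ← Finset.sum_add_distrib, ← smul_add]
  rfl

theorem zsmul_DY (z : ℤ) (x : DY m n) : z • x = (z : CH) • x :=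
  (Int.cast_smul_eq_zsmul CH z x).symm

theorem coeff_shift_minus (c : ℤ) (f : Series m n) (a : ℕ) :
    PowerSeries.coeff a (shift c Half.minus f) =
      ∑ x ∈ Finset.HasAntidiagonal.antidiagonal a,
        ((Nat.multichoose x.1 x.2 : CH) * ((c : CH) * h) ^ x.2) • PowerSeries.coeff x.1 f := by
  rw [shift, PowerSeries.coeff_mk]
  refine Finset.sum_congr rfl fun x _ => ?_
  rw [zsmul_DY, smul_smul, Int.cast_mul, Int.cast_natCast, Int.cast_pow, mul_pow, mul_assoc]

theorem coeff_shift_plus (c : ℤ) (f : Series m n) (a : ℕ) :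
    PowerSeries.coeff a (shift c Half.plus f) = hSum fun s : ℕ =>
      ((Nat.choose (a + s) s : CH) * (-(c : CH)) ^ s) • PowerSeries.coeff (a + s) f := by
  rw [shift, PowerSeries.coeff_mk]
  congr 1
  funext s
  rw [zsmul_DY, Int.cast_mul, Int.cast_natCast, Int.cast_pow, Int.cast_neg]

theorem shift_add (c : ℤ) (ε : Half) (f g : Series m n) :
    shift c ε (f + g) = shift c ε f + shift c ε g := by
  refine PowerSeries.ext fun a => ?_
  cases ε
  · simp only [coeff_shift_minus, map_add, smul_add, Finset.sum_add_distrib]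
  · simp only [coeff_shift_plus, map_add, smul_add, hSum_add]

/-- The `h`-adic continuity of the shift: for the superscript `+` the terms with `s ≥ k` are
divisible by `h ^ k`, and the others use only coefficients below `N + k`. -/
theorem small_shift (c : ℤ) (ε : Half) {N k : ℕ} {f : Series m n} (hf : Small (N + k) k f) :
    Small N k (shift c ε f) := by
  intro a ha
  cases ε
  · rw [coeff_shift_minus]
    refine exists_smul_sum fun x hx => ?_
    obtain ⟨y, hy⟩ := hf x.1 (by have := Finset.HasAntidiagonal.mem_antidiagonal.1 hx; omega)
    exact ⟨_ • y, by rw [hy, smul_comm]⟩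
  · rw [coeff_shift_plus]
    obtain ⟨y, hy⟩ := hSum_sub_sum (fun s : ℕ =>
      ((Nat.choose (a + s) s : CH) * (-(c : CH)) ^ s) • PowerSeries.coeff (a + s) f) k
    obtain ⟨z, hz⟩ : ∃ z, ∑ s ∈ Finset.range k, h ^ s •
        (((Nat.choose (a + s) s : CH) * (-(c : CH)) ^ s) • PowerSeries.coeff (a + s) f) =
          h ^ k • z := by
      refine exists_smul_sum fun s hs => ?_
      obtain ⟨y, hy⟩ := hf (a + s) (by have := Finset.mem_range.1 hs; omega)
      exact ⟨(h ^ s * ((Nat.choose (a + s) s : CH) * (-(c : CH)) ^ s)) • y, by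
        rw [hy, smul_smul, smul_comm]⟩
    exact ⟨y + z, by rw [smul_add, ← hy, ← hz, sub_add_cancel]⟩

/-- A continuous additive map vanishing on monomials is zero. -/
theorem eq_zero_of_monomial (F : Series m n → Series m n) (hadd : ∀ f g, F (f + g) = F f + F g)
    (hF : ∀ N k, ∃ N', ∀ f, Small N' k f → Small N k (F f))
    (hmon : ∀ i x, F (PowerSeries.monomial i x) = 0) (f : Series m n) : F f = 0 := by
  refine PowerSeries.ext fun a => ?_
  rw [map_zero]
  refine hComplete_hCompletion.sep _ fun k => ?_
  obtain ⟨N, hN⟩ := hF (a + 1) k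
  have h0 : F 0 = 0 := by
    have := hmon 0 0
    rwa [map_zero] at this
  have h1 : ∀ s : Finset ℕ, F (∑ i ∈ s, PowerSeries.monomial i (PowerSeries.coeff i f)) = 0 := by
    intro s
    induction s using Finset.cons_induction with
    | empty => exact h0
    | cons i s hi ih => rw [Finset.sum_cons, hadd, hmon, ih, add_zero]
  have h2 : F f = F (f - ∑ i ∈ Finset.range N, PowerSeries.monomial i (PowerSeries.coeff i f)) := by
    conv_lhs => rw [← sub_add_cancel f (∑ i ∈ Finset.range N,
      PowerSeries.monomial i (PowerSeries.coeff i f)), hadd, h1, add_zero]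
  rw [h2]
  refine hN _ (fun b hb => ⟨0, ?_⟩) a a.lt_succ_self
  rw [smul_zero, map_sub, map_sum, Finset.sum_eq_single b, PowerSeries.coeff_monomial_same, sub_self]
  · intro i _ hi
    rw [PowerSeries.coeff_monomial, if_neg hi.symm]
  · intro hc
    exact absurd (Finset.mem_range.2 hb) hc

/-- The image of the variable of the series. -/
noncomputable def shiftVar (c : ℤ) : Half → PowerSeries CH
  | Half.minus => PowerSeries.X * PowerSeries.rescale ((c : CH) * h) (PowerSeries.mk 1)
  | Half.plus => PowerSeries.X - PowerSeries.C ((c : CH) * h)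

/-- Scalar series. -/
noncomputable def scalarSeries (m n : ℕ) : PowerSeries CH →+* Series m n :=
  PowerSeries.map (algebraMap CH (DY m n))

theorem coeff_scalarSeries_mul_C (p : PowerSeries CH) (x : DY m n) (a : ℕ) :
    PowerSeries.coeff a (scalarSeries m n p * PowerSeries.C x) = PowerSeries.coeff a p • x := by
  rw [scalarSeries, PowerSeries.coeff_mul_C, PowerSeries.coeff_map, Algebra.smul_def]

theorem commute_scalarSeries (p : PowerSeries CH) (f : Series m n) :
    Commute (scalarSeries m n p) f :=
  commute_powerSeries (fun k x => by
    rw [scalarSeries, PowerSeries.coeff_map]; exact Algebra.commutes _ x) f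

theorem coeff_shiftVar_minus_pow (c : ℤ) (i a : ℕ) :
    PowerSeries.coeff a (shiftVar c Half.minus ^ i) =
      if i ≤ a then (Nat.multichoose i (a - i) : CH) * ((c : CH) * h) ^ (a - i) else 0 := by
  rw [shiftVar, mul_pow, PowerSeries.coeff_X_pow_mul']
  split_ifs with hia
  · obtain ⟨s, rfl⟩ := Nat.exists_eq_add_of_le hia
    rw [Nat.add_sub_cancel_left, ← map_pow, PowerSeries.coeff_rescale, mul_comm]
    congr 1
    rcases i with _ | i
    · rw [pow_zero, PowerSeries.coeff_one]
      rcases s with _ | s <;> simp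
    · rw [PowerSeries.mk_one_pow_eq_mk_choose_add, PowerSeries.coeff_mk, Nat.multichoose_eq]
      congr 1
      rw [show i + 1 + s - 1 = i + s by omega, ← Nat.choose_symm_of_eq_add (add_comm i s)]
  · rfl

theorem coeff_shiftVar_plus_pow (c : ℤ) (i a : ℕ) :
    PowerSeries.coeff a (shiftVar c Half.plus ^ i) =
      (Nat.choose i a : CH) * (-((c : CH) * h)) ^ (i - a) := by
  have : shiftVar c Half.plus = ((Polynomial.X + Polynomial.C (-((c : CH) * h)) : Polynomial CH) :
      PowerSeries CH) := by
    rw [shiftVar, Polynomial.coe_add, Polynomial.coe_X, Polynomial.coe_C, map_neg, sub_eq_add_neg]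
  rw [this, ← Polynomial.coe_pow, Polynomial.coeff_coe, Polynomial.coeff_X_add_C_pow, mul_comm]

theorem shift_monomial (c : ℤ) (ε : Half) (i : ℕ) (x : DY m n) :
    shift c ε (PowerSeries.monomial i x) =
      scalarSeries m n (shiftVar c ε ^ i) * PowerSeries.C x := by
  refine PowerSeries.ext fun a => ?_
  rw [coeff_scalarSeries_mul_C]
  cases ε
  · rw [coeff_shift_minus, coeff_shiftVar_minus_pow]
    split_ifs with hia
    · rw [Finset.sum_eq_single (i, a - i)]
      · rw [PowerSeries.coeff_monomial_same]
      · intro y hy hne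
        rw [PowerSeries.coeff_monomial, if_neg, smul_zero]
        rintro hc
        refine hne (Prod.ext hc ?_)
        have := Finset.HasAntidiagonal.mem_antidiagonal.1 hy
        change y.2 = a - i
        omega
      · intro hc
        exact absurd (Finset.HasAntidiagonal.mem_antidiagonal.2 (Nat.add_sub_cancel' hia)) hc
    · rw [zero_smul]
      refine Finset.sum_eq_zero fun y hy => ?_
      rw [PowerSeries.coeff_monomial, if_neg, smul_zero]
      have := Finset.HasAntidiagonal.mem_antidiagonal.1 hy
      omega
  · rw [coeff_shift_plus, coeff_shiftVar_plus_pow]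
    -- The infinite sum has at most one nonzero term, at `s = i - a`; truncating at `k + (i + 1)`
    -- retains it.
    refine sub_eq_zero.1 (hComplete_hCompletion.sep _ fun k => ?_)
    obtain ⟨y, hy⟩ := hSum_sub_sum (fun s : ℕ => ((Nat.choose (a + s) s : CH) *
      (-(c : CH)) ^ s) • PowerSeries.coeff (a + s) (PowerSeries.monomial i x)) (k + (i + 1))
    have key : ∑ s ∈ Finset.range (k + (i + 1)), h ^ s • (((Nat.choose (a + s) s : CH) *
        (-(c : CH)) ^ s) • PowerSeries.coeff (a + s) (PowerSeries.monomial i x)) =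
        ((Nat.choose i a : CH) * (-((c : CH) * h)) ^ (i - a)) • x := by
      by_cases hia : a ≤ i
      · obtain ⟨s, rfl⟩ := Nat.exists_eq_add_of_le hia
        rw [Finset.sum_eq_single s]
        · rw [PowerSeries.coeff_monomial_same, smul_smul, Nat.add_sub_cancel_left,
            Nat.choose_symm_add]
          congr 1
          rw [← neg_mul, mul_pow]
          ring
        · intro s' _ hs'
          rw [PowerSeries.coeff_monomial, if_neg (by omega), smul_zero, smul_zero]
        · intro hc
          exact absurd (Finset.mem_range.2 (by omega)) hc
      · rw [Nat.choose_eq_zero_of_lt (not_le.1 hia), Nat.cast_zero, zero_mul, zero_smul]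
        refine Finset.sum_eq_zero fun s _ => ?_
        rw [PowerSeries.coeff_monomial, if_neg (by omega), smul_zero, smul_zero]
    rw [key] at hy
    exact ⟨h ^ (i + 1) • y, by rw [hy, pow_add, mul_smul]⟩

theorem shift_C (c : ℤ) (ε : Half) (x : DY m n) :
    shift c ε (PowerSeries.C x) = PowerSeries.C x := by
  rw [← PowerSeries.monomial_zero_eq_C_apply, shift_monomial, pow_zero, map_one, one_mul,
    PowerSeries.monomial_zero_eq_C_apply]

theorem shift_X (c : ℤ) (ε : Half) :
    shift c ε (PowerSeries.X : Series m n) = scalarSeries m n (shiftVar c ε) := by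
  rw [PowerSeries.X_eq, shift_monomial, pow_one, map_one, mul_one]

theorem shift_mul_monomial (c : ℤ) (ε : Half) (i j : ℕ) (x y : DY m n) :
    shift c ε (PowerSeries.monomial i x * PowerSeries.monomial j y) =
      shift c ε (PowerSeries.monomial i x) * shift c ε (PowerSeries.monomial j y) := by
  rw [PowerSeries.monomial_mul_monomial, shift_monomial, shift_monomial, shift_monomial, pow_add,
    map_mul, map_mul, mul_assoc, mul_assoc, ← mul_assoc (PowerSeries.C x),
    ← (commute_scalarSeries _ (PowerSeries.C x)).eq, mul_assoc]

/-- On monomials the shift is substitution for the variable. Multiplicativity extends to all series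
by additivity and continuity, one factor at a time. -/
theorem shift_mul (c : ℤ) (ε : Half) (f g : Series m n) :
    shift c ε (f * g) = shift c ε f * shift c ε g := by
  have h1 : ∀ (i : ℕ) (x : DY m n) (g : Series m n), shift c ε (PowerSeries.monomial i x * g) =
      shift c ε (PowerSeries.monomial i x) * shift c ε g := by
    intro i x g
    refine sub_eq_zero.1 (eq_zero_of_monomial (fun g => shift c ε (PowerSeries.monomial i x * g) -
      shift c ε (PowerSeries.monomial i x) * shift c ε g) (fun g g' => ?_) (fun N k => ?_)
      (fun j y => ?_) g)
    · simp only [mul_add, shift_add]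
      abel
    · exact ⟨N + k, fun g hg => (small_shift c ε (hg.mul_left _)).sub
        ((small_shift c ε hg).mul_left _)⟩
    · exact sub_eq_zero.2 (shift_mul_monomial c ε i j x y)
  refine sub_eq_zero.1 (eq_zero_of_monomial (fun f => shift c ε (f * g) -
      shift c ε f * shift c ε g) (fun g g' => ?_) (fun N k => ?_)
      (fun j y => ?_) f)
  · simp only [add_mul, shift_add]
    abel
  · exact ⟨N + k, fun g hg => (small_shift c ε (hg.mul_right _)).sub
      ((small_shift c ε hg).mul_right _)⟩
  · exact sub_eq_zero.2 (h1 j y g)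

/-- The shift as a ring homomorphism. -/
noncomputable def shiftHom (m n : ℕ) (c : ℤ) (ε : Half) : Series m n →+* Series m n where
  toFun := shift c ε
  map_one' := shift_C c ε 1
  map_mul' := shift_mul c ε
  map_zero' := by
    have := shift_C c ε (0 : DY m n)
    rwa [map_zero] at this
  map_add' := shift_add c ε

theorem shiftHom_apply (c : ℤ) (ε : Half) (f : Series m n) : shiftHom m n c ε f = shift c ε f := rfl

theorem scalarSeries_C (c : CH) :
    scalarSeries m n (PowerSeries.C c) = PowerSeries.C (algebraMap CH (DY m n) c) :=
  PowerSeries.map_C _ _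

theorem scalarSeries_X : scalarSeries m n PowerSeries.X = PowerSeries.X := PowerSeries.map_X _

theorem shiftVar_minus_mul (c : ℤ) :
    shiftVar c Half.minus * (1 - PowerSeries.C ((c : CH) * h) * PowerSeries.X) = PowerSeries.X := by
  have h1 : (PowerSeries.mk 1 : PowerSeries CH) * (1 - PowerSeries.X) = 1 :=
    PowerSeries.mk_one_mul_one_sub_eq_one CH
  have h2 := congrArg (PowerSeries.rescale ((c : CH) * h)) h1
  rw [map_mul, map_sub, map_one, PowerSeries.rescale_X] at h2
  rw [shiftVar, mul_assoc, h2, mul_one]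

theorem shift_scalarSeries_C (c : ℤ) (ε : Half) (γ : CH) :
    shift c ε (scalarSeries m n (PowerSeries.C γ)) = scalarSeries m n (PowerSeries.C γ) := by
  rw [scalarSeries_C, shift_C]

theorem shift_scalarSeries_X (c : ℤ) (ε : Half) :
    shift c ε (scalarSeries m n PowerSeries.X) = scalarSeries m n (shiftVar c ε) := by
  rw [scalarSeries_X, shift_X]

theorem shift_shiftVar (c d : ℤ) (ε : Half) :
    shift c ε (scalarSeries m n (shiftVar d ε)) = scalarSeries m n (shiftVar (c + d) ε) := by
  have hsub : ∀ f g : Series m n, shift c ε (f - g) = shift c ε f - shift c ε g := fun f g =>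
    (shiftHom m n c ε).map_sub f g
  have hss : ∀ p q : PowerSeries CH, scalarSeries m n (p - q) =
    scalarSeries m n p - scalarSeries m n q := fun p q => (scalarSeries m n).map_sub p q
  have hsm : ∀ p q : PowerSeries CH, scalarSeries m n (p * q) =
    scalarSeries m n p * scalarSeries m n q := fun p q => (scalarSeries m n).map_mul p q
  cases ε
  · have h1 := congrArg (fun f => shift c Half.minus (scalarSeries m n f))
      (shiftVar_minus_mul d)
    have h5 : shift c Half.minus (1 : Series m n) = 1 := shift_C c Half.minus 1
    simp only [hsm, hss, (scalarSeries m n).map_one, shift_mul, hsub, shift_scalarSeries_C,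
      shift_scalarSeries_X, h5] at h1
    set Z := shift c Half.minus (scalarSeries m n (shiftVar d Half.minus)) with hZ
    -- The new variable is `X / (1 - c h X)`. Substituting it into `X / (1 - d h X)` gives `X / (1 -
    -- (c + d) h X)`, as is seen after clearing the invertible denominators.
    have h4 : Z * scalarSeries m n (1 - PowerSeries.C (((c + d : ℤ) : CH) * h) * PowerSeries.X) =
        scalarSeries m n PowerSeries.X := by
      conv_rhs => rw [← shiftVar_minus_mul c]
      rw [hsm, ← h1, mul_assoc]
      congr 1
      rw [← (scalarSeries m n).map_one, ← hsm, ← hss, ← hsm]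
      congr 1
      rw [sub_mul, one_mul, mul_assoc, shiftVar_minus_mul, Int.cast_add, add_mul, map_add]
      ring
    have hu : IsUnit (1 - PowerSeries.C (((c + d : ℤ) : CH) * h) * PowerSeries.X :
        PowerSeries CH) := by
      rw [PowerSeries.isUnit_iff_constantCoeff]
      simp
    refine (hu.map (scalarSeries m n)).mul_right_cancel ?_
    rw [h4, ← hsm, shiftVar_minus_mul]
  · rw [shiftVar, hss, hsub, shift_scalarSeries_X, shift_scalarSeries_C, ← hss, shiftVar, shiftVar]
    congr 1
    rw [Int.cast_add, add_mul, map_add]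
    ring

theorem shift_shift (c d : ℤ) (ε : Half) (f : Series m n) :
    shift c ε (shift d ε f) = shift (c + d) ε f := by
  refine sub_eq_zero.1 (eq_zero_of_monomial (fun f => shift c ε (shift d ε f) -
      shift (c + d) ε f) (fun g g' => ?_) (fun N k => ?_) (fun j y => ?_) f)
  · simp only [shift_add]
    abel
  · exact ⟨N + k + k, fun g hg => (small_shift c ε (small_shift d ε hg)).sub
      (small_shift _ ε (hg.mono (by omega)))⟩
  · refine sub_eq_zero.2 ?_
    rw [shift_monomial, shift_monomial, shift_mul, shift_C, map_pow, map_pow, ← shift_shiftVar,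
      ← shiftHom_apply, map_pow]
    rfl

/-- All coefficients of the two series commute. -/
def CoeffCommute (f : Series m n) (x : DY m n) : Prop := ∀ a, Commute (PowerSeries.coeff a f) x

theorem coeffCommute_iff {f : Series m n} {x : DY m n} :
    CoeffCommute f x ↔ Commute f (PowerSeries.C x) := by
  constructor
  · intro H
    refine PowerSeries.ext fun a => ?_
    rw [PowerSeries.coeff_mul_C, PowerSeries.coeff_C_mul, (H a).eq]
  · intro H a
    have := congrArg (PowerSeries.coeff a) H.eq
    rwa [PowerSeries.coeff_mul_C, PowerSeries.coeff_C_mul] at this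

theorem CoeffCommute.shift {f : Series m n} {x : DY m n} (H : CoeffCommute f x) (c : ℤ) (ε : Half) :
    CoeffCommute (shift c ε f) x := by
  rw [coeffCommute_iff] at H ⊢
  rw [← shift_C c ε x, ← shiftHom_apply, ← shiftHom_apply]
  exact H.map (shiftHom m n c ε)

end Shift
end DoubleYangian

namespace DoubleYangian

/-! ### Cancellation of `u - v` and `u - v ± h` -/

section Regular

variable {R : Type} [Ring R]

/-- Left multiplication by the element is injective. -/
def LeftRegular (q : R) : Prop := ∀ x, q * x = 0 → x = 0

theorem leftRegular_of_coeff_zero {f : PowerSeries R}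
    (hf : LeftRegular (PowerSeries.coeff 0 f)) : LeftRegular f := by
  intro x hx
  have key : ∀ N, ∀ a < N, PowerSeries.coeff a x = 0 := by
    intro N
    induction N with
    | zero => intro a ha; omega
    | succ N ih =>
      intro a ha
      rcases Nat.lt_succ_iff_lt_or_eq.1 ha with h1 | rfl
      · exact ih a h1
      · have h2 := congrArg (PowerSeries.coeff a) hx
        rw [PowerSeries.coeff_mul, map_zero, Finset.sum_eq_single (0, a)] at h2
        · exact hf _ h2
        · intro y hy hne
          rw [ih, mul_zero]
          have h3 := Finset.HasAntidiagonal.mem_antidiagonal.1 hy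
          rcases Nat.eq_zero_or_pos y.1 with h4 | h4
          · exact absurd (Prod.ext h4 (by change y.2 = a; omega)) hne
          · omega
        · intro hc
          exact absurd (Finset.HasAntidiagonal.mem_antidiagonal.2 (zero_add a)) hc
  refine PowerSeries.ext fun a => ?_
  rw [key (a + 1) a a.lt_succ_self, map_zero]

theorem leftRegular_X : LeftRegular (PowerSeries.X : PowerSeries R) := by
  intro x hx
  refine PowerSeries.ext fun a => ?_
  rw [← PowerSeries.coeff_succ_X_mul, hx, map_zero, map_zero]

theorem leftRegular_one : LeftRegular (1 : R) := fun x hx => by rwa [one_mul] at hx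

theorem LeftRegular.neg {q : R} (hq : LeftRegular q) : LeftRegular (-q) := fun x hx =>
  hq x (by rwa [neg_mul, neg_eq_zero] at hx)

theorem TorsionFree.leftRegular [Algebra CH R] (hR : TorsionFree R) :
    LeftRegular (algebraMap CH R h) := fun x hx => hR x (by rwa [Algebra.smul_def])

theorem coeff_zero_algebraMap [Algebra CH R] (c : CH) :
    PowerSeries.coeff 0 (algebraMap CH (PowerSeries R) c) = algebraMap CH R c := by
  rw [Algebra.algebraMap_eq_smul_one, PowerSeries.coeff_smul, PowerSeries.coeff_zero_one,
    Algebra.algebraMap_eq_smul_one]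

/-- Regularity can be tested on constant terms. In the outer variable this leaves the inner
variable, `1`, or minus the inner variable plus `c`; in the last case the constant term is `±h`
unless `c = 0`. -/
theorem leftRegular_rtt [Algebra CH R] (hR : TorsionFree R) {c : CH}
    (hc : c = 0 ∨ c = h ∨ c = -h) (ε₁ ε₂ : Half) :
    LeftRegular (rttNum R ε₁ ε₂ + algebraMap CH _ c * rttDen R ε₁ ε₂) := by
  have hX : LeftRegular (PowerSeries.X : PowerSeries R) := leftRegular_X
  have hplus : LeftRegular (-PowerSeries.X + algebraMap CH (PowerSeries R) c) := by
    rcases hc with rfl | hc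
    · rw [map_zero, add_zero]
      exact hX.neg
    · refine leftRegular_of_coeff_zero ?_
      rw [map_add, map_neg, PowerSeries.coeff_zero_X, neg_zero, zero_add, coeff_zero_algebraMap]
      rcases hc with rfl | rfl
      · exact hR.leftRegular
      · rw [map_neg]
        exact hR.leftRegular.neg
  refine leftRegular_of_coeff_zero ?_
  cases ε₁ <;> cases ε₂ <;>
    simp only [rttNum, rttDen, map_add, map_sub, inInner, PowerSeries.coeff_zero_X,
      PowerSeries.coeff_zero_C, PowerSeries.coeff_zero_one, PowerSeries.coeff_zero_X_mul, sub_zero,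
      ← mul_assoc, mul_one, zero_sub, coeff_zero_algebraMap, PowerSeries.coeff_zero_mul_X,
      PowerSeries.coeff_mul_C, zero_mul, add_zero]
  · exact hX
  · exact leftRegular_one
  · exact hplus
  · exact hplus

end Regular

/-! ### Commuting entries of `T` and `T⁻¹` -/

section Cross

variable {R : Type} [Ring R] [Algebra CH R] {J K : Type} [Fintype J] [DecidableEq J] [Fintype K] [DecidableEq K]

/-- `X(u)` and `Y(v)` satisfy an `RTT` relation. -/
def Cross (par : J → ℕ) (X Y : Matrix J J (PowerSeries R)) : Prop :=
  ∃ p q : PowerSeries (PowerSeries R), (∀ x, Commute p x) ∧ (∀ x, Commute q x) ∧ LeftRegular q ∧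
    LeftRegular (q + p) ∧ LeftRegular (q - p) ∧
    (IsRTT par p q (X.map (inOuter R)) (Y.map (inInner R)) ∨
      IsRTT par p q (X.map (inInner R)) (Y.map (inOuter R)))

theorem Cross.submatrix {par : J → ℕ} {X Y : Matrix J J (PowerSeries R)} (H : Cross par X Y)
    (e : K → J) : Cross (par ∘ e) (X.submatrix e e) (Y.submatrix e e) := by
  obtain ⟨p, q, hp, hq, h1, h2, h3, H⟩ := H
  exact ⟨p, q, hp, hq, h1, h2, h3, H.imp (fun H => H.submatrix e) (fun H => H.submatrix e)⟩

theorem coeff_commute_of_outer_inner {f g : PowerSeries R}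
    (H : Commute (inOuter R f) (inInner R g)) (a b : ℕ) :
    Commute (PowerSeries.coeff a f) (PowerSeries.coeff b g) := by
  have := congrArg (coeff₂ a b) H.eq
  rwa [coeff₂_outer_mul_inner, coeff₂_inner_mul_outer] at this

theorem map_mul_eq_one {B B' : Type} [Ring B] [Ring B'] (f : B →+* B') {X Z : Matrix J J B}
    (hZ : X * Z = 1) : X.map f * Z.map f = 1 := by
  have := congrArg f.mapMatrix hZ
  rwa [map_mul, map_one] at this

theorem Cross.coeff_commute {par : J → ℕ} {X Y Z : Matrix J J (PowerSeries R)} (H : Cross par X Y)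
    (h1 : Y * Z = 1) (h2 : Z * Y = 1) {i j k l : J} (hkj : k ≠ j) (hil : i ≠ l)
    (hij : par i = par j) (a b : ℕ) :
    Commute (PowerSeries.coeff a (X i j)) (PowerSeries.coeff b (Z k l)) := by
  obtain ⟨p, q, hp, hq, hreg, -, -, H | H⟩ := H
  · exact coeff_commute_of_outer_inner (H.commute_inv hp hq hreg (map_mul_eq_one _ h1)
      (map_mul_eq_one _ h2) hkj hil hij) a b
  · exact (coeff_commute_of_outer_inner (H.commute_inv hp hq hreg (map_mul_eq_one _ h1)
      (map_mul_eq_one _ h2) hkj hil hij).symm b a).symm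

/-- With all four indices equal the relation reads `(q - p) [x, y] = 0`. -/
theorem Cross.coeff_commute_self {X Y : Matrix J J (PowerSeries R)} (H : Cross (fun _ => 0) X Y)
    (i : J) (a b : ℕ) :
    Commute (PowerSeries.coeff a (X i i)) (PowerSeries.coeff b (Y i i)) := by
  obtain ⟨p, q, hp, hq, hreg, h1, h2, H⟩ := H
  have key : ∀ X Y : Matrix J J (PowerSeries (PowerSeries R)), IsRTT (fun _ => 0) p q X Y →
      Commute (X i i) (Y i i) := by
    intro X Y H
    have := isRTT_iff.1 H i i i i
    simp only [mul_zero, pow_zero, one_mul] at this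
    refine sub_eq_zero.1 (h2 _ ?_)
    rw [sub_mul, this, sub_self]
  rcases H with H | H
  · have := key (X.map (inOuter R)) (Y.map (inInner R)) H
    exact coeff_commute_of_outer_inner this a b
  · have := key (X.map (inInner R)) (Y.map (inOuter R)) H
    exact (coeff_commute_of_outer_inner this.symm b a).symm

end Cross

section Family

variable {m n : ℕ} {R : Type} [Ring R] [Algebra CH R]

/-- The parameter of the `RTT` relation. -/
noncomputable def rttPar (R : Type) [Ring R] [Algebra CH R] (ε₁ ε₂ : Half) :
    PowerSeries (PowerSeries R) :=
  algebraMap CH _ h * rttDen R ε₁ ε₂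

theorem commute_rttPar (ε₁ ε₂ : Half) (x : PowerSeries (PowerSeries R)) :
    Commute (rttPar R ε₁ ε₂) x :=
  Commute.mul_left (Algebra.commutes h x) (commute_rttDen ε₁ ε₂ x)

theorem leftRegular_rttNum (hR : TorsionFree R) (ε₁ ε₂ : Half) :
    LeftRegular (rttNum R ε₁ ε₂) := by
  have := leftRegular_rtt hR (c := 0) (Or.inl rfl) ε₁ ε₂
  rwa [map_zero, zero_mul, add_zero] at this

theorem leftRegular_rttNum_add (hR : TorsionFree R) (ε₁ ε₂ : Half) :
    LeftRegular (rttNum R ε₁ ε₂ + rttPar R ε₁ ε₂) :=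
  leftRegular_rtt hR (c := h) (Or.inr (Or.inl rfl)) ε₁ ε₂

theorem leftRegular_rttNum_sub (hR : TorsionFree R) (ε₁ ε₂ : Half) :
    LeftRegular (rttNum R ε₁ ε₂ - rttPar R ε₁ ε₂) := by
  have := leftRegular_rtt hR (c := -h) (Or.inr (Or.inr rfl)) ε₁ ε₂
  rwa [map_neg, neg_mul, ← sub_eq_add_neg] at this

/-- The `RTT` relation between series in `u` and in `v`. -/
def SeriesRTT {J : Type} [Fintype J] [DecidableEq J] (par : J → ℕ) (ε₁ ε₂ : Half)
    (X Y : Matrix J J (PowerSeries R)) : Prop :=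
  IsRTT par (rttPar R ε₁ ε₂) (rttNum R ε₁ ε₂) (X.map (inOuter R)) (Y.map (inInner R))

section Matrices

variable {J K : Type} [Fintype J] [DecidableEq J] [Fintype K] [DecidableEq K]
  {par : J → ℕ} {ε₁ ε₂ : Half} {X Y : Matrix J J (PowerSeries R)}

theorem SeriesRTT.isAltRTT (hR : TorsionFree R) (H : SeriesRTT par ε₁ ε₂ X Y) :
    IsAltRTT par (rttPar R ε₁ ε₂) (rttNum R ε₁ ε₂) (X.map (inOuter R)) (Y.map (inInner R)) :=
  IsAltRTT.of_isRTT (commute_rttPar _ _) (commute_rttNum _ _) (leftRegular_rttNum_sub hR _ _)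
    (leftRegular_rttNum_add hR _ _) H

theorem SeriesRTT.cross (hR : TorsionFree R) (H : SeriesRTT par ε₁ ε₂ X Y) : Cross par X Y :=
  ⟨rttPar R ε₁ ε₂, rttNum R ε₁ ε₂, commute_rttPar _ _, commute_rttNum _ _,
    leftRegular_rttNum hR _ _, leftRegular_rttNum_add hR _ _, leftRegular_rttNum_sub hR _ _,
    Or.inl H⟩

/-- The other form of the relation allows the factors to be exchanged, which makes the order `+, -`
available. -/
theorem SeriesRTT.cross_symm (hR : TorsionFree R) (H : SeriesRTT par ε₁ ε₂ X Y) :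
    Cross par Y X := by
  refine ⟨rttPar R ε₁ ε₂, -rttNum R ε₁ ε₂, commute_rttPar _ _,
    fun x => (commute_rttNum _ _ x).neg_left, (leftRegular_rttNum hR _ _).neg, ?_, ?_,
    Or.inr (H.isAltRTT hR).swap⟩
  · have := (leftRegular_rttNum_sub hR ε₁ ε₂).neg
    rwa [neg_sub, sub_eq_neg_add] at this
  · have := (leftRegular_rttNum_add hR ε₁ ε₂).neg
    rwa [neg_add, ← sub_eq_add_neg] at this

theorem SeriesRTT.submatrix (H : SeriesRTT par ε₁ ε₂ X Y) (e : K → J) :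
    SeriesRTT (par ∘ e) ε₁ ε₂ (X.submatrix e e) (Y.submatrix e e) := IsRTT.submatrix H e

/-- The `RTT` relations for the inverse matrices, restricted to odd indices. -/
theorem SeriesRTT.inv_odd (hR : TorsionFree R) (H : SeriesRTT par ε₁ ε₂ X Y)
    {X' Y' : Matrix J J (PowerSeries R)} (hX1 : X * X' = 1) (hX2 : X' * X = 1) (hY1 : Y * Y' = 1)
    (hY2 : Y' * Y = 1) {e : K → J} (he : ∀ k, par (e k) = 1) :
    SeriesRTT (fun _ => 0) ε₁ ε₂ (X'.submatrix e e) (Y'.submatrix e e) := by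
  have h1 := (H.isAltRTT hR).inv_inv (commute_rttPar _ _) (commute_rttNum _ _)
    (map_mul_eq_one _ hX1) (map_mul_eq_one _ hX2) (map_mul_eq_one _ hY1) (map_mul_eq_one _ hY2)
  have h2 := h1.submatrix e
  rw [show par ∘ e = fun _ => 1 from funext he] at h2
  have h3 := h2.of_odd
  rw [neg_neg] at h3
  exact h3

end Matrices

theorem IsRTTFamily.seriesRTT {t : Idx m n → Idx m n → Deg → R} (ht : IsRTTFamily t)
    {ε₁ ε₂ : Half} (hε : ¬ (ε₁ = Half.plus ∧ ε₂ = Half.minus)) :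
    SeriesRTT par ε₁ ε₂ (seriesMatrix t ε₁) (seriesMatrix t ε₂) :=
  isRTTFamily_iff.1 ht ε₁ ε₂ hε

/-- A relation that holds for `SeriesRTT` in either order. -/
theorem half_cases {p : Half → Half → Prop}
    (hp : ∀ ε₁ ε₂, ¬ (ε₁ = Half.plus ∧ ε₂ = Half.minus) → p ε₁ ε₂ ∧ p ε₂ ε₁) (ε₁ ε₂ : Half) :
    p ε₁ ε₂ := by
  cases ε₁ <;> cases ε₂
  · exact (hp _ _ (by simp)).1
  · exact (hp _ _ (by simp)).1
  · exact (hp Half.minus Half.plus (by simp)).2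
  · exact (hp _ _ (by simp)).1

theorem IsRTTFamily.cross {t : Idx m n → Idx m n → Deg → R} (ht : IsRTTFamily t)
    (hR : TorsionFree R) (ε₁ ε₂ : Half) :
    Cross par (seriesMatrix t ε₁) (seriesMatrix t ε₂) :=
  half_cases (p := fun ε₁ ε₂ => Cross par (seriesMatrix t ε₁) (seriesMatrix t ε₂))
    (fun _ _ hε => ⟨(ht.seriesRTT hε).cross hR, (ht.seriesRTT hε).cross_symm hR⟩) ε₁ ε₂

theorem IsRTTFamily.cross_inv {t : Idx m n → Idx m n → Deg → R} (ht : IsRTTFamily t)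
    (hR : TorsionFree R) {T' : Half → Matrix (Idx m n) (Idx m n) (PowerSeries R)}
    (h1 : ∀ ε, seriesMatrix t ε * T' ε = 1) (h2 : ∀ ε, T' ε * seriesMatrix t ε = 1)
    {K : Type} [Fintype K] [DecidableEq K] {e : K → Idx m n} (he : ∀ k, par (e k) = 1)
    (ε₁ ε₂ : Half) :
    Cross (fun _ => 0) ((T' ε₁).submatrix e e) ((T' ε₂).submatrix e e) :=
  half_cases (p := fun ε₁ ε₂ => Cross (fun _ => 0) ((T' ε₁).submatrix e e)
    ((T' ε₂).submatrix e e)) (fun ε₁ ε₂ hε => by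
      have := (ht.seriesRTT hε).inv_odd hR (h1 ε₁) (h2 ε₁) (h1 ε₂) (h2 ε₂) he
      exact ⟨this.cross hR, this.cross_symm hR⟩) ε₁ ε₂

/-- The matrix of the series `±∑ tᵢⱼ⁽ʳ⁾ u⁻ʳ`. -/
noncomputable def tauMatrix (t : Idx m n → Idx m n → Deg → R) (ε : Half) :
    Matrix (Idx m n) (Idx m n) (PowerSeries R) :=
  Matrix.of fun i j => PowerSeries.mk fun c => tauCoeff t ε i j (ε.exponent c)

theorem coeff_tauMatrix (t : Idx m n → Idx m n → Deg → R) (ε : Half) (i j : Idx m n) (c : ℕ) :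
    PowerSeries.coeff c (tauMatrix t ε i j) = tauCoeff t ε i j (ε.exponent c) := by
  rw [tauMatrix, Matrix.of_apply, PowerSeries.coeff_mk]

/-- The matrix `T` is congruent to `1` modulo `h`. -/
theorem seriesMatrix_eq (t : Idx m n → Idx m n → Deg → R) (ε : Half) :
    seriesMatrix t ε = 1 + h • tauMatrix t ε := by
  refine Matrix.ext fun i j => PowerSeries.ext fun c => ?_
  rw [coeff_seriesMatrix, tCoeff_eq, Matrix.add_apply, map_add]
  congr 1
  · have : ε.exponent c = 0 ↔ c = 0 := by cases ε <;> simp [Half.exponent]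
    simp only [delta, this, Matrix.one_apply]
    by_cases hij : i = j <;> by_cases hc : c = 0 <;> simp [hij, hc, PowerSeries.coeff_one]
  · rw [Matrix.smul_apply, PowerSeries.coeff_smul, coeff_tauMatrix]

/-- The commutation relations with the zero modes. -/
theorem IsRTTFamily.zero_mode {t : Idx m n → Idx m n → Deg → R} (ht : IsRTTFamily t)
    (hR : TorsionFree R) {i j : Idx m n} (hij : i ≠ j) (ε : Half) (k l : Idx m n) (b : ℤ) :
    (-1) ^ ((par i + par j) * par k) * (t i j ⟨1, one_ne_zero⟩ * tCoeff t ε k l b) -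
      (-1) ^ ((par i + par j) * par l) * (tCoeff t ε k l b * t i j ⟨1, one_ne_zero⟩) =
    (-1) ^ (par i * par j) * ((if k = j then tCoeff t ε i l b else 0) -
      (if i = l then tCoeff t ε k j b else 0)) := by
  -- At `a = 0` the coefficients of `T⁻` are `h t^{(1)}` and Kronecker deltas. Since `i ≠ j` removes
  -- one delta, the relation can be divided by `h`.
  have h1 := ht Half.minus ε (fun hc => Half.noConfusion hc.1) 0 b i j k l
  have h2 : ∀ k l : Idx m n, tCoeff t Half.minus k l 0 = if k = l then 1 else 0 := fun k l => by
    simp [tCoeff]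
  have h3 : tCoeff t Half.minus i j (0 - 1) = h • t i j ⟨1, one_ne_zero⟩ := by
    simp [tCoeff]
  rw [rttEntry, h3, h2, h2, h2, if_neg hij, zero_mul, mul_zero, sub_zero, sub_zero, smul_mul_assoc,
    mul_smul_comm, mul_smul_comm, mul_smul_comm, ← smul_sub, ← smul_sub] at h1
  refine sub_eq_zero.1 ?_
  convert hR _ h1 using 2
  split_ifs <;> simp

end Family
end DoubleYangian

namespace DoubleYangian
open MulOpposite

/-! ### The `RTT` relation at `v = u - h` -/

section Specialisation

variable {R : Type} [Ring R] [Algebra CH R]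

/-- The series in one variable obtained by setting the two variables equal. -/
noncomputable def diagonal (F : PowerSeries (PowerSeries R)) : PowerSeries R :=
  PowerSeries.mk fun a => ∑ x ∈ Finset.HasAntidiagonal.antidiagonal a, coeff₂ x.1 x.2 F

theorem coeff_diagonal (F : PowerSeries (PowerSeries R)) (a : ℕ) :
    PowerSeries.coeff a (diagonal F) =
      ∑ x ∈ Finset.HasAntidiagonal.antidiagonal a, coeff₂ x.1 x.2 F := PowerSeries.coeff_mk _ _

theorem diagonal_sub (F G : PowerSeries (PowerSeries R)) :
    diagonal (F - G) = diagonal F - diagonal G := by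
  refine PowerSeries.ext fun a => ?_
  simp only [coeff_diagonal, map_sub, Finset.sum_sub_distrib]

theorem diagonal_X_mul (F : PowerSeries (PowerSeries R)) :
    diagonal (PowerSeries.X * F) = PowerSeries.X * diagonal F := by
  refine PowerSeries.ext fun a => ?_
  rcases a with _ | a
  · rw [coeff_diagonal, PowerSeries.coeff_zero_X_mul, Finset.Nat.antidiagonal_zero,
      Finset.sum_singleton, coeff₂_apply, PowerSeries.coeff_zero_X_mul, map_zero]
  · rw [PowerSeries.coeff_succ_X_mul, coeff_diagonal, coeff_diagonal,
      Finset.Nat.sum_antidiagonal_succ, coeff₂_apply, PowerSeries.coeff_zero_X_mul, map_zero,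
      zero_add]
    exact Finset.sum_congr rfl fun x _ => by
      rw [coeff₂_apply, PowerSeries.coeff_succ_X_mul, coeff₂_apply]

theorem diagonal_inInner_X_mul (F : PowerSeries (PowerSeries R)) :
    diagonal (inInner R PowerSeries.X * F) = PowerSeries.X * diagonal F := by
  have h0 : ∀ a, coeff₂ a 0 (inInner R PowerSeries.X * F) = 0 := fun a => by
    rw [coeff₂_apply, inInner, PowerSeries.coeff_C_mul, PowerSeries.coeff_zero_X_mul]
  refine PowerSeries.ext fun a => ?_
  rcases a with _ | a
  · rw [coeff_diagonal, PowerSeries.coeff_zero_X_mul, Finset.Nat.antidiagonal_zero,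
      Finset.sum_singleton, h0]
  · rw [PowerSeries.coeff_succ_X_mul, coeff_diagonal, coeff_diagonal,
      Finset.Nat.sum_antidiagonal_succ', h0, zero_add]
    exact Finset.sum_congr rfl fun x _ => by
      rw [coeff₂_apply, inInner, PowerSeries.coeff_C_mul, PowerSeries.coeff_succ_X_mul,
        coeff₂_apply]

theorem diagonal_outer_mul_inner (f : PowerSeries R) (g : PowerSeries R) :
    diagonal (inOuter R f * inInner R g) = f * g := by
  refine PowerSeries.ext fun a => ?_
  rw [coeff_diagonal, PowerSeries.coeff_mul]
  exact Finset.sum_congr rfl fun x _ => by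
    rw [coeff₂_apply, inOuter, inInner, PowerSeries.coeff_mul_C, PowerSeries.coeff_map,
      PowerSeries.coeff_C_mul]

theorem diagonal_inner_mul_outer (f : PowerSeries R) (g : PowerSeries R) :
    diagonal (inInner R g * inOuter R f) = g * f := by
  refine PowerSeries.ext fun a => ?_
  rw [coeff_diagonal, PowerSeries.coeff_mul, ← Finset.Nat.sum_antidiagonal_swap]
  exact Finset.sum_congr rfl fun x _ => by
    rw [Prod.fst_swap, Prod.snd_swap, coeff₂_apply, inOuter, inInner, PowerSeries.coeff_C_mul,
      PowerSeries.coeff_map, PowerSeries.coeff_mul_C]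

theorem diagonal_smul (c : CH) (F : PowerSeries (PowerSeries R)) :
    diagonal (algebraMap CH _ c * F) = c • diagonal F := by
  refine PowerSeries.ext fun a => ?_
  rw [PowerSeries.coeff_smul, coeff_diagonal, coeff_diagonal, Finset.smul_sum]
  exact Finset.sum_congr rfl fun x _ => coeff₂_smul F x.1 x.2 c

theorem algebraMap_eq_inInner (c : CH) :
    algebraMap CH (PowerSeries (PowerSeries R)) c = inInner R (algebraMap CH _ c) :=
  PowerSeries.algebraMap_apply

/-- The substitution `u ↦ u - h`. -/
structure IsUnitShift (ε : Half) (σ : PowerSeries R →+* PowerSeries R) : Prop where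
  map_C : ∀ x, σ (PowerSeries.C x) = PowerSeries.C x
  minus : ε = Half.minus → σ PowerSeries.X - h • (PowerSeries.X * σ PowerSeries.X) = PowerSeries.X
  plus : ε = Half.plus → σ PowerSeries.X = PowerSeries.X - h • 1

theorem map_inOuter {σ : PowerSeries R →+* PowerSeries R}
    (hσ : ∀ x, σ (PowerSeries.C x) = PowerSeries.C x) (f : PowerSeries R) :
    PowerSeries.map σ (inOuter R f) = inOuter R f := by
  refine PowerSeries.ext fun a => ?_
  rw [PowerSeries.coeff_map, inOuter, PowerSeries.coeff_map, hσ]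

theorem map_inInner (σ : PowerSeries R →+* PowerSeries R) (f : PowerSeries R) :
    PowerSeries.map σ (inInner R f) = inInner R (σ f) := PowerSeries.map_C _ _

/-- At `v = u - h` the factors `u - v` and `h` coincide and cancel by torsion freeness. The
substitution acts on the inner variable, and then the two variables are set equal. -/
theorem diagonal_map_rttNum (hR : TorsionFree R) {ε : Half} {σ : PowerSeries R →+* PowerSeries R}
    (hσ : IsUnitShift ε σ) (hh : ∀ c : CH, σ (algebraMap CH _ c) = algebraMap CH _ c)
    {K L : PowerSeries (PowerSeries R)}
    (H : rttNum R ε ε * K = rttPar R ε ε * L) :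
    diagonal (PowerSeries.map σ K) = diagonal (PowerSeries.map σ L) := by
  have hR' := hR.powerSeries
  have hC : ∀ c : CH, PowerSeries.map σ (algebraMap CH _ c) = algebraMap CH _ c := fun c => by
    have : algebraMap CH (PowerSeries (PowerSeries R)) c =
      PowerSeries.C (algebraMap CH (PowerSeries R) c) := PowerSeries.algebraMap_apply
    rw [this, PowerSeries.map_C, hh]
  have h1 := congrArg (PowerSeries.map σ) H
  set K' := PowerSeries.map σ K with hK
  set L' := PowerSeries.map σ L with hL
  cases ε
  · have hX := hσ.minus rfl
    have hX' : ∀ F : PowerSeries (PowerSeries R),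
        diagonal (inInner R (σ PowerSeries.X) * F) - h • (PowerSeries.X *
          diagonal (inInner R (σ PowerSeries.X) * F)) = PowerSeries.X * diagonal F := by
      intro F
      have h2 := congrArg (fun f => diagonal (inInner R f * F)) hX
      beta_reduce at h2
      rw [diagonal_inInner_X_mul, (inInner R).map_sub, sub_mul, diagonal_sub, Algebra.smul_def,
        (inInner R).map_mul, (inInner R).map_mul, mul_assoc, mul_assoc,
        ← algebraMap_eq_inInner, diagonal_smul,
        diagonal_inInner_X_mul] at h2
      exact h2
    rw [rttPar, rttNum, rttDen, map_mul, map_mul, map_mul, map_mul, map_sub, map_inInner,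
      PowerSeries.map_X, hC, ← hK, ← hL, sub_mul] at h1
    have h2 := congrArg diagonal h1
    rw [diagonal_sub, mul_assoc, diagonal_smul, mul_assoc, diagonal_X_mul, diagonal_X_mul] at h2
    have hK2 := hX' K'
    have hL2 := hX' L'
    generalize diagonal (inInner R (σ PowerSeries.X) * K') = A at *
    generalize diagonal (inInner R (σ PowerSeries.X) * L') = B at *
    generalize diagonal K' = a at *
    generalize diagonal L' = b at *
    -- Here `A - X a = h X B`. Applying `1 - h X`, which turns `A` into `X a` and `B` into `X b`,
    -- gives `h X² a = h X² b`.
    have h3 : h • (PowerSeries.X * (PowerSeries.X * (a - b))) = 0 := by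
      have e1 : A = PowerSeries.X * a + h • (PowerSeries.X * B) := by rw [← h2]; abel
      have e2 : PowerSeries.X * a + h • (PowerSeries.X * B) -
          h • (PowerSeries.X * (PowerSeries.X * a + h • (PowerSeries.X * B))) =
            PowerSeries.X * a := by rw [← e1, hK2]
      have e3 : h • (PowerSeries.X * (B - h • (PowerSeries.X * B))) -
          h • (PowerSeries.X * (PowerSeries.X * a)) = 0 := by
        refine Eq.trans ?_ (sub_eq_zero.2 e2)
        simp only [mul_sub, mul_add, smul_sub, smul_add, mul_smul_comm]
        abel
      rw [hL2] at e3
      rw [← neg_eq_zero, ← e3]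
      simp only [mul_sub, smul_sub]
      abel
    exact sub_eq_zero.1 (leftRegular_X _ (leftRegular_X _ (hR' _ h3)))
  · rw [rttPar, rttNum, rttDen, map_mul, map_mul, map_mul, map_sub, map_inInner,
      PowerSeries.map_X, hC, map_one, mul_one, ← hK, ← hL, sub_mul, hσ.plus rfl] at h1
    have h2 := congrArg diagonal h1
    rw [diagonal_sub, diagonal_X_mul, (inInner R).map_sub, sub_mul, diagonal_sub,
      diagonal_inInner_X_mul, sub_sub_cancel, Algebra.smul_def, mul_one,
      ← algebraMap_eq_inInner, diagonal_smul,
      diagonal_smul] at h2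
    exact sub_eq_zero.1 (hR' _ (by rw [smul_sub, h2, sub_self]))

variable {J : Type} [Fintype J] [DecidableEq J]

theorem SeriesRTT.unit_shift (hR : TorsionFree R) {ε : Half} {X : Matrix J J (PowerSeries R)}
    (H : SeriesRTT (fun _ => 0) ε ε X X) {σ : PowerSeries R →+* PowerSeries R}
    (hσ : IsUnitShift ε σ) (hh : ∀ c : CH, σ (algebraMap CH _ c) = algebraMap CH _ c)
    (i j k l : J) :
    X i j * σ (X k l) - σ (X k l) * X i j = X k j * σ (X i l) - σ (X k j) * X i l := by
  have h1 := isRTT_iff.1 H i j k l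
  simp only [mul_zero, pow_zero, one_mul, Matrix.map_apply] at h1
  have h2 := diagonal_map_rttNum hR hσ hh h1
  simpa only [map_sub, map_mul, map_inInner, map_inOuter hσ.map_C, diagonal_sub,
    diagonal_outer_mul_inner, diagonal_inner_mul_outer] using h2

end Specialisation

section ColAlt

variable {S K : Type} [Ring S]

/-- Add the relation to the one with `j` and `l` exchanged; the terms with the factors in reverse
order cancel. -/
theorem colAlt_of_relation {X Y : Matrix K K S}
    (H : ∀ i j k l, X i j * Y k l - Y k l * X i j = X k j * Y i l - Y k j * X i l) :
    ColAlt X Y := by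
  intro i j k l
  have h1 := H i j k l
  have h2 := H i l k j
  have h3 := congrArg₂ (· + ·) h1 h2
  beta_reduce at h3
  rw [← sub_eq_zero] at h3 ⊢
  rw [← h3]
  abel

theorem colAlt_op_of_relation {X Y : Matrix K K S}
    (H : ∀ i j k l, X i j * Y k l - Y k l * X i j = X k j * Y i l - Y k j * X i l) :
    ColAlt (Matrix.of fun p q => op (X q p)) (Matrix.of fun p q => op (Y q p)) := by
  intro i j k l
  simp only [Matrix.of_apply, ← op_mul, ← op_add]
  refine congrArg op ?_
  have h1 := H j i l k
  have h2 := H l i j k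
  have h3 := congrArg₂ (· + ·) h1 h2
  beta_reduce at h3
  rw [← sub_eq_zero] at h3 ⊢
  rw [← neg_eq_zero, ← h3]
  abel

end ColAlt

section Block

variable {m n : ℕ}

theorem isUnitShift_shiftHom (ε : Half) : IsUnitShift ε (shiftHom m n 1 ε) where
  map_C := shift_C 1 ε
  minus := by
    rintro rfl
    have h1 := congrArg (scalarSeries m n) (shiftVar_minus_mul 1)
    rw [(scalarSeries m n).map_mul, (scalarSeries m n).map_sub, (scalarSeries m n).map_one,
      (scalarSeries m n).map_mul, scalarSeries_X, Int.cast_one, one_mul, scalarSeries_C, mul_sub,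
      mul_one, (commute_scalarSeries _ _).eq, mul_assoc] at h1
    rw [shiftHom_apply, shift_X, Algebra.smul_def, PowerSeries.algebraMap_apply]
    exact h1
  plus := by
    rintro rfl
    rw [shiftHom_apply, shift_X, shiftVar, (scalarSeries m n).map_sub, scalarSeries_X, Int.cast_one,
      one_mul, scalarSeries_C, Algebra.smul_def, mul_one, PowerSeries.algebraMap_apply]

theorem shiftHom_algebraMap (c : ℤ) (ε : Half) (x : CH) :
    shiftHom m n c ε (algebraMap CH (Series m n) x) = algebraMap CH (Series m n) x := by
  rw [PowerSeries.algebraMap_apply]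
  exact shift_C c ε _

/-- The family of the shifts of a matrix. -/
noncomputable def shiftFamily {k : ℕ} (c : ℤ) (ε : Half) (X : Matrix (Fin k) (Fin k) (Series m n)) :
    Fin k → Matrix (Fin k) (Fin k) (Series m n) :=
  fun a => X.map (shiftHom m n (c + (a : ℕ)) ε)

theorem shiftFamily_relation {k : ℕ} {ε : Half} {X : Matrix (Fin k) (Fin k) (Series m n)}
    (H : SeriesRTT (fun _ => 0) ε ε X X) (c : ℤ) {a b : Fin k} (hab : (a : ℕ) + 1 = b)
    (i j p l : Fin k) :
    shiftFamily c ε X a i j * shiftFamily c ε X b p l -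
      shiftFamily c ε X b p l * shiftFamily c ε X a i j =
    shiftFamily c ε X a p j * shiftFamily c ε X b i l -
      shiftFamily c ε X b p j * shiftFamily c ε X a i l := by
  have h1 := congrArg (shiftHom m n (c + (a : ℕ)) ε) (H.unit_shift torsionFree_DY
    (isUnitShift_shiftHom ε) (shiftHom_algebraMap 1 ε) i j p l)
  have h2 : ∀ f : Series m n, shiftHom m n (c + (a : ℕ)) ε (shiftHom m n 1 ε f) =
      shiftHom m n (c + (b : ℕ)) ε f := fun f => by
    rw [shiftHom_apply, shiftHom_apply, shiftHom_apply, shift_shift, ← hab, Nat.cast_add,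
      Nat.cast_one, add_assoc]
  rw [(shiftHom m n (c + (a : ℕ)) ε).map_sub, (shiftHom m n (c + (a : ℕ)) ε).map_sub,
    (shiftHom m n (c + (a : ℕ)) ε).map_mul, (shiftHom m n (c + (a : ℕ)) ε).map_mul,
    (shiftHom m n (c + (a : ℕ)) ε).map_mul, (shiftHom m n (c + (a : ℕ)) ε).map_mul, h2, h2, h2] at h1
  exact h1

theorem colAltFamily_shiftFamily {k : ℕ} {ε : Half} {X : Matrix (Fin k) (Fin k) (Series m n)}
    (H : SeriesRTT (fun _ => 0) ε ε X X) (c : ℤ) : ColAltFamily (shiftFamily c ε X) :=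
  fun _ _ hab => colAlt_of_relation (shiftFamily_relation H c hab)

theorem colAltFamily_op_shiftFamily {k : ℕ} {ε : Half} {X : Matrix (Fin k) (Fin k) (Series m n)}
    (H : SeriesRTT (fun _ => 0) ε ε X X) (c : ℤ) : ColAltFamily (opFamily (shiftFamily c ε X)) :=
  fun _ _ hab => colAlt_op_of_relation (shiftFamily_relation H c hab)

end Block
end DoubleYangian

namespace DoubleYangian
open MulOpposite

section Invertibility

variable {R J : Type} [Ring R] [Algebra CH R] [Fintype J] [DecidableEq J]

/-- Matrices congruent to `1` modulo `h` are invertible, with inverse congruent to `1`. -/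
theorem HComplete.exists_inverse (hR : HComplete R) (N : Matrix J J R) :
    ∃ Z N' : Matrix J J R, (1 + h • N) * Z = 1 ∧ Z * (1 + h • N) = 1 ∧ Z = 1 + h • N' := by
  obtain ⟨u, hu⟩ := hR.matrix.isUnit N
  refine ⟨(u⁻¹ : (Matrix J J R)ˣ), -(N * ((u⁻¹ : (Matrix J J R)ˣ) : Matrix J J R)), ?_, ?_, ?_⟩
  · rw [← hu, u.mul_inv]
  · rw [← hu, u.inv_mul]
  · have := u.mul_inv
    rw [hu, add_mul, one_mul, smul_mul_assoc] at this
    rw [smul_neg, ← sub_eq_add_neg, ← this, add_sub_cancel_right]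

theorem commute_of_coeff_commute {f g : PowerSeries R}
    (H : ∀ a b, Commute (PowerSeries.coeff a f) (PowerSeries.coeff b g)) : Commute f g := by
  refine PowerSeries.ext fun a => ?_
  rw [PowerSeries.coeff_mul, PowerSeries.coeff_mul, ← Finset.Nat.sum_antidiagonal_swap]
  exact Finset.sum_congr rfl fun x _ => (H _ _).eq

end Invertibility

section Commutation

variable {S : Type} [Ring S]

theorem commute_qdet_of_entries {k : ℕ} {M : Fin k → Matrix (Fin k) (Fin k) S} {x : S}
    (H : ∀ a p q, Commute x (M a p q)) (f g : Fin k → Fin k) : Commute x (qdet M f g) := by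
  refine Commute.sum_right _ _ _ fun τ _ => Commute.smul_right ?_ _
  refine Commute.list_prod_right _ _ fun y hy => ?_
  obtain ⟨a, rfl⟩ := List.mem_ofFn.1 hy
  exact H _ _ _

theorem commute_rdet_of_entries {k : ℕ} {M : Fin k → Matrix (Fin k) (Fin k) S} {x : S}
    (H : ∀ a p q, Commute x (M a p q)) : Commute x (rdet M) :=
  (commute_qdet_of_entries (M := opFamily M) (x := op x) (fun a p q => (H a q p).op) id id).unop

end Commutation

/-! ### Peeling quantum determinants -/

section Block

variable {m n : ℕ}

theorem twoFree_series : TwoFree (Series m n) := fun x hx =>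
  (Submodule.mem_bot CH).1 (mem_of_nsmul_mem (S := ⊥) two_ne_zero (by
    rw [two_nsmul, hx]; exact zero_mem _))

/-- The matrices to which the theory of quantum determinants applies. -/
def IsBlock {k : ℕ} (ε : Half) (X : Matrix (Fin k) (Fin k) (Series m n)) : Prop :=
  SeriesRTT (fun _ => 0) ε ε X X ∧ ∃ N, X = 1 + h • N

theorem IsBlock.corner {k : ℕ} {ε : Half} {X : Matrix (Fin (k + 1)) (Fin (k + 1)) (Series m n)}
    (hX : IsBlock ε X) : IsBlock ε (X.submatrix Fin.castSucc Fin.castSucc) := by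
  obtain ⟨h1, N, rfl⟩ := hX
  refine ⟨h1.submatrix Fin.castSucc, N.submatrix Fin.castSucc Fin.castSucc, ?_⟩
  refine Matrix.ext fun i j => ?_
  simp only [Matrix.submatrix_apply, Matrix.add_apply, Matrix.smul_apply, Matrix.one_apply,
    Fin.castSucc_inj]

theorem hComplete_series : HComplete (Series m n) := hComplete_hCompletion.powerSeries

theorem shiftHom_smul (c : ℤ) (ε : Half) (x : CH) (f : Series m n) :
    shiftHom m n c ε (x • f) = x • shiftHom m n c ε f := by
  rw [Algebra.smul_def, (shiftHom m n c ε).map_mul, shiftHom_algebraMap, Algebra.smul_def]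

/-- The peeling formulas for quantum determinants. -/
theorem IsBlock.peel {k : ℕ} {ε : Half} {X : Matrix (Fin (k + 1)) (Fin (k + 1)) (Series m n)}
    (hX : IsBlock ε X) (c : ℤ) :
    ∃ Z : Matrix (Fin (k + 1)) (Fin (k + 1)) (Series m n), X * Z = 1 ∧ Z * X = 1 ∧
      IsUnit (shiftHom m n (c + k) ε (Z (Fin.last k) (Fin.last k))) ∧
      qdet (shiftFamily c ε X) id id * shiftHom m n (c + k) ε (Z (Fin.last k) (Fin.last k)) =
        qdet (shiftFamily c ε (X.submatrix Fin.castSucc Fin.castSucc)) id id ∧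
      shiftHom m n (c + k) ε (Z (Fin.last k) (Fin.last k)) * rdet (shiftFamily c ε X) =
        rdet (shiftFamily c ε (X.submatrix Fin.castSucc Fin.castSucc)) := by
  obtain ⟨h1, N, hN⟩ := hX
  obtain ⟨Z, N', hZ1, hZ2, hZ⟩ := hComplete_series.exists_inverse N
  rw [← hN] at hZ1 hZ2
  have hl : ((Fin.last k : Fin (k + 1)) : ℕ) = k := rfl
  refine ⟨Z, hZ1, hZ2, ?_, ?_, ?_⟩
  · rw [hZ, Matrix.add_apply, Matrix.one_apply_eq, Matrix.smul_apply, (shiftHom m n _ ε).map_add,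
      (shiftHom m n _ ε).map_one, shiftHom_smul]
    exact hComplete_series.isUnit _
  · exact qdet_mul_inv twoFree_series (colAltFamily_shiftFamily h1 c)
      (Z := Z.map (shiftHom m n (c + k) ε)) (map_mul_eq_one (shiftHom m n (c + k) ε) hZ1)
  · exact inv_mul_rdet twoFree_series (colAltFamily_op_shiftFamily h1 c)
      (Z := Z.map (shiftHom m n (c + k) ε)) (map_mul_eq_one (shiftHom m n (c + k) ε) hZ2)

theorem commute_shiftHom {f g : Series m n} {c : ℤ} {ε : Half}
    (H : ∀ b, Commute f (PowerSeries.C (PowerSeries.coeff b g))) :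
    Commute f (shiftHom m n c ε g) := by
  refine commute_of_coeff_commute fun a b => ?_
  have h1 : CoeffCommute g (PowerSeries.coeff a f) := fun b =>
    (coeffCommute_iff.2 (H b) a).symm
  exact (h1.shift c ε b).symm

theorem commute_C_shiftHom {x : DY m n} {g : Series m n} {c : ℤ} {ε : Half}
    (H : ∀ b, Commute x (PowerSeries.coeff b g)) :
    Commute (PowerSeries.C x) (shiftHom m n c ε g) :=
  (coeffCommute_iff.1 (CoeffCommute.shift (fun b => (H b).symm) c ε)).symm

/-- With `z` the shifted last diagonal entry of the inverse, `qdet * z` and `z * rdet` are the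
corner determinants, equal by induction. The corner entries commute with `z`, hence so does `qdet`
after cancelling a unit, and then `z` itself cancels. -/
theorem IsBlock.qdet_eq_rdet {k : ℕ} {ε : Half} {X : Matrix (Fin k) (Fin k) (Series m n)}
    (hX : IsBlock ε X) (c : ℤ) :
    qdet (shiftFamily c ε X) id id = rdet (shiftFamily c ε X) := by
  induction k with
  | zero => rw [rdet_eq_sum]; simp [qdet]
  | succ k ih =>
    obtain ⟨Z, hZ1, hZ2, hu, h1, h2⟩ := hX.peel c
    have h3 := ih hX.corner
    rw [← h1, ← h2] at h3
    have hcross := hX.1.cross torsionFree_DY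
    have hne : ∀ i : Fin k, Fin.last k ≠ i.castSucc := fun i => (Fin.castSucc_lt_last i).ne'
    have h4 : Commute (qdet (shiftFamily c ε (X.submatrix Fin.castSucc Fin.castSucc)) id id)
        (shiftHom m n (c + k) ε (Z (Fin.last k) (Fin.last k))) := by
      refine commute_shiftHom fun b => (commute_qdet_of_entries (fun a p q => ?_) id id).symm
      exact commute_C_shiftHom fun d =>
        (hcross.coeff_commute hZ1 hZ2 (hne q) (hne p).symm rfl d b).symm
    rw [← h1] at h4
    have h5 := h4.eq
    rw [← mul_assoc] at h5
    have h6 := hu.mul_right_cancel h5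
    rw [h6] at h3
    exact hu.mul_left_cancel h3

/-- The series `Y 0 0` commutes with the last diagonal entry of the inverse, since their positions
are disjoint, and with the corner determinant by induction. The case of size one is
`Cross.coeff_commute_self`. -/
theorem IsBlock.commute_qdet {k : ℕ} {ε : Half}
    {X Y : Matrix (Fin (k + 1)) (Fin (k + 1)) (Series m n)} (hX : IsBlock ε X)
    (hY : Cross (fun _ => 0) Y X) (c : ℤ) (a : ℕ) :
    Commute (PowerSeries.C (PowerSeries.coeff a (Y 0 0))) (qdet (shiftFamily c ε X) id id) := by
  induction k with
  | zero =>
    refine commute_qdet_of_entries (fun _ p q => ?_) id id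
    have hz : ∀ i : Fin (0 + 1), i = 0 := fun i => Fin.ext (by omega)
    rw [hz p, hz q]
    exact commute_C_shiftHom fun b => hY.coeff_commute_self 0 a b
  | succ k ih =>
    obtain ⟨Z, hZ1, hZ2, hu, h1, -⟩ := hX.peel c
    have h3 := ih hX.corner (hY.submatrix Fin.castSucc)
    rw [← h1] at h3
    have hne : Fin.last (k + 1) ≠ 0 := Fin.last_pos.ne'
    have h4 : Commute (PowerSeries.C (PowerSeries.coeff a (Y 0 0)))
        (shiftHom m n (c + (k + 1 : ℕ)) ε (Z (Fin.last (k + 1)) (Fin.last (k + 1)))) :=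
      commute_C_shiftHom fun b => hY.coeff_commute hZ1 hZ2 hne hne.symm rfl a b
    have h5 := h3.eq
    change PowerSeries.C (PowerSeries.coeff a (Y 0 0)) * _ =
      _ * PowerSeries.C (PowerSeries.coeff a (Y 0 0)) at h5
    rw [mul_assoc, ← h4.eq, ← mul_assoc, ← mul_assoc] at h5
    exact hu.mul_right_cancel h5

end Block
end DoubleYangian

namespace DoubleYangian

/-! ### Zero modes -/

section ZeroModes

variable {m n : ℕ} {S : Type} [Ring S]

/-- The commutation relations of a zero mode `E` with the entries of a matrix. -/
def IsZeroMode (i j : Idx m n) (E : S) (V : Idx m n → Idx m n → S) : Prop := ∀ k l,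
  (-1) ^ ((par i + par j) * par k) * (E * V k l) - (-1) ^ ((par i + par j) * par l) * (V k l * E) =
    (-1) ^ (par i * par j) * ((if k = j then V i l else 0) - (if i = l then V k j else 0))

theorem neg_one_pow_mul_cancel {k : ℕ} {x y : S} (hxy : (-1) ^ k * x = (-1) ^ k * y) : x = y := by
  rw [← one_mul x, ← one_mul y, ← neg_one_pow_mul_self k, mul_assoc, hxy, mul_assoc]

theorem IsZeroMode.commute {i j : Idx m n} {E : S} {V : Idx m n → Idx m n → S}
    (H : IsZeroMode i j E V) {k l : Idx m n} (hk : k ≠ j) (hl : i ≠ l) (hkl : par k = par l) :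
    Commute E (V k l) := by
  have := H k l
  rw [if_neg hk, if_neg hl, sub_zero, mul_zero, hkl, sub_eq_zero] at this
  exact neg_one_pow_mul_cancel this

/-- The matrix whose commutation with `T` expresses `IsZeroMode`. -/
noncomputable def zeroModeMatrix (i j : Idx m n) (E : S) : Matrix (Idx m n) (Idx m n) S :=
  Matrix.diagonal (fun k => (-1) ^ ((par i + par j) * par k) * E) -
    Matrix.single j i ((-1) ^ (par i * par j))

/-- Written as commutation with a fixed matrix, the relations pass immediately to the inverse
matrix. -/
theorem isZeroMode_iff {i j : Idx m n} {E : S} {T : Matrix (Idx m n) (Idx m n) S} :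
    IsZeroMode i j E T ↔ Commute (zeroModeMatrix i j E) T := by
  have e1 : ∀ k l, (zeroModeMatrix i j E * T) k l =
      (-1) ^ ((par i + par j) * par k) * (E * T k l) -
        (-1) ^ (par i * par j) * (if k = j then T i l else 0) := by
    intro k l
    rw [zeroModeMatrix, sub_mul, Matrix.sub_apply, Matrix.diagonal_mul, mul_assoc]
    congr 1
    by_cases hk : k = j
    · rw [if_pos hk, hk, Matrix.single_mul_apply_same]
    · rw [if_neg hk, Matrix.single_mul_apply_of_ne _ _ _ _ _ hk, mul_zero]
  have e2 : ∀ k l, (T * zeroModeMatrix i j E) k l =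
      (-1) ^ ((par i + par j) * par l) * (T k l * E) -
        (-1) ^ (par i * par j) * (if i = l then T k j else 0) := by
    intro k l
    rw [zeroModeMatrix, mul_sub, Matrix.sub_apply, Matrix.mul_diagonal, ← mul_assoc, mul_neg_one_pow, mul_assoc]
    congr 1
    by_cases hl : i = l
    · rw [if_pos hl, ← hl, Matrix.mul_single_apply_same, mul_neg_one_pow]
    · rw [if_neg hl, Matrix.mul_single_apply_of_ne _ _ _ _ _ (fun hc => hl hc.symm), mul_zero]
  constructor
  · intro H
    refine Matrix.ext fun k l => ?_
    rw [e1, e2, sub_eq_sub_iff_sub_eq_sub, H k l, mul_sub]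
  · intro H k l
    have := congrFun (congrFun H.eq k) l
    rw [e1, e2, sub_eq_sub_iff_sub_eq_sub] at this
    rw [this, mul_sub]

theorem commute_of_inverse {A : Type} [Ring A] {w t z : A} (H : Commute w t) (h1 : t * z = 1)
    (h2 : z * t = 1) : Commute w z := by
  change w * z = z * w
  calc w * z = z * (t * w) * z := by rw [← mul_assoc, h2, one_mul]
    _ = z * w := by rw [← H.eq, mul_assoc, mul_assoc, h1, mul_one]

theorem IsZeroMode.inv {i j : Idx m n} {E : S} {T Z : Matrix (Idx m n) (Idx m n) S}
    (H : IsZeroMode i j E T) (h1 : T * Z = 1) (h2 : Z * T = 1) : IsZeroMode i j E Z :=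
  isZeroMode_iff.2 (commute_of_inverse (isZeroMode_iff.1 H) h1 h2)

theorem IsZeroMode.commute_rhs {i j : Idx m n} {E b : S} {V : Idx m n → Idx m n → S}
    (H : IsZeroMode i j E V) (hE : Commute b E) {k l : Idx m n} (hV : Commute b (V k l)) :
    Commute b ((if k = j then V i l else 0) - (if i = l then V k j else 0)) := by
  have hs : ∀ k, Commute b ((-1) ^ k) := fun k => (Commute.neg_one_right b).pow_right k
  have h1 : Commute b ((-1) ^ (par i * par j) *
      ((if k = j then V i l else 0) - (if i = l then V k j else 0))) := by
    rw [← H k l]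
    exact ((hs _).mul_right (hE.mul_right hV)).sub_right ((hs _).mul_right (hV.mul_right hE))
  have h2 := (hs (par i * par j)).mul_right h1
  rwa [← mul_assoc, neg_one_pow_mul_self, one_mul] at h2

theorem IsZeroMode.commute_left {i j l : Idx m n} {E b : S} {V : Idx m n → Idx m n → S}
    (H : IsZeroMode i j E V) (hE : Commute b E) (hil : i ≠ l) (hV : Commute b (V j l)) :
    Commute b (V i l) := by
  have := H.commute_rhs hE hV
  rwa [if_pos rfl, if_neg hil, sub_zero] at this

theorem IsZeroMode.commute_right {i j k : Idx m n} {E b : S} {V : Idx m n → Idx m n → S}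
    (H : IsZeroMode i j E V) (hE : Commute b E) (hkj : k ≠ j) (hV : Commute b (V k i)) :
    Commute b (V k j) := by
  have := H.commute_rhs hE hV
  rw [if_pos rfl, if_neg hkj, zero_sub] at this
  exact Commute.neg_right_iff.1 this

/-- An element that commutes with all zero modes and with one diagonal entry commutes with all
entries. -/
theorem commute_of_zeroModes {E V : Idx m n → Idx m n → S} {b : S}
    (H : ∀ i j, i ≠ j → IsZeroMode i j (E i j) V) (hE : ∀ i j, i ≠ j → Commute b (E i j))
    {o : Idx m n} (ho : Commute b (V o o)) (k l : Idx m n) : Commute b (V k l) := by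
  have h1 : ∀ i, i ≠ o → Commute b (V i o) := fun i hi =>
    (H i o hi).commute_left (hE i o hi) hi ho
  have h2 : ∀ j, j ≠ o → Commute b (V o j) := fun j hj =>
    (H o j hj.symm).commute_right (hE o j hj.symm) hj.symm ho
  by_cases hk : k = o
  · subst hk
    by_cases hl : l = k
    · rwa [hl]
    · exact h2 l hl
  by_cases hl : l = o
  · subst hl
    exact h1 k hk
  by_cases hkl : k = l
  · subst hkl
    -- The zero mode applied to the entry `(o, k)` produces `V k k - V o o`, and `V o o` is already
    -- known to commute with `b`.
    have := (H k o hk).commute_rhs (hE k o hk) (h2 k hk)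
    rw [if_pos rfl, if_pos rfl] at this
    simpa using this.add_right ho
  · exact (H k o hk).commute_left (hE k o hk) hkl (h2 l hl)

/-- The zero modes for the simple roots generate all zero modes. -/
theorem commute_zeroModes {E : Idx m n → Idx m n → S} {b : S}
    (H : ∀ i j, i ≠ j → IsZeroMode i j (E i j) E)
    (hev : ∀ i j, i ≠ j → Commute b (E (Sum.inl i) (Sum.inl j)))
    (hodd : ∀ i j, i ≠ j → Commute b (E (Sum.inr i) (Sum.inr j)))
    (hsim : 0 < m → 0 < n → ∃ p q, Commute b (E (Sum.inl p) (Sum.inr q)) ∧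
      Commute b (E (Sum.inr q) (Sum.inl p))) (i j : Idx m n) (hij : i ≠ j) :
    Commute b (E i j) := by
  have key : ∀ (p : Fin m) (q : Fin n),
      Commute b (E (Sum.inl p) (Sum.inr q)) ∧ Commute b (E (Sum.inr q) (Sum.inl p)) := by
    intro p q
    obtain ⟨p₀, q₀, h1, h2⟩ := hsim (Nat.zero_lt_of_lt p.2) (Nat.zero_lt_of_lt q.2)
    have h3 : ∀ p, Commute b (E (Sum.inl p) (Sum.inr q₀)) ∧
        Commute b (E (Sum.inr q₀) (Sum.inl p)) := by
      intro p
      by_cases hp : p = p₀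
      · rw [hp]; exact ⟨h1, h2⟩
      · have hp' : (Sum.inl p : Idx m n) ≠ Sum.inl p₀ := fun hc => hp (Sum.inl.inj hc)
        exact ⟨(H _ _ hp').commute_left (hev _ _ hp) (by simp) h1,
          (H _ _ hp'.symm).commute_right (hev _ _ (fun hc => hp hc.symm)) (by simp) h2⟩
    by_cases hq : q = q₀
    · rw [hq]; exact h3 p
    · have hq' : (Sum.inr q : Idx m n) ≠ Sum.inr q₀ := fun hc => hq (Sum.inr.inj hc)
      exact ⟨(H _ _ hq'.symm).commute_right (hodd _ _ (fun hc => hq hc.symm)) (by simp) (h3 p).1,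
        (H _ _ hq').commute_left (hodd _ _ hq) (by simp) (h3 p).2⟩
  rcases i with i | i <;> rcases j with j | j
  · exact hev i j fun hc => hij (by rw [hc])
  · exact (key i j).1
  · exact (key j i).2
  · exact hodd i j fun hc => hij (by rw [hc])

variable {R : Type} [Ring R] [Algebra CH R] {t : Idx m n → Idx m n → Deg → R}

theorem IsRTTFamily.isZeroMode (ht : IsRTTFamily t) (hR : TorsionFree R) {i j : Idx m n}
    (hij : i ≠ j) (ε : Half) :
    IsZeroMode i j (PowerSeries.C (t i j ⟨1, one_ne_zero⟩)) (seriesMatrix t ε) := by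
  intro k l
  have hs : ∀ (s : ℕ) (f : PowerSeries R) (a : ℕ), PowerSeries.coeff a ((-1) ^ s * f) =
      (-1) ^ s * PowerSeries.coeff a f := fun s f a => by
    rcases Nat.even_or_odd s with hs | hs <;> simp [hs.neg_one_pow]
  have hi : ∀ (p : Prop) [Decidable p] (f : PowerSeries R) (a : ℕ),
      PowerSeries.coeff a (if p then f else 0) = if p then PowerSeries.coeff a f else 0 :=
    fun p _ f a => by split_ifs <;> simp
  refine PowerSeries.ext fun a => ?_
  rw [map_sub, hs, hs, hs, map_sub, hi, hi, PowerSeries.coeff_C_mul, PowerSeries.coeff_mul_C]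
  simp only [coeff_seriesMatrix]
  exact ht.zero_mode hR hij ε k l _

theorem IsRTTFamily.isZeroMode_self (ht : IsRTTFamily t) (hR : TorsionFree R) {i j : Idx m n}
    (hij : i ≠ j) :
    IsZeroMode i j (t i j ⟨1, one_ne_zero⟩) (fun k l => t k l ⟨1, one_ne_zero⟩) := by
  intro k l
  have h1 := ht.zero_mode hR hij Half.minus k l (-1)
  have h2 : ∀ k l : Idx m n, tCoeff t Half.minus k l (-1) = h • t k l ⟨1, one_ne_zero⟩ := by
    intro k l
    simp [tCoeff]
  have hi : ∀ (p : Prop) [Decidable p] (x : R), (if p then h • x else 0) =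
      h • (if p then x else 0) := fun p _ x => by split_ifs <;> simp
  simp only [h2, hi, mul_smul_comm, smul_mul_assoc, ← smul_sub] at h1
  exact hR.cancel h1

end ZeroModes
end DoubleYangian

namespace DoubleYangian

section MatrixInverse

variable {R J K : Type} [Ring R] [Algebra CH R] [Fintype J] [DecidableEq J] [Fintype K]
  [DecidableEq K]

/-- The two matrices of series are inverse to each other. -/
def MatInv (X Z : Matrix J J (PowerSeries R)) : Prop := X * Z = 1 ∧ Z * X = 1

theorem HComplete.exists_matInv (hR : HComplete R) (N : Matrix J J (PowerSeries R)) :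
    ∃ Z N' : Matrix J J (PowerSeries R), MatInv (1 + h • N) Z ∧ Z = 1 + h • N' := by
  obtain ⟨Z, N', h1, h2, h3⟩ := hR.powerSeries.exists_inverse N
  exact ⟨Z, N', ⟨h1, h2⟩, h3⟩

theorem MatInv.inverse_eq {X Z : Matrix J J (PowerSeries R)} (H : MatInv X Z) :
    Ring.inverse X = Z := Ring.inverse_unit (⟨X, Z, H.1, H.2⟩ : (Matrix _ _ _)ˣ)

theorem Cross.coeff_commute_matInv {par : J → ℕ} {X Y Z : Matrix J J (PowerSeries R)}
    (H : Cross par X Y) (hZ : MatInv Y Z) {i j k l : J} (hkj : k ≠ j) (hil : i ≠ l)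
    (hij : par i = par j) (a b : ℕ) :
    Commute (PowerSeries.coeff a (X i j)) (PowerSeries.coeff b (Z k l)) :=
  H.coeff_commute hZ.1 hZ.2 hkj hil hij a b

theorem SeriesRTT.matInv_odd (hR : TorsionFree R) {par : J → ℕ} {ε₁ ε₂ : Half}
    {X Y X' Y' : Matrix J J (PowerSeries R)} (H : SeriesRTT par ε₁ ε₂ X Y)
    (hX : MatInv X X') (hY : MatInv Y Y') {e : K → J} (he : ∀ k, par (e k) = 1) :
    SeriesRTT (fun _ => 0) ε₁ ε₂ (X'.submatrix e e) (Y'.submatrix e e) :=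
  H.inv_odd hR hX.1 hX.2 hY.1 hY.2 he

theorem C_neg (x : R) : (PowerSeries.C (-x) : PowerSeries R) = -PowerSeries.C x := map_neg _ x

theorem IsZeroMode.matInv {m n : ℕ} {i j : Idx m n} {E : PowerSeries R}
    {T Z : Matrix (Idx m n) (Idx m n) (PowerSeries R)} (H : IsZeroMode i j E T) (hZ : MatInv T Z) :
    IsZeroMode i j E Z := H.inv hZ.1 hZ.2

theorem commute_C_of_neg {x : R} {f : PowerSeries R} (H : Commute (PowerSeries.C (-x)) f) :
    Commute (PowerSeries.C x) f := by
  rw [C_neg] at H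
  exact Commute.neg_left_iff.1 H

theorem IsZeroMode.even_entry {m n : ℕ} {i j : Fin m} {x : R}
    {V : Matrix (Idx m n) (Idx m n) (PowerSeries R)}
    (H : IsZeroMode (Sum.inl i) (Sum.inl j) (PowerSeries.C x) V) (p q : Fin m) :
    PowerSeries.C x * V (Sum.inl p) (Sum.inl q) - V (Sum.inl p) (Sum.inl q) * PowerSeries.C x =
      (if p = j then V (Sum.inl i) (Sum.inl q) else 0) -
        (if q = i then V (Sum.inl p) (Sum.inl j) else 0) := by
  have := H (Sum.inl p) (Sum.inl q)
  simp only [par, mul_zero, pow_zero, one_mul, Sum.inl.injEq] at this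
  simp only [this, eq_comm (a := q)]

/-- For odd indices both supercommutator signs are `-1`. Replacing `x` by `-x` and reversing the
order of the indices gives the form expected by the determinant of the reversed odd block. -/
theorem IsZeroMode.odd_entry {m n : ℕ} {i j : Fin n} {x : R}
    {V : Matrix (Idx m n) (Idx m n) (PowerSeries R)}
    (H : IsZeroMode (Sum.inr i) (Sum.inr j) (PowerSeries.C x) V) (p q : Fin n) :
    PowerSeries.C (-x) * V (Sum.inr (Fin.rev p)) (Sum.inr (Fin.rev q)) -
      V (Sum.inr (Fin.rev p)) (Sum.inr (Fin.rev q)) * PowerSeries.C (-x) =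
      (if p = Fin.rev j then V (Sum.inr (Fin.rev (Fin.rev i))) (Sum.inr (Fin.rev q)) else 0) -
        (if q = Fin.rev i then V (Sum.inr (Fin.rev p)) (Sum.inr (Fin.rev (Fin.rev j))) else 0) := by
  have := H (Sum.inr (Fin.rev p)) (Sum.inr (Fin.rev q))
  simp only [par, mul_one, one_add_one_eq_two, neg_one_sq, one_mul, pow_one, Sum.inr.injEq,
    neg_mul] at this
  rw [C_neg, neg_mul, mul_neg, ← neg_sub', this, neg_neg, Fin.rev_rev, Fin.rev_rev]
  simp only [Fin.rev_eq_iff, eq_comm (a := i)]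

end MatrixInverse

/-! ### The Berezinian as a product of two block determinants -/

section Berezinian

variable {m n : ℕ}

/-- The map to the completion, as a homomorphism. -/
noncomputable def toCompletionHom (A : Type) [Ring A] [Algebra CH A] : A →ₐ[CH] hCompletion A where
  toFun := toCompletion A
  map_one' := rfl
  map_mul' _ _ := rfl
  map_zero' := rfl
  map_add' _ _ := rfl
  commutes' _ := rfl

theorem isRTTFamily_gen : IsRTTFamily (gen m n) := isRTTFamily_algHom (toCompletionHom (PreDY m n))

theorem tMatrix_eq (ε : Half) : tMatrix m n ε = seriesMatrix (gen m n) ε := by cases ε <;> rfl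

theorem exists_tInvMatrix_eq (ε : Half) : MatInv (tMatrix m n ε) (tInvMatrix m n ε) ∧
    ∃ N, tInvMatrix m n ε = 1 + h • N := by
  obtain ⟨Z, N', h1, h3⟩ := hComplete_hCompletion.exists_matInv (tauMatrix (gen m n) ε)
  rw [← seriesMatrix_eq, ← tMatrix_eq] at h1
  have hZ : tInvMatrix m n ε = Z := h1.inverse_eq
  rw [hZ]
  exact ⟨h1, N', h3⟩

theorem matInv_tMatrix (ε : Half) : MatInv (tMatrix m n ε) (tInvMatrix m n ε) :=
  (exists_tInvMatrix_eq ε).1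

/-- The block of `T` with even indices. -/
noncomputable def evenBlock (m n : ℕ) (ε : Half) : Matrix (Fin m) (Fin m) (Series m n) :=
  (tMatrix m n ε).submatrix Sum.inl Sum.inl

/-- The block of the inverse of `T` with odd indices, in the reversed order. -/
noncomputable def oddBlock (m n : ℕ) (ε : Half) : Matrix (Fin n) (Fin n) (Series m n) :=
  (tInvMatrix m n ε).submatrix (Sum.inr ∘ Fin.rev) (Sum.inr ∘ Fin.rev)

theorem submatrix_one_add {J K : Type} [DecidableEq J] [DecidableEq K] {e : K → J}
    (he : Function.Injective e) (N : Matrix J J (Series m n)) :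
    (1 + h • N).submatrix e e = 1 + h • N.submatrix e e := by
  refine Matrix.ext fun i j => ?_
  simp only [Matrix.submatrix_apply, Matrix.add_apply, Matrix.smul_apply, Matrix.one_apply,
    he.eq_iff]

theorem inr_rev_injective : Function.Injective (Sum.inr ∘ Fin.rev : Fin n → Idx m n) :=
  Sum.inr_injective.comp Fin.rev_injective

theorem tMatrix_seriesRTT (ε : Half) : SeriesRTT par ε ε (tMatrix m n ε) (tMatrix m n ε) := by
  rw [tMatrix_eq]
  exact isRTTFamily_gen.seriesRTT (by rintro ⟨h1, h2⟩; rw [h1] at h2; exact Half.noConfusion h2)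

theorem tMatrix_cross (ε₁ ε₂ : Half) : Cross par (tMatrix m n ε₁) (tMatrix m n ε₂) := by
  rw [tMatrix_eq, tMatrix_eq]
  exact isRTTFamily_gen.cross torsionFree_DY ε₁ ε₂

theorem isBlock_evenBlock (ε : Half) : IsBlock ε (evenBlock m n ε) := by
  refine ⟨(tMatrix_seriesRTT ε).submatrix Sum.inl, ?_⟩
  exact ⟨(tauMatrix (gen m n) ε).submatrix Sum.inl Sum.inl, by
    rw [evenBlock, tMatrix_eq, seriesMatrix_eq, submatrix_one_add Sum.inl_injective]⟩

theorem isBlock_oddBlock (ε : Half) : IsBlock ε (oddBlock m n ε) := by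
  obtain ⟨h1, N, hN⟩ := exists_tInvMatrix_eq (m := m) (n := n) ε
  refine ⟨(tMatrix_seriesRTT ε).matInv_odd torsionFree_DY h1 h1 fun _ => rfl, ?_⟩
  exact ⟨N.submatrix (Sum.inr ∘ Fin.rev) (Sum.inr ∘ Fin.rev), by
    rw [oddBlock, hN, submatrix_one_add inr_rev_injective]⟩

/-- The shifts of the second product decrease from `m - 1` to `m - n`; reversing the odd indices
makes them increase, which is the convention of `shiftFamily`, and a row determinant reads its
family backwards. -/
theorem berezinian_eq (ε : Half) : berezinian m n ε =
    qdet (shiftFamily 0 ε (evenBlock m n ε)) id id *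
      rdet (shiftFamily ((m : ℤ) - n) ε (oddBlock m n ε)) := by
  have h1 : ∀ a p q : Fin m, shift ((a : ℕ) : ℤ) ε (tMatrix m n ε (Sum.inl p) (Sum.inl q)) =
      shiftFamily 0 ε (evenBlock m n ε) a p q := fun a p q => by
    rw [shiftFamily, zero_add]
    rfl
  have h2 : ∀ a p q : Fin n, shift ((m : ℤ) - 1 - (a : ℕ)) ε
      (tInvMatrix m n ε (Sum.inr p) (Sum.inr q)) =
      shiftFamily ((m : ℤ) - n) ε (oddBlock m n ε) (Fin.rev a) (Fin.rev p) (Fin.rev q) :=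
    fun a p q => by
    have : (m : ℤ) - 1 - (a : ℕ) = (m : ℤ) - n + ((Fin.rev a : Fin n) : ℕ) := by
      rw [Fin.val_rev]
      have := a.2
      omega
    rw [this]
    simp only [shiftFamily, oddBlock, Matrix.map_apply, Matrix.submatrix_apply,
      Function.comp_apply, Fin.rev_rev]
    rfl
  rw [berezinian, rdet_eq_sum, qdet]
  simp only [h1, h2]
  rfl

/-- Entries of the two blocks commute. -/
theorem commute_even_odd (ε₁ ε₂ : Half) {i j : Fin m} {k l : Fin n} (a b : ℕ) :
    Commute (PowerSeries.coeff a (evenBlock m n ε₁ i j))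
      (PowerSeries.coeff b (oddBlock m n ε₂ k l)) := by
  have h1 : (Sum.inr (Fin.rev k) : Idx m n) ≠ Sum.inl j := Sum.inr_ne_inl
  have h2 : (Sum.inl i : Idx m n) ≠ Sum.inr (Fin.rev l) := Sum.inl_ne_inr
  have := (tMatrix_cross ε₁ ε₂).coeff_commute_matInv (matInv_tMatrix ε₂) h1 h2 rfl a b
  rw [evenBlock, oddBlock, Matrix.submatrix_apply, Matrix.submatrix_apply]
  exact this

theorem commute_shiftHom_shiftHom {f g : Series m n} {c d : ℤ} {ε : Half}
    (H : ∀ a b, Commute (PowerSeries.coeff a f) (PowerSeries.coeff b g)) :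
    Commute (shiftHom m n c ε f) (shiftHom m n d ε g) :=
  commute_shiftHom fun b => (commute_C_shiftHom fun a => (H a b).symm).symm

theorem commute_even_rdet_odd (ε : Half) (c d : ℤ) (a : Fin m) (p q : Fin m) :
    Commute (rdet (shiftFamily d ε (oddBlock m n ε))) (shiftFamily c ε (evenBlock m n ε) a p q) := by
  refine Commute.symm ?_
  refine commute_rdet_of_entries fun _ _ _ => ?_
  refine commute_shiftHom_shiftHom fun a b => ?_
  exact commute_even_odd ε ε a b

theorem commute_qdet_rdet (ε : Half) (c d : ℤ) :
    Commute (rdet (shiftFamily d ε (oddBlock m n ε)))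
      (qdet (shiftFamily c ε (evenBlock m n ε)) id id) := by
  refine commute_qdet_of_entries (fun a p q => ?_) id id
  exact commute_even_rdet_odd ε c d a p q

theorem zeroMode_tMatrix {i j : Idx m n} (hij : i ≠ j) (ε : Half) :
    IsZeroMode i j (PowerSeries.C (gen m n i j ⟨1, one_ne_zero⟩)) (tMatrix m n ε) := by
  rw [tMatrix_eq]
  exact isRTTFamily_gen.isZeroMode torsionFree_DY hij ε

theorem zeroMode_tInvMatrix {i j : Idx m n} (hij : i ≠ j) (ε : Half) :
    IsZeroMode i j (PowerSeries.C (gen m n i j ⟨1, one_ne_zero⟩)) (tInvMatrix m n ε) :=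
  (zeroMode_tMatrix hij ε).matInv (matInv_tMatrix ε)

theorem shiftHom_C (c : ℤ) (ε : Half) (x : DY m n) :
    shiftHom m n c ε (PowerSeries.C x) = PowerSeries.C x := shift_C c ε x

theorem shiftHom_comm_eq {x : DY m n} {f g : Series m n}
    (H : PowerSeries.C x * f - f * PowerSeries.C x = g) (c : ℤ) (ε : Half) :
    PowerSeries.C x * shiftHom m n c ε f - shiftHom m n c ε f * PowerSeries.C x =
      shiftHom m n c ε g := by
  rw [← H, (shiftHom m n c ε).map_sub, (shiftHom m n c ε).map_mul, (shiftHom m n c ε).map_mul,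
    shiftHom_C]

theorem shiftHom_commute {x : DY m n} {f : Series m n} (H : Commute (PowerSeries.C x) f) (c : ℤ)
    (ε : Half) : Commute (PowerSeries.C x) (shiftHom m n c ε f) := by
  have := H.map (shiftHom m n c ε)
  rwa [shiftHom_C] at this

theorem IsBlock.commute_qdet_zeroMode {k : ℕ} {ε : Half} {X : Matrix (Fin k) (Fin k) (Series m n)}
    (hX : IsBlock ε X) {i j : Fin k} (hij : i ≠ j) {x : DY m n}
    (hx : ∀ p q, PowerSeries.C x * X p q - X p q * PowerSeries.C x =
      (if p = j then X i q else 0) - (if q = i then X p j else 0)) (c : ℤ) :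
    Commute (PowerSeries.C x) (qdet (shiftFamily c ε X) id id) := by
  refine DoubleYangian.commute_qdet twoFree_series (colAltFamily_shiftFamily hX.1 c) hij
    fun a p q => ?_
  have := shiftHom_comm_eq (hx p q) (c + (a : ℕ)) ε
  rw [(shiftHom m n _ ε).map_sub] at this
  rw [apply_ite (shiftHom m n _ ε), apply_ite (shiftHom m n _ ε), (shiftHom m n _ ε).map_zero]
    at this
  exact this

theorem commute_berezinian_even {i j : Fin m} (hij : i ≠ j) (ε : Half) :
    Commute (PowerSeries.C (gen m n (Sum.inl i) (Sum.inl j) ⟨1, one_ne_zero⟩))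
      (berezinian m n ε) := by
  have hne : (Sum.inl i : Idx m n) ≠ Sum.inl j := fun hc => hij (Sum.inl.inj hc)
  rw [berezinian_eq]
  refine Commute.mul_right ?_ ?_
  · refine (isBlock_evenBlock ε).commute_qdet_zeroMode hij (fun p q => ?_) 0
    exact (zeroMode_tMatrix hne ε).even_entry p q
  · refine commute_rdet_of_entries fun a p q => ?_
    refine shiftHom_commute ?_ _ _
    exact (zeroMode_tInvMatrix hne ε).commute (by simp) (by simp) rfl

theorem commute_berezinian_odd {i j : Fin n} (hij : i ≠ j) (ε : Half) :
    Commute (PowerSeries.C (gen m n (Sum.inr i) (Sum.inr j) ⟨1, one_ne_zero⟩))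
      (berezinian m n ε) := by
  have hne : (Sum.inr i : Idx m n) ≠ Sum.inr j := fun hc => hij (Sum.inr.inj hc)
  rw [berezinian_eq]
  refine Commute.mul_right ?_ ?_
  · refine commute_qdet_of_entries (fun a p q => ?_) id id
    refine shiftHom_commute ?_ _ _
    exact (zeroMode_tMatrix hne ε).commute (by simp) (by simp) rfl
  · rw [← (isBlock_oddBlock ε).qdet_eq_rdet]
    have hij' : Fin.rev i ≠ Fin.rev j := fun hc => hij (Fin.rev_injective hc)
    have key : Commute (PowerSeries.C (-gen m n (Sum.inr i) (Sum.inr j) ⟨1, one_ne_zero⟩))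
        (qdet (shiftFamily ((m : ℤ) - n) ε (oddBlock m n ε)) id id) := by
      refine (isBlock_oddBlock ε).commute_qdet_zeroMode hij' (fun p q => ?_) _
      exact (zeroMode_tInvMatrix hne ε).odd_entry p q
    exact commute_C_of_neg key

end Berezinian
end DoubleYangian

namespace DoubleYangian

/-! ### The Berezinian and the odd simple roots -/

section Simple

variable {m n : ℕ}

section Entries

variable {R : Type} [Ring R] {x : R} {i : Fin m} {j : Fin n}
  {V : Matrix (Idx m n) (Idx m n) (PowerSeries R)}

theorem IsZeroMode.evenOdd_even
    (H : IsZeroMode (Sum.inl i) (Sum.inr j) (PowerSeries.C x) V) (p : Fin m) :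
    PowerSeries.C x * V (Sum.inl p) (Sum.inl i) - V (Sum.inl p) (Sum.inl i) * PowerSeries.C x =
      -V (Sum.inl p) (Sum.inr j) := by
  have := H (Sum.inl p) (Sum.inl i)
  simpa [par] using this

theorem IsZeroMode.evenOdd_odd
    (H : IsZeroMode (Sum.inl i) (Sum.inr j) (PowerSeries.C x) V) (q : Fin n) :
    PowerSeries.C x * V (Sum.inr j) (Sum.inr q) - V (Sum.inr j) (Sum.inr q) * PowerSeries.C x =
      -V (Sum.inl i) (Sum.inr q) := by
  have := H (Sum.inr j) (Sum.inr q)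
  simp only [par, mul_one, zero_add, pow_one, zero_mul, pow_zero, one_mul, neg_mul, if_true,
    reduceCtorEq, if_false, sub_zero, neg_sub_neg] at this
  rw [← neg_sub, this]

theorem IsZeroMode.oddEven_even
    (H : IsZeroMode (Sum.inr j) (Sum.inl i) (PowerSeries.C x) V) (q : Fin m) :
    PowerSeries.C x * V (Sum.inl i) (Sum.inl q) - V (Sum.inl i) (Sum.inl q) * PowerSeries.C x =
      V (Sum.inr j) (Sum.inl q) := by
  have := H (Sum.inl i) (Sum.inl q)
  simpa [par] using this

theorem IsZeroMode.oddEven_odd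
    (H : IsZeroMode (Sum.inr j) (Sum.inl i) (PowerSeries.C x) V) (p : Fin n) :
    PowerSeries.C x * V (Sum.inr p) (Sum.inr j) - V (Sum.inr p) (Sum.inr j) * PowerSeries.C x =
      V (Sum.inr p) (Sum.inl i) := by
  have := H (Sum.inr p) (Sum.inr j)
  simp only [par, mul_one, add_zero, pow_one, mul_zero, pow_zero, one_mul, neg_mul, if_true,
    reduceCtorEq, if_false, zero_sub, neg_sub_neg] at this
  rw [← neg_sub, this, neg_neg]

theorem MatInv.sum_even_odd [Algebra CH R] {T Z : Matrix (Idx m n) (Idx m n) (PowerSeries R)}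
    (H : MatInv T Z) (i : Fin m) (j : Fin n) (f : PowerSeries R →+* PowerSeries R) :
    ∑ a : Fin m, f (T (Sum.inl i) (Sum.inl a)) * f (-Z (Sum.inl a) (Sum.inr j)) +
      ∑ b : Fin n, f (-T (Sum.inl i) (Sum.inr (Fin.rev b))) * f (Z (Sum.inr (Fin.rev b)) (Sum.inr j))
        = 0 := by
  have h1 := congrArg (fun X => f (X (Sum.inl i) (Sum.inr j))) H.1
  simp only [Matrix.mul_apply, Fintype.sum_sum_type, map_add, map_sum, map_mul,
    Matrix.one_apply_ne (Sum.inl_ne_inr : (Sum.inl i : Idx m n) ≠ Sum.inr j), map_zero] at h1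
  rw [← Equiv.sum_comp Fin.revPerm (fun b => f (T (Sum.inl i) (Sum.inr b)) * f (Z (Sum.inr b) (Sum.inr j)))]
    at h1
  simp only [map_neg, mul_neg, neg_mul, Finset.sum_neg_distrib, ← neg_add]
  rw [neg_eq_zero]
  exact h1

theorem MatInv.sum_odd_even [Algebra CH R] {T Z : Matrix (Idx m n) (Idx m n) (PowerSeries R)}
    (H : MatInv T Z) (i : Fin n) (j : Fin m) (f : PowerSeries R →+* PowerSeries R) :
    ∑ a : Fin n, f (Z (Sum.inr i) (Sum.inr (Fin.rev a))) * f (T (Sum.inr (Fin.rev a)) (Sum.inl j)) +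
      ∑ b : Fin m, f (Z (Sum.inr i) (Sum.inl b)) * f (T (Sum.inl b) (Sum.inl j)) = 0 := by
  have h1 := congrArg (fun X => f (X (Sum.inr i) (Sum.inl j))) H.2
  simp only [Matrix.mul_apply, Fintype.sum_sum_type, map_add, map_sum, map_mul,
    Matrix.one_apply_ne (Sum.inr_ne_inl : (Sum.inr i : Idx m n) ≠ Sum.inl j), map_zero] at h1
  rw [← Equiv.sum_comp Fin.revPerm (fun b => f (Z (Sum.inr i) (Sum.inr b)) * f (T (Sum.inr b) (Sum.inl j))),
    add_comm] at h1
  exact h1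

end Entries

theorem shiftFamily_evenBlock (c d : ℤ) (ε : Half) (a p q : Fin m) (hd : c + (a : ℕ) = d) :
    shiftFamily c ε (evenBlock m n ε) a p q =
      shiftHom m n d ε (tMatrix m n ε (Sum.inl p) (Sum.inl q)) := by
  rw [← hd]; rfl

theorem shiftFamily_oddBlock (c d : ℤ) (ε : Half) (a p q : Fin n) (hd : c + (a : ℕ) = d) :
    shiftFamily c ε (oddBlock m n ε) a p q =
      shiftHom m n d ε (tInvMatrix m n ε (Sum.inr (Fin.rev p)) (Sum.inr (Fin.rev q))) := by
  rw [← hd]; rfl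

/-- The zero mode acts only on the last column of the even block and on the last row of the reversed
odd block. With `m + 1` even indices both carry the shift `m`, so the required identity is the
vanishing of an off-diagonal entry of `T T⁻¹`. -/
theorem commute_berezinian_evenOdd (ε : Half) :
    Commute (PowerSeries.C (gen (m + 1) (n + 1) (Sum.inl (Fin.last m))
      (Sum.inr (Fin.rev (Fin.last n))) ⟨1, one_ne_zero⟩)) (berezinian (m + 1) (n + 1) ε) := by
  have hne : (Sum.inl (Fin.last m) : Idx (m + 1) (n + 1)) ≠ Sum.inr (Fin.rev (Fin.last n)) :=
    Sum.inl_ne_inr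
  have hm : (0 : ℤ) + ((Fin.last m : Fin (m + 1)) : ℕ) = m := by rw [Fin.val_last, zero_add]
  have hn : ((m + 1 : ℕ) : ℤ) - ((n + 1 : ℕ) : ℤ) + ((Fin.last n : Fin (n + 1)) : ℕ) = m := by
    rw [Fin.val_last]; push_cast; ring
  rw [berezinian_eq]
  refine commute_qdet_mul_rdet (c := fun b p => shiftHom _ _ (m : ℤ) ε
      (-tMatrix (m + 1) (n + 1) ε (Sum.inl p) (Sum.inr (Fin.rev b))))
    (d := fun a p => shiftHom _ _ (m : ℤ) ε
      (-tInvMatrix (m + 1) (n + 1) ε (Sum.inl a) (Sum.inr (Fin.rev p)))) twoFree_series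
    (colAltFamily_shiftFamily (isBlock_evenBlock ε).1 _)
    (colAltFamily_op_shiftFamily (isBlock_oddBlock ε).1 _) (fun i j => ?_) (fun a ha p => ?_)
    (fun b hb p => ?_) (fun p => ?_) (fun p => ?_)
  · simp only [shiftFamily_evenBlock _ _ ε _ _ _ hm, shiftFamily_oddBlock _ _ ε _ _ _ hn]
    exact (matInv_tMatrix ε).sum_even_odd i (Fin.rev j) (shiftHom _ _ (m : ℤ) ε)
  · refine shiftHom_commute ?_ _ _
    exact (zeroMode_tMatrix hne ε).commute (by simp) (fun hc => ha (Sum.inl.inj hc).symm) rfl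
  · refine shiftHom_commute ?_ _ _
    exact (zeroMode_tInvMatrix hne ε).commute
      (fun hc => hb (Fin.rev_injective (Sum.inr.inj hc))) (by simp) rfl
  · rw [shiftFamily_evenBlock _ _ ε _ _ _ hm]
    exact shiftHom_comm_eq ((zeroMode_tMatrix hne ε).evenOdd_even p) _ _
  · rw [shiftFamily_oddBlock _ _ ε _ _ _ hn]
    exact shiftHom_comm_eq ((zeroMode_tInvMatrix hne ε).evenOdd_odd (Fin.rev p)) _ _

/-- Here `T⁻¹ T = 1` is the relevant identity, so the two determinants are first interchanged and
rewritten so that the odd one is a column and the even one a row determinant. -/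
theorem commute_berezinian_oddEven (ε : Half) :
    Commute (PowerSeries.C (gen (m + 1) (n + 1) (Sum.inr (Fin.rev (Fin.last n)))
      (Sum.inl (Fin.last m)) ⟨1, one_ne_zero⟩)) (berezinian (m + 1) (n + 1) ε) := by
  have hne : (Sum.inr (Fin.rev (Fin.last n)) : Idx (m + 1) (n + 1)) ≠ Sum.inl (Fin.last m) :=
    Sum.inr_ne_inl
  have hm : (0 : ℤ) + ((Fin.last m : Fin (m + 1)) : ℕ) = m := by rw [Fin.val_last, zero_add]
  have hn : ((m + 1 : ℕ) : ℤ) - ((n + 1 : ℕ) : ℤ) + ((Fin.last n : Fin (n + 1)) : ℕ) = m := by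
    rw [Fin.val_last]; push_cast; ring
  rw [berezinian_eq, ← (commute_qdet_rdet ε _ _).eq, (isBlock_evenBlock ε).qdet_eq_rdet,
    ← (isBlock_oddBlock ε).qdet_eq_rdet]
  refine commute_qdet_mul_rdet (c := fun b p => shiftHom _ _ (m : ℤ) ε
      (tInvMatrix (m + 1) (n + 1) ε (Sum.inr (Fin.rev p)) (Sum.inl b)))
    (d := fun a p => shiftHom _ _ (m : ℤ) ε
      (tMatrix (m + 1) (n + 1) ε (Sum.inr (Fin.rev a)) (Sum.inl p))) twoFree_series
    (colAltFamily_shiftFamily (isBlock_oddBlock ε).1 _)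
    (colAltFamily_op_shiftFamily (isBlock_evenBlock ε).1 _) (fun i j => ?_) (fun a ha p => ?_)
    (fun b hb p => ?_) (fun p => ?_) (fun p => ?_)
  · simp only [shiftFamily_evenBlock _ _ ε _ _ _ hm, shiftFamily_oddBlock _ _ ε _ _ _ hn]
    exact (matInv_tMatrix ε).sum_odd_even (Fin.rev i) j (shiftHom _ _ (m : ℤ) ε)
  · refine shiftHom_commute ?_ _ _
    exact (zeroMode_tInvMatrix hne ε).commute (by simp)
      (fun hc => ha (Fin.rev_injective (Sum.inr.inj hc)).symm) rfl
  · refine shiftHom_commute ?_ _ _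
    exact (zeroMode_tMatrix hne ε).commute (fun hc => hb (Sum.inl.inj hc)) (by simp) rfl
  · rw [shiftFamily_oddBlock _ _ ε _ _ _ hn]
    exact shiftHom_comm_eq ((zeroMode_tInvMatrix hne ε).oddEven_odd (Fin.rev p)) _ _
  · rw [shiftFamily_evenBlock _ _ ε _ _ _ hm]
    exact shiftHom_comm_eq ((zeroMode_tMatrix hne ε).oddEven_even p) _ _

end Simple
end DoubleYangian

namespace DoubleYangian

section Generic

variable {R : Type} [Ring R] [Algebra CH R]

theorem commute_C_of_coeff {x : R} {f : PowerSeries R}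
    (H : ∀ a, Commute x (PowerSeries.coeff a f)) : Commute (PowerSeries.C x) f := by
  refine PowerSeries.ext fun a => ?_
  rw [PowerSeries.coeff_mul_C, PowerSeries.coeff_C_mul, (H a).eq]

theorem coeff_commute_of_C {x : R} {f : PowerSeries R} (H : Commute (PowerSeries.C x) f) (a : ℕ) :
    Commute x (PowerSeries.coeff a f) := by
  have := congrArg (PowerSeries.coeff a) H.eq
  rwa [PowerSeries.coeff_mul_C, PowerSeries.coeff_C_mul] at this

theorem MatInv.commute_entries {J : Type} [Fintype J] [DecidableEq J]
    {X Z : Matrix J J (PowerSeries R)} (hXZ : MatInv X Z) {x : R}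
    (H : ∀ k l a, Commute x (PowerSeries.coeff a (Z k l))) (k l : J) (a : ℕ) :
    Commute x (PowerSeries.coeff a (X k l)) := by
  have h1 : Commute (Matrix.scalar J (PowerSeries.C x)) Z := by
    refine Matrix.ext fun k l => ?_
    rw [Matrix.scalar_apply, Matrix.diagonal_mul, Matrix.mul_diagonal,
      (commute_C_of_coeff (H k l)).eq]
  have h2 := congrFun (congrFun (commute_of_inverse h1 hXZ.2 hXZ.1).eq k) l
  rw [Matrix.scalar_apply, Matrix.diagonal_mul, Matrix.mul_diagonal] at h2
  exact coeff_commute_of_C h2 a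

theorem commute_coeff_of_zeroModes {m n : ℕ} {V : Matrix (Idx m n) (Idx m n) (PowerSeries R)}
    {E : Idx m n → Idx m n → R} {x : R}
    (H : ∀ i j, i ≠ j → IsZeroMode i j (PowerSeries.C (E i j)) V)
    (hE : ∀ i j, i ≠ j → Commute x (E i j)) {o : Idx m n}
    (ho : ∀ a, Commute x (PowerSeries.coeff a (V o o))) (k l : Idx m n) (a : ℕ) :
    Commute x (PowerSeries.coeff a (V k l)) :=
  coeff_commute_of_C (commute_of_zeroModes (E := fun i j => PowerSeries.C (E i j)) H
    (fun i j hij => (hE i j hij).map PowerSeries.C) (commute_C_of_coeff ho) k l) a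

variable {m n : ℕ} {t : Idx m n → Idx m n → Deg → R}

theorem IsRTTFamily.cross_matInv (ht : IsRTTFamily t) (hR : TorsionFree R)
    {T' : Half → Matrix (Idx m n) (Idx m n) (PowerSeries R)}
    (h1 : ∀ ε, MatInv (seriesMatrix t ε) (T' ε)) {K : Type} [Fintype K] [DecidableEq K]
    {e : K → Idx m n} (he : ∀ k, par (e k) = 1) (ε₁ ε₂ : Half) :
    Cross (fun _ => 0) ((T' ε₁).submatrix e e) ((T' ε₂).submatrix e e) :=
  ht.cross_inv hR (fun ε => (h1 ε).1) (fun ε => (h1 ε).2) he ε₁ ε₂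

theorem commute_of_seriesMatrix (hR : TorsionFree R) {x : R} {i j : Idx m n}
    (H : ∀ ε a, Commute x (PowerSeries.coeff a (seriesMatrix t ε i j))) (r : Deg) :
    Commute x (t i j r) := by
  have h1 : ∀ ε a, Commute x (tauCoeff t ε i j (ε.exponent a)) := by
    intro ε a
    have h2 := H ε a
    rw [coeff_seriesMatrix, tCoeff_eq] at h2
    have h3 := h2.sub_right ((Commute.one_right x).smul_right (delta i j (ε.exponent a)))
    rw [add_sub_cancel_left] at h3
    have h4 := h3.eq
    rw [mul_smul_comm, smul_mul_assoc] at h4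
    exact hR.cancel h4
  obtain ⟨r, hr⟩ := r
  rcases lt_or_gt_of_ne hr with h0 | h0
  · have h2 := h1 Half.plus (-r - 1).toNat
    rw [tauCoeff, Half.exponent, dif_pos (by omega)] at h2
    convert Commute.neg_right_iff.1 h2 using 2
    exact Subtype.ext (by change r = -(((-r - 1).toNat : ℤ) + 1); omega)
  · have h2 := h1 Half.minus r.toNat
    rw [tauCoeff, Half.exponent, dif_pos (by omega)] at h2
    convert h2 using 2
    exact Subtype.ext (by change r = -(-(r.toNat : ℤ)); omega)

/-- Commutation with generators extends to the image of the algebra before completion, and modulo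
each `h ^ k` every element agrees with one from that image. -/
theorem mem_center_DY {x : DY m n} (hx : ∀ i j r, Commute x (gen m n i j r)) :
    x ∈ Subalgebra.center CH (DY m n) := by
  have h1 : ∀ y : PreDY m n, Commute x (toCompletionHom (PreDY m n) y) := by
    intro y
    obtain ⟨f, rfl⟩ := RingQuot.mkAlgHom_surjective CH (Rel m n) y
    induction f using FreeAlgebra.induction with
    | grade0 c =>
      rw [AlgHom.commutes, AlgHom.commutes]
      exact (Algebra.commutes c x).symm
    | grade1 z => exact hx z.1 z.2.1 z.2.2
    | mul a b ha hb => rw [map_mul, map_mul]; exact ha.mul_right hb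
    | add a b ha hb => rw [map_add, map_add]; exact ha.add_right hb
  refine Subalgebra.mem_center_iff.2 fun z => ?_
  refine sub_eq_zero.1 (hComplete_hCompletion.sep _ fun k => ?_)
  obtain ⟨y, hy⟩ := Ideal.Quotient.mk_surjective (z.1 k)
  obtain ⟨w, hw⟩ := exists_eq_h_pow_smul (k := k) (x := z - toCompletionHom (PreDY m n) y) (by
    change z.1 k - Ideal.Quotient.mk _ y = 0
    rw [hy, sub_self])
  refine ⟨w * x - x * w, ?_⟩
  rw [smul_sub, ← smul_mul_assoc, ← mul_smul_comm, ← hw, sub_mul, mul_sub, (h1 y).eq]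
  abel

end Generic

/-! ### Centrality of the Berezinian coefficients -/

section Center

variable {m n : ℕ}

theorem commute_berezinian_diag_even (ε ε' : Half) (a : ℕ) :
    Commute (PowerSeries.C (PowerSeries.coeff a
      (tMatrix (m + 1) n ε' (Sum.inl 0) (Sum.inl 0)))) (berezinian (m + 1) n ε) := by
  rw [berezinian_eq]
  refine Commute.mul_right ?_ ?_
  · exact (isBlock_evenBlock ε).commute_qdet ((tMatrix_cross ε' ε).submatrix Sum.inl) 0 a
  · refine commute_rdet_of_entries fun b p q => ?_
    refine commute_C_shiftHom fun c => ?_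
    exact commute_even_odd (i := 0) (j := 0) ε' ε a c

theorem matInv_seriesMatrix (ε : Half) :
    MatInv (seriesMatrix (gen m n) ε) (tInvMatrix m n ε) := by
  rw [← tMatrix_eq]
  exact matInv_tMatrix ε

theorem oddBlock_cross (ε₁ ε₂ : Half) :
    Cross (fun _ => 0) (oddBlock m n ε₁) (oddBlock m n ε₂) :=
  isRTTFamily_gen.cross_matInv torsionFree_DY matInv_seriesMatrix (fun _ => rfl) ε₁ ε₂

theorem commute_berezinian_diag_odd (ε ε' : Half) (a : ℕ) :
    Commute (PowerSeries.C (PowerSeries.coeff a (oddBlock 0 (n + 1) ε' 0 0)))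
      (berezinian 0 (n + 1) ε) := by
  rw [berezinian_eq]
  refine Commute.mul_right ?_ ?_
  · exact commute_qdet_of_entries (fun b => b.elim0) id id
  · rw [← (isBlock_oddBlock ε).qdet_eq_rdet]
    exact (isBlock_oddBlock ε).commute_qdet (oddBlock_cross ε' ε) _ a

theorem commute_coeff_of_commute_C {x : DY m n} {f : Series m n} (H : Commute (PowerSeries.C x) f)
    (c : ℕ) : Commute (PowerSeries.coeff c f) x := coeffCommute_iff.2 H.symm c

theorem commute_coeff_berezinian_zeroMode (ε : Half) (c : ℕ) {i j : Idx m n} (hij : i ≠ j) :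
    Commute (PowerSeries.coeff c (berezinian m n ε)) (gen m n i j ⟨1, one_ne_zero⟩) := by
  refine commute_zeroModes (E := fun i j => gen m n i j ⟨1, one_ne_zero⟩)
    (fun i j hij => isRTTFamily_gen.isZeroMode_self torsionFree_DY hij)
    (fun i j hij => ?_) (fun i j hij => ?_) (fun hm hn => ?_) i j hij
  · exact commute_coeff_of_commute_C (commute_berezinian_even hij ε) c
  · exact commute_coeff_of_commute_C (commute_berezinian_odd hij ε) c
  · obtain ⟨m, rfl⟩ := Nat.exists_eq_succ_of_ne_zero hm.ne'
    obtain ⟨n, rfl⟩ := Nat.exists_eq_succ_of_ne_zero hn.ne'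
    -- The last even and the first odd index: the simple odd root, where the two blocks meet.
    exact ⟨Fin.last m, Fin.rev (Fin.last n),
      commute_coeff_of_commute_C (commute_berezinian_evenOdd ε) c,
      commute_coeff_of_commute_C (commute_berezinian_oddEven ε) c⟩

-- The zero modes spread commutation from one diagonal series to all entries. If there are even
-- indices, `T` at the first one serves; otherwise the argument runs for `T⁻¹` and is transferred
-- back to `T`.
set_option maxHeartbeats 1000000 in
theorem commute_coeff_berezinian_tMatrix (hmn : 0 < m + n) (ε ε' : Half) (c : ℕ) (i j : Idx m n)
    (a : ℕ) : Commute (PowerSeries.coeff c (berezinian m n ε))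
      (PowerSeries.coeff a (tMatrix m n ε' i j)) := by
  have hE : ∀ i j : Idx m n, i ≠ j →
      Commute (PowerSeries.coeff c (berezinian m n ε)) (gen m n i j ⟨1, one_ne_zero⟩) :=
    fun i j hij => commute_coeff_berezinian_zeroMode ε c hij
  rcases m with _ | m
  · rcases n with _ | n
    · exact absurd hmn (lt_irrefl 0)
    · refine (matInv_tMatrix ε').commute_entries (fun k l b => ?_) i j a
      refine commute_coeff_of_zeroModes (fun i j hij => zeroMode_tInvMatrix hij ε') hE
        (o := Sum.inr (Fin.rev 0)) (fun d => ?_) k l b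
      exact commute_coeff_of_commute_C (commute_berezinian_diag_odd ε ε' d) c
  · refine commute_coeff_of_zeroModes (fun i j hij => zeroMode_tMatrix hij ε') hE (o := Sum.inl 0)
      (fun d => ?_) i j a
    exact commute_coeff_of_commute_C (commute_berezinian_diag_even ε ε' d) c

/-- The coefficients of the quantum Berezinian are central. -/
theorem coeff_berezinian_mem_center (hmn : 0 < m + n) (ε : Half) (c : ℕ) :
    PowerSeries.coeff c (berezinian m n ε) ∈ Subalgebra.center CH (DY m n) := by
  refine mem_center_DY fun i j r => commute_of_seriesMatrix torsionFree_DY (fun ε' a => ?_) r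
  rw [← tMatrix_eq]
  exact commute_coeff_berezinian_tMatrix hmn ε ε' c i j a

end Center
end DoubleYangian

namespace DoubleYangian

/-! ### The Berezinian modulo `h ^ 2` -/

section FirstOrder

variable {R : Type} [Ring R] [Algebra CH R]

/-- The element is `1 + h s` modulo `h ^ 2`. -/
def FirstOrder (x s : R) : Prop := ∃ y, x = 1 + h • s + h ^ 2 • y

theorem FirstOrder.congr {x s s' w : R} (H : FirstOrder x s) (hs : s' = s + h • w) :
    FirstOrder x s' := by
  obtain ⟨y, rfl⟩ := H
  refine ⟨y - w, ?_⟩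
  rw [hs, smul_add, smul_smul, ← pow_two, smul_sub]
  abel

theorem FirstOrder.mul {x x' s s' : R} (H : FirstOrder x s) (H' : FirstOrder x' s') :
    FirstOrder (x * x') (s + s') := by
  obtain ⟨y, hy⟩ := H
  obtain ⟨y', rfl⟩ := H'
  have h1 : x = 1 + h • (s + h • y) := by
    rw [hy, smul_add, smul_smul, ← pow_two, add_assoc]
  refine ⟨y + (s + h • y) * s' + x * y', ?_⟩
  rw [mul_add, mul_add, mul_one, mul_smul_comm, mul_smul_comm]
  nth_rewrite 1 [hy]
  nth_rewrite 1 [h1]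
  rw [add_mul, one_mul, smul_mul_assoc, smul_add, smul_add, smul_add, smul_add, smul_smul,
    ← pow_two]
  abel

/-- Division in first order, arranged so that the peeling formula can be used without inverting `z`.
First the equation gives `x ≡ 1` modulo `h`, and reinserting this gives the next order. -/
theorem FirstOrder.of_mul {x z x' s s' : R} (hx : x * z = x') (H : FirstOrder z (-s))
    (H' : FirstOrder x' s') : FirstOrder x (s' + s) := by
  obtain ⟨y, hy⟩ := H
  obtain ⟨y', hy'⟩ := H'
  have h1 : x = x' + h • (x * s - h • (x * y)) := by
    rw [← hx, hy, mul_add, mul_add, mul_one, mul_smul_comm, mul_smul_comm, mul_neg, smul_neg,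
      smul_sub, smul_smul, ← pow_two]
    abel
  have h2 : x = 1 + h • (s' + h • y' + (x * s - h • (x * y))) := by
    rw [smul_add, smul_add, smul_smul, ← pow_two, ← add_assoc, ← add_assoc, ← hy']
    exact h1
  set w := s' + h • y' + (x * s - h • (x * y)) with hw
  have h3 : x * s = s + h • (w * s) := by
    nth_rewrite 1 [h2]
    rw [add_mul, one_mul, smul_mul_assoc]
  refine ⟨y' + w * s - x * y, ?_⟩
  rw [h3, hy'] at h1
  refine h1.trans ?_
  rw [smul_sub, smul_add, smul_add, smul_sub, smul_add, smul_smul, smul_smul, ← pow_two]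
  abel

theorem firstOrder_inverse {J : Type} [Fintype J] [DecidableEq J] {N Z : Matrix J J R}
    (hZ : (1 + h • N) * Z = 1) : ∃ y, Z = 1 + h • (-N) + h ^ 2 • y := by
  have h1 : Z = 1 - h • (N * Z) := by
    rw [← hZ, add_mul, one_mul, smul_mul_assoc, add_sub_cancel_right]
  refine ⟨N * (N * Z), ?_⟩
  have h2 : N * Z = N - h • (N * (N * Z)) := by
    conv_lhs => rw [h1]
    rw [mul_sub, mul_one, mul_smul_comm]
  conv_lhs => rw [h1, h2]
  rw [smul_sub, smul_smul, ← pow_two, smul_neg]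
  abel

end FirstOrder

section Block

variable {m n : ℕ}

theorem exists_shift_eq (c : ℤ) (ε : Half) (f : Series m n) :
    ∃ g, shiftHom m n c ε f = f + h • g := by
  have : ∀ a, ∃ y, PowerSeries.coeff a (shift c ε f) = PowerSeries.coeff a f + h • y := by
    intro a
    cases ε
    · rw [coeff_shift_minus]
      obtain ⟨y, hy⟩ := exists_smul_sum (R := DY m n) (c := h)
        (s := (Finset.HasAntidiagonal.antidiagonal a).erase (a, 0))
        (f := fun x => ((Nat.multichoose x.1 x.2 : CH) * ((c : CH) * h) ^ x.2) •
          PowerSeries.coeff x.1 f) (fun x hx => by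
          obtain ⟨hne, hx⟩ := Finset.mem_erase.1 hx
          have h2 := Finset.HasAntidiagonal.mem_antidiagonal.1 hx
          obtain ⟨s, hs⟩ := Nat.exists_eq_succ_of_ne_zero (n := x.2) (fun hc => hne (Prod.ext
            (by change x.1 = a; omega) hc))
          refine ⟨((Nat.multichoose x.1 x.2 : CH) * (c : CH) * ((c : CH) * h) ^ s) •
            PowerSeries.coeff x.1 f, ?_⟩
          rw [smul_smul, hs]
          congr 1
          rw [pow_succ]
          ring)
      refine ⟨y, ?_⟩
      rw [← Finset.add_sum_erase _ _ (show (a, 0) ∈ Finset.HasAntidiagonal.antidiagonal a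
        from Finset.HasAntidiagonal.mem_antidiagonal.2 (add_zero a)), hy]
      simp
    · rw [coeff_shift_plus]
      obtain ⟨y, hy⟩ := hSum_sub_sum (fun s : ℕ => ((Nat.choose (a + s) s : CH) *
        (-(c : CH)) ^ s) • PowerSeries.coeff (a + s) f) 1
      refine ⟨y, ?_⟩
      rw [pow_one, Finset.sum_range_one] at hy
      rw [← hy]
      simp
  choose y hy using this
  refine ⟨PowerSeries.mk y, PowerSeries.ext fun a => ?_⟩
  rw [shiftHom_apply, hy, map_add, PowerSeries.coeff_smul, PowerSeries.coeff_mk]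

theorem firstOrder_shiftHom {f s : Series m n} (H : FirstOrder f s) (c : ℤ) (ε : Half) :
    FirstOrder (shiftHom m n c ε f) s := by
  obtain ⟨y, rfl⟩ := H
  obtain ⟨g, hg⟩ := exists_shift_eq c ε s
  refine ⟨g + shiftHom m n c ε y, ?_⟩
  rw [(shiftHom m n c ε).map_add, (shiftHom m n c ε).map_add, (shiftHom m n c ε).map_one,
    shiftHom_smul, shiftHom_smul, hg, smul_add, smul_smul, ← pow_two, smul_add]
  abel

/-- Each peeling step contributes one diagonal entry, because `T⁻¹` is `1 - h N` modulo `h ^ 2`;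
shifts do not matter in first order. The determinant thus starts with the trace. -/
theorem IsBlock.firstOrder_qdet {k : ℕ} {ε : Half} {X N : Matrix (Fin k) (Fin k) (Series m n)}
    (hX : IsBlock ε X) (hN : X = 1 + h • N) (c : ℤ) :
    FirstOrder (qdet (shiftFamily c ε X) id id) (∑ a, N a a) := by
  induction k with
  | zero => exact ⟨0, by simp [qdet]⟩
  | succ k ih =>
    obtain ⟨Z, hZ1, -, -, h1, -⟩ := hX.peel c
    rw [hN] at hZ1
    obtain ⟨Y, hY⟩ := firstOrder_inverse hZ1
    have h2 : FirstOrder (Z (Fin.last k) (Fin.last k)) (-N (Fin.last k) (Fin.last k)) :=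
      ⟨Y (Fin.last k) (Fin.last k), by
        rw [hY, Matrix.add_apply, Matrix.add_apply, Matrix.one_apply_eq, Matrix.smul_apply,
          Matrix.smul_apply, Matrix.neg_apply]⟩
    rw [Fin.sum_univ_castSucc]
    refine FirstOrder.of_mul h1 (firstOrder_shiftHom h2 _ _)
      (ih hX.corner (N := N.submatrix Fin.castSucc Fin.castSucc) ?_)
    rw [hN]
    refine Matrix.ext fun i j => ?_
    simp only [Matrix.submatrix_apply, Matrix.add_apply, Matrix.smul_apply, Matrix.one_apply,
      Fin.castSucc_inj]

theorem coeff_zero_shiftHom (c : ℤ) (f : Series m n) :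
    PowerSeries.constantCoeff (shiftHom m n c Half.minus f) = PowerSeries.constantCoeff f := by
  rw [← PowerSeries.coeff_zero_eq_constantCoeff_apply, ← PowerSeries.coeff_zero_eq_constantCoeff_apply,
    shiftHom_apply, coeff_shift_minus, Finset.Nat.antidiagonal_zero, Finset.sum_singleton]
  simp

/-- The constant term in `u⁻¹` must equal `1` exactly, whereas the first-order expansion controls it
only modulo `h ^ 2`. Shifts preserve constant terms of series in `u⁻¹`, so peeling applies. -/
theorem IsBlock.constantCoeff_qdet {k : ℕ} {X : Matrix (Fin k) (Fin k) (Series m n)}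
    (hX : IsBlock Half.minus X) (hX' : X.map (PowerSeries.constantCoeff (R := DY m n)) = 1) (c : ℤ) :
    PowerSeries.constantCoeff (qdet (shiftFamily c Half.minus X) id id) = 1 := by
  induction k with
  | zero => simp [qdet]
  | succ k ih =>
    obtain ⟨Z, hZ1, -, -, h1, -⟩ := hX.peel c
    have h2 : Z.map (PowerSeries.constantCoeff (R := DY m n)) = 1 := by
      have := map_mul_eq_one (PowerSeries.constantCoeff (R := DY m n)) hZ1
      rwa [hX', one_mul] at this
    have h3 : PowerSeries.constantCoeff (Z (Fin.last k) (Fin.last k)) = 1 := by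
      have := congrFun (congrFun h2 (Fin.last k)) (Fin.last k)
      rwa [Matrix.map_apply, Matrix.one_apply_eq] at this
    have h4 := congrArg PowerSeries.constantCoeff h1
    rw [(PowerSeries.constantCoeff (R := DY m n)).map_mul, coeff_zero_shiftHom, h3, mul_one] at h4
    rw [h4]
    refine ih hX.corner (Matrix.ext fun i j => ?_)
    have := congrFun (congrFun hX' i.castSucc) j.castSucc
    rw [Matrix.map_apply, Matrix.one_apply] at this
    rw [Matrix.map_apply, Matrix.submatrix_apply, this, Matrix.one_apply]
    simp only [Fin.castSucc_inj]

end Block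
end DoubleYangian

namespace DoubleYangian

section Berezinian

variable {m n : ℕ}

theorem MatInv.exists_eq {R J : Type} [Ring R] [Algebra CH R] [Fintype J] [DecidableEq J]
    {N Z : Matrix J J (PowerSeries R)} (hZ : MatInv (1 + h • N) Z) :
    ∃ Y, Z = 1 + h • (-N + h • Y) := by
  obtain ⟨Y, hY⟩ := firstOrder_inverse hZ.1
  exact ⟨Y, by rw [hY, smul_add, smul_smul, ← pow_two, add_assoc]⟩

theorem MatInv.map_constantCoeff {R J : Type} [Ring R] [Algebra CH R] [Fintype J] [DecidableEq J]
    {X Z : Matrix J J (PowerSeries R)} (H : MatInv X Z)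
    (hX : ∀ i j, PowerSeries.constantCoeff (X i j) = if i = j then 1 else 0) (i j : J) :
    PowerSeries.constantCoeff (Z i j) = if i = j then 1 else 0 := by
  have h1 : X.map (PowerSeries.constantCoeff (R := R)) = 1 := Matrix.ext fun i j => by
    rw [Matrix.map_apply, hX, Matrix.one_apply]
  have h2 := map_mul_eq_one (PowerSeries.constantCoeff (R := R)) H.1
  rw [h1, one_mul] at h2
  have := congrFun (congrFun h2 i) j
  rwa [Matrix.map_apply, Matrix.one_apply] at this

theorem constantCoeff_seriesMatrix {R : Type} [Ring R] [Algebra CH R]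
    (t : Idx m n → Idx m n → Deg → R) (i j : Idx m n) :
    PowerSeries.constantCoeff (seriesMatrix t Half.minus i j) = if i = j then 1 else 0 := by
  rw [← PowerSeries.coeff_zero_eq_constantCoeff_apply, coeff_seriesMatrix, Half.exponent]
  simp [tCoeff]

theorem firstOrder_even (ε : Half) (c : ℤ) :
    FirstOrder (qdet (shiftFamily c ε (evenBlock m n ε)) id id)
      (∑ a, tauMatrix (gen m n) ε (Sum.inl a) (Sum.inl a)) := by
  refine (isBlock_evenBlock ε).firstOrder_qdet
    (N := (tauMatrix (gen m n) ε).submatrix Sum.inl Sum.inl) ?_ c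
  rw [evenBlock, tMatrix_eq, seriesMatrix_eq, submatrix_one_add Sum.inl_injective]

theorem firstOrder_odd (ε : Half) (c : ℤ) :
    FirstOrder (rdet (shiftFamily c ε (oddBlock m n ε)))
      (-∑ a, tauMatrix (gen m n) ε (Sum.inr a) (Sum.inr a)) := by
  have h0 := matInv_seriesMatrix (m := m) (n := n) ε
  rw [seriesMatrix_eq] at h0
  obtain ⟨Y, hY⟩ := h0.exists_eq
  have h1 := (isBlock_oddBlock ε).firstOrder_qdet
    (N := (-tauMatrix (gen m n) ε + h • Y).submatrix (Sum.inr ∘ Fin.rev) (Sum.inr ∘ Fin.rev)) (by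
      rw [oddBlock, hY, submatrix_one_add inr_rev_injective]) c
  rw [← (isBlock_oddBlock ε).qdet_eq_rdet]
  refine h1.congr (w := -∑ a, Y (Sum.inr (Fin.rev a)) (Sum.inr (Fin.rev a))) ?_
  rw [← Equiv.sum_comp Fin.revPerm, smul_neg, Finset.smul_sum, ← sub_eq_add_neg,
    ← Finset.sum_sub_distrib, ← Finset.sum_neg_distrib]
  refine Finset.sum_congr rfl fun a _ => ?_
  rw [Matrix.submatrix_apply, Matrix.add_apply, Matrix.neg_apply, Matrix.smul_apply]
  exact (add_sub_cancel_right _ _).symm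

theorem firstOrder_berezinian (ε : Half) : FirstOrder (berezinian m n ε)
    (∑ a, tauMatrix (gen m n) ε (Sum.inl a) (Sum.inl a) +
      -∑ a, tauMatrix (gen m n) ε (Sum.inr a) (Sum.inr a)) := by
  rw [berezinian_eq]
  exact (firstOrder_even ε _).mul (firstOrder_odd ε _)

theorem map_constantCoeff_block {k : ℕ} {X : Matrix (Fin k) (Fin k) (Series m n)}
    (hX : ∀ i j, PowerSeries.constantCoeff (X i j) = if i = j then 1 else 0) :
    X.map (PowerSeries.constantCoeff (R := DY m n)) = 1 := Matrix.ext fun i j => by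
  rw [Matrix.map_apply, hX, Matrix.one_apply]

theorem constantCoeff_berezinian :
    PowerSeries.constantCoeff (berezinian m n Half.minus) = 1 := by
  rw [berezinian_eq, (PowerSeries.constantCoeff (R := DY m n)).map_mul,
    ← (isBlock_oddBlock Half.minus).qdet_eq_rdet,
    (isBlock_evenBlock Half.minus).constantCoeff_qdet,
    (isBlock_oddBlock Half.minus).constantCoeff_qdet, one_mul]
  · refine map_constantCoeff_block fun i j => ?_
    rw [oddBlock, Matrix.submatrix_apply,
      (matInv_seriesMatrix Half.minus).map_constantCoeff (constantCoeff_seriesMatrix _)]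
    simp only [inr_rev_injective.eq_iff]
  · refine map_constantCoeff_block fun i j => ?_
    rw [evenBlock, Matrix.submatrix_apply, tMatrix_eq, constantCoeff_seriesMatrix]
    simp only [Sum.inl_injective.eq_iff]

/-- The elements `∑ (-1)^ī tᵢᵢ` of the double Yangian. -/
noncomputable def diagGen (m n : ℕ) (r : Deg) : DY m n :=
  ∑ a : Fin m, gen m n (Sum.inl a) (Sum.inl a) r - ∑ a : Fin n, gen m n (Sum.inr a) (Sum.inr a) r

theorem coeff_berezinian (ε : Half) (c : ℕ) : ∃ y, PowerSeries.coeff c (berezinian m n ε) =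
    PowerSeries.coeff c (1 : Series m n) +
      h • (∑ a : Fin m, tauCoeff (gen m n) ε (Sum.inl a) (Sum.inl a) (ε.exponent c) -
        ∑ a : Fin n, tauCoeff (gen m n) ε (Sum.inr a) (Sum.inr a) (ε.exponent c) + h • y) := by
  obtain ⟨y, hy⟩ := firstOrder_berezinian (m := m) (n := n) ε
  refine ⟨PowerSeries.coeff c y, ?_⟩
  rw [hy, map_add, map_add, PowerSeries.coeff_smul, PowerSeries.coeff_smul, map_add, map_neg,
    map_sum, map_sum]
  simp only [coeff_tauMatrix]
  rw [smul_add _ (_ - _), smul_smul, ← pow_two, add_assoc, sub_eq_add_neg]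

/-- Division by `h` of the nonconstant part is possible by the first-order expansion, whose leading
term is the supertrace. The two implications have exclusive premises, according to the sign of `r`.
-/
theorem exists_berezinianCoeff (r : Deg) : ∃ x : DY m n,
    (∀ a : ℕ, r.1 = a → PowerSeries.coeff a (berezinian m n Half.minus) = h • x) ∧
    (∀ a : ℕ, r.1 = -((a : ℤ) + 1) → PowerSeries.coeff a (berezinian m n Half.plus) =
      PowerSeries.coeff a (1 : Series m n) - h • x) ∧ ∃ y, x = diagGen m n r + h • y := by
  obtain ⟨r, hr⟩ := r
  rcases lt_or_gt_of_ne hr with h0 | h0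
  · obtain ⟨y, hy⟩ := coeff_berezinian (m := m) (n := n) Half.plus (-r - 1).toNat
    have h1 : ∀ i j, tauCoeff (gen m n) Half.plus i j (Half.plus.exponent (-r - 1).toNat) =
        -gen m n i j ⟨r, hr⟩ := fun i j => by
      rw [tauCoeff, Half.exponent, dif_pos (by omega)]
      congr 2
      exact Subtype.ext (by change -(((-r - 1).toNat : ℤ) + 1) = r; omega)
    simp only [h1, Finset.sum_neg_distrib] at hy
    refine ⟨diagGen m n ⟨r, hr⟩ + h • -y, fun a ha => ?_, fun a ha => ?_, -y, rfl⟩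
    · have ha' : r = a := ha
      omega
    · have ha' : r = -((a : ℤ) + 1) := ha
      rw [show a = (-r - 1).toNat by omega, hy, diagGen, sub_eq_add_neg _ (h • _), ← smul_neg]
      congr 2
      rw [smul_neg]
      abel
  · obtain ⟨y, hy⟩ := coeff_berezinian (m := m) (n := n) Half.minus r.toNat
    have h1 : ∀ i j, tauCoeff (gen m n) Half.minus i j (Half.minus.exponent r.toNat) =
        gen m n i j ⟨r, hr⟩ := fun i j => by
      rw [tauCoeff, Half.exponent, dif_pos (by omega)]
      congr 1
      exact Subtype.ext (by change -(-(r.toNat : ℤ)) = r; omega)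
    simp only [h1] at hy
    refine ⟨diagGen m n ⟨r, hr⟩ + h • y, fun a ha => ?_, fun a ha => ?_, y, rfl⟩
    · have ha' : r = a := ha
      rw [show a = r.toNat by omega, hy, PowerSeries.coeff_one, if_neg (by omega), zero_add]
      rfl
    · have ha' : r = -((a : ℤ) + 1) := ha
      omega

end Berezinian
end DoubleYangian

namespace DoubleYangian

/-! ### Lifting from the reduction modulo `h` -/

section Lifting

variable {R V : Type} [Ring R] [Algebra CH R] [Ring V] [Algebra CH V]

/-- A central subset whose reduction modulo `h` generates the center topologically generates the
center. -/
theorem center_eq_hClosure {ι : Type} (hR : TorsionFree R)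
    (hsep : ∀ x : R, (∀ k : ℕ, ∃ y, x = h ^ k • y) → x = 0) (φ : R →ₐ[CH] V)
    (hφ : Function.Surjective φ) (hker : ∀ x, φ x = 0 → ∃ y, x = h • y)
    {b : ι → R} (hb : ∀ r, b r ∈ Subalgebra.center CH R)
    (hV : ∀ x : V, (∀ y, Commute x y) → x ∈ Algebra.adjoin CH (Set.range fun r => φ (b r))) :
    (Subalgebra.center CH R : Set R) = hClosure (Algebra.adjoin CH (Set.range b) : Set R) := by
  have hle : Algebra.adjoin CH (Set.range b) ≤ Subalgebra.center CH R :=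
    Algebra.adjoin_le (Set.range_subset_iff.2 hb)
  refine Set.Subset.antisymm ?_ ?_
  · have hmap : (Algebra.adjoin CH (Set.range b)).map φ =
        Algebra.adjoin CH (Set.range fun r => φ (b r)) := by
      rw [AlgHom.map_adjoin, ← Set.range_comp]
      rfl
    intro x hx k
    suffices ∃ y ∈ Algebra.adjoin CH (Set.range b), ∃ z ∈ Subalgebra.center CH R,
        x - y = h ^ k • z by
      obtain ⟨y, hy, z, -, hz⟩ := this
      exact ⟨y, hy, z, hz⟩
    induction k with
    | zero => exact ⟨0, zero_mem _, x, hx, by rw [sub_zero, pow_zero, one_smul]⟩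
    | succ k ih =>
      obtain ⟨y, hy, z, hz, hxy⟩ := ih
      -- Since `φ` is surjective, the reduction of the central remainder `z` is central, hence is
      -- the reduction of an element of the subalgebra; what remains is divisible by `h`.
      have h1 : φ z ∈ (Algebra.adjoin CH (Set.range b)).map φ := by
        rw [hmap]
        refine hV _ fun v => ?_
        obtain ⟨w, rfl⟩ := hφ v
        have : Commute z w := (Subalgebra.mem_center_iff.1 hz w).symm
        exact this.map φ
      obtain ⟨w, hw, hwz⟩ := h1
      obtain ⟨z', hz'⟩ := hker (z - w) (by rw [map_sub, sub_eq_zero]; exact hwz.symm)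
      refine ⟨y + h ^ k • w, add_mem hy (Subalgebra.smul_mem _ hw _), z', ?_, ?_⟩
      -- The new remainder `z'` is central because `h • z'` is and `h` can be cancelled; this keeps
      -- the approximation going.
      · have hc : z - w ∈ Subalgebra.center CH R := sub_mem hz (hle hw)
        rw [hz'] at hc
        refine Subalgebra.mem_center_iff.2 fun v => hR.cancel ?_
        rw [← mul_smul_comm, ← smul_mul_assoc]
        exact Subalgebra.mem_center_iff.1 hc v
      · rw [← sub_sub, hxy, ← smul_sub, hz', smul_smul, pow_succ]
  · intro x hx
    refine Subalgebra.mem_center_iff.2 fun v => sub_eq_zero.1 (hsep _ fun k => ?_)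
    obtain ⟨y, hy, z, hz⟩ := hx k
    refine ⟨v * z - z * v, ?_⟩
    have h1 : v * y = y * v := Subalgebra.mem_center_iff.1 (hle hy) v
    rw [smul_sub, ← mul_smul_comm, ← smul_mul_assoc, ← hz, mul_sub, sub_mul, h1]
    abel

theorem eq_zero_of_h_pow_smul {ι : Type} {P : MvPolynomial ι CH}
    (hP : ∀ k : ℕ, ∃ Q, h ^ k • Q = P) : P = 0 := by
  refine MvPolynomial.ext _ _ fun d => ?_
  rw [MvPolynomial.coeff_zero]
  refine PowerSeries.ext fun k => ?_
  rw [map_zero]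
  obtain ⟨Q, rfl⟩ := hP (k + 1)
  rw [MvPolynomial.coeff_smul, smul_eq_mul]
  exact PowerSeries.X_pow_dvd_iff.1 (Dvd.intro _ rfl) k k.lt_succ_self

/-- A relation reduces to a relation modulo `h`, so its polynomial is divisible by `h`. By torsion
freeness the quotient is again a relation, and a polynomial divisible by all powers of `h` is zero.
-/
theorem algebraicIndependent_center {ι : Type} (hR : TorsionFree R) (φ : R →ₐ[CH] V)
    {b : ι → R} (hb : ∀ r, b r ∈ Subalgebra.center CH R)
    (H : ∀ e : MvPolynomial ι CH →ₐ[CH] V, (∀ r, e (MvPolynomial.X r) = φ (b r)) →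
      ∀ P, e P = 0 → ∃ Q, h • Q = P) :
    AlgebraicIndependent CH (fun r => (⟨b r, hb r⟩ : Subalgebra.center CH R)) := by
  let f : MvPolynomial ι CH →ₐ[CH] Subalgebra.center CH R :=
    MvPolynomial.aeval fun r => (⟨b r, hb r⟩ : Subalgebra.center CH R)
  let e : MvPolynomial ι CH →ₐ[CH] V := φ.comp ((Subalgebra.center CH R).val.comp f)
  have he : ∀ r, e (MvPolynomial.X r) = φ (b r) := fun r => by
    show φ ((f (MvPolynomial.X r) : Subalgebra.center CH R) : R) = _
    rw [MvPolynomial.aeval_X]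
  refine (injective_iff_map_eq_zero f).2 fun P hP => eq_zero_of_h_pow_smul fun k => ?_
  suffices ∃ Q, h ^ k • Q = P ∧ f Q = 0 by
    obtain ⟨Q, hQ, -⟩ := this
    exact ⟨Q, hQ⟩
  induction k with
  | zero => exact ⟨P, by rw [pow_zero, one_smul], hP⟩
  | succ k ih =>
    obtain ⟨Q, hQ, hQ0⟩ := ih
    obtain ⟨Q', rfl⟩ := H e he Q (by
      show φ ((f Q : Subalgebra.center CH R) : R) = 0
      rw [hQ0, ZeroMemClass.coe_zero, map_zero])
    refine ⟨Q', by rw [← hQ, smul_smul, pow_succ], Subtype.ext (hR _ ?_)⟩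
    rw [map_smul] at hQ0
    exact congrArg Subtype.val hQ0

end Lifting

/-! ### The Berezinian coefficients generate the center -/

section Main

theorem coeff_add_mk {R : Type} [Ring R] (p : PowerSeries R) (f : ℕ → R) (a : ℕ) :
    PowerSeries.coeff a (p + PowerSeries.mk f) = PowerSeries.coeff a p + f a := by
  rw [map_add, PowerSeries.coeff_mk]

theorem coeff_sub_mk {R : Type} [Ring R] (p : PowerSeries R) (f : ℕ → R) (a : ℕ) :
    PowerSeries.coeff a (p - PowerSeries.mk f) = PowerSeries.coeff a p - f a := by
  rw [map_sub, PowerSeries.coeff_mk]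

variable {m n : ℕ}

/-- The reduction modulo `h` of the double Yangian. -/
noncomputable def reduce (m n : ℕ) : DY m n →ₐ[CH] U m n :=
  (Pi.evalAlgHom CH (fun k : ℕ => PreDY m n ⧸ hIdeal (PreDY m n) k) 1).comp
    (hCompletion (PreDY m n)).val

theorem reduce_toCompletion (y : PreDY m n) :
    reduce m n (toCompletion (PreDY m n) y) = toU m n y := rfl

theorem reduce_surjective : Function.Surjective (reduce m n) := fun x => by
  obtain ⟨y, rfl⟩ := toU_surjective x
  exact ⟨_, reduce_toCompletion y⟩

theorem exists_eq_h_smul_of_reduce {x : DY m n} (hx : reduce m n x = 0) : ∃ y, x = h • y := by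
  obtain ⟨y, hy⟩ := exists_eq_h_pow_smul (k := 1) (x := x) hx
  exact ⟨y, by rw [hy, pow_one]⟩

theorem reduce_gen (i j : Idx m n) (r : Deg) : reduce m n (gen m n i j r) = genU m n i j r := rfl

theorem reduce_diagGen (r : Deg) : reduce m n (diagGen m n r) = casimir m n r := by
  rw [diagGen, casimir, Fintype.sum_sum_type, map_sub (reduce m n), map_sum, map_sum,
    sub_eq_add_neg, ← Finset.sum_neg_distrib]
  congr 1
  · exact Finset.sum_congr rfl fun a _ => by rw [reduce_gen, par, pow_zero, one_mul]
  · exact Finset.sum_congr rfl fun a _ => by rw [reduce_gen, par, pow_one, neg_one_mul]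

theorem isBerezinianCoeffs_iff {b : Deg → DY m n} : IsBerezinianCoeffs m n b ↔
    ∀ r, (∀ a : ℕ, r.1 = (a : ℤ) → PowerSeries.coeff a (berezinian m n Half.minus) = h • b r) ∧
      ∀ a : ℕ, r.1 = -((a : ℤ) + 1) → PowerSeries.coeff a (berezinian m n Half.plus) =
        PowerSeries.coeff a (1 : Series m n) - h • b r := by
  constructor
  · rintro ⟨h1, h2⟩ ⟨r, hr⟩
    refine ⟨?_, ?_⟩
    · rintro a rfl
      have ha : a ≠ 0 := by omega
      rw [h1, coeff_add_mk, dif_neg ha,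
        PowerSeries.coeff_one, if_neg ha, zero_add]
    · rintro a rfl
      rw [h2, coeff_sub_mk]
  · intro H
    refine ⟨PowerSeries.ext fun a => ?_, PowerSeries.ext fun a => ?_⟩
    · rw [coeff_add_mk, PowerSeries.coeff_one]
      split_ifs with ha
      · subst ha
        rw [PowerSeries.coeff_zero_eq_constantCoeff_apply, constantCoeff_berezinian, add_zero]
      · rw [zero_add]
        exact (H ⟨(a : ℤ), by omega⟩).1 a rfl
    · rw [coeff_sub_mk]
      exact (H ⟨-((a : ℤ) + 1), by omega⟩).2 a rfl

theorem Deg.cases (r : Deg) : (∃ a : ℕ, r.1 = (a : ℤ)) ∨ ∃ a : ℕ, r.1 = -((a : ℤ) + 1) := by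
  obtain ⟨r, hr⟩ := r
  rcases lt_or_gt_of_ne hr with h0 | h0
  · exact Or.inr ⟨(-r - 1).toNat, by simp only; omega⟩
  · exact Or.inl ⟨r.toNat, by simp only; omega⟩

theorem IsBerezinianCoeffs.unique {b b' : Deg → DY m n} (hb : IsBerezinianCoeffs m n b)
    (hb' : IsBerezinianCoeffs m n b') : b = b' := by
  rw [isBerezinianCoeffs_iff] at hb hb'
  funext r
  refine torsionFree_DY.cancel ?_
  rcases r.cases with ⟨a, ha⟩ | ⟨a, ha⟩
  · rw [← (hb r).1 a ha, ← (hb' r).1 a ha]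
  · exact sub_right_injective (((hb r).2 a ha).symm.trans ((hb' r).2 a ha))

theorem exists_isBerezinianCoeffs :
    ∃ b : Deg → DY m n, IsBerezinianCoeffs m n b ∧ ∀ r, ∃ y, b r = diagGen m n r + h • y := by
  choose b h1 h2 h3 using exists_berezinianCoeff (m := m) (n := n)
  exact ⟨b, isBerezinianCoeffs_iff.2 fun r => ⟨h1 r, h2 r⟩, h3⟩

theorem IsBerezinianCoeffs.mem_center (hmn : 0 < m + n) {b : Deg → DY m n}
    (hb : IsBerezinianCoeffs m n b) (r : Deg) : b r ∈ Subalgebra.center CH (DY m n) := by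
  rw [isBerezinianCoeffs_iff] at hb
  have h1 : h • b r ∈ Subalgebra.center CH (DY m n) := by
    rcases r.cases with ⟨a, ha⟩ | ⟨a, ha⟩
    · rw [← (hb r).1 a ha]
      exact coeff_berezinian_mem_center hmn _ a
    · have h2 : h • b r = PowerSeries.coeff a (1 : Series m n) -
          PowerSeries.coeff a (berezinian m n Half.plus) := by
        rw [(hb r).2 a ha, sub_sub_cancel]
      rw [h2, PowerSeries.coeff_one]
      refine sub_mem ?_ (coeff_berezinian_mem_center hmn _ a)
      split_ifs
      · exact one_mem _
      · exact zero_mem _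
  refine Subalgebra.mem_center_iff.2 fun v => torsionFree_DY.cancel ?_
  rw [← mul_smul_comm, ← smul_mul_assoc]
  exact Subalgebra.mem_center_iff.1 h1 v

theorem IsBerezinianCoeffs.reduce_eq {b : Deg → DY m n} (hb : IsBerezinianCoeffs m n b) (r : Deg) :
    reduce m n (b r) = casimir m n r := by
  obtain ⟨b', hb', h1⟩ := exists_isBerezinianCoeffs (m := m) (n := n)
  obtain ⟨y, hy⟩ := h1 r
  rw [hb.unique hb', hy, map_add (reduce m n), map_smul (reduce m n), h_smul_U, add_zero,
    reduce_diagGen]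

/-- Centrality of the `casimir`s is read off from that of the Berezinian coefficients, of which they
are the reductions. -/
theorem casimir_commute (hmn : 0 < m + n) (r : Deg) (x : U m n) : Commute (casimir m n r) x := by
  obtain ⟨b, hb, -⟩ := exists_isBerezinianCoeffs (m := m) (n := n)
  obtain ⟨y, rfl⟩ := reduce_surjective x
  rw [← hb.reduce_eq r]
  have : Commute (b r) y := (Subalgebra.mem_center_iff.1 (hb.mem_center hmn r) y).symm
  exact this.map (reduce m n)

theorem nonempty_idx (hmn : 0 < m + n) : Nonempty (Idx m n) := by
  rw [← Fintype.card_pos_iff, Fintype.card_sum, Fintype.card_fin, Fintype.card_fin]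
  exact hmn

theorem IsBerezinianCoeffs.center_eq (hmn : 0 < m + n) {b : Deg → DY m n}
    (hb : IsBerezinianCoeffs m n b) : (Subalgebra.center CH (DY m n) : Set (DY m n)) =
      hClosure (Algebra.adjoin CH (Set.range b) : Set (DY m n)) := by
  refine center_eq_hClosure torsionFree_DY hComplete_hCompletion.sep (reduce m n)
    reduce_surjective (fun x => exists_eq_h_smul_of_reduce) (hb.mem_center hmn) fun x hx => ?_
  have h1 : (fun r => reduce m n (b r)) = casimir m n := funext hb.reduce_eq
  rw [h1]
  exact mem_casimirAlg_of_commute (casimir_commute hmn) (nonempty_idx hmn).some hx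

theorem IsBerezinianCoeffs.algebraicIndependent (hmn : 0 < m + n) {b : Deg → DY m n}
    (hb : IsBerezinianCoeffs m n b) : AlgebraicIndependent CH
      (fun r => (⟨b r, hb.mem_center hmn r⟩ : Subalgebra.center CH (DY m n))) :=
  algebraicIndependent_center torsionFree_DY (reduce m n) (hb.mem_center hmn) fun _ he _ hP =>
    exists_h_smul_of_casimir (nonempty_idx hmn).some
      (fun r => (he r).trans (hb.reduce_eq r)) hP

end Main

end DoubleYangian

theorem theorem3p6 (m n : ℕ) (hmn : 0 < m + n) :
    (∃! b : DoubleYangian.Deg → DoubleYangian.DY m n, DoubleYangian.IsBerezinianCoeffs m n b) ∧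
    ∀ b : DoubleYangian.Deg → DoubleYangian.DY m n, DoubleYangian.IsBerezinianCoeffs m n b →
      ∃ hb : ∀ r, b r ∈ Subalgebra.center DoubleYangian.CH (DoubleYangian.DY m n),
        AlgebraicIndependent DoubleYangian.CH
          (fun r => (⟨b r, hb r⟩ :
            Subalgebra.center DoubleYangian.CH (DoubleYangian.DY m n))) ∧
        (Subalgebra.center DoubleYangian.CH (DoubleYangian.DY m n) :
            Set (DoubleYangian.DY m n)) =
          DoubleYangian.hClosure
            (Algebra.adjoin DoubleYangian.CH (Set.range b) : Set (DoubleYangian.DY m n)) := by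
  obtain ⟨b₀, hb₀, -⟩ := DoubleYangian.exists_isBerezinianCoeffs (m := m) (n := n)
  exact ⟨⟨b₀, hb₀, fun b hb => hb.unique hb₀⟩, fun b hb =>
    ⟨hb.mem_center hmn, hb.algebraicIndependent hmn, hb.center_eq hmn⟩⟩
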